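/- **Setting.** Let $d$ and $P\ge 2$ be integers. An oriented varifold is a finite Borel measure $m$ on $\mathbb{R}^d\times\mathbb{S}^{d-1}$; it is disintegrated as $m=\omega\otimes(\lambda_x)_x$, with mass measure $\omega$ and $\langle\lambda_x\rangle:=\int p\,d\lambda_x(p)$. For a set $A$ of finite perimeter, $\nabla\chi_A$ is the distributional gradient of the indicator function $\chi_A$, $\nabla\chi_A/|\nabla\chi_A|$ is the inner unit normal and $\partial^*A$ is the reduced boundary. A *phase partition* is a family $A=(A^1,\dots,A^P)$ of pairwise disjoint open sets of finite perimeter that cover $\mathbb{R}^d$ up to a Lebesgue null set, all except $A^P$ having finite volume. For varifolds $(\mu^{i,j})_{1\le i,j\le P}$ put $\mu^i:=2\mu^{i,i}+\sum_{j\ne i}\mu^{j,i}$ and $\mu:=\frac12\sum_i\mu^i$, with mass measures $\omega^{i,j},\omega^i,\omega$. Call $((\mu^{i,j}),A)$ *compatible* if for all $i\neq j$: $\omega^{i,j}=\omega^{j,i}$; $\langle\lambda^{i,j}_x\rangle=-\langle\lambda^{j,i}_x\rangle$ for $\omega^{i,j}$-a.e. $x$; and for all $i$: $\langle\lambda^{i,i}_x\rangle=0$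 for $\omega^{i,i}$-a.e. $x$; $\int\eta\cdot d\nabla\chi_{A^i}=\int\eta\cdot p\,d\mu^i$ for all $\eta\in C_c^\infty(\mathbb{R}^d;\mathbb{R}^d)$. **De Giorgi type varifold solutions (equal surface tensions).** Let $((\mu^{i,j}_0),A_0)$ be compatible, $A_0$ a phase partition. For $t>0$ let $\mu^{i,j}_t$ be oriented varifolds such that $t\mapsto\int\eta(\cdot,\cdot,t)\,d\mu^{i,j}_t$ is measurable for all $\eta\in L^1((0,\infty);C_0(\mathbb{R}^d\times\mathbb{S}^{d-1}))$, and let $A(t)$ be phase partitions such that $\chi^i(\cdot,t):=\chi_{A^i(t)}$ satisfies $\chi^i\in L^\infty((0,\infty);BV_{loc}(\mathbb{R}^d;\{0,1\}))$; write $\chi^i_0:=\chi_{A^i_0}$. The pair $(\mu,\chi)$ is a De Giorgi type varifold solution with initial data $(\mu_0,\chi_0)$ if $((\mu_t^{i,j}),A(t))$ is compatible for a.e. $t>0$ and there are $V^i\in L^2((0,\infty);L^2(\omega^i_t))$ and $\mathbf H\in L^2((0,\infty);L^2(\omega_t;\mathbb{R}^d))$ such that for a.e. $T>0$, all $i$,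 all $\zeta\in C_c^\infty(\mathbb{R}^d\times[0,\infty))$ and all $F\in C_c^\infty(\mathbb{R}^d\times[0,\infty);\mathbb{R}^d)$ $$\int\chi^i(\cdot,T)\zeta(\cdot,T)\,dx-\int\chi^i_0\zeta(\cdot,0)\,dx=\int_0^T\!\!\int\chi^i\partial_t\zeta\,dx\,dt-\int_0^T\!\!\int V^i\zeta\,d\omega^i_t\,dt,$$ $$\int_0^T\!\!\int\mathbf H\cdot F\,d\omega_t\,dt=-\int_0^T\!\!\int(I_d-p\otimes p):\nabla F\,d\mu_t\,dt,$$ $$\omega_T(\mathbb{R}^d)+\frac12\sum_{i=1}^P\int_0^T\!\!\int\frac12|V^i|^2\,d\omega^i_t\,dt+\frac12\int_0^T\!\!\int|\mathbf H|^2\,d\omega_t\,dt\le\omega_0(\mathbb{R}^d),$$ and for a.e. $t>0$, all $i\ne j$ and $\omega^{i,j}_t$-a.e. $x$: $V^i=-V^j$ and $|\langle\lambda^{i,j}_{x,t}\rangle|^2\mathbf H=(\mathbf H\cdot\langle\lambda^{i,j}_{x,t}\rangle)\langle\lambda^{i,j}_{x,t}\rangle$. **Calibrated evolutions.** Let $T_{cal}\in(0,\infty)$,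 and for $t\in[0,T_{cal}]$ let $\mathscr A(t)$ be a phase partition into non-empty sets with $\partial\mathscr A^i(t)=\overline{\partial^*\mathscr A^i(t)}$ and $\mathcal H^{d-1}(\partial\mathscr A^i(t)\setminus\partial^*\mathscr A^i(t))=0$. Let $\mathcal I_{i,j}(t):=\partial^*\mathscr A^i(t)\cap\partial^*\mathscr A^j(t)$, with unit normal $n_{\mathcal I_{i,j}(t)}$ pointing from $\mathscr A^i(t)$ to $\mathscr A^j(t)$, and $\mathrm{dist}(x,\emptyset):=\infty$. $\mathscr A$ is a calibrated evolution on $[0,T_{cal}]$ if there are vector fields $\xi_i$, $B$ and weights $\vartheta^i$ on $\mathbb{R}^d\times[0,T_{cal}]$ — $\xi_i$ of class $C^1$, bounded with bounded first derivatives; $B$ continuous and $C^1$ in $x$, with $B,\nabla B$ bounded and continuous on $\mathbb{R}^d\times[0,T_{cal}]$; $\vartheta^i$ Lipschitz — such that, with $\xi_{i,j}:=\xi_i-\xi_j$, some $c\in(0,1]$, $C'\ge1$, for all $i\ne j$, $t\in[0,T_{cal}]$, $x,v\in\mathbb{R}^d$, and $O(\cdot)$ uniform: $\xi_{i,j}=n_{\mathcal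 I_{i,j}(t)}$ along $\mathcal I_{i,j}(t)$; $\;c\min\{1,\mathrm{dist}^2(x,\mathcal I_{i,j}(t))\}\le1-|\xi_{i,j}(x,t)|$; $\partial_t\xi_{i,j}+(B\cdot\nabla)\xi_{i,j}+(\nabla B)^{\mathsf T}\xi_{i,j}=O(\min\{1,\mathrm{dist}(x,\mathcal I_{i,j}(t))\})$; $\xi_{i,j}\cdot(\partial_t\xi_{i,j}+(B\cdot\nabla)\xi_{i,j})=O(\min\{1,\mathrm{dist}^2(x,\mathcal I_{i,j}(t))\})$; $B\cdot\xi_{i,j}+\nabla\cdot\xi_{i,j}=O(\min\{1,\mathrm{dist}(x,\mathcal I_{i,j}(t))\})$; $|(\xi_{i,j}\otimes w+w\otimes\xi_{i,j}):\nabla B|=O(|v|\min\{1,\mathrm{dist}(x,\mathcal I_{i,j}(t))\})$ with $w:=(I_d-\xi_{i,j}\otimes\xi_{i,j})v$; $\vartheta^i(\cdot,t)<0$ in $\mathscr A^i(t)$, $\vartheta^i(\cdot,t)>0$ in $\mathbb{R}^d\setminus\overline{\mathscr A^i(t)}$; $\;c\min\{1,\mathrm{dist}(x,\partial\mathscr A^i(t))\}\le|\vartheta^i(x,t)|\le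 C'\min\{1,\mathrm{dist}(x,\partial\mathscr A^i(t))\}$; and $\partial_t\vartheta^i+(B\cdot\nabla)\vartheta^i=O(\min\{1,\mathrm{dist}(x,\partial\mathscr A^i(t))\})$ for a.e. $(x,t)$. **Theorem.** Let $\mathscr A$ be a calibrated evolution on $[0,T_{cal}]$ (with $\xi_i,B,\vartheta^i$ as above). There is a constant $C>0$ depending only on this calibrated evolution such that the following holds for every De Giorgi type varifold solution $(\mu,\chi)$ with initial data $(\mu_0,\chi_0)$. Put $$E[\mu,\chi|\mathscr A](t):=\int1\,d\omega_t-\frac12\sum_{i\ne j}\int p\cdot\xi_{i,j}(\cdot,t)\,d\mu^{i,j}_t,\qquad E_{bulk}[\chi|\mathscr A](t):=\sum_{i=1}^P\int|\chi_{A^i(t)}-\chi_{\mathscr A^i(t)}|\,|\vartheta^i(\cdot,t)|\,dx,$$ and define $E[\mu_0,\chi_0|\mathscr A(0)]$, $E_{bulk}[\chi_0|\mathscr A(0)]$ in the same way from the initial data at $t=0$. Both functions are integrable on $[0,T_{cal}]$, and for a.e. $T\in[0,T_{cal}]$ $$E[\mu,\chi|\mathscr A](T)\le E[\mu_0,\chi_0|\mathscr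 A(0)]+C\int_0^TE[\mu,\chi|\mathscr A](t)\,dt,$$ $$E_{bulk}[\chi|\mathscr A](T)\le E_{bulk}[\chi_0|\mathscr A(0)]+E[\mu_0,\chi_0|\mathscr A(0)]+C\int_0^T\big(E_{bulk}[\chi|\mathscr A](t)+E[\mu,\chi|\mathscr A](t)\big)\,dt.$$ In particular, if $\chi^i_0=\chi_{\mathscr A^i(0)}$ a.e. and $\mu^i_0=|\nabla\chi^i_0|\otimes(\delta_{n^i_0(x)})_x$ with $n_0^i=\nabla\chi_0^i/|\nabla\chi_0^i|$ for all $i$, then for a.e. $t\in[0,T_{cal}]$ and all $i$: $\chi_{A^i(t)}=\chi_{\mathscr A^i(t)}$ a.e. in $\mathbb{R}^d$, and $\mu^i_t=|\nabla\chi_{A^i(t)}|\otimes(\delta_{n^i(x,t)})_x$ with $n^i(\cdot,t)=\nabla\chi_{A^i(t)}/|\nabla\chi_{A^i(t)}|$. -/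

import Mathlib

open MeasureTheory Set Filter Topology
open scoped NNReal ContDiff ZeroAtInfty

noncomputable section

namespace MultiPhaseMCF

/-! ### Euclidean space, oriented varifolds, test functions -/

/-- The Euclidean space `ℝ^d`. -/
abbrev Space (d : ℕ) : Type := EuclideanSpace ℝ (Fin d)

/-- The unit sphere `𝕊^{d-1}` of `ℝ^d`. -/
abbrev Sph (d : ℕ) : Type := Metric.sphere (0 : Space d) 1

/-- Oriented varifolds: finite Borel measures on `ℝ^d × 𝕊^{d-1}`. -/
abbrev Varifold (d : ℕ) : Type := FiniteMeasure (Space d × Sph d)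

variable {d P : ℕ}

/-- The mass measure `ω` of an oriented varifold, i.e. its marginal on `ℝ^d`. -/
def mass (m : Varifold d) : Measure (Space d) := (m : Measure (Space d × Sph d)).fst

/-- An oriented varifold, regarded as a measure on `ℝ^d × ℝ^d` carried by `ℝ^d × 𝕊^{d-1}`. -/
def ambient (m : Varifold d) : Measure (Space d × Space d) :=
  (m : Measure (Space d × Sph d)).map (fun z => (z.1, (z.2 : Space d)))

instance (m : Varifold d) : IsFiniteMeasure (ambient m) := by
  unfold ambient; infer_instance

/-- The expected value `⟨λ_x⟩ = ∫ p dλ_x(p)`, where `m = ω ⊗ (λ_x)_x` is the disintegration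
of `m` with respect to its mass measure. -/
def meanNormal (m : Varifold d) (x : Space d) : Space d :=
  ∫ p, p ∂((ambient m).condKernel x)

/-- The divergence of a vector field. -/
def divergence (F : Space d → Space d) (x : Space d) : ℝ :=
  ∑ k : Fin d, (fderiv ℝ F x (EuclideanSpace.single k 1)) k

/-- Smooth functions with compact support. On `ℝ × ℝ^d` (time first), their restrictions to
`t ≥ 0` are the elements of `C_c^∞(ℝ^d × [0,∞))`. -/
def IsTest {X Y : Type*} [NormedAddCommGroup X] [NormedSpace ℝ X]
    [NormedAddCommGroup Y] [NormedSpace ℝ Y] (f : X → Y) : Prop :=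
  ContDiff ℝ ∞ f ∧ HasCompactSupport f

/-! ### Sets of finite perimeter -/

/-- `ρ = |∇χ_A|` and `n = ∇χ_A / |∇χ_A|`: the distributional gradient of the indicator function
of `A` is the finite vector measure `n ρ`, with `|n| = 1` `ρ`-almost everywhere. This determines
`ρ`, and it determines `n` up to `ρ`-null sets. -/
def IsPolarGradient (A : Set (Space d)) (ρ : Measure (Space d)) (n : Space d → Space d) : Prop :=
  IsFiniteMeasure ρ ∧ Measurable n ∧ (∀ᵐ x ∂ρ, ‖n x‖ = 1) ∧
    ∀ φ : Space d → Space d, IsTest φ →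
      ∫ x in A, divergence φ x = - ∫ x, inner ℝ (φ x) (n x) ∂ρ

/-- `A` is a measurable set of finite perimeter in `ℝ^d`. -/
def HasFinitePerimeter (A : Set (Space d)) : Prop :=
  MeasurableSet A ∧ ∃ q : Measure (Space d) × (Space d → Space d), IsPolarGradient A q.1 q.2

open Classical in
/-- The total variation measure `|∇χ_A|` (for `A` of finite perimeter). -/
def perimeterMeasure (A : Set (Space d)) : Measure (Space d) :=
  if h : HasFinitePerimeter A then h.2.choose.1 else 0

open Classical in
/-- The density `∇χ_A / |∇χ_A|`, i.e. the measure theoretic inner unit normal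
(for `A` of finite perimeter). -/
def innerNormal (A : Set (Space d)) : Space d → Space d :=
  if h : HasFinitePerimeter A then h.2.choose.2 else 0

/-- `x` is a point of the reduced boundary of `A`, with inner unit normal `ν` at `x`. -/
def IsInnerNormalAt (A : Set (Space d)) (x ν : Space d) : Prop :=
  (∀ r : ℝ, 0 < r → 0 < perimeterMeasure A (Metric.ball x r)) ∧ ‖ν‖ = 1 ∧
    Tendsto (fun r : ℝ => ⨍ y in Metric.ball x r, innerNormal A y ∂(perimeterMeasure A))
      (𝓝[>] 0) (𝓝 ν)

/-- The (De Giorgi) reduced boundary `∂*A`. -/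
def reducedBoundary (A : Set (Space d)) : Set (Space d) := {x | ∃ ν, IsInnerNormalAt A x ν}

/-- `m = |∇χ_A| ⊗ (δ_{n(x)})_x` with `n = ∇χ_A / |∇χ_A|`. -/
def IsUnitDensityBoundary (m : Varifold d) (A : Set (Space d)) : Prop :=
  ambient m = (perimeterMeasure A).map (fun x => (x, innerNormal A x))

/-- `A = (A^1,…,A^P)` is a partition (up to Lebesgue null sets) of `ℝ^d` into open sets of finite
perimeter, all of which except for the last one have finite volume. -/
structure IsPhasePartition (A : Fin P → Set (Space d)) : Prop where
  isOpen : ∀ i, IsOpen (A i)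
  finitePerimeter : ∀ i, HasFinitePerimeter (A i)
  disjoint : ∀ i j, i ≠ j → Disjoint (A i) (A j)
  cover : ∀ᵐ x : Space d, ∃ i, x ∈ A i
  finiteVolume : ∀ i : Fin P, (i : ℕ) + 1 ≠ P → volume (A i) < ⊤

/-! ### De Giorgi type varifold solutions -/

/-- The varifold `μ^i = 2 μ^{i,i} + ∑_{j ≠ i} μ^{j,i}` of the `i`-th phase. -/
def grain (m : Fin P → Fin P → Varifold d) (i : Fin P) : Varifold d :=
  (2 : ℝ≥0) • m i i + ∑ j ∈ Finset.univ.erase i, m j i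

/-- The varifold `μ = (1/2) ∑_i μ^i` of the whole network. -/
def network (m : Fin P → Fin P → Varifold d) : Varifold d :=
  (2⁻¹ : ℝ≥0) • ∑ i, grain m i

/-- The compatibility conditions at a fixed time which couple the varifolds among each other and
with the phases. -/
structure IsCompatible (m : Fin P → Fin P → Varifold d) (A : Fin P → Set (Space d)) : Prop where
  mass_symm : ∀ i j, i ≠ j → mass (m i j) = mass (m j i)
  normal_antisymm : ∀ i j, i ≠ j →
    ∀ᵐ x ∂(mass (m i j)), meanNormal (m i j) x = - meanNormal (m j i) x
  normal_diag : ∀ i, ∀ᵐ x ∂(mass (m i i)), meanNormal (m i i) x = 0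
  gradient : ∀ i, ∀ φ : Space d → Space d, IsTest φ →
    ∫ x, inner ℝ (φ x) (innerNormal (A i) x) ∂(perimeterMeasure (A i)) =
      ∫ z, inner ℝ (φ z.1) (z.2 : Space d) ∂(grain m i : Measure (Space d × Sph d))

/-- The pair `(μ, A)` (families indexed by the times `t > 0`; values at other times play no role)
is a De Giorgi type varifold solution for multi-phase mean curvature flow with initial data
`(μ₀, A₀)`. -/
structure IsDeGiorgiSolution (μ₀ : Fin P → Fin P → Varifold d) (A₀ : Fin P → Set (Space d))
    (μ : ℝ → Fin P → Fin P → Varifold d) (A : ℝ → Fin P → Set (Space d)) : Prop where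
  initial_partition : IsPhasePartition A₀
  initial_compatible : IsCompatible μ₀ A₀
  varifold_measurable : ∀ i j, ∀ η : ℝ → C₀(Space d × Sph d, ℝ), IntegrableOn η (Ioi 0) →
    AEStronglyMeasurable (fun t => ∫ z, η t z ∂(μ t i j : Measure (Space d × Sph d)))
      (volume.restrict (Ioi 0))
  partition : ∀ t, 0 < t → IsPhasePartition (A t)
  phase_measurable : ∀ i, NullMeasurableSet {q : ℝ × Space d | q.2 ∈ A q.1 i}
    (volume.restrict (Ioi (0 : ℝ) ×ˢ univ))
  locally_bounded_perimeter : ∀ i, ∀ R : ℝ, ∃ M : ℝ≥0, ∀ᵐ t ∂(volume.restrict (Ioi (0 : ℝ))),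
    perimeterMeasure (A t i) (Metric.ball 0 R) ≤ M
  compatible : ∀ᵐ t ∂(volume.restrict (Ioi (0 : ℝ))), IsCompatible (μ t) (A t)
  exists_velocity_curvature :
    ∃ (V : ℝ → Fin P → Space d → ℝ) (H : ℝ → Space d → Space d),
      -- `V^i ∈ L²((0,∞); L²(ω^i_t))` and `H ∈ L²((0,∞); L²(ω_t; ℝ^d))`
      (∀ i, Measurable (fun q : ℝ × Space d => V q.1 i q.2)) ∧
      (∀ i, ∫⁻ t in Ioi (0 : ℝ), ∫⁻ x, ‖V t i x‖ₑ ^ 2 ∂(mass (grain (μ t) i)) < ⊤) ∧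
      Measurable (fun q : ℝ × Space d => H q.1 q.2) ∧
      (∫⁻ t in Ioi (0 : ℝ), ∫⁻ x, ‖H t x‖ₑ ^ 2 ∂(mass (network (μ t))) < ⊤) ∧
      -- the `V^i` are the normal speeds of the phases
      (∀ i, ∀ᵐ T ∂(volume.restrict (Ioi (0 : ℝ))), ∀ ζ : ℝ × Space d → ℝ, IsTest ζ →
        (∫ x in A T i, ζ (T, x)) - ∫ x in A₀ i, ζ (0, x) =
          (∫ t in (0 : ℝ)..T, ∫ x in A t i, deriv (fun s => ζ (s, x)) t) -
            ∫ t in (0 : ℝ)..T, ∫ x, V t i x * ζ (t, x) ∂(mass (grain (μ t) i))) ∧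
      -- `H` is the generalized mean curvature vector
      (∀ᵐ T ∂(volume.restrict (Ioi (0 : ℝ))), ∀ F : ℝ × Space d → Space d, IsTest F →
        ∫ t in (0 : ℝ)..T, ∫ x, inner ℝ (H t x) (F (t, x)) ∂(mass (network (μ t))) =
          - ∫ t in (0 : ℝ)..T, ∫ z, (divergence (fun y => F (t, y)) z.1 -
              inner ℝ (z.2 : Space d) (fderiv ℝ (fun y => F (t, y)) z.1 (z.2 : Space d)))
            ∂(network (μ t) : Measure (Space d × Sph d))) ∧
      -- sharp energy dissipation principle
      (∀ᵐ T ∂(volume.restrict (Ioi (0 : ℝ))),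
        mass (network (μ T)) univ
          + 2⁻¹ * (∑ i, ∫⁻ t in Ioc 0 T, ∫⁻ x, 2⁻¹ * ‖V t i x‖ₑ ^ 2 ∂(mass (grain (μ t) i)))
          + 2⁻¹ * (∫⁻ t in Ioc 0 T, ∫⁻ x, ‖H t x‖ₑ ^ 2 ∂(mass (network (μ t))))
          ≤ mass (network μ₀) univ) ∧
      -- compatibility of the normal speeds, direction of the mean curvature vector
      (∀ᵐ t ∂(volume.restrict (Ioi (0 : ℝ))), ∀ i j, i ≠ j →
        ∀ᵐ x ∂(mass (μ t i j)), V t i x = - V t j x ∧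
          ‖meanNormal (μ t i j) x‖ ^ 2 • H t x =
            inner ℝ (H t x) (meanNormal (μ t i j) x) • meanNormal (μ t i j) x)

/-! ### Calibrated evolutions -/

/-- `min {1, dist(x, S)}`, with the convention `dist(x, ∅) = ∞`. -/
def truncDist (x : Space d) (S : Set (Space d)) : ℝ := (min 1 (Metric.infEDist x S)).toReal

/-- The interface `∂*A^i ∩ ∂*A^j`. -/
def interface (A : Fin P → Set (Space d)) (i j : Fin P) : Set (Space d) :=
  reducedBoundary (A i) ∩ reducedBoundary (A j)

/-- `ξ_{i,j} = ξ_i - ξ_j`. -/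
def xiDiff (ξ : ℝ → Fin P → Space d → Space d) (i j : Fin P) (t : ℝ) (x : Space d) : Space d :=
  ξ t i x - ξ t j x

/-- `𝒜 = (𝒜^1,…,𝒜^P)` is a calibrated evolution on `[0,T]`, with calibrating vector fields
`ξ_i`, velocity field `B` and weights `ϑ^i`. -/
structure IsCalibratedEvolution (T : ℝ) (𝒜 : ℝ → Fin P → Set (Space d))
    (ξ : ℝ → Fin P → Space d → Space d) (B : ℝ → Space d → Space d)
    (ϑ : ℝ → Fin P → Space d → ℝ) : Prop where
  -- the evolving partition
  partition : ∀ t ∈ Icc 0 T, IsPhasePartition (𝒜 t)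
  nonempty : ∀ t ∈ Icc 0 T, ∀ i, (𝒜 t i).Nonempty
  frontier_eq : ∀ t ∈ Icc 0 T, ∀ i, frontier (𝒜 t i) = closure (reducedBoundary (𝒜 t i))
  frontier_null : ∀ t ∈ Icc 0 T, ∀ i,
    Measure.hausdorffMeasure ((d : ℝ) - 1) (frontier (𝒜 t i) \ reducedBoundary (𝒜 t i)) = 0
  -- regularity: `ξ_i` is `C^1`, `B` is continuous and `C^1` in space, `ϑ^i` is Lipschitz
  xi_contDiff : ∀ i, ContDiffOn ℝ 1 (fun q : ℝ × Space d => ξ q.1 i q.2) (Icc 0 T ×ˢ univ)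
  xi_bounded : ∃ M : ℝ, ∀ i, ∀ t ∈ Icc 0 T, ∀ x, ‖ξ t i x‖ ≤ M ∧
    ‖derivWithin (fun s => ξ s i x) (Icc 0 T) t‖ ≤ M ∧ ‖fderiv ℝ (ξ t i) x‖ ≤ M
  B_continuous : ContinuousOn (fun q : ℝ × Space d => B q.1 q.2) (Icc 0 T ×ˢ univ)
  B_differentiable : ∀ t ∈ Icc 0 T, Differentiable ℝ (B t)
  B_fderiv_continuous :
    ContinuousOn (fun q : ℝ × Space d => fderiv ℝ (B q.1) q.2) (Icc 0 T ×ˢ univ)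
  B_bounded : ∃ M : ℝ, ∀ t ∈ Icc 0 T, ∀ x, ‖B t x‖ ≤ M ∧ ‖fderiv ℝ (B t) x‖ ≤ M
  weight_lipschitz : ∀ i, ∃ L : ℝ≥0,
    LipschitzOnWith L (fun q : ℝ × Space d => ϑ q.1 i q.2) (Icc 0 T ×ˢ univ)
  -- `ξ_{i,j}` extends the unit normal of the interface pointing from `𝒜^i` to `𝒜^j`
  extension : ∀ i j, i ≠ j → ∀ t ∈ Icc 0 T, ∀ x ∈ interface (𝒜 t) i j,
    ∀ ν, IsInnerNormalAt (𝒜 t i) x ν → xiDiff ξ i j t x = - ν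
  length_control : ∃ c : ℝ, 0 < c ∧ c ≤ 1 ∧ ∀ i j, i ≠ j → ∀ t ∈ Icc 0 T, ∀ x,
    c * truncDist x (interface (𝒜 t) i j) ^ 2 ≤ 1 - ‖xiDiff ξ i j t x‖
  transport_xi : ∃ C : ℝ, ∀ i j, i ≠ j → ∀ t ∈ Icc 0 T, ∀ x,
    ‖derivWithin (fun s => xiDiff ξ i j s x) (Icc 0 T) t
        + fderiv ℝ (xiDiff ξ i j t) x (B t x)
        + ContinuousLinearMap.adjoint (fderiv ℝ (B t) x) (xiDiff ξ i j t x)‖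
      ≤ C * truncDist x (interface (𝒜 t) i j)
  transport_length : ∃ C : ℝ, ∀ i j, i ≠ j → ∀ t ∈ Icc 0 T, ∀ x,
    |inner ℝ (xiDiff ξ i j t x)
        (derivWithin (fun s => xiDiff ξ i j s x) (Icc 0 T) t
          + fderiv ℝ (xiDiff ξ i j t) x (B t x))|
      ≤ C * truncDist x (interface (𝒜 t) i j) ^ 2
  mean_curvature : ∃ C : ℝ, ∀ i j, i ≠ j → ∀ t ∈ Icc 0 T, ∀ x,
    |inner ℝ (B t x) (xiDiff ξ i j t x) + divergence (xiDiff ξ i j t) x|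
      ≤ C * truncDist x (interface (𝒜 t) i j)
  -- the extra condition on `∇B`, with `w = (I_d - ξ_{i,j} ⊗ ξ_{i,j}) v`
  gradient_B : ∃ C : ℝ, ∀ i j, i ≠ j → ∀ t ∈ Icc 0 T, ∀ x v w,
    w = v - inner ℝ (xiDiff ξ i j t x) v • xiDiff ξ i j t x →
    |inner ℝ (xiDiff ξ i j t x) (fderiv ℝ (B t) x w)
        + inner ℝ w (fderiv ℝ (B t) x (xiDiff ξ i j t x))|
      ≤ C * (‖v‖ * truncDist x (interface (𝒜 t) i j))
  -- the weights
  weight_neg : ∀ i, ∀ t ∈ Icc 0 T, ∀ x ∈ 𝒜 t i, ϑ t i x < 0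
  weight_pos : ∀ i, ∀ t ∈ Icc 0 T, ∀ x, x ∉ closure (𝒜 t i) → 0 < ϑ t i x
  weight_transport : ∃ C : ℝ, ∀ i,
    ∀ᵐ q : ℝ × Space d ∂(volume.restrict (Ioo 0 T ×ˢ univ)),
      |deriv (fun s => ϑ s i q.2) q.1 + fderiv ℝ (ϑ q.1 i) q.2 (B q.1 q.2)|
        ≤ C * truncDist q.2 (frontier (𝒜 q.1 i))
  weight_coercive : ∃ c C : ℝ, 0 < c ∧ c ≤ 1 ∧ 1 ≤ C ∧ ∀ i, ∀ t ∈ Icc 0 T, ∀ x,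
    c * truncDist x (frontier (𝒜 t i)) ≤ |ϑ t i x| ∧
      |ϑ t i x| ≤ C * truncDist x (frontier (𝒜 t i))

/-! ### Relative entropy and bulk error -/

/-- The relative entropy at a fixed time,
`∫ 1 dω - (1/2) ∑_{i ≠ j} ∫ p · ξ_{i,j} dμ^{i,j}`. -/
def relEntropy (m : Fin P → Fin P → Varifold d) (ξ : ℝ → Fin P → Space d → Space d)
    (t : ℝ) : ℝ :=
  (mass (network m)).real univ - (1 / 2) * ∑ i, ∑ j ∈ Finset.univ.erase i,
    ∫ z, inner ℝ (z.2 : Space d) (xiDiff ξ i j t z.1) ∂(m i j : Measure (Space d × Sph d))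

/-- The bulk error at a fixed time, `∑_i ∫ |χ_{A^i} - χ_{𝒜^i}| |ϑ^i| dx`. -/
def bulkError (A 𝒜 : Fin P → Set (Space d)) (ϑ : Fin P → Space d → ℝ) : ℝ :=
  ∑ i, ∫ x, |(A i).indicator (fun _ => (1 : ℝ)) x - (𝒜 i).indicator (fun _ => (1 : ℝ)) x|
    * |ϑ i x|

end MultiPhaseMCF

end

open MultiPhaseMCF

/-!
The proof is a relative entropy argument. By compatibility the relative entropy `E` equals
`ω(ℝ^d) + ∑_i ∫ p · ξ_i dμ^i` (`relEntropy_eq_flux`), which is affine in the fluxes of the `ξ_i`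
through the grains. It also equals `∑_i ω^{i,i}(ℝ^d) + ½ ∑_{i≠j} ∫ (1 - p · ξ_{i,j}) dμ^{i,j}`
(`relEntropy_eq_tiltExcess`). Hence it is nonnegative, and it controls the tilt excess and, by the
length condition on `ξ_{i,j}`, the squared distance to the calibrated interfaces.

Growth of `E`. The divergence of `ξ_i` is admissible in the velocity equation and turns it into the
evolution of the flux of `ξ_i` (`WeakEvolution.flux`); `B` is admissible in the equation for the mean
curvature vector (`curvature_identity_of_test`). Added to these two is the fact that the boundary of a
set does not see the divergence-free field `(ξ_i·∇)B + (∇·ξ_i)B - (B·∇)ξ_i - (∇·B)ξ_i`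
(`WeakEvolution.integral_wedgeField`). With the energy dissipation inequality, `E(T) - E(0)` is then
bounded by a space-time integral (`IsSpacetimeForm.relEntropy_le`). At a fixed time the two grains
meeting at an interface are paired, with `μ^{j,i}` exchanged for `μ^{i,j}` in everything which is
affine in the normal. Completing squares in `V + B · ξ` and in `H - (B · ξ) ξ`, which uses that `H` is
parallel to the mean normal, leaves only errors quadratic in the tilt and in the distance
(`exists_pointwise_bound`, `exists_pair_bound`, `exists_fixed_time_bound`).

The identities above hold for smooth compactly supported fields only. They are extended to bounded
`C¹` fields, and to Lipschitz weights with an integrable spatial cut-off, by mollification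
(`exists_test_approx`): values and derivatives converge boundedly, and at every point where the
derivative is continuous, which matters because the varifolds are singular. The fields are first
frozen in time outside `[0, T]` (`IsCalibratedEvolution.exists_spacetimeCalibration`). Measurability in
time is handled by representing the families of varifolds by kernels (`exists_kernel_ae_eq`).

Bulk error. As `ϑ^i` is negative exactly on `𝒜^i`, one has `|χ_A - χ_𝒜| |ϑ| = χ_A ϑ + ϑ⁻`. So the
transport of `ϑ` on the moving set and of `ϑ⁻` on the whole space suffices (`weighted_bulk_le`). The
boundary term `∫ ϑ^i (B · p - V^i) dω^i` is absorbed into the same completed squares, because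
`ϑ^i - ϑ^j` is of the order of the distance to the interface; this is where the weights enter in
`exists_fixed_time_bound`. The estimates are first proved with a decaying weight in space, Grönwall's
inequality makes them uniform, and letting the weight tend to one removes it
(`IsCalibratedEvolution.exists_stability`).

Uniqueness. Well prepared data have `E = 0` and no bulk error, so by Grönwall both vanish at almost
every time. If the bulk error vanishes, the phases agree, since the weights vanish only on the null set
`⋃ ∂𝒜^i`. If `E = 0`, then `μ^{i,i} = 0` and `p = ξ_{i,j}` holds `μ^{i,j}`-almost everywhere. The
unit vectors occurring in a grain make angles of at most `60°`, so its mean normal does not vanish,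
and the gradient identity shows that its mass is absolutely continuous with respect to the perimeter
measure. The mass is therefore carried by the reduced boundaries, where `ξ_{i,j}` is the
normal. Thus `μ^i` provides a polar decomposition of `∇χ_{A^i}`, and polar decompositions are unique
(`IsCalibratedEvolution.rigidity`, `IsPolarGradient.unique`, `ae_isInnerNormalAt`).
-/

set_option linter.unusedSectionVars false

namespace MultiPhaseMCF

/-! ### Mollification and approximation by test functions -/


section Mollification

open scoped Convolution

variable {E : Type*} [NormedAddCommGroup E] [NormedSpace ℝ E] [FiniteDimensional ℝ E]
  [MeasurableSpace E] [BorelSpace E] {Y : Type*} [NormedAddCommGroup Y] [NormedSpace ℝ Y]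
  [CompleteSpace Y] {μ : Measure E} [μ.IsAddHaarMeasure]

/-- A sequence of bump functions concentrating at the origin. -/
noncomputable def shrinkingBump (E : Type*) [NormedAddCommGroup E] [NormedSpace ℝ E] (n : ℕ) :
    ContDiffBump (0 : E) where
  rIn := 1 / ((n : ℝ) + 1)
  rOut := 2 * (1 / ((n : ℝ) + 1))
  rIn_pos := by positivity
  rIn_lt_rOut := by
    have : 0 < 1 / ((n : ℝ) + 1) := by positivity
    linarith

lemma tendsto_rOut_shrinkingBump :
    Tendsto (fun n => (shrinkingBump E n).rOut) atTop (𝓝 0) := by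
  have := (tendsto_one_div_add_atTop_nhds_zero_nat (𝕜 := ℝ)).const_mul 2
  simpa [shrinkingBump] using this

/-- Mollification of `f` at scale `1 / (n + 1)`. -/
noncomputable def mollify (μ : Measure E) [μ.IsAddHaarMeasure] (n : ℕ) (f : E → Y) : E → Y :=
  (shrinkingBump E n).normed μ ⋆[ContinuousLinearMap.lsmul ℝ ℝ, μ] f

lemma mollify_apply (n : ℕ) (f : E → Y) (z : E) :
    mollify μ n f z = ∫ w, (shrinkingBump E n).normed μ w • f (z - w) ∂μ := by
  simp [mollify, convolution_def]

lemma norm_mollify_le (n : ℕ) {f : E → Y} {M : ℝ} (hf : ∀ z, ‖f z‖ ≤ M) (z : E) :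
    ‖mollify μ n f z‖ ≤ M := by
  rw [mollify_apply]
  calc ‖∫ w, (shrinkingBump E n).normed μ w • f (z - w) ∂μ‖
      ≤ ∫ w, (shrinkingBump E n).normed μ w * M ∂μ := by
        apply norm_integral_le_of_norm_le
        · exact ((shrinkingBump E n).integrable_normed).mul_const M
        · refine Eventually.of_forall fun w => ?_
          rw [norm_smul, Real.norm_of_nonneg ((shrinkingBump E n).nonneg_normed w)]
          exact mul_le_mul_of_nonneg_left (hf _) ((shrinkingBump E n).nonneg_normed w)
    _ = M := by rw [integral_mul_const, (shrinkingBump E n).integral_normed, one_mul]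

lemma contDiff_mollify (n : ℕ) {f : E → Y} (hf : Continuous f) : ContDiff ℝ ∞ (mollify μ n f) :=
  (shrinkingBump E n).hasCompactSupport_normed.contDiff_convolution_left _
    (shrinkingBump E n).contDiff_normed hf.locallyIntegrable

lemma tendsto_mollify {f : E → Y} {z : E} (hm : AEStronglyMeasurable f μ)
    (hf : ContinuousAt f z) : Tendsto (fun n => mollify μ n f z) atTop (𝓝 (f z)) := by
  refine ContDiffBump.convolution_tendsto_right (g := fun _ => f) (k := fun _ => z)
    tendsto_rOut_shrinkingBump (Eventually.of_forall fun _ => hm) ?_ tendsto_const_nhds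
  exact Tendsto.comp hf tendsto_snd

lemma ae_tendsto_mollify {f : E → Y} (hf : LocallyIntegrable f μ) :
    ∀ᵐ z ∂μ, Tendsto (fun n => mollify μ n f z) atTop (𝓝 (f z)) := by
  refine ContDiffBump.ae_convolution_tendsto_right_of_locallyIntegrable
    (φ := shrinkingBump E) (K := 2) tendsto_rOut_shrinkingBump ?_ hf
  exact Eventually.of_forall fun n => le_of_eq (by simp [shrinkingBump])

/-- Differentiation commutes with mollification, in every direction along which the function is
Lipschitz and almost everywhere differentiable. -/
lemma fderiv_mollify (n : ℕ) {f : E → Y} (hf : Continuous f) {v : E} {L : ℝ}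
    (hL : ∀ z (s : ℝ), ‖f (z + s • v) - f z‖ ≤ L * |s|)
    (hd : ∀ᵐ z ∂μ, LineDifferentiableAt ℝ f z v) (z : E) :
    fderiv ℝ (mollify μ n f) z v = mollify μ n (fun w => lineDeriv ℝ f w v) z := by
  set φ := (shrinkingBump E n).normed μ with hφ
  have hφc : Continuous φ := (shrinkingBump E n).contDiff_normed (n := 0).continuous
  have hφi : Integrable φ μ := (shrinkingBump E n).integrable_normed
  have hφs : HasCompactSupport φ := (shrinkingBump E n).hasCompactSupport_normed
  have hmeas : ∀ s : ℝ, Continuous fun w => φ w • f (z + s • v - w) := fun s => by fun_prop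
  have key := hasDerivAt_integral_of_dominated_loc_of_lip (μ := μ) (𝕜 := ℝ)
    (F := fun (s : ℝ) w => φ w • f (z + s • v - w)) (x₀ := 0) (s := univ)
    (F' := fun w => φ w • lineDeriv ℝ f (z - w) v) (bound := fun w => φ w * L)
    univ_mem (Eventually.of_forall fun s => (hmeas s).aestronglyMeasurable)
    ((hmeas 0).integrable_of_hasCompactSupport hφs.smul_right) ?_ ?_ (hφi.mul_const L) ?_
  · have h1 : HasDerivAt (fun s : ℝ => mollify μ n f (z + s • v))
        (fderiv ℝ (mollify μ n f) z v) 0 := by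
      have hdf : HasFDerivAt (mollify μ n f) (fderiv ℝ (mollify μ n f) z) (z + (0 : ℝ) • v) := by
        simpa using ((contDiff_mollify n hf).differentiable (by simp) z).hasFDerivAt
      have hl : HasDerivAt (fun s : ℝ => z + s • v) v 0 := by
        simpa using ((hasDerivAt_id (0 : ℝ)).smul_const v).const_add z
      exact hdf.comp_hasDerivAt (0 : ℝ) hl
    have h2 := key.2
    simp only [← mollify_apply, hφ] at h2
    rw [mollify_apply]
    exact h1.unique h2
  · exact hφc.aestronglyMeasurable.smul
      ((stronglyMeasurable_lineDeriv hf).aestronglyMeasurable.comp_measurePreserving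
        (Measure.measurePreserving_sub_left μ z))
  · refine Eventually.of_forall fun w => ?_
    refine LipschitzOnWith.of_dist_le_mul fun s _ s' _ => ?_
    have h0 := (shrinkingBump E n).nonneg_normed (μ := μ) w
    have hL' := hL (z + s' • v - w) (s - s')
    have e : z + s' • v - w + (s - s') • v = z + s • v - w := by module
    rw [e] at hL'
    have : (0 : ℝ) ≤ L * |s - s'| := (norm_nonneg _).trans hL'
    rw [dist_eq_norm, ← smul_sub, norm_smul, Real.norm_of_nonneg h0, Real.dist_eq,
      Real.coe_nnabs]
    calc φ w * ‖f (z + s • v - w) - f (z + s' • v - w)‖ ≤ φ w * (L * |s - s'|) := by gcongr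
      _ = (φ w * L) * |s - s'| := by ring
      _ ≤ _ := by gcongr; exact le_abs_self _
  · have := (Measure.measurePreserving_sub_left μ z).quasiMeasurePreserving.ae hd
    filter_upwards [this] with w hw
    have h3 : HasDerivAt (fun s : ℝ => f (z - w + s • v)) (lineDeriv ℝ f (z - w) v) 0 :=
      hw.hasLineDerivAt
    have h4 := h3.const_smul (φ w)
    refine h4.congr_of_eventuallyEq (Eventually.of_forall fun s => ?_)
    simp only [Pi.smul_apply]
    congr 2; module

/-- A Lipschitz bound along lines in the direction `v` bounds the derivative in this direction; at
points without a line derivative, `lineDeriv` vanishes. -/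
lemma norm_lineDeriv_le_of_lip {f : E → Y} {v : E} {L : ℝ} (hL0 : 0 ≤ L)
    (hL : ∀ z (s : ℝ), ‖f (z + s • v) - f z‖ ≤ L * |s|) (z : E) : ‖lineDeriv ℝ f z v‖ ≤ L := by
  refine norm_deriv_le_of_lip' hL0 (Eventually.of_forall fun s => ?_)
  simpa using hL z s

/-- A smooth cut-off function with values in `[0, 1]`, equal to one on the ball of radius `n + 1`. -/
noncomputable def cutoff (E : Type*) [NormedAddCommGroup E] [NormedSpace ℝ E]
    [FiniteDimensional ℝ E] (n : ℕ) (z : E) : ℝ :=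
  (⟨1, 2, by norm_num, by norm_num⟩ : ContDiffBump (0 : E)) ((1 / ((n : ℝ) + 1)) • z)

lemma contDiff_cutoff (n : ℕ) : ContDiff ℝ ∞ (cutoff E n) :=
  (ContDiffBump.contDiff _).comp (contDiff_const_smul _)

lemma hasCompactSupport_cutoff (n : ℕ) : HasCompactSupport (cutoff E n) :=
  (ContDiffBump.hasCompactSupport _).comp_homeomorph
    (Homeomorph.smulOfNeZero (1 / ((n : ℝ) + 1)) (by positivity))

lemma cutoff_nonneg (n : ℕ) (z : E) : 0 ≤ cutoff E n z := ContDiffBump.nonneg _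

lemma cutoff_le_one (n : ℕ) (z : E) : cutoff E n z ≤ 1 := ContDiffBump.le_one _

lemma eventually_cutoff_eq_one (z : E) : ∀ᶠ n in atTop, cutoff E n =ᶠ[𝓝 z] 1 := by
  obtain ⟨N, hN⟩ := exists_nat_gt ‖z‖
  filter_upwards [eventually_ge_atTop N] with n hn
  have hlt : ‖z‖ < (n : ℝ) + 1 := by
    have : (N : ℝ) ≤ n := by exact_mod_cast hn
    linarith
  have : ∀ᶠ y : E in 𝓝 z, ‖y‖ < (n : ℝ) + 1 := continuous_norm.continuousAt.eventually_lt_const hlt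
  filter_upwards [this] with y hy
  refine ContDiffBump.one_of_mem_closedBall _ ?_
  have hp : (0 : ℝ) < (n : ℝ) + 1 := by positivity
  rw [mem_closedBall_zero_iff, norm_smul, Real.norm_of_nonneg (by positivity), one_div,
    inv_mul_le_iff₀ hp]
  simpa using hy.le

lemma exists_fderiv_cutoff_bound :
    ∃ K : ℝ, 0 ≤ K ∧ ∀ n (z v : E), ‖fderiv ℝ (cutoff E n) z v‖ ≤ K * ‖v‖ := by
  set φ : ContDiffBump (0 : E) := ⟨1, 2, by norm_num, by norm_num⟩
  have hφ : ContDiff ℝ ∞ φ := φ.contDiff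
  obtain ⟨K, hK⟩ := (hφ.continuous_fderiv (by simp)).bounded_above_of_compact_support
    (φ.hasCompactSupport.fderiv (𝕜 := ℝ))
  have hK0 : 0 ≤ K := (norm_nonneg _).trans (hK 0)
  refine ⟨K, hK0, fun n z v => ?_⟩
  have h1 : fderiv ℝ (cutoff E n) z v = (1 / ((n : ℝ) + 1)) • fderiv ℝ φ ((1 / ((n : ℝ) + 1)) • z) v := by
    have : cutoff E n = fun z => φ ((1 / ((n : ℝ) + 1)) • z) := rfl
    rw [this, fderiv_comp_smul]; rfl
  rw [h1, norm_smul, Real.norm_of_nonneg (by positivity)]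
  have h2 : 1 / ((n : ℝ) + 1) ≤ 1 := by
    rw [div_le_one (by positivity)]; linarith [n.cast_nonneg (α := ℝ)]
  calc 1 / ((n : ℝ) + 1) * ‖fderiv ℝ φ ((1 / ((n : ℝ) + 1)) • z) v‖
      ≤ 1 * ‖fderiv ℝ φ ((1 / ((n : ℝ) + 1)) • z) v‖ := by gcongr
    _ ≤ K * ‖v‖ := by
      rw [one_mul]
      exact (ContinuousLinearMap.le_opNorm _ _).trans (by gcongr; exact hK _)

/-- Approximation of a bounded continuous function by test functions. The values converge
everywhere with a uniform bound; the derivatives converge with a uniform bound in those directions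
along which the function is Lipschitz. -/
lemma exists_test_approx (μ : Measure E) [μ.IsAddHaarMeasure] {f : E → Y} {M : ℝ}
    (hf : Continuous f) (hM : ∀ z, ‖f z‖ ≤ M) :
    ∃ F : ℕ → E → Y, (∀ n, IsTest (F n)) ∧ (∀ n z, ‖F n z‖ ≤ M) ∧
      (∀ z, Tendsto (fun n => F n z) atTop (𝓝 (f z))) ∧
      ∀ (v : E) (L : ℝ), 0 ≤ L → (∀ z (s : ℝ), ‖f (z + s • v) - f z‖ ≤ L * |s|) →
        (∀ᵐ z ∂μ, LineDifferentiableAt ℝ f z v) →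
        (∃ K, ∀ n z, ‖fderiv ℝ (F n) z v‖ ≤ K) ∧
        (∀ᵐ z ∂μ, Tendsto (fun n => fderiv ℝ (F n) z v) atTop (𝓝 (lineDeriv ℝ f z v))) ∧
        (∀ z, ContinuousAt (fun w => lineDeriv ℝ f w v) z →
          Tendsto (fun n => fderiv ℝ (F n) z v) atTop (𝓝 (lineDeriv ℝ f z v))) := by
  have hM0 : 0 ≤ M := (norm_nonneg _).trans (hM 0)
  obtain ⟨K, hK0, hK⟩ := exists_fderiv_cutoff_bound (E := E)
  have hfd : ∀ n z v, fderiv ℝ (fun z => cutoff E n z • mollify μ n f z) z v =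
      cutoff E n z • fderiv ℝ (mollify μ n f) z v +
        fderiv ℝ (cutoff E n) z v • mollify μ n f z := fun n z v => by
    rw [fderiv_fun_smul ((contDiff_cutoff n).differentiable (by simp) z)
      ((contDiff_mollify n hf).differentiable (by simp) z)]
    simp
  have hbd : ∀ n z, ‖cutoff E n z‖ ≤ 1 := fun n z => by
    rw [Real.norm_of_nonneg (cutoff_nonneg n z)]; exact cutoff_le_one n z
  refine ⟨fun n z => cutoff E n z • mollify μ n f z, fun n =>
    ⟨(contDiff_cutoff n).smul (contDiff_mollify n hf), (hasCompactSupport_cutoff n).smul_right⟩,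
    fun n z => ?_, fun z => ?_, fun v L hL0 hL hd => ?_⟩
  · rw [norm_smul]
    calc _ ≤ 1 * M := mul_le_mul (hbd n z) (norm_mollify_le n hM z) (norm_nonneg _) zero_le_one
      _ = M := one_mul M
  · refine (tendsto_mollify (μ := μ) hf.aestronglyMeasurable hf.continuousAt).congr' ?_
    filter_upwards [eventually_cutoff_eq_one z] with n hn
    rw [hn.eq_of_nhds]; simp
  · have hg := norm_lineDeriv_le_of_lip hL0 hL
    have hgm : StronglyMeasurable fun w => lineDeriv ℝ f w v := stronglyMeasurable_lineDeriv hf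
    have hev : ∀ z, ∀ᶠ n in atTop, mollify μ n (fun w => lineDeriv ℝ f w v) z =
        fderiv ℝ (fun z => cutoff E n z • mollify μ n f z) z v := fun z => by
      filter_upwards [eventually_cutoff_eq_one z] with n hn
      rw [hfd, fderiv_mollify n hf hL hd, hn.eq_of_nhds, hn.fderiv_eq]
      simp
    refine ⟨⟨L + K * ‖v‖ * M, fun n z => ?_⟩, ?_, fun z hz => ?_⟩
    · rw [hfd, fderiv_mollify n hf hL hd]
      refine (norm_add_le _ _).trans (add_le_add ?_ ?_)
      · rw [norm_smul]
        calc _ ≤ 1 * L := mul_le_mul (hbd n z) (norm_mollify_le n hg z) (norm_nonneg _) zero_le_one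
          _ = L := one_mul L
      · rw [norm_smul]
        exact mul_le_mul (hK n z v) (norm_mollify_le n hM z) (norm_nonneg _) (by positivity)
    · have hli : LocallyIntegrable (fun w => lineDeriv ℝ f w v) μ := by
        refine (locallyIntegrable_const L).mono hgm.aestronglyMeasurable
          (Eventually.of_forall fun z => ?_)
        rw [Real.norm_of_nonneg hL0]; exact hg z
      filter_upwards [ae_tendsto_mollify hli] with z hz
      exact hz.congr' (hev z)
    · exact (tendsto_mollify (μ := μ) hgm.aestronglyMeasurable hz).congr' (hev z)

end Mollification

/-! ### Measurable families of varifolds as kernels -/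

section Kernels

open ProbabilityTheory
open scoped ENNReal

variable {Z : Type*} [MetricSpace Z] [ProperSpace Z] [MeasurableSpace Z] [BorelSpace Z]

/-- The indicator function of a closed set is a bounded pointwise limit of functions in `C₀`. -/
lemma exists_zeroAtInfty_tendsto_indicator {F : Set Z} (hF : IsClosed F) (z₀ : Z) :
    ∃ f : ℕ → C₀(Z, ℝ), (∀ n z, ‖f n z‖ ≤ 1) ∧
      ∀ z, Tendsto (fun n => f n z) atTop (𝓝 (F.indicator (fun _ => (1 : ℝ)) z)) := by
  set c : ℕ → Z → ℝ := fun n z => max 0 (min 1 ((n : ℝ) + 1 - dist z z₀)) with hc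
  have hcc : ∀ n, Continuous (c n) := fun n => by fun_prop
  have hcs : ∀ n, HasCompactSupport (c n) := fun n => by
    refine HasCompactSupport.of_support_subset_isCompact
      (isCompact_closedBall z₀ ((n : ℝ) + 1)) fun z hz => ?_
    by_contra h
    rw [Metric.mem_closedBall, not_le] at h
    refine hz (max_eq_left ?_)
    exact (min_le_right _ _).trans (by linarith)
  have hc0 : ∀ n z, 0 ≤ c n z := fun n z => le_max_left _ _
  have hc1 : ∀ n z, c n z ≤ 1 := fun n z => max_le zero_le_one (min_le_left _ _)
  have hδ : ∀ n : ℕ, (0 : ℝ) < 1 / ((n : ℝ) + 1) := fun n => by positivity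
  set g : ℕ → Z → ℝ := fun n z => (thickenedIndicator (hδ n) F z : ℝ≥0) with hg
  have hgc : ∀ n, Continuous (g n) := fun n =>
    NNReal.continuous_coe.comp (thickenedIndicator (hδ n) F).continuous
  have hg1 : ∀ n z, g n z ≤ 1 := fun n z => by
    have := thickenedIndicator_le_one (hδ n) F z
    exact NNReal.coe_le_coe.2 this
  have hg0 : ∀ n z, 0 ≤ g n z := fun n z => NNReal.coe_nonneg _
  refine ⟨fun n => ⟨⟨fun z => g n z * c n z, (hgc n).mul (hcc n)⟩,
    ((hcs n).mul_left).is_zero_at_infty⟩, fun n z => ?_, fun z => ?_⟩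
  · change ‖g n z * c n z‖ ≤ 1
    rw [Real.norm_of_nonneg (mul_nonneg (hg0 n z) (hc0 n z))]
    exact mul_le_one₀ (hg1 n z) (hc0 n z) (hc1 n z)
  · change Tendsto (fun n => g n z * c n z) atTop _
    have h1 : Tendsto (fun n => g n z) atTop (𝓝 (F.indicator (fun _ => (1 : ℝ)) z)) := by
      have := thickenedIndicator_tendsto_indicator_closure hδ
        tendsto_one_div_add_atTop_nhds_zero_nat F
      rw [tendsto_pi_nhds] at this
      have h2 := (NNReal.continuous_coe.tendsto _).comp (this z)
      rw [hF.closure_eq] at h2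
      have h3 : ((F.indicator (fun _ => (1 : ℝ≥0)) z : ℝ≥0) : ℝ) = F.indicator (fun _ => 1) z := by
        by_cases hz : z ∈ F <;> simp [hz]
      rw [h3] at h2
      exact h2
    have h2 : Tendsto (fun n => c n z) atTop (𝓝 1) := by
      obtain ⟨N, hN⟩ := exists_nat_gt (dist z z₀)
      refine tendsto_const_nhds.congr' ?_
      filter_upwards [eventually_ge_atTop N] with n hn
      have : (N : ℝ) ≤ n := by exact_mod_cast hn
      simp only [hc]
      rw [min_eq_left (by linarith), max_eq_right zero_le_one]
    simpa using h1.mul h2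

/-- There is a countable system of closed sets, stable under intersections, which generates the
Borel sets. -/
lemma exists_countable_piSystem_isClosed :
    ∃ C : Set (Set Z), C.Countable ∧ IsPiSystem C ∧ (∀ F ∈ C, IsClosed F) ∧ univ ∈ C ∧
      ‹MeasurableSpace Z› = MeasurableSpace.generateFrom C := by
  set B := compl '' TopologicalSpace.countableBasis Z
  have hB : B.Countable := (TopologicalSpace.countable_countableBasis Z).image _
  refine ⟨(fun f => ⋂₀ f) '' {f | f.Finite ∧ f ⊆ B},
    (countable_ofPred_finite_subset hB).image _, ?_, ?_, ?_, ?_⟩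
  · rintro _ ⟨f, hf, rfl⟩ _ ⟨g, hg, rfl⟩ -
    exact ⟨f ∪ g, ⟨hf.1.union hg.1, union_subset hf.2 hg.2⟩, sInter_union f g⟩
  · rintro _ ⟨f, hf, rfl⟩
    refine isClosed_sInter fun s hs => ?_
    obtain ⟨b, hb, rfl⟩ := hf.2 hs
    exact (TopologicalSpace.isOpen_of_mem_countableBasis hb).isClosed_compl
  · exact ⟨∅, ⟨finite_empty, empty_subset _⟩, sInter_empty⟩
  · apply le_antisymm
    · rw [BorelSpace.measurable_eq (α := Z),
        (TopologicalSpace.isBasis_countableBasis Z).borel_eq_generateFrom]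
      refine MeasurableSpace.generateFrom_le fun b hb => ?_
      rw [← compl_compl b]
      refine (MeasurableSpace.measurableSet_generateFrom ?_).compl
      exact ⟨{bᶜ}, ⟨finite_singleton _, singleton_subset_iff.2 (mem_image_of_mem _ hb)⟩, by simp⟩
    · refine MeasurableSpace.generateFrom_le ?_
      rintro _ ⟨f, hf, rfl⟩
      refine IsClosed.measurableSet (isClosed_sInter fun s hs => ?_)
      obtain ⟨b, hb, rfl⟩ := hf.2 hs
      exact (TopologicalSpace.isOpen_of_mem_countableBasis hb).isClosed_compl

/-- A family of finite measures which is weakly-* measurable in time and essentially bounded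
agrees, at almost every time, with a finite kernel. -/
lemma exists_kernel_ae_eq (m : ℝ → FiniteMeasure Z)
    (hm : ∀ η : ℝ → C₀(Z, ℝ), IntegrableOn η (Ioi 0) →
      AEStronglyMeasurable (fun t => ∫ z, η t z ∂(m t : Measure Z)) (volume.restrict (Ioi 0)))
    {M : ℝ≥0∞} (hM : M < ⊤)
    (hmM : ∀ᵐ t ∂(volume.restrict (Ioi (0 : ℝ))), (m t : Measure Z) univ ≤ M) :
    ∃ κ : Kernel ℝ Z, IsFiniteKernel κ ∧
      ∀ᵐ t ∂(volume.restrict (Ioi (0 : ℝ))), κ t = (m t : Measure Z) := by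
  rcases isEmpty_or_nonempty Z with hZ | ⟨⟨z₀⟩⟩
  · refine ⟨0, inferInstance, Eventually.of_forall fun t => ?_⟩
    rw [Measure.eq_zero_of_isEmpty ((0 : Kernel ℝ Z) t), Measure.eq_zero_of_isEmpty (m t : Measure Z)]
  have h1 : ∀ f : C₀(Z, ℝ), AEStronglyMeasurable (fun t => ∫ z, f z ∂(m t : Measure Z))
      (volume.restrict (Ioi 0)) := fun f => by
    have h := hm (fun t => Real.exp (-t) • f) ((integrableOn_exp_neg_Ioi 0).smul_const f)
    have h2 := (Real.continuous_exp.aestronglyMeasurable (μ := volume.restrict (Ioi (0 : ℝ)))).mul h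
    refine h2.congr (Eventually.of_forall fun t => ?_)
    simp only [Pi.mul_apply, ZeroAtInftyContinuousMap.coe_smul, Pi.smul_apply, smul_eq_mul]
    rw [integral_const_mul, ← mul_assoc, ← Real.exp_add, add_neg_cancel, Real.exp_zero, one_mul]
  have h2 : ∀ F : Set Z, IsClosed F →
      AEMeasurable (fun t => (m t : Measure Z) F) (volume.restrict (Ioi 0)) := fun F hF => by
    obtain ⟨f, hf1, hf⟩ := exists_zeroAtInfty_tendsto_indicator hF z₀
    have h3 : AEMeasurable (fun t => (m t : Measure Z).real F) (volume.restrict (Ioi 0)) := by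
      refine aemeasurable_of_tendsto_metrizable_ae atTop (fun n => (h1 (f n)).aemeasurable)
        (Eventually.of_forall fun t => ?_)
      have := tendsto_integral_of_dominated_convergence (μ := (m t : Measure Z)) (fun _ => (1 : ℝ))
        (fun n => (f n).continuous.aestronglyMeasurable) (integrable_const 1)
        (fun n => Eventually.of_forall (hf1 n)) (Eventually.of_forall hf)
      rwa [integral_indicator hF.measurableSet, setIntegral_const, smul_eq_mul, mul_one] at this
    refine h3.ennreal_ofReal.congr (Eventually.of_forall fun t => ?_)
    simp [Measure.real, ENNReal.ofReal_toReal]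
  obtain ⟨C, hCc, hCpi, hCcl, hCu, hCg⟩ := exists_countable_piSystem_isClosed (Z := Z)
  have h4 : ∀ᵐ t ∂(volume.restrict (Ioi (0 : ℝ))), ∀ F (hF : F ∈ C),
      (m t : Measure Z) F = (h2 F (hCcl F hF)).mk _ t :=
    (ae_ball_iff hCc).2 fun F hF => (h2 F (hCcl F hF)).ae_eq_mk
  set good : Set ℝ := {t | (∀ F (hF : F ∈ C), (m t : Measure Z) F = (h2 F (hCcl F hF)).mk _ t) ∧
    (m t : Measure Z) univ ≤ M}
  have hgood : volume.restrict (Ioi (0 : ℝ)) goodᶜ = 0 := h4.and hmM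
  obtain ⟨N, hN, hNm, hN0⟩ := exists_measurable_superset_of_null hgood
  classical
  set k : ℝ → Measure Z := fun t => if t ∈ N then 0 else (m t : Measure Z) with hk
  have hfin : ∀ t, IsFiniteMeasure (k t) := fun t => by
    simp only [hk]; split_ifs <;> infer_instance
  have hkm : Measurable k := by
    refine Measurable.measure_of_isPiSystem hCg hCpi ?_ ?_
    · intro F hF
      have : (fun t => k t F) = N.indicator 0 + Nᶜ.indicator ((h2 F (hCcl F hF)).mk _) := by
        funext t
        by_cases ht : t ∈ N
        · simp [hk, ht]
        · have : t ∈ good := by by_contra h; exact ht (hN h)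
          simp [hk, ht, this.1 F hF]
      rw [this]
      exact (measurable_const.indicator hNm).add
        ((h2 F (hCcl F hF)).measurable_mk.indicator hNm.compl)
    · have : (fun t => k t univ) =
          N.indicator 0 + Nᶜ.indicator ((h2 univ (hCcl univ hCu)).mk _) := by
        funext t
        by_cases ht : t ∈ N
        · simp [hk, ht]
        · have : t ∈ good := by by_contra h; exact ht (hN h)
          simp [hk, ht, this.1 univ hCu]
      rw [this]
      exact (measurable_const.indicator hNm).add
        ((h2 univ (hCcl univ hCu)).measurable_mk.indicator hNm.compl)
  refine ⟨⟨k, hkm⟩, ⟨M, hM, fun t => ?_⟩, ?_⟩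
  · change k t univ ≤ M
    by_cases ht : t ∈ N
    · simp [hk, ht]
    · have : t ∈ good := by by_contra h; exact ht (hN h)
      simpa [hk, ht] using this.2
  · have : ∀ᵐ t ∂(volume.restrict (Ioi (0 : ℝ))), t ∉ N := measure_eq_zero_iff_ae_notMem.1 hN0
    filter_upwards [this] with t ht
    change k t = _
    simp [hk, ht]

/-- The space-time measure `dt ⊗ κ_t` on the time interval `(0, T]`. -/
noncomputable def spacetime (κ : Kernel ℝ Z) (T : ℝ) : Measure (ℝ × Z) :=
  (volume.restrict (Ioc 0 T)) ⊗ₘ κ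

instance (κ : Kernel ℝ Z) [IsFiniteKernel κ] (T : ℝ) : IsFiniteMeasure (spacetime κ T) := by
  unfold spacetime; infer_instance

variable {κ : Kernel ℝ Z} [IsFiniteKernel κ] {m : ℝ → FiniteMeasure Z} {T : ℝ}

lemma ae_restrict_Ioc_of_Ioi {p : ℝ → Prop} (h : ∀ᵐ t ∂(volume.restrict (Ioi (0 : ℝ))), p t) :
    ∀ᵐ t ∂(volume.restrict (Ioc 0 T)), p t :=
  ae_mono (Measure.restrict_mono_set volume Ioc_subset_Ioi_self) h

/-- Integrals against the space-time measure of a kernel are iterated integrals against the family of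
measures which it represents. -/
lemma integral_spacetime (hκ : ∀ᵐ t ∂(volume.restrict (Ioi (0 : ℝ))), κ t = (m t : Measure Z))
    {f : ℝ × Z → ℝ} (hf : Integrable f (spacetime κ T)) :
    ∫ q, f q ∂(spacetime κ T) = ∫ t in Ioc 0 T, ∫ z, f (t, z) ∂(m t : Measure Z) := by
  rw [spacetime, Measure.integral_compProd hf]
  refine integral_congr_ae ?_
  filter_upwards [ae_restrict_Ioc_of_Ioi hκ] with t ht
  rw [ht]

lemma integrable_integral_spacetime
    (hκ : ∀ᵐ t ∂(volume.restrict (Ioi (0 : ℝ))), κ t = (m t : Measure Z))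
    {f : ℝ × Z → ℝ} (hf : Integrable f (spacetime κ T)) :
    IntegrableOn (fun t => ∫ z, f (t, z) ∂(m t : Measure Z)) (Ioc 0 T) := by
  refine (Integrable.integral_compProd hf).congr ?_
  filter_upwards [ae_restrict_Ioc_of_Ioi hκ] with t ht
  rw [← ht]; rfl

lemma lintegral_spacetime (hκ : ∀ᵐ t ∂(volume.restrict (Ioi (0 : ℝ))), κ t = (m t : Measure Z))
    {f : ℝ × Z → ℝ≥0∞} (hf : Measurable f) :
    ∫⁻ q, f q ∂(spacetime κ T) = ∫⁻ t in Ioc 0 T, ∫⁻ z, f (t, z) ∂(m t : Measure Z) := by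
  rw [spacetime, Measure.lintegral_compProd hf]
  refine lintegral_congr_ae ?_
  filter_upwards [ae_restrict_Ioc_of_Ioi hκ] with t ht
  rw [ht]

lemma ae_spacetime_of_ae_time {p : ℝ → Prop} (h : ∀ᵐ t ∂(volume.restrict (Ioc 0 T)), p t) :
    ∀ᵐ q ∂(spacetime κ T), p q.1 := by
  obtain ⟨N, hN, hNm, hN0⟩ := exists_measurable_superset_of_null (ae_iff.1 h)
  have h2 : ∀ᵐ q ∂(spacetime κ T), q ∈ Prod.fst ⁻¹' Nᶜ := by
    refine (Measure.ae_compProd_iff (p := fun q : ℝ × Z => q ∈ Prod.fst ⁻¹' Nᶜ)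
      (measurable_fst hNm.compl)).2 ?_
    have : ∀ᵐ t ∂(volume.restrict (Ioc 0 T)), t ∉ N := measure_eq_zero_iff_ae_notMem.1 hN0
    filter_upwards [this] with t ht
    exact Eventually.of_forall fun _ => ht
  filter_upwards [h2] with q hq
  by_contra hp
  exact hq (hN hp)

lemma ae_spacetime_mem_Ioo : ∀ᵐ q ∂(spacetime κ T), q.1 ∈ Ioo 0 T := by
  refine ae_spacetime_of_ae_time (p := fun t => t ∈ Ioo 0 T) ?_
  rw [← restrict_Ioo_eq_restrict_Ioc]
  exact ae_restrict_mem measurableSet_Ioo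

end Kernels

/-! ### Calculus in space-time -/

section SpacetimeCalculus

variable {d : ℕ} {Y : Type*} [NormedAddCommGroup Y] [NormedSpace ℝ Y]

/-- The `k`-th coordinate vector of `ℝ^d`. -/
noncomputable def basisVec (k : Fin d) : Space d := EuclideanSpace.single k 1

/-- The trace of an endomorphism of `ℝ^d`, in coordinates. -/
noncomputable def traceL (L : Space d →L[ℝ] Space d) : ℝ := ∑ k : Fin d, (L (basisVec k)) k

/-- The spatial divergence of a field on space-time. -/
noncomputable def divX (F : ℝ × Space d → Space d) (q : ℝ × Space d) : ℝ :=
  ∑ k : Fin d, (fderiv ℝ F q (0, basisVec k)) k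

lemma divergence_eq_traceL (F : Space d → Space d) (x : Space d) :
    divergence F x = traceL (fderiv ℝ F x) := rfl

lemma norm_basisVec (k : Fin d) : ‖(basisVec k : Space d)‖ = 1 := by simp [basisVec]

lemma abs_coord_le (x : Space d) (k : Fin d) : |x k| ≤ ‖x‖ := by
  simpa using EuclideanSpace.norm_eq x ▸ Real.abs_le_sqrt
    (Finset.single_le_sum (f := fun i => ‖x i‖ ^ 2) (fun _ _ => by positivity) (Finset.mem_univ k)
      |>.trans_eq' (by simp))

lemma abs_traceL_le (L : Space d →L[ℝ] Space d) : |traceL L| ≤ d * ‖L‖ := by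
  refine (Finset.abs_sum_le_sum_abs _ _).trans ?_
  calc ∑ k : Fin d, |(L (basisVec k)) k| ≤ ∑ _k : Fin d, ‖L‖ := Finset.sum_le_sum fun k _ => by
        refine (abs_coord_le _ _).trans ((L.le_opNorm _).trans ?_)
        rw [norm_basisVec, mul_one]
    _ = d * ‖L‖ := by simp

lemma sum_coord_smul_basisVec (x : Space d) : ∑ k : Fin d, x k • (basisVec k : Space d) = x := by
  ext i
  simp [basisVec, Finset.sum_apply, Pi.single_apply]

lemma clm_prod_expand (L : ℝ × Space d →L[ℝ] Y) (x : Space d) :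
    L (0, x) = ∑ k : Fin d, x k • L (0, basisVec k) := by
  have : ((0 : ℝ), x) = ∑ k : Fin d, x k • ((0 : ℝ), (basisVec k : Space d)) := by
    rw [Prod.ext_iff]
    constructor
    · simp [Prod.fst_sum]
    · simp [Prod.snd_sum, sum_coord_smul_basisVec]
  conv_lhs => rw [this]
  simp only [map_sum, Prod.smul_mk, smul_zero]
  refine Finset.sum_congr rfl fun k _ => ?_
  rw [← map_smul]; simp

lemma fderiv_slice_space {F : ℝ × Space d → Y} {q : ℝ × Space d} (hF : DifferentiableAt ℝ F q)
    (v : Space d) : fderiv ℝ (fun y => F (q.1, y)) q.2 v = fderiv ℝ F q (0, v) := by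
  have h1 : HasFDerivAt (fun y : Space d => (q.1, y)) (ContinuousLinearMap.inr ℝ ℝ (Space d)) q.2 :=
    hasFDerivAt_prodMk_right q.1 q.2
  have h2 : HasFDerivAt F (fderiv ℝ F q) (q.1, q.2) := hF.hasFDerivAt
  have h3 : HasFDerivAt (fun y => F (q.1, y)) _ q.2 := h2.comp q.2 h1
  rw [h3.fderiv]
  simp

lemma deriv_slice_time {F : ℝ × Space d → Y} {q : ℝ × Space d} (hF : DifferentiableAt ℝ F q) :
    deriv (fun s => F (s, q.2)) q.1 = fderiv ℝ F q (1, 0) := by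
  have h1 : HasDerivAt (fun s : ℝ => (s, q.2)) ((1 : ℝ), (0 : Space d)) q.1 :=
    (hasDerivAt_id q.1).prodMk (hasDerivAt_const q.1 q.2)
  have h2 : HasFDerivAt F (fderiv ℝ F q) (q.1, q.2) := hF.hasFDerivAt
  exact (h2.comp_hasDerivAt q.1 h1).deriv

lemma divergence_slice {F : ℝ × Space d → Space d} {q : ℝ × Space d} (hF : DifferentiableAt ℝ F q) :
    divergence (fun y => F (q.1, y)) q.2 = divX F q := by
  simp only [divergence, divX]
  exact Finset.sum_congr rfl fun k _ => by rw [fderiv_slice_space hF]; rfl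

section Test

variable {E : Type*} [NormedAddCommGroup E] [NormedSpace ℝ E]
  {Y' : Type*} [NormedAddCommGroup Y'] [NormedSpace ℝ Y']

lemma IsTest.differentiable {F : E → Y} (hF : IsTest F) : Differentiable ℝ F :=
  hF.1.differentiable (by simp)

lemma IsTest.continuous {F : E → Y} (hF : IsTest F) : Continuous F := hF.1.continuous

lemma IsTest.fderiv_apply {F : E → Y} (hF : IsTest F) (v : E) :
    IsTest (fun q => fderiv ℝ F q v) :=
  ⟨(hF.1.fderiv_right (m := ∞) (by simp)).clm_apply contDiff_const,
    (hF.2.fderiv (𝕜 := ℝ)).comp_left (g := fun L : E →L[ℝ] Y => L v) (by simp)⟩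

lemma IsTest.add {F G : E → Y} (hF : IsTest F) (hG : IsTest G) : IsTest (fun q => F q + G q) :=
  ⟨hF.1.add hG.1, hF.2.add hG.2⟩

lemma IsTest.sub {F G : E → Y} (hF : IsTest F) (hG : IsTest G) : IsTest (fun q => F q - G q) := by
  refine ⟨hF.1.sub hG.1, ?_⟩
  exact hF.2.comp₂_left hG.2 (m := fun a b => a - b) (by simp)

lemma IsTest.sum {ι : Type*} {s : Finset ι} {F : ι → E → Y} (hF : ∀ i, IsTest (F i)) :
    IsTest (fun q => ∑ i ∈ s, F i q) := by
  classical
  induction s using Finset.induction_on with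
  | empty => simpa using ⟨contDiff_const, HasCompactSupport.zero⟩
  | insert a s ha ih => simpa [Finset.sum_insert ha] using (hF a).add ih

lemma IsTest.smul_left {F : E → Y} (hF : IsTest F) {c : E → ℝ} (hc : ContDiff ℝ ∞ c) :
    IsTest (fun q => c q • F q) := ⟨hc.smul hF.1, hF.2.smul_left⟩

lemma IsTest.clm_comp {F : E → Y} (hF : IsTest F) (L : Y →L[ℝ] Y') : IsTest (fun q => L (F q)) :=
  ⟨L.contDiff.comp hF.1, hF.2.comp_left (g := L) (map_zero L)⟩

lemma IsTest.coord {F : E → Space d} (hF : IsTest F) (k : Fin d) : IsTest (fun q => F q k) :=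
  hF.clm_comp (EuclideanSpace.proj k)

lemma IsTest.slice {F : ℝ × E → Y} (hF : IsTest F) (t : ℝ) : IsTest (fun x => F (t, x)) := by
  refine ⟨hF.1.comp (contDiff_prodMk_right t), ?_⟩
  refine HasCompactSupport.intro (hF.2.image continuous_snd) fun x hx => ?_
  refine image_eq_zero_of_notMem_tsupport (f := F) fun h => hx ⟨(t, x), h, rfl⟩

lemma IsTest.divX {F : ℝ × Space d → Space d} (hF : IsTest F) : IsTest (divX F) :=
  IsTest.sum fun k => (hF.fderiv_apply (0, basisVec k)).coord k

lemma IsTest.fderiv_fderiv_comm {F : E → Y} (hF : IsTest F) (u v q : E) :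
    fderiv ℝ (fun q => fderiv ℝ F q u) q v = fderiv ℝ (fun q => fderiv ℝ F q v) q u := by
  have h2 : DifferentiableAt ℝ (fderiv ℝ F) q :=
    (hF.1.fderiv_right (m := ∞) (by simp)).differentiable (by simp) q
  have hs : IsSymmSndFDerivAt ℝ F q := hF.1.contDiffAt.isSymmSndFDerivAt (by
    rw [minSmoothness_of_isRCLikeNormedField]; exact WithTop.coe_le_coe.2 le_top)
  have e : ∀ w, fderiv ℝ (fun q => fderiv ℝ F q w) q = (fderiv ℝ (fderiv ℝ F) q).flip w := by
    intro w
    rw [fderiv_clm_apply h2 (differentiableAt_const w)]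
    simp
  rw [e, e]
  exact (hs.eq v u)

lemma fderiv_coord {F : E → Space d} {q : E} (hF : DifferentiableAt ℝ F q) (k : Fin d) (v : E) :
    fderiv ℝ (fun q => F q k) q v = fderiv ℝ F q v k := by
  have := ((EuclideanSpace.proj (𝕜 := ℝ) k).hasFDerivAt (x := F q)).comp q hF.hasFDerivAt
  change fderiv ℝ (⇑(EuclideanSpace.proj (𝕜 := ℝ) k) ∘ F) q v = _
  rw [this.fderiv]
  simp

end Test

/-- For smooth fields, the time derivative commutes with the spatial divergence. -/
lemma fderiv_divX_time {F : ℝ × Space d → Space d} (hF : IsTest F) (q : ℝ × Space d) :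
    fderiv ℝ (divX F) q (1, 0) = divX (fun q => fderiv ℝ F q (1, 0)) q := by
  have h1 : divX F = fun q => ∑ k : Fin d, (fderiv ℝ F q (0, basisVec k)) k := rfl
  have ht : ∀ k : Fin d, IsTest fun q => (fderiv ℝ F q (0, basisVec k)) k :=
    fun k => (hF.fderiv_apply _).coord k
  rw [h1, fderiv_fun_sum fun k _ => (ht k).differentiable q]
  simp only [divX, _root_.sum_apply]
  refine Finset.sum_congr rfl fun k _ => ?_
  rw [fderiv_coord ((hF.fderiv_apply _).differentiable q), hF.fderiv_fderiv_comm]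

/-- The field `(ξ·∇)B + (∇·ξ)B - (B·∇)ξ - (∇·B)ξ`, that is, the divergence of the antisymmetric
tensor `B ⊗ ξ - ξ ⊗ B`. -/
noncomputable def wedgeDiv (ξ B : ℝ × Space d → Space d) (q : ℝ × Space d) : Space d :=
  fderiv ℝ B q (0, ξ q) + divX ξ q • B q - fderiv ℝ ξ q (0, B q) - divX B q • ξ q

lemma wedgeDiv_eq {ξ B : ℝ × Space d → Space d} (hξ : Differentiable ℝ ξ) (hB : Differentiable ℝ B)
    (q : ℝ × Space d) : wedgeDiv ξ B q =
      ∑ k : Fin d, fderiv ℝ (fun q => ξ q k • B q - B q k • ξ q) q (0, basisVec k) := by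
  have hc : ∀ {F : ℝ × Space d → Space d} (hF : Differentiable ℝ F) (k : Fin d),
      DifferentiableAt ℝ (fun q => F q k) q := fun {F} hF k =>
    ((EuclideanSpace.proj (𝕜 := ℝ) k).differentiable.comp hF) q
  have h : ∀ k : Fin d, fderiv ℝ (fun q => ξ q k • B q - B q k • ξ q) q (0, basisVec k) =
      (ξ q k • fderiv ℝ B q (0, basisVec k) + fderiv ℝ ξ q (0, basisVec k) k • B q) -
      (B q k • fderiv ℝ ξ q (0, basisVec k) + fderiv ℝ B q (0, basisVec k) k • ξ q) := fun k => by
    rw [fderiv_fun_sub ((hc hξ k).fun_smul (hB q)) ((hc hB k).fun_smul (hξ q)),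
      fderiv_fun_smul (hc hξ k) (hB q), fderiv_fun_smul (hc hB k) (hξ q)]
    simp [fderiv_coord (hξ q), fderiv_coord (hB q)]
  simp only [h, Finset.sum_sub_distrib, Finset.sum_add_distrib, ← Finset.sum_smul,
    ← clm_prod_expand, wedgeDiv, divX]
  abel

lemma isTest_wedgeDiv {ξ B : ℝ × Space d → Space d} (hξ : IsTest ξ) (hB : IsTest B) :
    IsTest (wedgeDiv ξ B) := by
  have : wedgeDiv ξ B = fun q =>
      ∑ k : Fin d, fderiv ℝ (fun q => ξ q k • B q - B q k • ξ q) q (0, basisVec k) :=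
    funext fun q => wedgeDiv_eq hξ.differentiable hB.differentiable q
  rw [this]
  exact IsTest.sum fun k => ((hB.smul_left (hξ.coord k).1).sub
    (hξ.smul_left (hB.coord k).1)).fderiv_apply _

/-- The divergence of an antisymmetric tensor field is divergence free. -/
lemma divX_wedgeDiv {ξ B : ℝ × Space d → Space d} (hξ : IsTest ξ) (hB : IsTest B)
    (q : ℝ × Space d) : divX (wedgeDiv ξ B) q = 0 := by
  have hw : wedgeDiv ξ B = fun q =>
      ∑ k : Fin d, fderiv ℝ (fun q => ξ q k • B q - B q k • ξ q) q (0, basisVec k) :=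
    funext fun q => wedgeDiv_eq hξ.differentiable hB.differentiable q
  have ht : ∀ k : Fin d, IsTest fun q => ξ q k • B q - B q k • ξ q := fun k =>
    (hB.smul_left (hξ.coord k).1).sub (hξ.smul_left (hB.coord k).1)
  set a : Fin d → Fin d → ℝ × Space d → ℝ := fun k l q => ξ q k * B q l - B q k * ξ q l with ha
  have hat : ∀ k l, IsTest (a k l) := fun k l => by
    have := (ht k).coord l
    simpa [ha] using this
  have h1 : divX (wedgeDiv ξ B) q = ∑ l : Fin d, ∑ k : Fin d,
      fderiv ℝ (fun q => fderiv ℝ (a k l) q (0, basisVec k)) q (0, basisVec l) := by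
    simp only [divX]
    refine Finset.sum_congr rfl fun l _ => ?_
    rw [← fderiv_coord ((isTest_wedgeDiv hξ hB).differentiable q), hw]
    have : (fun q => (∑ k : Fin d, fderiv ℝ (fun q => ξ q k • B q - B q k • ξ q) q
        (0, basisVec k)) l) = fun q => ∑ k : Fin d, fderiv ℝ (a k l) q (0, basisVec k) := by
      funext q
      simp only [WithLp.ofLp_sum, Finset.sum_apply]
      refine Finset.sum_congr rfl fun k _ => ?_
      rw [← fderiv_coord ((ht k).differentiable q)]
      simp [ha]
    rw [this, fderiv_fun_sum fun k _ => ((hat k l).fderiv_apply _).differentiable q]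
    simp
  have h2 : ∀ k l, a k l = fun q => -a l k q := fun k l => by
    funext q; simp only [ha]; ring
  have h3 : ∀ k l, fderiv ℝ (fun q => fderiv ℝ (a k l) q (0, basisVec k)) q (0, basisVec l) =
      -fderiv ℝ (fun q => fderiv ℝ (a l k) q (0, basisVec l)) q (0, basisVec k) := fun k l => by
    rw [(hat k l).fderiv_fderiv_comm, h2 k l]
    have : (fun q => fderiv ℝ (fun q => -a l k q) q (0, basisVec l)) =
        fun q => -fderiv ℝ (a l k) q (0, basisVec l) := by
      funext q; rw [fderiv_fun_neg]; rfl
    rw [this, fderiv_fun_neg]; rfl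
  have h4 : divX (wedgeDiv ξ B) q = -divX (wedgeDiv ξ B) q := by
    rw [h1]
    calc _ = ∑ l : Fin d, ∑ k : Fin d,
        -fderiv ℝ (fun q => fderiv ℝ (a l k) q (0, basisVec l)) q (0, basisVec k) :=
          Finset.sum_congr rfl fun l _ => Finset.sum_congr rfl fun k _ => h3 k l
      _ = _ := by rw [Finset.sum_comm]; simp only [Finset.sum_neg_distrib]
  linarith

end SpacetimeCalculus

/-! ### Approximation of fields on space-time -/

section Approximation

variable {d : ℕ} {Y : Type*} [NormedAddCommGroup Y] [NormedSpace ℝ Y]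

/-- The test functions `F n` approximate the bounded function `f` on space-time: the values converge
boundedly, and so do the derivatives in directions along which `f` is Lipschitz, almost everywhere
as well as at points of continuity of the derivative. -/
structure TestApprox (f : ℝ × Space d → Y) (M : ℝ) (F : ℕ → ℝ × Space d → Y) : Prop where
  isTest : ∀ n, IsTest (F n)
  norm_le : ∀ n z, ‖F n z‖ ≤ M
  tendsto : ∀ z, Tendsto (fun n => F n z) atTop (𝓝 (f z))
  dir : ∀ (v : ℝ × Space d) (L : ℝ), 0 ≤ L → (∀ z (s : ℝ), ‖f (z + s • v) - f z‖ ≤ L * |s|) →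
    (∀ᵐ z, LineDifferentiableAt ℝ f z v) →
    (∃ K, ∀ n z, ‖fderiv ℝ (F n) z v‖ ≤ K) ∧
    (∀ᵐ z, Tendsto (fun n => fderiv ℝ (F n) z v) atTop (𝓝 (lineDeriv ℝ f z v))) ∧
    (∀ z, ContinuousAt (fun w => lineDeriv ℝ f w v) z →
      Tendsto (fun n => fderiv ℝ (F n) z v) atTop (𝓝 (lineDeriv ℝ f z v)))

lemma exists_testApprox [CompleteSpace Y] {f : ℝ × Space d → Y} {M : ℝ} (hf : Continuous f)
    (hM : ∀ z, ‖f z‖ ≤ M) : ∃ F, TestApprox f M F := by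
  have : (volume : Measure (ℝ × Space d)).IsAddHaarMeasure := by
    rw [Measure.volume_eq_prod]; infer_instance
  obtain ⟨F, h1, h2, h3, h4⟩ := exists_test_approx (volume : Measure (ℝ × Space d)) hf hM
  exact ⟨F, h1, h2, h3, h4⟩

/-- A bounded field on space-time which is continuously differentiable in space, with bounded
derivative `Df`. -/
structure SpatiallyC1 (f : ℝ × Space d → Y) (Df : ℝ × Space d → Space d →L[ℝ] Y) (M : ℝ) :
    Prop where
  continuous : Continuous f
  norm_le : ∀ z, ‖f z‖ ≤ M
  hasFDerivAt : ∀ t x, HasFDerivAt (fun y => f (t, y)) (Df (t, x)) x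
  continuous_deriv : Continuous Df
  norm_deriv_le : ∀ z, ‖Df z‖ ≤ M

/-- Bounds on the coordinate derivatives bound all spatial derivatives. -/
lemma norm_clm_prod_le {L : ℝ × Space d →L[ℝ] Y} {K : Fin d → ℝ}
    (hK : ∀ k, ‖L (0, basisVec k)‖ ≤ K k) (v : Space d) : ‖L (0, v)‖ ≤ (∑ k, K k) * ‖v‖ := by
  rw [clm_prod_expand, Finset.sum_mul]
  refine (norm_sum_le _ _).trans (Finset.sum_le_sum fun k _ => ?_)
  rw [norm_smul, mul_comm, Real.norm_eq_abs]
  exact mul_le_mul (hK k) (abs_coord_le v k) (abs_nonneg _) ((norm_nonneg _).trans (hK k))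

lemma tendsto_clm_of_basis {L : ℕ → ℝ × Space d →L[ℝ] Y} {l : Space d →L[ℝ] Y}
    (h : ∀ k, Tendsto (fun n => L n (0, basisVec k)) atTop (𝓝 (l (basisVec k)))) (v : Space d) :
    Tendsto (fun n => L n (0, v)) atTop (𝓝 (l v)) := by
  have h1 : l v = ∑ k : Fin d, v k • l (basisVec k) := by
    conv_lhs => rw [← sum_coord_smul_basisVec v]
    simp only [map_sum]
    exact Finset.sum_congr rfl fun k _ => by rw [map_smul]
  rw [h1]
  simp_rw [fun n => clm_prod_expand (L n) v]
  exact tendsto_finsetSum _ fun k _ => (h k).const_smul _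

/-- Convergence of uniformly bounded linear maps along a convergent sequence of directions. -/
lemma tendsto_clm_varying {L : ℕ → ℝ × Space d →L[ℝ] Y} {y : Y} {K : ℝ} {v : Space d}
    {w : ℕ → Space d} (hK : ∀ n v, ‖L n (0, v)‖ ≤ K * ‖v‖)
    (hL : Tendsto (fun n => L n (0, v)) atTop (𝓝 y)) (hw : Tendsto w atTop (𝓝 v)) :
    Tendsto (fun n => L n (0, w n)) atTop (𝓝 y) := by
  have h1 : Tendsto (fun n => L n (0, w n - v)) atTop (𝓝 0) := by
    refine squeeze_zero_norm (fun n => hK n _) ?_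
    have := ((hw.sub_const v).norm).const_mul K
    simpa using this
  have h2 := h1.add hL
  simp only [zero_add] at h2
  refine h2.congr fun n => ?_
  rw [← map_add]; simp

/-- The spatial derivatives of the approximations of a spatially `C¹` field converge everywhere. -/
lemma TestApprox.space {f : ℝ × Space d → Y} {Df : ℝ × Space d → Space d →L[ℝ] Y}
    {M : ℝ} {F : ℕ → ℝ × Space d → Y} (h : TestApprox f M F) (hf : SpatiallyC1 f Df M) :
    ∃ K : ℝ, 0 ≤ K ∧ (∀ n z v, ‖fderiv ℝ (F n) z (0, v)‖ ≤ K * ‖v‖) ∧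
      ∀ z v, Tendsto (fun n => fderiv ℝ (F n) z (0, v)) atTop (𝓝 (Df z v)) := by
  have hM0 : 0 ≤ M := (norm_nonneg _).trans (hf.norm_le 0)
  have hline : ∀ z v, HasLineDerivAt ℝ f (Df z v) z (0, v) := fun z v => by
    have h1 : HasDerivAt (fun s : ℝ => z.2 + s • v) v 0 := by
      simpa using ((hasDerivAt_id (0 : ℝ)).smul_const v).const_add z.2
    have h2 : HasFDerivAt (fun y => f (z.1, y)) (Df z) (z.2 + (0 : ℝ) • v) := by
      simpa using hf.hasFDerivAt z.1 z.2
    refine (h2.comp_hasDerivAt (0 : ℝ) h1).congr_of_eventuallyEq (Eventually.of_forall fun s => ?_)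
    simp only [Function.comp]
    congr 1
    exact Prod.ext (by simp) (by simp)
  have hlip : ∀ v z (s : ℝ), ‖f (z + s • ((0 : ℝ), v)) - f z‖ ≤ M * ‖v‖ * |s| := fun v z s => by
    have := convex_univ.norm_image_sub_le_of_norm_hasFDerivWithin_le
      (f := fun y => f (z.1, y)) (x := z.2) (y := z.2 + s • v)
      (fun y _ => (hf.hasFDerivAt z.1 y).hasFDerivWithinAt) (fun y _ => hf.norm_deriv_le _)
      (mem_univ _) (mem_univ _)
    have e : z + s • ((0 : ℝ), v) = (z.1, z.2 + s • v) := Prod.ext (by simp) (by simp)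
    rw [e]
    refine this.trans (le_of_eq ?_)
    rw [add_sub_cancel_left, norm_smul, Real.norm_eq_abs]; ring
  have hdir := fun v => h.dir (0, v) (M * ‖v‖) (by positivity) (hlip v)
    (Eventually.of_forall fun z => (hline z v).lineDifferentiableAt)
  choose K hK using fun k => (hdir (basisVec k)).1
  have hK0 : ∀ k, 0 ≤ K k := fun k => (norm_nonneg _).trans (hK k 0 0)
  refine ⟨∑ k, K k, Finset.sum_nonneg fun k _ => hK0 k,
    fun n z v => norm_clm_prod_le (fun k => hK k n z) v, fun z v => ?_⟩
  have h3 : (fun w => lineDeriv ℝ f w (0, v)) = fun w => Df w v :=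
    funext fun w => (hline w v).lineDeriv
  have h4 := (hdir v).2.2 z (by
    rw [h3]; exact (hf.continuous_deriv.clm_apply continuous_const).continuousAt)
  rwa [(hline z v).lineDeriv] at h4

lemma norm_lip_direction {f : ℝ × Space d → Y} {L : ℝ≥0} (hf : LipschitzWith L f)
    (v z : ℝ × Space d) (s : ℝ) : ‖f (z + s • v) - f z‖ ≤ L * ‖v‖ * |s| := by
  have := hf.dist_le_mul (z + s • v) z
  rw [dist_eq_norm, dist_eq_norm, add_sub_cancel_left, norm_smul, Real.norm_eq_abs] at this
  linarith

lemma ae_differentiableAt_spacetime [FiniteDimensional ℝ Y] {f : ℝ × Space d → Y} {L : ℝ≥0}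
    (hf : LipschitzWith L f) : ∀ᵐ z, DifferentiableAt ℝ f z := by
  have : (volume : Measure (ℝ × Space d)).IsAddHaarMeasure := by
    rw [Measure.volume_eq_prod]; infer_instance
  exact hf.ae_differentiableAt

/-- The time derivatives of the approximations converge on the open time interval on which the time
derivative exists and is continuous. The extension in time of the field need not be differentiable at
the end points. -/
lemma TestApprox.time [FiniteDimensional ℝ Y] {f ft : ℝ × Space d → Y} {M T : ℝ}
    {F : ℕ → ℝ × Space d → Y} (h : TestApprox f M F) {L : ℝ≥0} (hf : LipschitzWith L f)
    (hft : ∀ t ∈ Ioo 0 T, ∀ x, HasDerivAt (fun s => f (s, x)) (ft (t, x)) t)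
    (hftc : ContinuousOn ft (Ioo 0 T ×ˢ univ)) :
    ∃ K : ℝ, 0 ≤ K ∧ (∀ n z, ‖fderiv ℝ (F n) z (1, 0)‖ ≤ K) ∧
      ∀ z : ℝ × Space d, z.1 ∈ Ioo 0 T →
        Tendsto (fun n => fderiv ℝ (F n) z (1, 0)) atTop (𝓝 (ft z)) := by
  obtain ⟨⟨K, hK⟩, -, h2⟩ := h.dir (1, 0) _ (by positivity) (norm_lip_direction hf (1, 0))
    ((ae_differentiableAt_spacetime hf).mono fun z hz => hz.lineDifferentiableAt)
  refine ⟨K, (norm_nonneg _).trans (hK 0 0), hK, fun z hz => ?_⟩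
  have hl : ∀ w : ℝ × Space d, w.1 ∈ Ioo 0 T → lineDeriv ℝ f w (1, 0) = ft w := fun w hw => by
    refine HasLineDerivAt.lineDeriv ?_
    have h1 : HasDerivAt (fun s : ℝ => w.1 + s) 1 0 := (hasDerivAt_id (0 : ℝ)).const_add w.1
    have h3 : HasDerivAt (fun s => f (s, w.2)) (ft w) (w.1 + 0) := by simpa using hft w.1 hw w.2
    have h4 := h3.scomp (0 : ℝ) h1
    rw [one_smul] at h4
    refine h4.congr_of_eventuallyEq (Eventually.of_forall fun s => ?_)
    simp only [Function.comp]
    congr 1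
    exact Prod.ext (by simp) (by simp)
  have hopen : IsOpen (Ioo 0 T ×ˢ (univ : Set (Space d))) := isOpen_Ioo.prod isOpen_univ
  have hz' : z ∈ Ioo 0 T ×ˢ (univ : Set (Space d)) := ⟨hz, mem_univ _⟩
  have := h2 z (by
    refine (hftc.continuousAt (hopen.mem_nhds hz')).congr ?_
    filter_upwards [hopen.mem_nhds hz'] with w hw
    exact (hl w hw.1).symm)
  rwa [hl z hz] at this

/-- The derivatives of the approximations of a Lipschitz function converge almost everywhere, by
Rademacher's theorem. -/
lemma TestApprox.lipschitz {f : ℝ × Space d → ℝ} {M : ℝ} {F : ℕ → ℝ × Space d → ℝ}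
    (h : TestApprox f M F) {L : ℝ≥0} (hf : LipschitzWith L f) :
    ∃ K : ℝ, 0 ≤ K ∧ (∀ n z v, ‖fderiv ℝ (F n) z (0, v)‖ ≤ K * ‖v‖) ∧
      (∀ n z, ‖fderiv ℝ (F n) z (1, 0)‖ ≤ K) ∧
      ∀ᵐ z, Tendsto (fun n => fderiv ℝ (F n) z (1, 0)) atTop (𝓝 (fderiv ℝ f z (1, 0))) ∧
        ∀ v, Tendsto (fun n => fderiv ℝ (F n) z (0, v)) atTop (𝓝 (fderiv ℝ f z (0, v))) := by
  have hd := ae_differentiableAt_spacetime hf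
  have hdir := fun v => h.dir v _ (by positivity) (norm_lip_direction hf v)
    (hd.mono fun z hz => hz.lineDifferentiableAt)
  obtain ⟨K₀, hK₀⟩ := (hdir (1, 0)).1
  choose K hK using fun k => (hdir (0, basisVec k)).1
  have hK0 : ∀ k, 0 ≤ K k := fun k => (norm_nonneg _).trans (hK k 0 0)
  have hK00 : 0 ≤ K₀ := (norm_nonneg _).trans (hK₀ 0 0)
  have hs : 0 ≤ ∑ k, K k := Finset.sum_nonneg fun k _ => hK0 k
  refine ⟨K₀ + ∑ k, K k, by positivity, fun n z v => ?_, fun n z => ?_, ?_⟩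
  · refine (norm_clm_prod_le (fun k => hK k n z) v).trans ?_
    gcongr; linarith
  · linarith [hK₀ n z]
  · filter_upwards [hd, (hdir (1, 0)).2.1, ae_all_iff.2 fun k => (hdir (0, basisVec k)).2.1]
      with z hz h1 h2
    refine ⟨by rwa [hz.lineDeriv_eq_fderiv] at h1, fun v => ?_⟩
    refine tendsto_clm_of_basis
      (l := (fderiv ℝ f z).comp (ContinuousLinearMap.inr ℝ ℝ (Space d))) (fun k => ?_) v
    have := h2 k
    rw [hz.lineDeriv_eq_fderiv] at this
    simpa using this

lemma tendsto_divX {F : ℕ → ℝ × Space d → Space d} {z : ℝ × Space d} {l : Space d →L[ℝ] Space d}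
    (h : ∀ v, Tendsto (fun n => fderiv ℝ (F n) z (0, v)) atTop (𝓝 (l v))) :
    Tendsto (fun n => divX (F n) z) atTop (𝓝 (traceL l)) :=
  tendsto_finsetSum _ fun k _ =>
    ((EuclideanSpace.proj (𝕜 := ℝ) k).continuous.tendsto _).comp (h (basisVec k))

lemma abs_divX_le {F : ℝ × Space d → Space d} {z : ℝ × Space d} {K : ℝ}
    (h : ∀ v, ‖fderiv ℝ F z (0, v)‖ ≤ K * ‖v‖) : |divX F z| ≤ d * K := by
  refine (Finset.abs_sum_le_sum_abs _ _).trans ?_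
  calc _ ≤ ∑ _k : Fin d, K := Finset.sum_le_sum fun k _ => by
        refine (abs_coord_le _ _).trans ((h _).trans ?_)
        rw [norm_basisVec, mul_one]
    _ = d * K := by simp

end Approximation

/-! ### Weak evolutions and their limit identities -/

section WeakEvolution

variable {d : ℕ}

/-- The projection `(t, x, p) ↦ (t, x)`. -/
def base (q : ℝ × (Space d × Sph d)) : ℝ × Space d := (q.1, q.2.1)

@[fun_prop]
lemma continuous_base : Continuous (base : ℝ × (Space d × Sph d) → ℝ × Space d) := by
  unfold base; fun_prop

lemma measurable_base : Measurable (base : ℝ × (Space d × Sph d) → ℝ × Space d) :=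
  continuous_base.measurable

lemma norm_sph (p : Sph d) : ‖(p : Space d)‖ = 1 := by simp

lemma abs_inner_sph_le (x : Space d) (p : Sph d) : |inner ℝ x (p : Space d)| ≤ ‖x‖ := by
  simpa using abs_real_inner_le_norm x (p : Space d)

/-- A set moving with normal speed `V`, in weak form and integrated over the time interval `(0, T]`.
The set enters through the Lebesgue measure `Λ` of its space-time track and the Lebesgue measures
`α₀`, `αT` of its initial and final states; the space-time varifold `Γ` carries its boundary. -/
structure WeakEvolution (T : ℝ) (α₀ αT : Measure (Space d)) (Λ : Measure (ℝ × Space d))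
    (Γ : Measure (ℝ × (Space d × Sph d))) (V : ℝ × Space d → ℝ) : Prop where
  finite : IsFiniteMeasure Γ
  mem_time : ∀ᵐ q ∂Γ, q.1 ∈ Ioo 0 T
  V_int : Integrable (fun q => V (base q)) Γ
  le_init : α₀ ≤ volume
  le_final : αT ≤ volume
  le_track : Λ ≤ volume.restrict (Ioc 0 T ×ˢ univ)
  velocity : ∀ ζ : ℝ × Space d → ℝ, IsTest ζ →
    (∫ x, ζ (T, x) ∂αT) - ∫ x, ζ (0, x) ∂α₀ =
      (∫ q, fderiv ℝ ζ q (1, 0) ∂Λ) - ∫ q, V (base q) * ζ (base q) ∂Γ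
  gradient : ∀ F : ℝ × Space d → Space d, IsTest F →
    ∫ q, divX F q ∂Λ = - ∫ q, inner ℝ (F (base q)) (q.2.2 : Space d) ∂Γ

variable {T : ℝ} {α₀ αT : Measure (Space d)} {Λ : Measure (ℝ × Space d)}
  {Γ : Measure (ℝ × (Space d × Sph d))} {V : ℝ × Space d → ℝ}

/-- The flux identity for test fields: test the velocity equation with the divergence of the field,
and use the gradient identity for the field and its time derivative. -/
lemma WeakEvolution.flux_test (h : WeakEvolution T α₀ αT Λ Γ V)
    {g₀ gT : Measure (Space d × Sph d)}
    (h₀ : ∀ φ : Space d → Space d, IsTest φ →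
      ∫ x, divergence φ x ∂α₀ = -∫ z, inner ℝ (φ z.1) (z.2 : Space d) ∂g₀)
    (hT : ∀ φ : Space d → Space d, IsTest φ →
      ∫ x, divergence φ x ∂αT = -∫ z, inner ℝ (φ z.1) (z.2 : Space d) ∂gT)
    {ξ : ℝ × Space d → Space d} (hξ : IsTest ξ) :
    (∫ z, inner ℝ (ξ (T, z.1)) (z.2 : Space d) ∂gT) -
        ∫ z, inner ℝ (ξ (0, z.1)) (z.2 : Space d) ∂g₀ =
      (∫ q, inner ℝ (fderiv ℝ ξ (base q) (1, 0)) (q.2.2 : Space d) ∂Γ) +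
        ∫ q, V (base q) * divX ξ (base q) ∂Γ := by
  have h1 := h.velocity _ hξ.divX
  have h2 := h.gradient _ (hξ.fderiv_apply (1, 0))
  have h3 := hT _ (hξ.slice T)
  have h4 := h₀ _ (hξ.slice 0)
  have e : ∀ t x, divergence (fun y => ξ (t, y)) x = divX ξ (t, x) := fun t x =>
    divergence_slice (q := (t, x)) (hξ.differentiable _)
  simp only [e] at h3 h4
  rw [h3, h4] at h1
  simp only [fderiv_divX_time hξ] at h1
  rw [h2] at h1
  linarith

lemma continuous_inner_base {ξ : ℝ × Space d → Space d} (hξ : Continuous ξ) :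
    Continuous fun q : ℝ × (Space d × Sph d) => inner ℝ (ξ (base q)) (q.2.2 : Space d) := by
  fun_prop

/-- The flux identity for a bounded `C¹` field. -/
lemma WeakEvolution.flux (h : WeakEvolution T α₀ αT Λ Γ V)
    {g₀ gT : Measure (Space d × Sph d)} [IsFiniteMeasure g₀] [IsFiniteMeasure gT]
    (h₀ : ∀ φ : Space d → Space d, IsTest φ →
      ∫ x, divergence φ x ∂α₀ = -∫ z, inner ℝ (φ z.1) (z.2 : Space d) ∂g₀)
    (hT : ∀ φ : Space d → Space d, IsTest φ →
      ∫ x, divergence φ x ∂αT = -∫ z, inner ℝ (φ z.1) (z.2 : Space d) ∂gT)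
    {ξ ξt : ℝ × Space d → Space d} {Dξ : ℝ × Space d → Space d →L[ℝ] Space d} {M : ℝ} {L : ℝ≥0}
    (hξ : SpatiallyC1 ξ Dξ M) (hL : LipschitzWith L ξ)
    (hξt : ∀ t ∈ Ioo 0 T, ∀ x, HasDerivAt (fun s => ξ (s, x)) (ξt (t, x)) t)
    (hξtc : ContinuousOn ξt (Ioo 0 T ×ˢ univ)) :
    (∫ z, inner ℝ (ξ (T, z.1)) (z.2 : Space d) ∂gT) -
        ∫ z, inner ℝ (ξ (0, z.1)) (z.2 : Space d) ∂g₀ =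
      (∫ q, inner ℝ (ξt (base q)) (q.2.2 : Space d) ∂Γ) +
        ∫ q, V (base q) * traceL (Dξ (base q)) ∂Γ := by
  have := h.finite
  obtain ⟨F, hF⟩ := exists_testApprox hξ.continuous hξ.norm_le
  obtain ⟨K, hK0, hK, hFx⟩ := hF.space hξ
  obtain ⟨K', hK'0, hK', hFt⟩ := hF.time hL hξt hξtc
  have hend : ∀ (t : ℝ) (g : Measure (Space d × Sph d)) [IsFiniteMeasure g],
      Tendsto (fun n => ∫ z, inner ℝ (F n (t, z.1)) (z.2 : Space d) ∂g) atTop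
        (𝓝 (∫ z, inner ℝ (ξ (t, z.1)) (z.2 : Space d) ∂g)) := fun t g _ => by
    refine tendsto_integral_of_dominated_convergence (fun _ => M) (fun n => ?_)
      (integrable_const _) (fun n => Eventually.of_forall fun z => ?_)
      (Eventually.of_forall fun z => ?_)
    · have := (hF.isTest n).continuous
      exact Continuous.aestronglyMeasurable (by fun_prop)
    · exact (abs_inner_sph_le _ _).trans (hF.norm_le n _)
    · exact (hF.tendsto _).inner tendsto_const_nhds
  have h1 : Tendsto (fun n => ∫ q, inner ℝ (fderiv ℝ (F n) (base q) (1, 0)) (q.2.2 : Space d) ∂Γ)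
      atTop (𝓝 (∫ q, inner ℝ (ξt (base q)) (q.2.2 : Space d) ∂Γ)) := by
    refine tendsto_integral_of_dominated_convergence (fun _ => K') (fun n => ?_)
      (integrable_const _) (fun n => Eventually.of_forall fun z => ?_) ?_
    · exact (continuous_inner_base
        ((hF.isTest n).fderiv_apply (1, 0)).continuous).aestronglyMeasurable
    · exact (abs_inner_sph_le _ _).trans (hK' n _)
    · filter_upwards [h.mem_time] with q hq
      exact (hFt (base q) hq).inner tendsto_const_nhds
  have h2 : Tendsto (fun n => ∫ q, V (base q) * divX (F n) (base q) ∂Γ)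
      atTop (𝓝 (∫ q, V (base q) * traceL (Dξ (base q)) ∂Γ)) := by
    refine tendsto_integral_of_dominated_convergence (fun q => |V (base q)| * (d * K)) (fun n => ?_)
      (h.V_int.abs.mul_const _) (fun n => Eventually.of_forall fun z => ?_)
      (Eventually.of_forall fun q => ?_)
    · exact h.V_int.aestronglyMeasurable.mul
        ((hF.isTest n).divX.continuous.comp continuous_base).aestronglyMeasurable
    · rw [norm_mul, Real.norm_eq_abs, Real.norm_eq_abs]
      gcongr
      exact abs_divX_le fun v => hK n _ v
    · exact (tendsto_divX fun v => hFx _ v).const_mul _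
  have h3 := (hend T gT).sub (hend 0 g₀)
  have h4 := h1.add h2
  refine tendsto_nhds_unique h3 (h4.congr fun n => ?_)
  exact (h.flux_test h₀ hT (hF.isTest n)).symm

/-- The field `(ξ·∇)B + (∇·ξ)B - (B·∇)ξ - (∇·B)ξ` in terms of the given derivatives. -/
noncomputable def wedgeField (ξ B : ℝ × Space d → Space d)
    (Dξ DB : ℝ × Space d → Space d →L[ℝ] Space d) (q : ℝ × Space d) : Space d :=
  DB q (ξ q) + traceL (Dξ q) • B q - Dξ q (B q) - traceL (DB q) • ξ q

/-- The boundary of a set does not see the divergence of an antisymmetric tensor field. -/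
lemma WeakEvolution.integral_wedgeField (h : WeakEvolution T α₀ αT Λ Γ V)
    {ξ B : ℝ × Space d → Space d} {Dξ DB : ℝ × Space d → Space d →L[ℝ] Space d} {M M' : ℝ}
    (hξ : SpatiallyC1 ξ Dξ M) (hB : SpatiallyC1 B DB M') :
    ∫ q, inner ℝ (wedgeField ξ B Dξ DB (base q)) (q.2.2 : Space d) ∂Γ = 0 := by
  have := h.finite
  obtain ⟨F, hF⟩ := exists_testApprox hξ.continuous hξ.norm_le
  obtain ⟨K, hK0, hK, hFx⟩ := hF.space hξ
  obtain ⟨G, hG⟩ := exists_testApprox hB.continuous hB.norm_le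
  obtain ⟨K', hK'0, hK', hGx⟩ := hG.space hB
  have hM0 : 0 ≤ M := (norm_nonneg _).trans (hξ.norm_le 0)
  have hM'0 : 0 ≤ M' := (norm_nonneg _).trans (hB.norm_le 0)
  have h1 : ∀ n, ∫ q, inner ℝ (wedgeDiv (F n) (G n) (base q)) (q.2.2 : Space d) ∂Γ = 0 :=
    fun n => by
      have := h.gradient _ (isTest_wedgeDiv (hF.isTest n) (hG.isTest n))
      simp only [divX_wedgeDiv (hF.isTest n) (hG.isTest n), integral_zero] at this
      linarith
  have h2 : Tendsto (fun n => ∫ q, inner ℝ (wedgeDiv (F n) (G n) (base q)) (q.2.2 : Space d) ∂Γ)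
      atTop (𝓝 (∫ q, inner ℝ (wedgeField ξ B Dξ DB (base q)) (q.2.2 : Space d) ∂Γ)) := by
    refine tendsto_integral_of_dominated_convergence
      (fun _ => K' * M + d * K * M' + K * M' + d * K' * M) (fun n => ?_)
      (integrable_const _) (fun n => Eventually.of_forall fun q => ?_)
      (Eventually.of_forall fun q => ?_)
    · exact (continuous_inner_base
        (isTest_wedgeDiv (hF.isTest n) (hG.isTest n)).continuous).aestronglyMeasurable
    · refine (abs_inner_sph_le _ _).trans ?_
      have e1 : ‖fderiv ℝ (G n) (base q) (0, F n (base q))‖ ≤ K' * M :=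
        (hK' n _ _).trans (by gcongr; exact hF.norm_le n _)
      have e2 : ‖divX (F n) (base q) • G n (base q)‖ ≤ d * K * M' := by
        rw [norm_smul]
        exact mul_le_mul (abs_divX_le fun v => hK n _ v) (hG.norm_le n _) (norm_nonneg _)
          (by positivity)
      have e3 : ‖fderiv ℝ (F n) (base q) (0, G n (base q))‖ ≤ K * M' :=
        (hK n _ _).trans (by gcongr; exact hG.norm_le n _)
      have e4 : ‖divX (G n) (base q) • F n (base q)‖ ≤ d * K' * M := by
        rw [norm_smul]
        exact mul_le_mul (abs_divX_le fun v => hK' n _ v) (hF.norm_le n _) (norm_nonneg _)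
          (by positivity)
      unfold wedgeDiv
      exact (norm_sub_le _ _).trans (add_le_add ((norm_sub_le _ _).trans
        (add_le_add ((norm_add_le _ _).trans (add_le_add e1 e2)) e3)) e4)
    · refine Tendsto.inner ?_ tendsto_const_nhds
      have a1 := tendsto_clm_varying (fun n v => hK' n (base q) v) (hGx (base q) _)
        (hF.tendsto (base q))
      have a2 := (tendsto_divX fun v => hFx (base q) v).smul (hG.tendsto (base q))
      have a3 := tendsto_clm_varying (fun n v => hK n (base q) v) (hFx (base q) _)
        (hG.tendsto (base q))
      have a4 := (tendsto_divX fun v => hGx (base q) v).smul (hF.tendsto (base q))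
      exact ((a1.add a2).sub a3).sub a4
  simp only [h1] at h2
  exact (tendsto_nhds_unique h2 tendsto_const_nhds)

/-- The mean curvature identity extends from test fields to bounded fields which are `C¹` in
space. -/
lemma curvature_identity_of_test [IsFiniteMeasure Γ] {H : ℝ × Space d → Space d}
    (hHi : Integrable (fun q => H (base q)) Γ)
    (hH : ∀ F : ℝ × Space d → Space d, IsTest F →
      ∫ q, inner ℝ (H (base q)) (F (base q)) ∂Γ = -∫ q, (divX F (base q) -
        inner ℝ (q.2.2 : Space d) (fderiv ℝ F (base q) (0, (q.2.2 : Space d)))) ∂Γ)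
    {B : ℝ × Space d → Space d} {DB : ℝ × Space d → Space d →L[ℝ] Space d} {M : ℝ}
    (hB : SpatiallyC1 B DB M) :
    ∫ q, inner ℝ (H (base q)) (B (base q)) ∂Γ = -∫ q, (traceL (DB (base q)) -
        inner ℝ (q.2.2 : Space d) (DB (base q) (q.2.2 : Space d))) ∂Γ := by
  obtain ⟨G, hG⟩ := exists_testApprox hB.continuous hB.norm_le
  obtain ⟨K, hK0, hK, hGx⟩ := hG.space hB
  have h1 : Tendsto (fun n => ∫ q, inner ℝ (H (base q)) (G n (base q)) ∂Γ) atTop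
      (𝓝 (∫ q, inner ℝ (H (base q)) (B (base q)) ∂Γ)) := by
    refine tendsto_integral_of_dominated_convergence (fun q => ‖H (base q)‖ * M) (fun n => ?_)
      (hHi.norm.mul_const _) (fun n => Eventually.of_forall fun q => ?_)
      (Eventually.of_forall fun q => ?_)
    · exact hHi.aestronglyMeasurable.inner
        ((hG.isTest n).continuous.comp continuous_base).aestronglyMeasurable
    · exact (abs_real_inner_le_norm _ _).trans (by gcongr; exact hG.norm_le n _)
    · exact tendsto_const_nhds.inner (hG.tendsto _)
  have h2 : Tendsto (fun n => ∫ q, (divX (G n) (base q) -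
        inner ℝ (q.2.2 : Space d) (fderiv ℝ (G n) (base q) (0, (q.2.2 : Space d)))) ∂Γ) atTop
      (𝓝 (∫ q, (traceL (DB (base q)) -
        inner ℝ (q.2.2 : Space d) (DB (base q) (q.2.2 : Space d))) ∂Γ)) := by
    refine tendsto_integral_of_dominated_convergence (fun q => d * K + K) (fun n => ?_)
      (integrable_const _) (fun n => Eventually.of_forall fun q => ?_)
      (Eventually.of_forall fun q => ?_)
    · have c1 := (hG.isTest n).divX.continuous.comp (continuous_base (d := d))
      have c2 : Continuous fun q : ℝ × (Space d × Sph d) =>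
          fderiv ℝ (G n) (base q) (0, (q.2.2 : Space d)) :=
        (((hG.isTest n).1.continuous_fderiv (by simp)).comp continuous_base).clm_apply
          (by fun_prop)
      exact Continuous.aestronglyMeasurable (by
        simp only [Function.comp_def] at c1
        fun_prop)
    · refine (norm_sub_le _ _).trans (add_le_add ?_ ?_)
      · exact abs_divX_le fun v => hK n _ v
      · refine (abs_real_inner_le_norm _ _).trans ?_
        have := hK n (base q) (q.2.2 : Space d)
        rw [norm_sph] at this ⊢
        linarith
    · exact (tendsto_divX fun v => hGx _ v).sub (tendsto_const_nhds.inner (hGx _ _))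
  exact tendsto_nhds_unique h1 (h2.neg.congr fun n => (hH _ (hG.isTest n)).symm)

lemma divX_smul {c : ℝ × Space d → ℝ} {F : ℝ × Space d → Space d} {q : ℝ × Space d}
    (hc : DifferentiableAt ℝ c q) (hF : DifferentiableAt ℝ F q) :
    divX (fun q => c q • F q) q = c q * divX F q + fderiv ℝ c q (0, F q) := by
  have e := clm_prod_expand (fderiv ℝ c q) (F q)
  rw [e]
  simp only [divX, Finset.mul_sum, ← Finset.sum_add_distrib]
  refine Finset.sum_congr rfl fun k _ => ?_
  rw [fderiv_fun_smul hc hF]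
  simp
  ring

/-- A smooth, nonnegative, integrable weight whose logarithmic gradient is bounded. -/
structure IsWeight (ψ : Space d → ℝ) (c : ℝ) : Prop where
  contDiff : ContDiff ℝ ∞ ψ
  nonneg : ∀ x, 0 ≤ ψ x
  le_one : ∀ x, ψ x ≤ 1
  integrable : Integrable ψ
  grad_le : ∀ x v, |fderiv ℝ ψ x v| ≤ c * ψ x * ‖v‖

lemma fderiv_comp_snd {ψ : Space d → ℝ} (hψ : ContDiff ℝ ∞ ψ) (q v : ℝ × Space d) :
    fderiv ℝ (fun q : ℝ × Space d => ψ q.2) q v = fderiv ℝ ψ q.2 v.2 := by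
  have h1 : HasFDerivAt ψ (fderiv ℝ ψ q.2) q.2 := (hψ.differentiable (by simp) _).hasFDerivAt
  have h2 : HasFDerivAt (fun q : ℝ × Space d => ψ q.2) _ q := h1.comp q hasFDerivAt_snd
  rw [h2.fderiv]; rfl

lemma integrable_weight_track {ψ : Space d → ℝ} (hψ : Integrable ψ) (T : ℝ) :
    Integrable (fun q : ℝ × Space d => ψ q.2) (volume.restrict (Ioc 0 T ×ˢ univ)) := by
  rw [Measure.volume_eq_prod, ← Measure.prod_restrict, Measure.restrict_univ]
  exact hψ.comp_snd _

/-- Transport of a bounded Lipschitz function `f`, localized by the weight `ψ`, along the velocity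
field `B`, measured on the moving set: only the mismatch `B · p - V` of the speeds appears on the
boundary. -/
lemma WeakEvolution.transport (h : WeakEvolution T α₀ αT Λ Γ V)
    {ψ : Space d → ℝ} {c : ℝ} (hψ : IsWeight ψ c)
    {f : ℝ × Space d → ℝ} {L : ℝ≥0} {M : ℝ} (hfL : LipschitzWith L f) (hfM : ∀ z, ‖f z‖ ≤ M)
    {B : ℝ × Space d → Space d} {DB : ℝ × Space d → Space d →L[ℝ] Space d} {M' : ℝ}
    (hB : SpatiallyC1 B DB M') :
    (∫ x, ψ x * f (T, x) ∂αT) - ∫ x, ψ x * f (0, x) ∂α₀ =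
      (∫ q, (ψ q.2 * (fderiv ℝ f q (1, 0) + fderiv ℝ f q (0, B q)) +
        f q * (fderiv ℝ ψ q.2 (B q) + ψ q.2 * traceL (DB q))) ∂Λ) +
      ∫ q, ψ q.2.1 * f (base q) * (inner ℝ (B (base q)) (q.2.2 : Space d) - V (base q)) ∂Γ := by
  have := h.finite
  obtain ⟨F, hF⟩ := exists_testApprox hfL.continuous hfM
  obtain ⟨K, hK0, hKx, hKt, hFd⟩ := hF.lipschitz hfL
  obtain ⟨G, hG⟩ := exists_testApprox hB.continuous hB.norm_le
  obtain ⟨K', hK'0, hK', hGx⟩ := hG.space hB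
  have hM0 : 0 ≤ M := (norm_nonneg _).trans (hfM 0)
  have hM'0 : 0 ≤ M' := (norm_nonneg _).trans (hB.norm_le 0)
  have hψc : Continuous ψ := hψ.contDiff.continuous
  have hψ2 : ContDiff ℝ ∞ fun q : ℝ × Space d => ψ q.2 := hψ.contDiff.comp contDiff_snd
  have hψΛ : Integrable (fun q : ℝ × Space d => ψ q.2) Λ :=
    (integrable_weight_track hψ.integrable T).mono_measure h.le_track
  have hΛ : Λ ≪ volume := (Measure.absolutelyContinuous_of_le h.le_track).trans
    Measure.restrict_le_self.absolutelyContinuous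
  have hFψ : ∀ n, IsTest fun q : ℝ × Space d => ψ q.2 * F n q := fun n =>
    (hF.isTest n).smul_left hψ2
  have hdψ : ∀ q : ℝ × Space d, DifferentiableAt ℝ (fun q : ℝ × Space d => ψ q.2) q :=
    fun q => hψ2.differentiable (by simp) q
  have hdF : ∀ n q v, fderiv ℝ (fun q : ℝ × Space d => ψ q.2 * F n q) q v =
      ψ q.2 * fderiv ℝ (F n) q v + fderiv ℝ ψ q.2 v.2 * F n q := fun n q v => by
    rw [fderiv_fun_mul (hdψ q) ((hF.isTest n).differentiable q)]
    simp [fderiv_comp_snd hψ.contDiff]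
    ring
  -- convergence of the terms in the velocity equation
  have hend : ∀ (t : ℝ) (α : Measure (Space d)), α ≤ volume →
      Tendsto (fun n => ∫ x, ψ x * F n (t, x) ∂α) atTop (𝓝 (∫ x, ψ x * f (t, x) ∂α)) :=
    fun t α hα => by
      refine tendsto_integral_of_dominated_convergence (fun x => ψ x * M) (fun n => ?_)
        ((hψ.integrable.mono_measure hα).mul_const M) (fun n => Eventually.of_forall fun x => ?_)
        (Eventually.of_forall fun x => (hF.tendsto _).const_mul _)
      · have := (hF.isTest n).continuous
        exact Continuous.aestronglyMeasurable (by fun_prop)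
      · rw [norm_mul, Real.norm_of_nonneg (hψ.nonneg x)]
        exact mul_le_mul_of_nonneg_left (hF.norm_le n _) (hψ.nonneg x)
  have ht1 : Tendsto (fun n => ∫ q, ψ q.2 * fderiv ℝ (F n) q (1, 0) ∂Λ) atTop
      (𝓝 (∫ q, ψ q.2 * fderiv ℝ f q (1, 0) ∂Λ)) := by
    refine tendsto_integral_of_dominated_convergence (fun q => ψ q.2 * K) (fun n => ?_)
      (hψΛ.mul_const K) (fun n => Eventually.of_forall fun q => ?_) ?_
    · have := ((hF.isTest n).fderiv_apply (1, 0)).continuous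
      exact Continuous.aestronglyMeasurable (by fun_prop)
    · rw [norm_mul, Real.norm_of_nonneg (hψ.nonneg _)]
      exact mul_le_mul_of_nonneg_left (hKt n _) (hψ.nonneg _)
    · filter_upwards [hΛ.ae_le hFd] with q hq
      exact hq.1.const_mul _
  have ht2 : Tendsto (fun n => ∫ q, V (base q) * (ψ q.2.1 * F n (base q)) ∂Γ) atTop
      (𝓝 (∫ q, V (base q) * (ψ q.2.1 * f (base q)) ∂Γ)) := by
    refine tendsto_integral_of_dominated_convergence (fun q => |V (base q)| * M) (fun n => ?_)
      (h.V_int.abs.mul_const M) (fun n => Eventually.of_forall fun q => ?_)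
      (Eventually.of_forall fun q => ((hF.tendsto _).const_mul _).const_mul _)
    · refine h.V_int.aestronglyMeasurable.mul (Continuous.aestronglyMeasurable ?_)
      have := (hF.isTest n).continuous
      fun_prop
    · rw [norm_mul, norm_mul, Real.norm_eq_abs, Real.norm_of_nonneg (hψ.nonneg _)]
      gcongr
      calc _ ≤ 1 * M := mul_le_mul (hψ.le_one _) (hF.norm_le n _) (norm_nonneg _) zero_le_one
        _ = M := one_mul M
  -- convergence of the terms in the gradient identity for the fields `ψ F G`
  have hg1 : Tendsto (fun n => ∫ q, (ψ q.2 * F n q * divX (G n) q +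
        (ψ q.2 * fderiv ℝ (F n) q (0, G n q) + fderiv ℝ ψ q.2 (G n q) * F n q)) ∂Λ) atTop
      (𝓝 (∫ q, (ψ q.2 * f q * traceL (DB q) +
        (ψ q.2 * fderiv ℝ f q (0, B q) + fderiv ℝ ψ q.2 (B q) * f q)) ∂Λ)) := by
    refine tendsto_integral_of_dominated_convergence
      (fun q => ψ q.2 * (M * (d * K') + (K * M' + |c| * M' * M))) (fun n => ?_)
      (hψΛ.mul_const _) (fun n => Eventually.of_forall fun q => ?_) ?_
    · have c1 := (hF.isTest n).continuous
      have c2 := (hG.isTest n).continuous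
      have c3 := (hG.isTest n).divX.continuous
      have c4 : Continuous fun q => fderiv ℝ (F n) q (0, G n q) :=
        ((hF.isTest n).1.continuous_fderiv (by simp)).clm_apply (by fun_prop)
      have c5 : Continuous fun q : ℝ × Space d => fderiv ℝ ψ q.2 (G n q) :=
        ((hψ.contDiff.continuous_fderiv (by simp)).comp continuous_snd).clm_apply c2
      exact Continuous.aestronglyMeasurable (by fun_prop)
    · have e0 := hψ.nonneg q.2
      have e1 : ‖ψ q.2 * F n q * divX (G n) q‖ ≤ ψ q.2 * (M * (d * K')) := by
        rw [norm_mul, norm_mul, Real.norm_of_nonneg e0, mul_assoc]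
        gcongr
        · exact hF.norm_le n q
        · exact abs_divX_le fun v => hK' n q v
      have e2 : ‖ψ q.2 * fderiv ℝ (F n) q (0, G n q)‖ ≤ ψ q.2 * (K * M') := by
        rw [norm_mul, Real.norm_of_nonneg e0]
        gcongr
        exact (hKx n q _).trans (by gcongr; exact hG.norm_le n q)
      have e3 : ‖fderiv ℝ ψ q.2 (G n q) * F n q‖ ≤ ψ q.2 * (|c| * M' * M) := by
        rw [norm_mul, Real.norm_eq_abs]
        calc _ ≤ (|c| * ψ q.2 * M') * M := by
              refine mul_le_mul ?_ (hF.norm_le n q) (norm_nonneg _) (by positivity)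
              refine (hψ.grad_le q.2 (G n q)).trans ?_
              gcongr
              · exact le_abs_self c
              · exact hG.norm_le n q
          _ = _ := by ring
      calc _ ≤ ψ q.2 * (M * (d * K')) + (ψ q.2 * (K * M') + ψ q.2 * (|c| * M' * M)) :=
            (norm_add_le _ _).trans (add_le_add e1 ((norm_add_le _ _).trans (add_le_add e2 e3)))
        _ = _ := by ring
    · filter_upwards [hΛ.ae_le hFd] with q hq
      have a1 := ((hF.tendsto q).const_mul (ψ q.2)).mul (tendsto_divX fun v => hGx q v)
      have a2 := (tendsto_clm_varying (fun n v => hKx n q v) (hq.2 (B q)) (hG.tendsto q)).const_mul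
        (ψ q.2)
      have a3 := (((fderiv ℝ ψ q.2).continuous.tendsto _).comp (hG.tendsto q)).mul (hF.tendsto q)
      exact a1.add (a2.add a3)
  have hg2 : Tendsto (fun n => ∫ q, inner ℝ ((ψ q.2.1 * F n (base q)) • G n (base q))
        (q.2.2 : Space d) ∂Γ) atTop
      (𝓝 (∫ q, inner ℝ ((ψ q.2.1 * f (base q)) • B (base q)) (q.2.2 : Space d) ∂Γ)) := by
    refine tendsto_integral_of_dominated_convergence (fun _ => M * M') (fun n => ?_)
      (integrable_const _) (fun n => Eventually.of_forall fun q => ?_)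
      (Eventually.of_forall fun q => ?_)
    · exact (continuous_inner_base (ξ := fun q => (ψ q.2 * F n q) • G n q)
        ((hG.isTest n).smul_left (hFψ n).1).continuous).aestronglyMeasurable
    · refine (abs_inner_sph_le _ _).trans ?_
      rw [norm_smul, norm_mul, Real.norm_of_nonneg (hψ.nonneg _)]
      calc _ ≤ (1 * M) * M' := by
            refine mul_le_mul (mul_le_mul (hψ.le_one _) (hF.norm_le n _) (norm_nonneg _)
              zero_le_one) (hG.norm_le n _) (norm_nonneg _) (by positivity)
        _ = _ := by ring
    · exact (((hF.tendsto _).const_mul _).smul (hG.tendsto _)).inner tendsto_const_nhds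
  have hv := tendsto_nhds_unique ((hend T αT h.le_final).sub (hend 0 α₀ h.le_init))
    ((ht1.sub ht2).congr fun n => by
      have := h.velocity _ (hFψ n)
      simp only [hdF, map_zero, zero_mul, add_zero] at this
      exact this.symm)
  have hg := tendsto_nhds_unique hg1 (hg2.neg.congr fun n => by
      have h1 : IsTest fun q : ℝ × Space d => (ψ q.2 * F n q) • G n q :=
        (hG.isTest n).smul_left (hFψ n).1
      have := h.gradient _ h1
      simp only [divX_smul ((hFψ n).differentiable _) ((hG.isTest n).differentiable _),
        hdF] at this
      exact this.symm)
  -- integrability of the limits, needed to combine the two identities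
  have i1 : Integrable (fun q => ψ q.2 * fderiv ℝ f q (1, 0)) Λ := by
    refine Integrable.mono' (hψΛ.mul_const K) ?_ ?_
    · exact (hψc.comp continuous_snd).aestronglyMeasurable.mul
        (measurable_fderiv_apply_const ℝ f (1, 0)).aestronglyMeasurable
    · filter_upwards [hΛ.ae_le hFd] with q hq
      rw [norm_mul, Real.norm_of_nonneg (hψ.nonneg _)]
      exact mul_le_mul_of_nonneg_left (le_of_tendsto hq.1.norm
        (Eventually.of_forall fun n => hKt n q)) (hψ.nonneg _)
  have i2 : Integrable (fun q => ψ q.2 * f q * traceL (DB q) +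
        (ψ q.2 * fderiv ℝ f q (0, B q) + fderiv ℝ ψ q.2 (B q) * f q)) Λ := by
    have cB := hB.continuous
    have cD : Continuous fun q => traceL (DB q) := by
      unfold traceL
      have := hB.continuous_deriv
      fun_prop
    have cf := hfL.continuous
    have cψ : Continuous fun q : ℝ × Space d => fderiv ℝ ψ q.2 (B q) :=
      ((hψ.contDiff.continuous_fderiv (by simp)).comp continuous_snd).clm_apply cB
    have mf : Measurable fun q => fderiv ℝ f q (0, B q) := by
      have : (fun q => fderiv ℝ f q (0, B q)) =
          fun q => ∑ k : Fin d, B q k • fderiv ℝ f q (0, basisVec k) :=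
        funext fun q => clm_prod_expand _ _
      rw [this]
      refine Finset.measurable_fun_sum _ fun k _ => ?_
      have c1 : Continuous fun q => B q k := by fun_prop
      exact c1.measurable.smul (measurable_fderiv_apply_const ℝ f _)
    refine Integrable.mono' (hψΛ.mul_const (M * (d * M') + (K * M' + |c| * M' * M))) ?_ ?_
    · refine AEStronglyMeasurable.add (Continuous.aestronglyMeasurable (by fun_prop))
        (AEStronglyMeasurable.add ?_ (Continuous.aestronglyMeasurable (by fun_prop)))
      exact (hψc.comp continuous_snd).aestronglyMeasurable.mul mf.aestronglyMeasurable
    · filter_upwards [hΛ.ae_le hFd] with q hq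
      have e0 := hψ.nonneg q.2
      have e1 : ‖ψ q.2 * f q * traceL (DB q)‖ ≤ ψ q.2 * (M * (d * M')) := by
        rw [norm_mul, norm_mul, Real.norm_of_nonneg e0, mul_assoc]
        gcongr
        · exact hfM q
        · exact (abs_traceL_le _).trans (by gcongr; exact hB.norm_deriv_le q)
      have e2 : ‖ψ q.2 * fderiv ℝ f q (0, B q)‖ ≤ ψ q.2 * (K * M') := by
        rw [norm_mul, Real.norm_of_nonneg e0]
        gcongr
        refine (le_of_tendsto (hq.2 (B q)).norm
          (Eventually.of_forall fun n => hKx n q (B q))).trans ?_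
        gcongr
        exact hB.norm_le q
      have e3 : ‖fderiv ℝ ψ q.2 (B q) * f q‖ ≤ ψ q.2 * (|c| * M' * M) := by
        rw [norm_mul, Real.norm_eq_abs]
        calc _ ≤ (|c| * ψ q.2 * M') * M := by
              refine mul_le_mul ?_ (hfM q) (norm_nonneg _) (by positivity)
              refine (hψ.grad_le q.2 (B q)).trans ?_
              gcongr
              · exact le_abs_self c
              · exact hB.norm_le q
          _ = _ := by ring
      calc _ ≤ ψ q.2 * (M * (d * M')) + (ψ q.2 * (K * M') + ψ q.2 * (|c| * M' * M)) :=
            (norm_add_le _ _).trans (add_le_add e1 ((norm_add_le _ _).trans (add_le_add e2 e3)))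
        _ = _ := by ring
  have i3 : Integrable (fun q => inner ℝ ((ψ q.2.1 * f (base q)) • B (base q))
      (q.2.2 : Space d)) Γ := by
    have c1 := hfL.continuous
    have c2 := hB.continuous
    refine Integrable.mono' (integrable_const (M * M'))
      (Continuous.aestronglyMeasurable (by fun_prop)) (Eventually.of_forall fun q => ?_)
    refine (abs_inner_sph_le _ _).trans ?_
    rw [norm_smul, norm_mul, Real.norm_of_nonneg (hψ.nonneg _)]
    calc _ ≤ (1 * M) * M' := by
          refine mul_le_mul (mul_le_mul (hψ.le_one _) (hfM _) (norm_nonneg _)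
            zero_le_one) (hB.norm_le _) (norm_nonneg _) (by positivity)
      _ = _ := by ring
  have i4 : Integrable (fun q => V (base q) * (ψ q.2.1 * f (base q))) Γ := by
    have c1 := hfL.continuous
    refine h.V_int.mul_bdd (c := M) (Continuous.aestronglyMeasurable (by fun_prop))
      (Eventually.of_forall fun q => ?_)
    rw [norm_mul, Real.norm_of_nonneg (hψ.nonneg _)]
    calc _ ≤ 1 * M := mul_le_mul (hψ.le_one _) (hfM _) (norm_nonneg _) zero_le_one
      _ = M := one_mul M
  have s1 : (∫ q, (ψ q.2 * (fderiv ℝ f q (1, 0) + fderiv ℝ f q (0, B q)) +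
        f q * (fderiv ℝ ψ q.2 (B q) + ψ q.2 * traceL (DB q))) ∂Λ) =
      (∫ q, ψ q.2 * fderiv ℝ f q (1, 0) ∂Λ) + ∫ q, (ψ q.2 * f q * traceL (DB q) +
        (ψ q.2 * fderiv ℝ f q (0, B q) + fderiv ℝ ψ q.2 (B q) * f q)) ∂Λ := by
    rw [← integral_add i1 i2]
    exact integral_congr_ae (Eventually.of_forall fun q => by simp only; ring)
  have s2 : (∫ q, ψ q.2.1 * f (base q) *
        (inner ℝ (B (base q)) (q.2.2 : Space d) - V (base q)) ∂Γ) =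
      (∫ q, inner ℝ ((ψ q.2.1 * f (base q)) • B (base q)) (q.2.2 : Space d) ∂Γ) -
        ∫ q, V (base q) * (ψ q.2.1 * f (base q)) ∂Γ := by
    rw [← integral_sub i3 i4]
    exact integral_congr_ae (Eventually.of_forall fun q => by
      simp only [real_inner_smul_left]; ring)
  rw [s1, s2]
  linarith

end WeakEvolution

/-! ### The pointwise dissipation estimate -/

section Pointwise

variable {X : Type*} [NormedAddCommGroup X] [InnerProductSpace ℝ X]

/-- The scalar inequality behind `curvature_pointwise`: there `s` is the tilt excess, `b = B · ξ`,
`r = B · (ν - ξ)`, `x = 1 - |ξ|²`, `n = 1 - |ν|²`, `y = |H - b ξ|`, and `p`, `w` are the inner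
products of `H - b ξ` with `ν` and `B - b ξ`. -/
lemma curvature_bound_real {y b r s x n M p w : ℝ} (hs0 : 0 ≤ s)
    (hs2 : s ≤ 2) (hb : b ^ 2 ≤ M ^ 2) (hr : r ^ 2 ≤ M ^ 2 * (2 * s))
    (hx1 : x ≤ 2 * s) (hx0 : 0 ≤ x) (hn0 : 0 ≤ n) (hn1 : n ≤ 1) (hn2 : n ≤ 2 * s) (hp : |p| ≤ y)
    (hw : |w| ≤ y * (2 * M)) :
    -(1 / 2) * y ^ 2 + 1 / 2 * b ^ 2 * x + p * (r + b * s) +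
        (b ^ 2 * s - b * s * r - b ^ 2 * s ^ 2) - (1 - n) * b ^ 2 * x + n * w ≤ 30 * M ^ 2 * s := by
  have hMs : 0 ≤ M ^ 2 * s := by positivity
  have hbs : b ^ 2 * s ≤ M ^ 2 * s := by gcongr
  have hbs2 : b ^ 2 * s ^ 2 ≤ 2 * (M ^ 2 * s) := by
    calc b ^ 2 * s ^ 2 = (b ^ 2 * s) * s := by ring
      _ ≤ (M ^ 2 * s) * 2 := by gcongr
      _ = _ := by ring
  have t2 : (r + b * s) ^ 2 ≤ 8 * M ^ 2 * s := by
    have : (r + b * s) ^ 2 ≤ 2 * r ^ 2 + 2 * (b ^ 2 * s ^ 2) := by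
      nlinarith only [sq_nonneg (r - b * s)]
    linarith
  have t1 : p * (r + b * s) ≤ 1 / 4 * y ^ 2 + (r + b * s) ^ 2 := by
    have h1 : p * (r + b * s) ≤ y * |r + b * s| := by
      refine (le_abs_self _).trans ?_
      rw [abs_mul]; gcongr
    nlinarith only [h1, sq_nonneg (1 / 2 * y - |r + b * s|), sq_abs (r + b * s)]
  have t3 : n * w ≤ 1 / 4 * y ^ 2 + 8 * M ^ 2 * s := by
    have h1 : n * w ≤ n * (y * (2 * M)) := by
      gcongr; exact le_of_abs_le hw
    have hnn : n ^ 2 ≤ 2 * s := by nlinarith only [hn0, hn1, hn2]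
    have h2 : (2 * M * n) ^ 2 ≤ 8 * M ^ 2 * s := by
      calc (2 * M * n) ^ 2 = 4 * M ^ 2 * n ^ 2 := by ring
        _ ≤ 4 * M ^ 2 * (2 * s) := by gcongr
        _ = _ := by ring
    nlinarith only [h1, h2, sq_nonneg (1 / 2 * y - 2 * M * n)]
  have t4 : -(b * s * r) ≤ 2 * M ^ 2 * s := by
    have : -(b * s * r) ≤ 1 / 2 * (b ^ 2 * s ^ 2) + 1 / 2 * r ^ 2 := by
      nlinarith only [sq_nonneg (b * s + r)]
    linarith
  have t5 : b ^ 2 * x ≤ 2 * (M ^ 2 * s) := by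
    calc b ^ 2 * x ≤ M ^ 2 * (2 * s) := by gcongr
      _ = _ := by ring
  have t6 : 0 ≤ (1 - n) * b ^ 2 * x := by
    have : 0 ≤ 1 - n := by linarith
    positivity
  have t7 : 0 ≤ b ^ 2 * s ^ 2 := by positivity
  linarith

/-- The part of the dissipation estimate which compares the mean curvature vector `H` with
`(B · ξ) ξ`. The vector `H` is parallel to the mean normal `ν`. -/
lemma curvature_pointwise {H B ξ ν : X} {M s : ℝ} (hν : ‖ν‖ ≤ 1) (hξ : ‖ξ‖ ≤ 1) (hB : ‖B‖ ≤ M)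
    (hs : s = 1 - inner ℝ ν ξ) (hH : ‖ν‖ ^ 2 • H = inner ℝ H ν • ν) :
    -(1 / 2) * ‖H‖ ^ 2 + inner ℝ H B - 1 / 2 * inner ℝ B ξ ^ 2 -
      inner ℝ B ξ * inner ℝ B (ν - ξ) ≤ 30 * M ^ 2 * s := by
  have hM0 : 0 ≤ M := (norm_nonneg _).trans hB
  set b := inner ℝ B ξ with hb
  set r := inner ℝ B (ν - ξ) with hr
  set D := H - b • ξ with hD
  set B' := B - b • ξ with hB'
  have hνξ : inner ℝ ν ξ = 1 - s := by linarith
  have hsξ : 1 - ‖ξ‖ ≤ s := by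
    have := real_inner_le_norm ν ξ
    nlinarith [norm_nonneg ξ]
  have hsν : 1 - ‖ν‖ ≤ s := by
    have := real_inner_le_norm ν ξ
    nlinarith [norm_nonneg ν]
  have hs0 : 0 ≤ s := by linarith
  have hs2 : s ≤ 2 := by
    have := neg_le_of_abs_le (abs_real_inner_le_norm ν ξ)
    nlinarith [norm_nonneg ξ, norm_nonneg ν]
  have hbM : |b| ≤ M := by
    refine (abs_real_inner_le_norm B ξ).trans ?_
    nlinarith only [norm_nonneg ξ, norm_nonneg B, hξ, hB]
  have hb2 : b ^ 2 ≤ M ^ 2 := sq_le_sq' (by linarith [neg_le_of_abs_le hbM]) (le_of_abs_le hbM)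
  have hνξ2 : ‖ν - ξ‖ ^ 2 ≤ 2 * s := by
    rw [norm_sub_sq_real, hνξ]
    nlinarith only [norm_nonneg ξ, norm_nonneg ν, hξ, hν]
  have hr2 : r ^ 2 ≤ M ^ 2 * (2 * s) := by
    have h1 : |r| ≤ M * ‖ν - ξ‖ := (abs_real_inner_le_norm _ _).trans (by gcongr)
    calc r ^ 2 = |r| ^ 2 := (sq_abs r).symm
      _ ≤ (M * ‖ν - ξ‖) ^ 2 := by gcongr
      _ = M ^ 2 * ‖ν - ξ‖ ^ 2 := by ring
      _ ≤ _ := by gcongr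
  have hξ2 : inner ℝ ξ ξ = ‖ξ‖ ^ 2 := real_inner_self_eq_norm_sq ξ
  have e1 : ‖H‖ ^ 2 = ‖D‖ ^ 2 + 2 * b * inner ℝ D ξ + b ^ 2 * ‖ξ‖ ^ 2 := by
    have : H = D + b • ξ := by rw [hD]; abel
    rw [this, norm_add_sq_real, norm_smul, inner_smul_right, Real.norm_eq_abs, mul_pow, sq_abs]
    ring
  have e2 : inner ℝ H B = inner ℝ D B' + b * inner ℝ D ξ + b ^ 2 := by
    have h1 : H = D + b • ξ := by rw [hD]; abel
    have h2 : B = B' + b • ξ := by rw [hB']; abel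
    have h3 : inner ℝ H B = inner ℝ D B + b * b := by
      conv_lhs => rw [h1]
      rw [inner_add_left, real_inner_smul_left, real_inner_comm B ξ]
    have h4 : inner ℝ D B = inner ℝ D B' + b * inner ℝ D ξ := by
      conv_lhs => rw [h2]
      rw [inner_add_right, inner_smul_right]
    rw [h3, h4]; ring
  have e3 : inner ℝ ν B' = r + b * s := by
    rw [hB', inner_sub_right, inner_smul_right, hνξ, hr, inner_sub_right, real_inner_comm B ν]
    ring
  have e4 : inner ℝ H ν = inner ℝ D ν + b * (1 - s) := by
    have h1 : H = D + b • ξ := by rw [hD]; abel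
    conv_lhs => rw [h1]
    rw [inner_add_left, real_inner_smul_left, real_inner_comm ν ξ, hνξ]
  have e5 : inner ℝ ξ B' = b * (1 - ‖ξ‖ ^ 2) := by
    rw [hB', inner_sub_right, inner_smul_right, hξ2, real_inner_comm B ξ]; ring
  have e6 : ‖ν‖ ^ 2 * inner ℝ H B' = inner ℝ H ν * inner ℝ ν B' := by
    have := congrArg (fun v => inner ℝ v B') hH
    simpa [real_inner_smul_left] using this
  have e7 : inner ℝ H B' = inner ℝ D B' + b * inner ℝ ξ B' := by
    have h1 : H = D + b • ξ := by rw [hD]; abel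
    conv_lhs => rw [h1]
    rw [inner_add_left, real_inner_smul_left]
  have hDν : |inner ℝ D ν| ≤ ‖D‖ := by
    refine (abs_real_inner_le_norm D ν).trans ?_
    nlinarith only [norm_nonneg D, hν]
  have hDB' : |inner ℝ D B'| ≤ ‖D‖ * (2 * M) := by
    refine (abs_real_inner_le_norm D B').trans ?_
    gcongr
    refine (norm_sub_le _ _).trans ?_
    rw [norm_smul, Real.norm_eq_abs]
    nlinarith only [norm_nonneg ξ, abs_nonneg b, hξ, hbM, hB]
  have hn0 : 0 ≤ 1 - ‖ν‖ ^ 2 := by nlinarith only [norm_nonneg ν, hν]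
  have hn1 : 1 - ‖ν‖ ^ 2 ≤ 2 * s := by nlinarith only [sq_nonneg (1 - ‖ν‖), hsν]
  have hx0 : 0 ≤ 1 - ‖ξ‖ ^ 2 := by nlinarith only [norm_nonneg ξ, hξ]
  have hx1 : 1 - ‖ξ‖ ^ 2 ≤ 2 * s := by nlinarith only [sq_nonneg (1 - ‖ξ‖), hsξ]
  rw [e5] at e7
  rw [e7, e4, e3] at e6
  set y := ‖D‖
  set n := 1 - ‖ν‖ ^ 2 with hn
  set x := 1 - ‖ξ‖ ^ 2 with hx
  -- the bracket, after completing the square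
  have key : -(1 / 2) * ‖H‖ ^ 2 + inner ℝ H B - 1 / 2 * b ^ 2 - b * r =
      -(1 / 2) * y ^ 2 + 1 / 2 * b ^ 2 * x + inner ℝ D ν * (r + b * s) +
        (b ^ 2 * s - b * s * r - b ^ 2 * s ^ 2) - (1 - n) * b ^ 2 * x + n * inner ℝ D B' := by
    rw [e1, e2]
    have hn' : ‖ν‖ ^ 2 = 1 - n := by rw [hn]; ring
    have hx' : ‖ξ‖ ^ 2 = 1 - x := by rw [hx]; ring
    rw [hn'] at e6
    rw [hx']
    linear_combination e6
  rw [key]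
  exact curvature_bound_real hs0 hs2 hb2 hr2 hx1 hx0 hn0
    (by rw [hn]; linarith [sq_nonneg ‖ν‖]) hn1 hDν hDB'

/-- The pointwise form of the relative entropy inequality on the interface between two phases: after
completing squares, all terms are controlled by the tilt excess `1 - ν · ξ`. Here `ν` is the mean
normal, `τ = ∂_t ξ`, `β = (B · ∇) ξ`, `f = ∇ · ξ`, `b' = ∇ · B`, and `W` is a weight error. -/
lemma exists_pointwise_bound [CompleteSpace X] {c C M : ℝ} (hc : 0 < c) (hC : 0 ≤ C) (N : ℝ) :
    ∃ K : ℝ, 0 ≤ K ∧ ∀ (H B ξ ν τ β : X) (DB : X →L[ℝ] X) (V f b' δ W : ℝ), ‖ν‖ ≤ 1 → 0 ≤ δ →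
      c * δ ^ 2 ≤ 1 - ‖ξ‖ → |inner ℝ B ξ + f| ≤ C * δ →
      ‖τ + β + ContinuousLinearMap.adjoint DB ξ‖ ≤ C * δ → |inner ℝ ξ (τ + β)| ≤ C * δ ^ 2 →
      ‖B‖ ≤ M → |b'| ≤ N → |W| ≤ C * δ → ‖ν‖ ^ 2 • H = inner ℝ H ν • ν →
      -(inner ℝ (τ - (DB ξ + f • B - β - b' • ξ) + W • B) ν) + V * f - 1 / 2 * V ^ 2 - W * V +
        (inner ℝ H B - 1 / 2 * ‖H‖ ^ 2) + (b' - inner ℝ ν (DB ξ) - inner ℝ ξ (DB ν) +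
          inner ℝ ξ (DB ξ)) ≤ K * (1 - inner ℝ ν ξ) := by
  have hCc : 0 ≤ C ^ 2 / c := by positivity
  refine ⟨C + C / c + |N| + 30 * M ^ 2 + 3 * M ^ 2 + 4 * (C ^ 2 / c) + C / c, by positivity,
    fun H B ξ ν τ β DB V f b' δ W hν hδ hlen hcurv htr htl hB hb' hW hH => ?_⟩
  have hM0 : 0 ≤ M := (norm_nonneg _).trans hB
  have hξ : ‖ξ‖ ≤ 1 := by nlinarith [sq_nonneg δ]
  set s := 1 - inner ℝ ν ξ with hs
  have hsξ : 1 - ‖ξ‖ ≤ s := by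
    have := real_inner_le_norm ν ξ
    nlinarith [norm_nonneg ξ]
  have hs0 : 0 ≤ s := by nlinarith [sq_nonneg δ]
  have hδs : δ ^ 2 ≤ s / c := by
    rw [le_div_iff₀ hc]; linarith
  have hνξ2 : ‖ν - ξ‖ ^ 2 ≤ 2 * s := by
    have : inner ℝ ν ξ = 1 - s := by linarith
    rw [norm_sub_sq_real, this]
    nlinarith only [norm_nonneg ξ, norm_nonneg ν, hξ, hν]
  set b := inner ℝ B ξ with hb
  set r := inner ℝ B (ν - ξ) with hr
  have hBν : inner ℝ B ν = b + r := by rw [hr, inner_sub_right]; ring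
  have hr2 : r ^ 2 ≤ M ^ 2 * (2 * s) := by
    have h1 : |r| ≤ M * ‖ν - ξ‖ := (abs_real_inner_le_norm _ _).trans (by gcongr)
    calc r ^ 2 = |r| ^ 2 := (sq_abs r).symm
      _ ≤ (M * ‖ν - ξ‖) ^ 2 := by gcongr
      _ = M ^ 2 * ‖ν - ξ‖ ^ 2 := by ring
      _ ≤ _ := by gcongr
  have hcur := curvature_pointwise hν hξ hB hs hH
  set e := b + f with he
  have he2 : e ^ 2 ≤ C ^ 2 * (s / c) := by
    calc e ^ 2 = |e| ^ 2 := (sq_abs e).symm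
      _ ≤ (C * δ) ^ 2 := by gcongr
      _ = C ^ 2 * δ ^ 2 := by ring
      _ ≤ _ := by gcongr
  have hW2 : W ^ 2 ≤ C ^ 2 * (s / c) := by
    calc W ^ 2 = |W| ^ 2 := (sq_abs W).symm
      _ ≤ (C * δ) ^ 2 := by gcongr
      _ = C ^ 2 * δ ^ 2 := by ring
      _ ≤ _ := by gcongr
  -- the transport terms
  have h1 : -inner ℝ (τ + β) ν = -inner ℝ (τ + β + ContinuousLinearMap.adjoint DB ξ) (ν - ξ) +
      (inner ℝ ξ (DB ν) - inner ℝ ξ (DB ξ)) - inner ℝ ξ (τ + β) := by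
    rw [inner_add_left (τ + β), ContinuousLinearMap.adjoint_inner_left, map_sub, inner_sub_right,
      inner_sub_right, real_inner_comm ξ (τ + β)]
    ring
  have h2 : -inner ℝ (τ + β + ContinuousLinearMap.adjoint DB ξ) (ν - ξ) ≤
      C * s + C * (s / c) := by
    have h3 := neg_le_of_abs_le (abs_real_inner_le_norm
      (τ + β + ContinuousLinearMap.adjoint DB ξ) (ν - ξ))
    have h4 : ‖τ + β + ContinuousLinearMap.adjoint DB ξ‖ * ‖ν - ξ‖ ≤ C * (δ * ‖ν - ξ‖) := by
      rw [← mul_assoc]; gcongr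
    have h5 : δ * ‖ν - ξ‖ ≤ s + s / c := by
      nlinarith only [sq_nonneg (δ - ‖ν - ξ‖), hδs, hνξ2, hs0, div_nonneg hs0 hc.le]
    have h6 : C * (δ * ‖ν - ξ‖) ≤ C * (s + s / c) := by gcongr
    linarith
  have h3 : -inner ℝ ξ (τ + β) ≤ C * (s / c) := by
    have h4 : C * δ ^ 2 ≤ C * (s / c) := by gcongr
    linarith [neg_le_of_abs_le htl]
  have h4 : b' * s ≤ |N| * s := by
    gcongr; exact (le_abs_self b').trans (hb'.trans (le_abs_self N))
  have hexp : inner ℝ (τ - (DB ξ + f • B - β - b' • ξ) + W • B) ν =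
      inner ℝ (τ + β) ν - inner ℝ ν (DB ξ) - f * (b + r) + b' * (1 - s) + W * (b + r) := by
    simp only [inner_add_left, inner_sub_left, real_inner_smul_left, hBν,
      real_inner_comm ν (DB ξ), real_inner_comm ν ξ]
    have : inner ℝ ν ξ = 1 - s := by linarith
    rw [this]; ring
  rw [hexp]
  have hf : f = e - b := by rw [he]; ring
  rw [hf]
  have q1 : (V + b) * e ≤ 1 / 4 * (V + b) ^ 2 + e ^ 2 := by
    nlinarith only [sq_nonneg (1 / 2 * (V + b) - e)]
  have q2 : -(W * (V + b)) ≤ 1 / 4 * (V + b) ^ 2 + W ^ 2 := by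
    nlinarith only [sq_nonneg (1 / 2 * (V + b) + W)]
  have q3 : e * r ≤ 1 / 2 * e ^ 2 + 1 / 2 * r ^ 2 := by nlinarith only [sq_nonneg (e - r)]
  have q4 : -(W * r) ≤ 1 / 2 * W ^ 2 + 1 / 2 * r ^ 2 := by nlinarith only [sq_nonneg (W + r)]
  have hsc : C ^ 2 * (s / c) = C ^ 2 / c * s := by ring
  have hsc' : C * (s / c) = C / c * s := by ring
  rw [hsc] at he2 hW2
  rw [hsc'] at h2 h3
  have hfin : -(inner ℝ (τ + β) ν - inner ℝ ν (DB ξ) - (e - b) * (b + r) + b' * (1 - s) +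
        W * (b + r)) + V * (e - b) - 1 / 2 * V ^ 2 - W * V + (inner ℝ H B - 1 / 2 * ‖H‖ ^ 2) +
        (b' - inner ℝ ν (DB ξ) - inner ℝ ξ (DB ν) + inner ℝ ξ (DB ξ)) =
      (-inner ℝ (τ + β + ContinuousLinearMap.adjoint DB ξ) (ν - ξ)) + (- inner ℝ ξ (τ + β)) +
        b' * s - 1 / 2 * (V + b) ^ 2 + (V + b) * e + e * r + (-(W * (V + b))) + (-(W * r)) +
        (-(1 / 2) * ‖H‖ ^ 2 + inner ℝ H B - 1 / 2 * b ^ 2 - b * r) := by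
    linear_combination h1
  rw [hfin]
  have hM2s : 0 ≤ M ^ 2 * s := by positivity
  have hCcs : 0 ≤ C ^ 2 / c * s := by positivity
  rw [← hb, ← hr] at hcur
  linarith

end Pointwise

/-! ### Mean normals and the algebra of the varifolds at a fixed time -/

section FixedTime

variable {d P : ℕ}

lemma mass_eq_map (m : Varifold d) :
    mass m = (m : Measure (Space d × Sph d)).map Prod.fst := rfl

instance (m : Varifold d) : IsFiniteMeasure (mass m) := by
  unfold mass; infer_instance

lemma measurable_toAmbient :
    Measurable fun z : Space d × Sph d => (z.1, (z.2 : Space d)) := by fun_prop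

lemma ambient_fst (m : Varifold d) : (ambient m).fst = mass m := by
  rw [ambient, Measure.fst, Measure.map_map measurable_fst measurable_toAmbient]
  rfl

lemma ae_of_ae_mass {m : Varifold d} {p : Space d → Prop} (h : ∀ᵐ x ∂(mass m), p x) :
    ∀ᵐ z ∂(m : Measure (Space d × Sph d)), p z.1 :=
  ae_of_ae_map measurable_fst.aemeasurable h

lemma integral_mass {m : Varifold d} {Y : Type*} [NormedAddCommGroup Y] [NormedSpace ℝ Y]
    {h : Space d → Y} (hh : StronglyMeasurable h) :
    ∫ x, h x ∂(mass m) = ∫ z, h z.1 ∂(m : Measure (Space d × Sph d)) := by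
  rw [mass_eq_map, integral_map measurable_fst.aemeasurable hh.aestronglyMeasurable]

lemma ae_ambient_norm (m : Varifold d) : ∀ᵐ y ∂(ambient m), ‖y.2‖ = 1 := by
  rw [ambient, ae_map_iff measurable_toAmbient.aemeasurable
    (measurableSet_eq_fun (by fun_prop) measurable_const)]
  exact Eventually.of_forall fun z => norm_sph z.2

lemma ae_condKernel_norm (m : Varifold d) :
    ∀ᵐ x ∂(mass m), ∀ᵐ p ∂((ambient m).condKernel x), ‖p‖ = 1 := by
  have h := ae_ambient_norm m
  rw [← (ambient m).disintegrate (ambient m).condKernel] at h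
  have h2 := Measure.ae_ae_of_ae_compProd h
  rwa [ambient_fst] at h2

lemma norm_meanNormal_le (m : Varifold d) : ∀ᵐ x ∂(mass m), ‖meanNormal m x‖ ≤ 1 := by
  filter_upwards [ae_condKernel_norm m] with x hx
  have := norm_integral_le_of_norm_le_const (μ := (ambient m).condKernel x)
    (f := fun p : Space d => p) (C := 1) (hx.mono fun p hp => hp.le)
  rw [meanNormal]
  simpa using this

lemma stronglyMeasurable_meanNormal (m : Varifold d) : StronglyMeasurable (meanNormal m) := by
  unfold meanNormal
  exact (stronglyMeasurable_id.comp_measurable measurable_snd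
    : StronglyMeasurable fun y : Space d × Space d => y.2).integral_kernel_prod_right'

/-- Averaging over the normal variable: expressions linear in the normal only see its mean. -/
lemma integral_inner_meanNormal (m : Varifold d) {u : Space d → Space d} (hu : Continuous u)
    {C : ℝ} (hC : ∀ x, ‖u x‖ ≤ C) :
    ∫ z, inner ℝ (u z.1) (z.2 : Space d) ∂(m : Measure (Space d × Sph d)) =
      ∫ z, inner ℝ (u z.1) (meanNormal m z.1) ∂(m : Measure (Space d × Sph d)) := by
  have hc : Continuous fun y : Space d × Space d => inner ℝ (u y.1) y.2 := by fun_prop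
  have h1 : ∫ z, inner ℝ (u z.1) (z.2 : Space d) ∂(m : Measure (Space d × Sph d)) =
      ∫ y, inner ℝ (u y.1) y.2 ∂(ambient m) := by
    rw [ambient, integral_map measurable_toAmbient.aemeasurable hc.aestronglyMeasurable]
  have hi : Integrable (fun y : Space d × Space d => inner ℝ (u y.1) y.2) (ambient m) := by
    refine Integrable.mono' (integrable_const C) hc.aestronglyMeasurable ?_
    filter_upwards [ae_ambient_norm m] with y hy
    have := abs_real_inner_le_norm (u y.1) y.2
    rw [hy, mul_one] at this
    exact this.trans (hC _)
  rw [h1, ← Measure.integral_condKernel hi, ambient_fst,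
    ← integral_mass (m := m) (h := fun x => inner ℝ (u x) (meanNormal m x))
      (hu.stronglyMeasurable.inner (stronglyMeasurable_meanNormal m))]
  refine integral_congr_ae ?_
  filter_upwards [ae_condKernel_norm m] with x hx
  have hp : Integrable (fun p : Space d => p) ((ambient m).condKernel x) :=
    Integrable.mono' (integrable_const 1) aestronglyMeasurable_id (hx.mono fun p hp => hp.le)
  rw [meanNormal, ← integral_inner hp]

lemma integrable_inner_varifold (m : Varifold d) {u : Space d → Space d} (hu : Continuous u)
    {C : ℝ} (hC : ∀ x, ‖u x‖ ≤ C) :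
    Integrable (fun z : Space d × Sph d => inner ℝ (u z.1) (z.2 : Space d))
      (m : Measure (Space d × Sph d)) :=
  Integrable.mono' (integrable_const C) (Continuous.aestronglyMeasurable (by fun_prop))
    (Eventually.of_forall fun z => (abs_inner_sph_le _ _).trans (hC _))

/-- Opposite mean normals change the sign of the flux of a field. -/
lemma integral_inner_swap {m m' : Varifold d} (hm : mass m = mass m')
    (hn : ∀ᵐ x ∂(mass m), meanNormal m x = -meanNormal m' x)
    {u : Space d → Space d} (hu : Continuous u) {C : ℝ} (hC : ∀ x, ‖u x‖ ≤ C) :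
    ∫ z, inner ℝ (u z.1) (z.2 : Space d) ∂(m : Measure (Space d × Sph d)) =
      -∫ z, inner ℝ (u z.1) (z.2 : Space d) ∂(m' : Measure (Space d × Sph d)) := by
  rw [integral_inner_meanNormal m hu hC, integral_inner_meanNormal m' hu hC,
    ← integral_mass (m := m) (h := fun x => inner ℝ (u x) (meanNormal m x))
      (hu.stronglyMeasurable.inner (stronglyMeasurable_meanNormal m)),
    ← integral_mass (m := m') (h := fun x => inner ℝ (u x) (meanNormal m' x))
      (hu.stronglyMeasurable.inner (stronglyMeasurable_meanNormal m')), ← hm, ← integral_neg]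
  refine integral_congr_ae ?_
  filter_upwards [hn] with x hx
  rw [hx, inner_neg_right]

lemma integral_inner_eq_zero {m : Varifold d} (hn : ∀ᵐ x ∂(mass m), meanNormal m x = 0)
    {u : Space d → Space d} (hu : Continuous u) {C : ℝ} (hC : ∀ x, ‖u x‖ ≤ C) :
    ∫ z, inner ℝ (u z.1) (z.2 : Space d) ∂(m : Measure (Space d × Sph d)) = 0 := by
  rw [integral_inner_meanNormal m hu hC]
  refine integral_eq_zero_of_ae ?_
  filter_upwards [ae_of_ae_mass hn] with z hz
  simp [hz]

lemma integral_fst_congr {m m' : Varifold d} (hm : mass m = mass m') {h : Space d → ℝ}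
    (hh : Measurable h) :
    ∫ z, h z.1 ∂(m : Measure (Space d × Sph d)) = ∫ z, h z.1 ∂(m' : Measure (Space d × Sph d)) := by
  rw [← integral_mass hh.stronglyMeasurable, ← integral_mass hh.stronglyMeasurable, hm]

/-! #### Decomposition of the grain and network varifolds -/

lemma coe_grain (m : Fin P → Fin P → Varifold d) (i : Fin P) :
    (grain m i : Measure (Space d × Sph d)) =
      (2 : ℝ≥0) • (m i i : Measure (Space d × Sph d)) +
        ∑ j ∈ Finset.univ.erase i, (m j i : Measure (Space d × Sph d)) := by
  simp [grain]

lemma coe_network (m : Fin P → Fin P → Varifold d) :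
    (network m : Measure (Space d × Sph d)) =
      (2⁻¹ : ℝ≥0) • ∑ i, (grain m i : Measure (Space d × Sph d)) := by
  simp [network]

lemma diag_le_grain (m : Fin P → Fin P → Varifold d) (i : Fin P) :
    (m i i : Measure (Space d × Sph d)) ≤ grain m i := by
  rw [coe_grain]
  intro s
  simp only [Measure.add_apply, Measure.smul_apply]
  refine le_trans ?_ le_self_add
  have : (2 : ℝ≥0) • (m i i : Measure (Space d × Sph d)) s =
    2 * (m i i : Measure (Space d × Sph d)) s := by
    simp [ENNReal.smul_def]
  rw [this, two_mul]
  exact le_self_add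

lemma le_grain (m : Fin P → Fin P → Varifold d) {i j : Fin P} (hij : i ≠ j) :
    (m j i : Measure (Space d × Sph d)) ≤ grain m i := by
  rw [coe_grain, ← Finset.add_sum_erase _ _ (Finset.mem_erase.2 ⟨hij.symm, Finset.mem_univ j⟩)]
  refine le_trans ?_ (Measure.le_add_left le_rfl)
  exact Measure.le_add_right le_rfl

lemma integral_grain (m : Fin P → Fin P → Varifold d) (i : Fin P) {h : Space d × Sph d → ℝ}
    (hh : Integrable h (grain m i : Measure (Space d × Sph d))) :
    ∫ z, h z ∂(grain m i : Measure (Space d × Sph d)) =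
      2 * ∫ z, h z ∂(m i i : Measure (Space d × Sph d)) +
        ∑ j ∈ Finset.univ.erase i, ∫ z, h z ∂(m j i : Measure (Space d × Sph d)) := by
  have h1 : Integrable h (m i i : Measure (Space d × Sph d)) := hh.mono_measure (diag_le_grain m i)
  have h2 : ∀ j ∈ Finset.univ.erase i, Integrable h (m j i : Measure (Space d × Sph d)) :=
    fun j hj => hh.mono_measure (le_grain m (Finset.ne_of_mem_erase hj).symm)
  rw [coe_grain, integral_add_measure (h1.smul_measure_nnreal)
    (integrable_finsetSum_measure.2 h2), integral_smul_nnreal_measure,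
    integral_finsetSum_measure h2]
  rfl

lemma sum_erase_comm (f : Fin P → Fin P → ℝ) :
    ∑ i, ∑ j ∈ Finset.univ.erase i, f i j = ∑ i, ∑ j ∈ Finset.univ.erase i, f j i := by
  have h : ∀ g : Fin P → Fin P → ℝ, ∑ i, ∑ j ∈ Finset.univ.erase i, g i j =
      ∑ i, ∑ j, if i = j then 0 else g i j := fun g => by
    refine Finset.sum_congr rfl fun i _ => ?_
    rw [← Finset.add_sum_erase Finset.univ _ (Finset.mem_univ i)]
    simp only [if_true, zero_add]
    exact Finset.sum_congr rfl fun j hj => by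
      rw [if_neg (Finset.ne_of_mem_erase hj).symm]
  rw [h, h, Finset.sum_comm]
  refine Finset.sum_congr rfl fun i _ => Finset.sum_congr rfl fun j _ => ?_
  by_cases hij : i = j
  · simp [hij]
  · simp [hij, Ne.symm hij]

lemma integrable_network_iff (m : Fin P → Fin P → Varifold d) {h : Space d × Sph d → ℝ} :
    Integrable h (network m : Measure (Space d × Sph d)) ↔
      ∀ i, Integrable h (grain m i : Measure (Space d × Sph d)) := by
  rw [coe_network]
  constructor
  · intro hh i
    have h2 := hh.smul_measure_nnreal (c := 2)
    rw [smul_smul] at h2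
    have : (2 : ℝ≥0) * 2⁻¹ = 1 := by norm_num
    rw [this, one_smul] at h2
    exact (integrable_finsetSum_measure.1 h2) i (Finset.mem_univ i)
  · intro hh
    exact (integrable_finsetSum_measure.2 fun i _ => hh i).smul_measure_nnreal

lemma integral_network (m : Fin P → Fin P → Varifold d) {h : Space d × Sph d → ℝ}
    (hh : Integrable h (network m : Measure (Space d × Sph d))) :
    ∫ z, h z ∂(network m : Measure (Space d × Sph d)) =
      ∑ i, ∫ z, h z ∂(m i i : Measure (Space d × Sph d)) +
        1 / 2 * ∑ i, ∑ j ∈ Finset.univ.erase i,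
          ∫ z, h z ∂(m i j : Measure (Space d × Sph d)) := by
  have hg := (integrable_network_iff m).1 hh
  rw [coe_network, integral_smul_nnreal_measure, integral_finsetSum_measure fun i _ => hg i]
  simp only [integral_grain m _ (hg _), Finset.sum_add_distrib, ← Finset.mul_sum]
  rw [sum_erase_comm fun i j => ∫ z, h z ∂(m i j : Measure (Space d × Sph d))]
  simp only [NNReal.smul_def, NNReal.coe_inv, NNReal.coe_ofNat, smul_eq_mul]
  ring

/-- The relative entropy as a sum of nonnegative contributions: the mass of the interfaces within a
phase, and the tilt excess of the interfaces between different phases. -/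
noncomputable def tiltExcess (m : Fin P → Fin P → Varifold d) (ξ : Fin P → Space d → Space d) : ℝ :=
  ∑ i, (m i i : Measure (Space d × Sph d)).real univ + 1 / 2 * ∑ i, ∑ j ∈ Finset.univ.erase i,
    ∫ z, (1 - inner ℝ (z.2 : Space d) (ξ i z.1 - ξ j z.1)) ∂(m i j : Measure (Space d × Sph d))

lemma relEntropy_eq_tiltExcess (m : Fin P → Fin P → Varifold d)
    {ξ : ℝ → Fin P → Space d → Space d} {t : ℝ} (hξ : ∀ i, Continuous (ξ t i)) {M : ℝ}
    (hM : ∀ i x, ‖ξ t i x‖ ≤ M) : relEntropy m ξ t = tiltExcess m (ξ t) := by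
  have h1 : (mass (network m)).real univ =
      ∫ _z, (1 : ℝ) ∂(network m : Measure (Space d × Sph d)) := by
    rw [mass_eq_map, map_measureReal_apply measurable_fst MeasurableSet.univ]
    simp
  have hi : ∀ i j, Integrable (fun z : Space d × Sph d =>
      inner ℝ (z.2 : Space d) (ξ t i z.1 - ξ t j z.1)) (m i j : Measure (Space d × Sph d)) :=
    fun i j => by
      have := integrable_inner_varifold (m i j) (u := fun x => ξ t i x - ξ t j x)
        ((hξ i).sub (hξ j)) (C := M + M)
        fun x => (norm_sub_le _ _).trans (add_le_add (hM i x) (hM j x))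
      exact this.congr (Eventually.of_forall fun z => real_inner_comm _ _)
  rw [relEntropy, h1, integral_network m (integrable_const _), tiltExcess]
  have h2 : ∀ i j, ∫ z, (1 - inner ℝ (z.2 : Space d) (ξ t i z.1 - ξ t j z.1))
      ∂(m i j : Measure (Space d × Sph d)) = ∫ _z, (1 : ℝ) ∂(m i j : Measure (Space d × Sph d)) -
        ∫ z, inner ℝ (z.2 : Space d) (ξ t i z.1 - ξ t j z.1) ∂(m i j : Measure (Space d × Sph d)) :=
    fun i j => integral_sub (integrable_const _) (hi i j)
  simp only [h2, Finset.sum_sub_distrib, xiDiff]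
  simp
  ring

end FixedTime

/-! ### The relative entropy inequality at a fixed time -/

section Dissipation

variable {d P : ℕ}

/-- At a fixed position, the field `(ξ·∇)B + (∇·ξ)B - (B·∇)ξ - (∇·B)ξ`. -/
noncomputable def wedgeAt (ξ B : Space d) (Dξ DB : Space d →L[ℝ] Space d) : Space d :=
  DB ξ + traceL Dξ • B - Dξ B - traceL DB • ξ

lemma traceL_sub (L L' : Space d →L[ℝ] Space d) : traceL (L - L') = traceL L - traceL L' := by
  simp [traceL]

@[fun_prop]
lemma continuous_traceL : Continuous (traceL : (Space d →L[ℝ] Space d) → ℝ) := by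
  unfold traceL
  fun_prop

lemma wedgeAt_sub (ξ ξ' B : Space d) (Dξ Dξ' DB : Space d →L[ℝ] Space d) :
    wedgeAt ξ B Dξ DB - wedgeAt ξ' B Dξ' DB = wedgeAt (ξ - ξ') B (Dξ - Dξ') DB := by
  simp only [wedgeAt, traceL_sub, map_sub, sub_smul, smul_sub, _root_.sub_apply]
  abel

lemma norm_wedgeAt_le {ξ B : Space d} {Dξ DB : Space d →L[ℝ] Space d} {M : ℝ}
    (h1 : ‖ξ‖ ≤ M) (h2 : ‖B‖ ≤ M) (h3 : ‖Dξ‖ ≤ M) (h4 : ‖DB‖ ≤ M) :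
    ‖wedgeAt ξ B Dξ DB‖ ≤ (2 + 2 * d) * M ^ 2 := by
  have hM : 0 ≤ M := (norm_nonneg _).trans h1
  have e1 : ‖DB ξ‖ ≤ M * M := (DB.le_opNorm _).trans (by gcongr)
  have e2 : ‖traceL Dξ • B‖ ≤ d * M * M := by
    rw [norm_smul]
    refine mul_le_mul ?_ h2 (norm_nonneg _) (by positivity)
    exact (abs_traceL_le _).trans (by gcongr)
  have e3 : ‖Dξ B‖ ≤ M * M := (Dξ.le_opNorm _).trans (by gcongr)
  have e4 : ‖traceL DB • ξ‖ ≤ d * M * M := by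
    rw [norm_smul]
    refine mul_le_mul ?_ h1 (norm_nonneg _) (by positivity)
    exact (abs_traceL_le _).trans (by gcongr)
  calc _ ≤ M * M + d * M * M + M * M + d * M * M := (norm_sub_le _ _).trans
        (add_le_add ((norm_sub_le _ _).trans (add_le_add ((norm_add_le _ _).trans
          (add_le_add e1 e2)) e3)) e4)
    _ = _ := by ring

/-- The fields of a calibration at a fixed time, with `τ i = ∂_t ξ_i` and `δ i j` the truncated
distance to the interface between the phases `i` and `j`. -/
structure CalibratedAt (c C M : ℝ) (ξ τ : Fin P → Space d → Space d)
    (Dξ : Fin P → Space d → Space d →L[ℝ] Space d) (B : Space d → Space d)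
    (DB : Space d → Space d →L[ℝ] Space d) (δ : Fin P → Fin P → Space d → ℝ) : Prop where
  xi_cont : ∀ i, Continuous (ξ i)
  tau_cont : ∀ i, Continuous (τ i)
  Dxi_cont : ∀ i, Continuous (Dξ i)
  B_cont : Continuous B
  DB_cont : Continuous DB
  xi_le : ∀ i x, ‖ξ i x‖ ≤ M
  tau_le : ∀ i x, ‖τ i x‖ ≤ M
  Dxi_le : ∀ i x, ‖Dξ i x‖ ≤ M
  B_le : ∀ x, ‖B x‖ ≤ M
  DB_le : ∀ x, ‖DB x‖ ≤ M
  dist_nonneg : ∀ i j x, 0 ≤ δ i j x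
  length : ∀ i j, i ≠ j → ∀ x, c * δ i j x ^ 2 ≤ 1 - ‖ξ i x - ξ j x‖
  curvature : ∀ i j, i ≠ j → ∀ x,
    |inner ℝ (B x) (ξ i x - ξ j x) + traceL (Dξ i x - Dξ j x)| ≤ C * δ i j x
  transport : ∀ i j, i ≠ j → ∀ x, ‖(τ i x - τ j x) + (Dξ i x - Dξ j x) (B x) +
    ContinuousLinearMap.adjoint (DB x) (ξ i x - ξ j x)‖ ≤ C * δ i j x
  transport_length : ∀ i j, i ≠ j → ∀ x,
    |inner ℝ (ξ i x - ξ j x) ((τ i x - τ j x) + (Dξ i x - Dξ j x) (B x))| ≤ C * δ i j x ^ 2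

/-- The normal speeds and the mean curvature vector of a De Giorgi solution at a fixed time. -/
structure KinematicsAt (m : Fin P → Fin P → Varifold d) (V : Fin P → Space d → ℝ)
    (H : Space d → Space d) : Prop where
  V_meas : ∀ i, Measurable (V i)
  H_meas : Measurable H
  V_int : ∀ i, Integrable (fun z => V i z.1 ^ 2) (grain m i : Measure (Space d × Sph d))
  H_int : Integrable (fun z => ‖H z.1‖ ^ 2) (network m : Measure (Space d × Sph d))
  V_antisymm : ∀ i j, i ≠ j → ∀ᵐ x ∂(mass (m i j)), V i x = -V j x
  H_dir : ∀ i j, i ≠ j → ∀ᵐ x ∂(mass (m i j)), ‖meanNormal (m i j) x‖ ^ 2 • H x =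
    inner ℝ (H x) (meanNormal (m i j) x) • meanNormal (m i j) x

/-- The quadratic term `p · DB p` can be linearized at `ξ` at the price of the tilt excess; what remains
is affine in `p` and only sees the mean normal. -/
lemma quadratic_tilt_le {p ξ : Space d} {DB : Space d →L[ℝ] Space d} {M : ℝ} (hp : ‖p‖ = 1)
    (hξ : ‖ξ‖ ≤ 1) (hDB : ‖DB‖ ≤ M) :
    -inner ℝ p (DB p) ≤ -inner ℝ p (DB ξ) - inner ℝ ξ (DB p) + inner ℝ ξ (DB ξ) +
      2 * M * (1 - inner ℝ p ξ) := by
  have hM : 0 ≤ M := (norm_nonneg _).trans hDB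
  have h1 : -inner ℝ (p - ξ) (DB (p - ξ)) ≤ M * ‖p - ξ‖ ^ 2 := by
    have := neg_le_of_abs_le (abs_real_inner_le_norm (p - ξ) (DB (p - ξ)))
    have h2 : ‖DB (p - ξ)‖ ≤ M * ‖p - ξ‖ := (DB.le_opNorm _).trans (by gcongr)
    nlinarith [norm_nonneg (p - ξ)]
  have h2 : ‖p - ξ‖ ^ 2 ≤ 2 * (1 - inner ℝ p ξ) := by
    rw [norm_sub_sq_real, hp]
    nlinarith [norm_nonneg ξ]
  have h3 : M * ‖p - ξ‖ ^ 2 ≤ M * (2 * (1 - inner ℝ p ξ)) := by gcongr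
  simp only [map_sub, inner_sub_left, inner_sub_right] at h1
  linarith

lemma integrable_of_sq {Z : Type*} [MeasurableSpace Z] {γ : Measure Z} [IsFiniteMeasure γ]
    {f : Z → ℝ} (hf : AEStronglyMeasurable f γ) (h : Integrable (fun z => f z ^ 2) γ) :
    Integrable f γ := by
  refine Integrable.mono' ((integrable_const 1).add h) hf (Eventually.of_forall fun z => ?_)
  simp only [Pi.add_apply, Real.norm_eq_abs]
  nlinarith [sq_nonneg (|f z| - 1), sq_abs (f z)]

/-- The integrated dissipation estimate on a single interface. -/
lemma exists_pair_bound {c C M : ℝ} (hc : 0 < c) (hC : 0 ≤ C) (hM : 0 ≤ M) :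
    ∃ K : ℝ, 0 ≤ K ∧ ∀ (m : Varifold d) (V f W δ : Space d → ℝ) (H ξ τ β B : Space d → Space d)
      (DB : Space d → Space d →L[ℝ] Space d), Measurable V → Measurable H → Continuous f →
      Continuous W → Continuous ξ → Continuous τ → Continuous β → Continuous B → Continuous DB →
      Integrable (fun z => V z.1 ^ 2) (m : Measure (Space d × Sph d)) →
      Integrable (fun z => ‖H z.1‖ ^ 2) (m : Measure (Space d × Sph d)) →
      (∃ M', ∀ x, ‖τ x‖ ≤ M' ∧ ‖β x‖ ≤ M' ∧ |f x| ≤ M' ∧ |W x| ≤ M') →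
      (∀ x, ‖B x‖ ≤ M) → (∀ x, ‖DB x‖ ≤ M) → (∀ x, 0 ≤ δ x) →
      (∀ x, c * δ x ^ 2 ≤ 1 - ‖ξ x‖) → (∀ x, |inner ℝ (B x) (ξ x) + f x| ≤ C * δ x) →
      (∀ x, ‖τ x + β x + ContinuousLinearMap.adjoint (DB x) (ξ x)‖ ≤ C * δ x) →
      (∀ x, |inner ℝ (ξ x) (τ x + β x)| ≤ C * δ x ^ 2) → (∀ x, |W x| ≤ C * δ x) →
      (∀ᵐ x ∂(mass m), ‖meanNormal m x‖ ^ 2 • H x =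
        inner ℝ (H x) (meanNormal m x) • meanNormal m x) →
      ∫ z, (-(inner ℝ (τ z.1 - (DB z.1 (ξ z.1) + f z.1 • B z.1 - β z.1 -
          traceL (DB z.1) • ξ z.1) + W z.1 • B z.1) (z.2 : Space d)) + V z.1 * f z.1 -
          1 / 2 * V z.1 ^ 2 - W z.1 * V z.1 + (inner ℝ (H z.1) (B z.1) - 1 / 2 * ‖H z.1‖ ^ 2 +
          (traceL (DB z.1) - inner ℝ (z.2 : Space d) (DB z.1 (z.2 : Space d)))))
          ∂(m : Measure (Space d × Sph d)) ≤
        K * ∫ z, (1 - inner ℝ (z.2 : Space d) (ξ z.1)) ∂(m : Measure (Space d × Sph d)) := by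
  obtain ⟨K, hK0, hK⟩ := exists_pointwise_bound (X := Space d) (M := M) hc hC (d * M)
  refine ⟨K + 2 * M, by positivity, ?_⟩
  intro m V f W δ H ξ τ β B DB hVm hHm hfc hWc hξc hτc hβc hBc hDBc hVi hHi hbd hB hDB hδ hlen
    hcurv htr htl hW hH
  obtain ⟨M', hM'⟩ := hbd
  set γ := (m : Measure (Space d × Sph d)) with hγ
  have hξ1 : ∀ x, ‖ξ x‖ ≤ 1 := fun x => by
    have := hlen x
    have h2 : 0 ≤ c * δ x ^ 2 := by positivity
    linarith
  have htrc : Continuous fun x => traceL (DB x) := continuous_traceL.comp hDBc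
  set U : Space d → Space d := fun x => τ x - (DB x (ξ x) + f x • B x - β x -
    traceL (DB x) • ξ x) + W x • B x with hU
  have hUc : Continuous U := by fun_prop
  have hadj : Continuous fun x => ContinuousLinearMap.adjoint (DB x) (ξ x) :=
    ((ContinuousLinearMap.adjoint (𝕜 := ℝ) (E := Space d) (F := Space d)).continuous.comp
      hDBc).clm_apply hξc
  -- the linear part `Y · p + S` of the integrand after replacing the quadratic term
  set Y : Space d → Space d := fun x => -U x - DB x (ξ x) -
    ContinuousLinearMap.adjoint (DB x) (ξ x) - (2 * M) • ξ x with hY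
  have hYc : Continuous Y := by fun_prop
  set S : Space d → ℝ := fun x => V x * f x - 1 / 2 * V x ^ 2 - W x * V x +
    (inner ℝ (H x) (B x) - 1 / 2 * ‖H x‖ ^ 2) + (traceL (DB x) + inner ℝ (ξ x) (DB x (ξ x))) +
      2 * M with hS
  have hDξ : ∀ x, ‖DB x (ξ x)‖ ≤ M := fun x => ((DB x).le_opNorm _).trans (by
    calc ‖DB x‖ * ‖ξ x‖ ≤ M * 1 := mul_le_mul (hDB x) (hξ1 x) (norm_nonneg _) hM
      _ = M := mul_one M)
  have htrb : ∀ x, |traceL (DB x)| ≤ d * M := fun x =>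
    (abs_traceL_le _).trans (by gcongr; exact hDB x)
  obtain ⟨CY, hCY⟩ : ∃ CY, ∀ x, ‖Y x‖ ≤ CY := by
    refine ⟨(M' + (M + M' * M + M' + d * M) + M' * M) + M + M + 2 * M, fun x => ?_⟩
    obtain ⟨b1, b2, b3, b4⟩ := hM' x
    have hM'0 : 0 ≤ M' := (norm_nonneg _).trans b1
    have e1 : ‖f x • B x‖ ≤ M' * M := by
      rw [norm_smul]; exact mul_le_mul b3 (hB x) (norm_nonneg _) hM'0
    have e2 : ‖W x • B x‖ ≤ M' * M := by
      rw [norm_smul]; exact mul_le_mul b4 (hB x) (norm_nonneg _) hM'0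
    have e3 : ‖traceL (DB x) • ξ x‖ ≤ d * M := by
      rw [norm_smul]
      calc _ ≤ (d * M) * 1 := mul_le_mul (htrb x) (hξ1 x) (norm_nonneg _) (by positivity)
        _ = _ := mul_one _
    have e4 : ‖ContinuousLinearMap.adjoint (DB x) (ξ x)‖ ≤ M := by
      refine ((ContinuousLinearMap.adjoint (DB x)).le_opNorm _).trans ?_
      rw [LinearIsometryEquiv.norm_map]
      calc ‖DB x‖ * ‖ξ x‖ ≤ M * 1 := mul_le_mul (hDB x) (hξ1 x) (norm_nonneg _) hM
        _ = M := mul_one M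
    have e5 : ‖(2 * M) • ξ x‖ ≤ 2 * M := by
      rw [norm_smul, Real.norm_of_nonneg (by positivity)]
      nlinarith [hξ1 x]
    have e6 : ‖U x‖ ≤ M' + (M + M' * M + M' + d * M) + M' * M :=
      (norm_add_le _ _).trans (add_le_add ((norm_sub_le _ _).trans (add_le_add b1
        ((norm_sub_le _ _).trans (add_le_add ((norm_sub_le _ _).trans (add_le_add
          ((norm_add_le _ _).trans (add_le_add (hDξ x) e1)) b2)) e3)))) e2)
    refine (norm_sub_le _ _).trans (add_le_add ((norm_sub_le _ _).trans (add_le_add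
      ((norm_sub_le _ _).trans (add_le_add ?_ (hDξ x))) e4)) e5)
    rwa [norm_neg]
  have hVz : Measurable fun z : Space d × Sph d => V z.1 := hVm.comp measurable_fst
  have hHz : Measurable fun z : Space d × Sph d => H z.1 := hHm.comp measurable_fst
  have iV : Integrable (fun z : Space d × Sph d => V z.1) γ :=
    integrable_of_sq hVz.aestronglyMeasurable hVi
  have iH : Integrable (fun z : Space d × Sph d => H z.1) γ := by
    rw [← integrable_norm_iff hHz.aestronglyMeasurable]
    exact integrable_of_sq hHz.norm.aestronglyMeasurable hHi
  have iVf : ∀ {g : Space d → ℝ}, Continuous g → (∀ x, |g x| ≤ M') →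
      Integrable (fun z : Space d × Sph d => V z.1 * g z.1) γ := fun {g} hg hgM =>
    iV.mul_bdd (c := M') (Continuous.aestronglyMeasurable (by fun_prop))
      (Eventually.of_forall fun z => hgM _)
  have iHB : Integrable (fun z : Space d × Sph d => inner ℝ (H z.1) (B z.1)) γ := by
    refine Integrable.mono' (iH.norm.mul_const M)
      (hHz.aestronglyMeasurable.inner (Continuous.aestronglyMeasurable (by fun_prop)))
      (Eventually.of_forall fun z => (abs_real_inner_le_norm _ _).trans ?_)
    gcongr; exact hB _
  have iS : Integrable (fun z : Space d × Sph d => S z.1) γ := by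
    have i1 := iVf hfc fun x => (hM' x).2.2.1
    have i2 := iVf hWc fun x => (hM' x).2.2.2
    have i3 : Integrable (fun z : Space d × Sph d =>
        traceL (DB z.1) + inner ℝ (ξ z.1) (DB z.1 (ξ z.1))) γ := by
      refine Integrable.mono' (integrable_const (d * M + M))
        (Continuous.aestronglyMeasurable (by fun_prop)) (Eventually.of_forall fun z => ?_)
      refine (norm_add_le _ _).trans (add_le_add (htrb _) ?_)
      refine (abs_real_inner_le_norm _ _).trans ?_
      calc _ ≤ 1 * M := mul_le_mul (hξ1 _) (hDξ _) (norm_nonneg _) zero_le_one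
        _ = M := one_mul M
    have i4 := (((i1.sub (hVi.const_mul (1 / 2))).sub i2).add
      (iHB.sub (hHi.const_mul (1 / 2)))).add (i3.add (integrable_const (2 * M)))
    refine i4.congr (Eventually.of_forall fun z => ?_)
    simp only [hS, Pi.add_apply, Pi.sub_apply]
    ring
  have iYp := integrable_inner_varifold m hYc hCY
  have hν1 := ae_of_ae_mass (norm_meanNormal_le m)
  have hνm : StronglyMeasurable fun z : Space d × Sph d => meanNormal m z.1 :=
    (stronglyMeasurable_meanNormal m).comp_measurable measurable_fst
  have hYz : Continuous fun z : Space d × Sph d => Y z.1 := by fun_prop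
  have iYν : Integrable (fun z : Space d × Sph d => inner ℝ (Y z.1) (meanNormal m z.1)) γ := by
    refine Integrable.mono' (integrable_const CY)
      (hYz.aestronglyMeasurable.inner hνm.aestronglyMeasurable) ?_
    filter_upwards [hν1] with z hz
    refine (abs_real_inner_le_norm _ _).trans ?_
    have := hCY z.1
    nlinarith [norm_nonneg (Y z.1), norm_nonneg (meanNormal m z.1)]
  have iξp : Integrable (fun z : Space d × Sph d => inner ℝ (ξ z.1) (z.2 : Space d)) γ :=
    integrable_inner_varifold m hξc hξ1
  have iξν : Integrable (fun z : Space d × Sph d => inner ℝ (ξ z.1) (meanNormal m z.1)) γ := by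
    have hξz : Continuous fun z : Space d × Sph d => ξ z.1 := by fun_prop
    refine Integrable.mono' (integrable_const 1)
      (hξz.aestronglyMeasurable.inner hνm.aestronglyMeasurable) ?_
    filter_upwards [hν1] with z hz
    refine (abs_real_inner_le_norm _ _).trans ?_
    have := hξ1 z.1
    nlinarith [norm_nonneg (ξ z.1), norm_nonneg (meanNormal m z.1)]
  have hadj_inner : ∀ x (q : Space d), inner ℝ (ContinuousLinearMap.adjoint (DB x) (ξ x)) q =
      inner ℝ (ξ x) (DB x q) := fun x q => ContinuousLinearMap.adjoint_inner_left _ _ _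
  -- the quadratic term is replaced by its linearization at `ξ`
  have step1 : ∫ z, (-(inner ℝ (U z.1) (z.2 : Space d)) + V z.1 * f z.1 -
          1 / 2 * V z.1 ^ 2 - W z.1 * V z.1 + (inner ℝ (H z.1) (B z.1) - 1 / 2 * ‖H z.1‖ ^ 2 +
          (traceL (DB z.1) - inner ℝ (z.2 : Space d) (DB z.1 (z.2 : Space d))))) ∂γ ≤
      ∫ z, (inner ℝ (Y z.1) (z.2 : Space d) + S z.1) ∂γ := by
    refine integral_mono_ae ?_ (iYp.add iS) (Eventually.of_forall fun z => ?_)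
    · have i1 := iVf hfc fun x => (hM' x).2.2.1
      have i2 := iVf hWc fun x => (hM' x).2.2.2
      have i5 : Integrable (fun z : Space d × Sph d => -(inner ℝ (U z.1) (z.2 : Space d)) +
          (traceL (DB z.1) - inner ℝ (z.2 : Space d) (DB z.1 (z.2 : Space d)))) γ := by
        have hUb : ∀ x, ‖U x‖ ≤ CY + M + M + 2 * M := fun x => by
          have : U x = -(Y x) - DB x (ξ x) - ContinuousLinearMap.adjoint (DB x) (ξ x) -
              (2 * M) • ξ x := by simp only [hY]; abel
          rw [this]
          have e4 : ‖ContinuousLinearMap.adjoint (DB x) (ξ x)‖ ≤ M := by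
            refine ((ContinuousLinearMap.adjoint (DB x)).le_opNorm _).trans ?_
            rw [LinearIsometryEquiv.norm_map]
            calc ‖DB x‖ * ‖ξ x‖ ≤ M * 1 := mul_le_mul (hDB x) (hξ1 x) (norm_nonneg _) hM
              _ = M := mul_one M
          have e5 : ‖(2 * M) • ξ x‖ ≤ 2 * M := by
            rw [norm_smul, Real.norm_of_nonneg (by positivity)]
            nlinarith [hξ1 x]
          refine (norm_sub_le _ _).trans (add_le_add ((norm_sub_le _ _).trans (add_le_add
            ((norm_sub_le _ _).trans (add_le_add ?_ (hDξ x))) e4)) e5)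
          rw [norm_neg]; exact hCY x
        refine Integrable.mono' (integrable_const ((CY + M + M + 2 * M) + (d * M + M)))
          (Continuous.aestronglyMeasurable (by fun_prop)) (Eventually.of_forall fun z => ?_)
        refine (norm_add_le _ _).trans (add_le_add ?_ ((norm_sub_le _ _).trans
          (add_le_add (htrb _) ?_)))
        · rw [norm_neg]; exact (abs_inner_sph_le _ _).trans (hUb _)
        · refine (abs_real_inner_le_norm _ _).trans ?_
          have h1 := (DB z.1).le_opNorm (z.2 : Space d)
          rw [norm_sph, mul_one] at h1
          rw [norm_sph, one_mul]
          exact h1.trans (hDB _)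
      have i4 := ((i1.sub (hVi.const_mul (1 / 2))).sub i2).add
        ((iHB.sub (hHi.const_mul (1 / 2))).add i5)
      refine i4.congr (Eventually.of_forall fun z => ?_)
      simp only [Pi.add_apply, Pi.sub_apply]
      ring
    · have hq := quadratic_tilt_le (DB := DB z.1) (norm_sph z.2) (hξ1 z.1) (hDB z.1)
      simp only [hY, hS, inner_sub_left, inner_neg_left, hadj_inner, real_inner_smul_left,
        real_inner_comm (z.2 : Space d) (DB z.1 (ξ z.1)), real_inner_comm (z.2 : Space d) (ξ z.1)]
      linarith
  have step2 : ∫ z, (inner ℝ (Y z.1) (z.2 : Space d) + S z.1) ∂γ =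
      ∫ z, (inner ℝ (Y z.1) (meanNormal m z.1) + S z.1) ∂γ := by
    rw [integral_add iYp iS, integral_add iYν iS, hγ, integral_inner_meanNormal m hYc hCY]
  have step3 : ∫ z, (inner ℝ (Y z.1) (meanNormal m z.1) + S z.1) ∂γ ≤
      ∫ z, (K + 2 * M) * (1 - inner ℝ (ξ z.1) (meanNormal m z.1)) ∂γ := by
    refine integral_mono_ae (iYν.add iS) (((integrable_const 1).sub iξν).const_mul _) ?_
    filter_upwards [hν1, ae_of_ae_mass hH] with z hz1 hz2
    have := hK (H z.1) (B z.1) (ξ z.1) (meanNormal m z.1) (τ z.1) (β z.1) (DB z.1) (V z.1) (f z.1)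
      (traceL (DB z.1)) (δ z.1) (W z.1) hz1 (hδ _) (hlen _) (hcurv _) (htr _) (htl _) (hB _)
      (htrb _) (hW _) hz2
    simp only [hY, hS, inner_sub_left, inner_neg_left, hadj_inner, real_inner_smul_left,
      real_inner_comm (meanNormal m z.1) (DB z.1 (ξ z.1)),
      real_inner_comm (meanNormal m z.1) (ξ z.1)]
    linarith
  have step4 : ∫ z, (1 - inner ℝ (ξ z.1) (meanNormal m z.1)) ∂γ =
      ∫ z, (1 - inner ℝ (z.2 : Space d) (ξ z.1)) ∂γ := by
    rw [integral_sub (integrable_const _) iξν, hγ, ← integral_inner_meanNormal m hξc hξ1,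
      ← integral_sub (integrable_const _) iξp]
    exact integral_congr_ae (Eventually.of_forall fun z => by
      simp only [real_inner_comm (z.2 : Space d) (ξ z.1)])
  rw [integral_const_mul, step4] at step3
  exact step1.trans (step2.trans_le step3)

end Dissipation

section FixedTimeTotal

variable {d P : ℕ}

/-- The contribution of the `i`-th grain to the dissipation at a fixed time; `w` is the weight with
which the mismatch of the normal speeds is tested. -/
noncomputable def grainTerm (V w : Space d → ℝ) (ξ τ B : Space d → Space d)
    (Dξ DB : Space d → Space d →L[ℝ] Space d) (z : Space d × Sph d) : ℝ :=
  inner ℝ (τ z.1 - wedgeAt (ξ z.1) (B z.1) (Dξ z.1) (DB z.1) + w z.1 • B z.1) (z.2 : Space d) +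
    V z.1 * traceL (Dξ z.1) - 1 / 4 * V z.1 ^ 2 - w z.1 * V z.1

/-- The contribution of the whole network to the dissipation at a fixed time. -/
noncomputable def networkTerm (H B : Space d → Space d) (DB : Space d → Space d →L[ℝ] Space d)
    (z : Space d × Sph d) : ℝ :=
  inner ℝ (H z.1) (B z.1) - 1 / 2 * ‖H z.1‖ ^ 2 +
    (traceL (DB z.1) - inner ℝ (z.2 : Space d) (DB z.1 (z.2 : Space d)))

lemma integrable_fst_congr {m m' : Varifold d} (hm : mass m = mass m') {h : Space d → ℝ}
    (hh : Measurable h)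
    (hi : Integrable (fun z => h z.1) (m : Measure (Space d × Sph d))) :
    Integrable (fun z => h z.1) (m' : Measure (Space d × Sph d)) := by
  have h1 : Integrable h (mass m) := by
    rw [mass_eq_map]
    exact (integrable_map_measure hh.aestronglyMeasurable measurable_fst.aemeasurable).2 hi
  rw [hm, mass_eq_map] at h1
  exact (integrable_map_measure hh.aestronglyMeasurable measurable_fst.aemeasurable).1 h1

variable {c C M : ℝ} {ξ τ : Fin P → Space d → Space d}
  {Dξ : Fin P → Space d → Space d →L[ℝ] Space d} {B : Space d → Space d}
  {DB : Space d → Space d →L[ℝ] Space d} {δ : Fin P → Fin P → Space d → ℝ}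

lemma CalibratedAt.continuous_wedgeAt (h : CalibratedAt c C M ξ τ Dξ B DB δ) (i : Fin P) :
    Continuous fun x => wedgeAt (ξ i x) (B x) (Dξ i x) (DB x) := by
  have h1 := h.xi_cont i
  have h2 := h.Dxi_cont i
  have h3 := h.B_cont
  have h4 := h.DB_cont
  unfold wedgeAt
  fun_prop

lemma CalibratedAt.norm_field_le (h : CalibratedAt c C M ξ τ Dξ B DB δ) (i : Fin P)
    {w : Space d → ℝ} (hw : ∀ x, |w x| ≤ M) (x : Space d) :
    ‖τ i x - wedgeAt (ξ i x) (B x) (Dξ i x) (DB x) + w x • B x‖ ≤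
      M + (2 + 2 * d) * M ^ 2 + M * M := by
  refine (norm_add_le _ _).trans (add_le_add ((norm_sub_le _ _).trans (add_le_add (h.tau_le i x)
    (norm_wedgeAt_le (h.xi_le i x) (h.B_le x) (h.Dxi_le i x) (h.DB_le x)))) ?_)
  rw [norm_smul]
  exact mul_le_mul (hw x) (h.B_le x) (norm_nonneg _) ((abs_nonneg _).trans (hw x))

lemma abs_sub_le_of_le {a b M : ℝ} (ha : |a| ≤ M) (hb : |b| ≤ M) : |a - b| ≤ M + M :=
  (abs_sub _ _).trans (add_le_add ha hb)

/-- The scalar part of `grainTerm`. -/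
noncomputable def scalarTerm (V w f : Space d → ℝ) (x : Space d) : ℝ :=
  V x * f x - 1 / 4 * V x ^ 2 - w x * V x

lemma integrable_scalarTerm {γ : Measure (Space d × Sph d)} [IsFiniteMeasure γ]
    {V w f : Space d → ℝ} (hV : Measurable V) (hw : Continuous w) (hf : Continuous f) {N : ℝ}
    (hwN : ∀ x, |w x| ≤ N) (hfN : ∀ x, |f x| ≤ N) (hVi : Integrable (fun z => V z.1 ^ 2) γ) :
    Integrable (fun z => scalarTerm V w f z.1) γ := by
  have hVz : Measurable fun z : Space d × Sph d => V z.1 := hV.comp measurable_fst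
  have iV : Integrable (fun z : Space d × Sph d => V z.1) γ :=
    integrable_of_sq hVz.aestronglyMeasurable hVi
  have iVf : ∀ {g : Space d → ℝ}, Continuous g → (∀ x, |g x| ≤ N) →
      Integrable (fun z : Space d × Sph d => V z.1 * g z.1) γ := fun {g} hg hgM =>
    iV.mul_bdd (c := N) (Continuous.aestronglyMeasurable (by fun_prop))
      (Eventually.of_forall fun z => hgM _)
  refine (((iVf hf hfN).sub (hVi.const_mul (1 / 4))).sub (iVf hw hwN)).congr
    (Eventually.of_forall fun z => ?_)
  simp only [scalarTerm, Pi.sub_apply]; ring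

lemma grainTerm_eq (V w : Space d → ℝ) (ξ τ B : Space d → Space d)
    (Dξ DB : Space d → Space d →L[ℝ] Space d) (z : Space d × Sph d) :
    grainTerm V w ξ τ B Dξ DB z =
      inner ℝ (τ z.1 - wedgeAt (ξ z.1) (B z.1) (Dξ z.1) (DB z.1) + w z.1 • B z.1) (z.2 : Space d) +
        scalarTerm V w (fun x => traceL (Dξ x)) z.1 := by
  simp only [grainTerm, scalarTerm]; ring

lemma measurable_scalarTerm {V w f : Space d → ℝ} (hV : Measurable V) (hw : Continuous w)
    (hf : Continuous f) : Measurable (scalarTerm V w f) := by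
  have := hw.measurable
  have := hf.measurable
  unfold scalarTerm
  fun_prop

lemma integrable_networkTerm {γ : Measure (Space d × Sph d)} [IsFiniteMeasure γ]
    {H B : Space d → Space d} {DB : Space d → Space d →L[ℝ] Space d} {M : ℝ} (hH : Measurable H)
    (hB : Continuous B) (hDB : Continuous DB) (hBM : ∀ x, ‖B x‖ ≤ M) (hDBM : ∀ x, ‖DB x‖ ≤ M)
    (hHi : Integrable (fun z => ‖H z.1‖ ^ 2) γ) : Integrable (networkTerm H B DB) γ := by
  have hHz : Measurable fun z : Space d × Sph d => H z.1 := hH.comp measurable_fst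
  have iH : Integrable (fun z : Space d × Sph d => H z.1) γ := by
    rw [← integrable_norm_iff hHz.aestronglyMeasurable]
    exact integrable_of_sq hHz.norm.aestronglyMeasurable hHi
  have iHB : Integrable (fun z : Space d × Sph d => inner ℝ (H z.1) (B z.1)) γ := by
    refine Integrable.mono' (iH.norm.mul_const M)
      (hHz.aestronglyMeasurable.inner (Continuous.aestronglyMeasurable (by fun_prop)))
      (Eventually.of_forall fun z => (abs_real_inner_le_norm _ _).trans ?_)
    gcongr; exact hBM _
  have i3 : Integrable (fun z : Space d × Sph d =>
      traceL (DB z.1) - inner ℝ (z.2 : Space d) (DB z.1 (z.2 : Space d))) γ := by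
    refine Integrable.mono' (integrable_const (d * M + M))
      (Continuous.aestronglyMeasurable (by fun_prop)) (Eventually.of_forall fun z => ?_)
    refine (norm_sub_le _ _).trans (add_le_add ?_ ?_)
    · exact (abs_traceL_le _).trans (by gcongr; exact hDBM _)
    · refine (abs_real_inner_le_norm _ _).trans ?_
      have h1 := (DB z.1).le_opNorm (z.2 : Space d)
      rw [norm_sph, mul_one] at h1
      rw [norm_sph, one_mul]
      exact h1.trans (hDBM _)
  exact (iHB.sub (hHi.const_mul (1 / 2))).add i3

lemma CalibratedAt.abs_trace_le (h : CalibratedAt c C M ξ τ Dξ B DB δ) (i : Fin P) (x : Space d) :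
    |traceL (Dξ i x)| ≤ d * M := (abs_traceL_le _).trans (by gcongr; exact h.Dxi_le i x)

lemma integrable_grainTerm (h : CalibratedAt c C M ξ τ Dξ B DB δ) {m : Varifold d}
    {V w : Space d → ℝ} (i : Fin P) (hV : Measurable V) (hw : Continuous w) (hwM : ∀ x, |w x| ≤ M)
    (hVi : Integrable (fun z => V z.1 ^ 2) (m : Measure (Space d × Sph d))) :
    Integrable (grainTerm V w (ξ i) (τ i) B (Dξ i) DB) (m : Measure (Space d × Sph d)) := by
  have h1 := h.continuous_wedgeAt i
  have h2 := h.tau_cont i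
  have h3 := h.B_cont
  have h4 := h.Dxi_cont i
  have hM : 0 ≤ M := (norm_nonneg _).trans (h.B_le 0)
  have hdM : 0 ≤ (d : ℝ) * M := by positivity
  have i1 := integrable_inner_varifold m (u := fun x => τ i x -
    wedgeAt (ξ i x) (B x) (Dξ i x) (DB x) + w x • B x) (by fun_prop) (h.norm_field_le i hwM)
  have i2 := integrable_scalarTerm (f := fun x => traceL (Dξ i x)) (N := M + d * M) hV hw
    (by fun_prop) (fun x => by linarith [hwM x])
    (fun x => by linarith [h.abs_trace_le i x]) hVi
  exact (i1.add i2).congr (Eventually.of_forall fun z => (grainTerm_eq _ _ _ _ _ _ _ z).symm)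

/-- At a fixed time the dissipation is controlled by the tilt excess. -/
lemma exists_fixed_time_bound (P : ℕ) {c C M : ℝ} (hc : 0 < c) (hC : 0 ≤ C) (hM : 0 ≤ M) :
    ∃ K : ℝ, 0 ≤ K ∧ ∀ (m : Fin P → Fin P → Varifold d) (A : Fin P → Set (Space d))
      (V w : Fin P → Space d → ℝ) (H : Space d → Space d) (ξ τ : Fin P → Space d → Space d)
      (Dξ : Fin P → Space d → Space d →L[ℝ] Space d) (B : Space d → Space d)
      (DB : Space d → Space d →L[ℝ] Space d) (δ : Fin P → Fin P → Space d → ℝ),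
      IsCompatible m A → KinematicsAt m V H → CalibratedAt c C M ξ τ Dξ B DB δ →
      (∀ i, Continuous (w i)) → (∀ i x, |w i x| ≤ M) →
      (∀ i j, i ≠ j → ∀ x, |w i x - w j x| ≤ C * δ i j x) →
      ∑ i, ∫ z, grainTerm (V i) (w i) (ξ i) (τ i) B (Dξ i) DB z
          ∂(grain m i : Measure (Space d × Sph d)) +
        ∫ z, networkTerm H B DB z ∂(network m : Measure (Space d × Sph d)) ≤
        K * tiltExcess m ξ := by
  obtain ⟨K₁, hK₁0, hK₁⟩ := exists_pair_bound (d := d) hc hC hM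
  set K₂ : ℝ := 2 * (d * M + M) ^ 2 + (M ^ 2 + (d * M + M)) with hK₂
  have hK₂0 : 0 ≤ K₂ := by positivity
  refine ⟨K₁ + K₂, by positivity, fun m A V w H ξ τ Dξ B DB δ hm hk hcal hwc hwM hwδ => ?_⟩
  have hgi : ∀ i, Integrable (grainTerm (V i) (w i) (ξ i) (τ i) B (Dξ i) DB)
      (grain m i : Measure (Space d × Sph d)) := fun i =>
    integrable_grainTerm hcal i (hk.V_meas i) (hwc i) (hwM i) (hk.V_int i)
  have hni : Integrable (networkTerm H B DB) (network m : Measure (Space d × Sph d)) :=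
    integrable_networkTerm hk.H_meas hcal.B_cont hcal.DB_cont hcal.B_le hcal.DB_le hk.H_int
  have hHg := (integrable_network_iff m).1 hk.H_int
  have hng := (integrable_network_iff m).1 hni
  rw [integral_network m hni]
  simp only [integral_grain m _ (hgi _)]
  -- the sum over ordered pairs is symmetrized
  set a : Fin P → Fin P → ℝ := fun i j =>
    ∫ z, grainTerm (V i) (w i) (ξ i) (τ i) B (Dξ i) DB z ∂(m j i : Measure (Space d × Sph d))
    with ha
  set b : Fin P → Fin P → ℝ := fun i j =>
    ∫ z, networkTerm H B DB z ∂(m i j : Measure (Space d × Sph d)) with hb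
  set E : Fin P → Fin P → ℝ := fun i j =>
    ∫ z, (1 - inner ℝ (z.2 : Space d) (ξ i z.1 - ξ j z.1)) ∂(m i j : Measure (Space d × Sph d))
    with hE
  have hE0 : ∀ i j, i ≠ j → 0 ≤ E i j := fun i j hij => by
    refine integral_nonneg fun z => ?_
    have h1 := real_inner_le_norm (z.2 : Space d) (ξ i z.1 - ξ j z.1)
    rw [norm_sph, one_mul] at h1
    have h2 := hcal.length i j hij z.1
    have h3 : 0 ≤ c * δ i j z.1 ^ 2 := by positivity
    change 0 ≤ 1 - inner ℝ (z.2 : Space d) (ξ i z.1 - ξ j z.1)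
    linarith
  have hpair : ∀ i j, i ≠ j → a i j + a j i + b i j ≤ K₁ * E i j := fun i j hij => by
    have hVij : Integrable (fun z => V i z.1 ^ 2) (m i j : Measure (Space d × Sph d)) := by
      refine integrable_fst_congr (hm.mass_symm j i hij.symm) (h := fun x => V i x ^ 2)
        ((hk.V_meas i).pow_const 2) ((hk.V_int i).mono_measure (le_grain m hij))
    have hVji : Integrable (fun z => V j z.1 ^ 2) (m i j : Measure (Space d × Sph d)) :=
      (hk.V_int j).mono_measure (le_grain m hij.symm)
    have hHij : Integrable (fun z => ‖H z.1‖ ^ 2) (m i j : Measure (Space d × Sph d)) :=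
      (hHg j).mono_measure (le_grain m hij.symm)
    have hbij : Integrable (networkTerm H B DB) (m i j : Measure (Space d × Sph d)) :=
      (hng j).mono_measure (le_grain m hij.symm)
    have ci := hcal.continuous_wedgeAt i
    have cj := hcal.continuous_wedgeAt j
    have ti := hcal.tau_cont i
    have tj := hcal.tau_cont j
    have xi := hcal.xi_cont i
    have xj := hcal.xi_cont j
    have Di := hcal.Dxi_cont i
    have Dj := hcal.Dxi_cont j
    have cB := hcal.B_cont
    have cDB := hcal.DB_cont
    have wi := hwc i
    have wj := hwc j
    have hdM : 0 ≤ (d : ℝ) * M := by positivity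
    have hu : Continuous fun x => τ i x - wedgeAt (ξ i x) (B x) (Dξ i x) (DB x) + w i x • B x := by
      fun_prop
    have hsm : Measurable (scalarTerm (V i) (w i) fun x => traceL (Dξ i x)) :=
      measurable_scalarTerm (hk.V_meas i) wi (by fun_prop)
    have isij := integrable_scalarTerm (γ := (m i j : Measure (Space d × Sph d)))
      (f := fun x => traceL (Dξ i x)) (N := M + d * M) (hk.V_meas i) wi
      (by fun_prop) (fun x => by linarith [hwM i x])
      (fun x => by linarith [hcal.abs_trace_le i x]) hVij
    have iuij := integrable_inner_varifold (m i j) hu (hcal.norm_field_le i (hwM i))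
    have iuji := integrable_inner_varifold (m j i) hu (hcal.norm_field_le i (hwM i))
    have haij : a i j = ∫ z, (-(inner ℝ (τ i z.1 - wedgeAt (ξ i z.1) (B z.1) (Dξ i z.1) (DB z.1) +
        w i z.1 • B z.1) (z.2 : Space d)) + scalarTerm (V i) (w i) (fun x => traceL (Dξ i x)) z.1)
        ∂(m i j : Measure (Space d × Sph d)) := by
      have isji := integrable_fst_congr (hm.mass_symm i j hij) hsm isij
      have e1 : a i j = ∫ z, (inner ℝ (τ i z.1 - wedgeAt (ξ i z.1) (B z.1) (Dξ i z.1) (DB z.1) +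
          w i z.1 • B z.1) (z.2 : Space d) + scalarTerm (V i) (w i) (fun x => traceL (Dξ i x)) z.1)
          ∂(m j i : Measure (Space d × Sph d)) :=
        integral_congr_ae (Eventually.of_forall fun z => grainTerm_eq _ _ _ _ _ _ _ z)
      have iuijn : Integrable (fun z => -(inner ℝ (τ i z.1 -
          wedgeAt (ξ i z.1) (B z.1) (Dξ i z.1) (DB z.1) + w i z.1 • B z.1) (z.2 : Space d)))
          (m i j : Measure (Space d × Sph d)) := iuij.neg
      rw [e1, integral_add iuji isji, integral_add iuijn isij,
        integral_inner_swap (hm.mass_symm j i hij.symm) (hm.normal_antisymm j i hij.symm) hu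
          (hcal.norm_field_le i (hwM i)), integral_neg,
        integral_fst_congr (hm.mass_symm j i hij.symm) hsm]
    have iaji := integrable_grainTerm hcal j (hk.V_meas j) wj (hwM j) hVji
    have hmain := hK₁ (m i j) (V i) (fun x => traceL (Dξ i x - Dξ j x)) (fun x => w i x - w j x)
      (δ i j) H (fun x => ξ i x - ξ j x) (fun x => τ i x - τ j x)
      (fun x => (Dξ i x - Dξ j x) (B x)) B DB (hk.V_meas i) hk.H_meas (by fun_prop) (by fun_prop)
      (by fun_prop) (by fun_prop) (by fun_prop) cB cDB hVij hHij
      ⟨M + M + (M + M) * M + d * (M + M), fun x => by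
        have e0 : ‖Dξ i x - Dξ j x‖ ≤ M + M :=
          (norm_sub_le _ _).trans (add_le_add (hcal.Dxi_le i x) (hcal.Dxi_le j x))
        have e1 : ‖τ i x - τ j x‖ ≤ M + M :=
          (norm_sub_le _ _).trans (add_le_add (hcal.tau_le i x) (hcal.tau_le j x))
        have e2 : ‖(Dξ i x - Dξ j x) (B x)‖ ≤ (M + M) * M :=
          ((Dξ i x - Dξ j x).le_opNorm _).trans
            (mul_le_mul e0 (hcal.B_le x) (norm_nonneg _) (by positivity))
        have e3 : |traceL (Dξ i x - Dξ j x)| ≤ d * (M + M) :=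
          (abs_traceL_le _).trans (by gcongr)
        have e4 := abs_sub_le_of_le (hwM i x) (hwM j x)
        have p1 : 0 ≤ (M + M) * M := by positivity
        have p2 : 0 ≤ (d : ℝ) * (M + M) := by positivity
        exact ⟨by linarith, by linarith, by linarith, by linarith⟩⟩
      hcal.B_le hcal.DB_le (hcal.dist_nonneg i j) (hcal.length i j hij) (hcal.curvature i j hij)
      (hcal.transport i j hij) (hcal.transport_length i j hij) (hwδ i j hij) (hk.H_dir i j hij)
    refine le_trans (le_of_eq ?_) hmain
    have e2 : a j i = ∫ z, grainTerm (V j) (w j) (ξ j) (τ j) B (Dξ j) DB z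
        ∂(m i j : Measure (Space d × Sph d)) := rfl
    have i1 : Integrable (fun z : Space d × Sph d => -(inner ℝ (τ i z.1 -
        wedgeAt (ξ i z.1) (B z.1) (Dξ i z.1) (DB z.1) + w i z.1 • B z.1) (z.2 : Space d)) +
        scalarTerm (V i) (w i) (fun x => traceL (Dξ i x)) z.1)
        (m i j : Measure (Space d × Sph d)) := iuij.neg.add isij
    have hbe : b i j = ∫ z, networkTerm H B DB z ∂(m i j : Measure (Space d × Sph d)) := rfl
    have i2 : Integrable (fun z => (-(inner ℝ (τ i z.1 -
        wedgeAt (ξ i z.1) (B z.1) (Dξ i z.1) (DB z.1) + w i z.1 • B z.1) (z.2 : Space d)) +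
        scalarTerm (V i) (w i) (fun x => traceL (Dξ i x)) z.1) +
        grainTerm (V j) (w j) (ξ j) (τ j) B (Dξ j) DB z)
        (m i j : Measure (Space d × Sph d)) := i1.add iaji
    rw [haij, e2, hbe, ← integral_add i1 iaji, ← integral_add i2 hbij]
    refine integral_congr_ae ?_
    filter_upwards [ae_of_ae_mass (hk.V_antisymm i j hij)] with z hz
    have hVj : V j z.1 = -V i z.1 := by linarith
    have hw := wedgeAt_sub (ξ i z.1) (ξ j z.1) (B z.1) (Dξ i z.1) (Dξ j z.1) (DB z.1)
    have hfield : τ i z.1 - τ j z.1 - (DB z.1 (ξ i z.1 - ξ j z.1) +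
        traceL (Dξ i z.1 - Dξ j z.1) • B z.1 - (Dξ i z.1 - Dξ j z.1) (B z.1) -
          traceL (DB z.1) • (ξ i z.1 - ξ j z.1)) + (w i z.1 - w j z.1) • B z.1 =
        (τ i z.1 - wedgeAt (ξ i z.1) (B z.1) (Dξ i z.1) (DB z.1) + w i z.1 • B z.1) -
        (τ j z.1 - wedgeAt (ξ j z.1) (B z.1) (Dξ j z.1) (DB z.1) + w j z.1 • B z.1) := by
      have hw' : DB z.1 (ξ i z.1 - ξ j z.1) +
        traceL (Dξ i z.1 - Dξ j z.1) • B z.1 - (Dξ i z.1 - Dξ j z.1) (B z.1) -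
          traceL (DB z.1) • (ξ i z.1 - ξ j z.1) =
          wedgeAt (ξ i z.1) (B z.1) (Dξ i z.1) (DB z.1) -
            wedgeAt (ξ j z.1) (B z.1) (Dξ j z.1) (DB z.1) := hw.symm
      rw [hw', sub_smul]; abel
    rw [hfield, grainTerm_eq]
    simp only [scalarTerm, networkTerm, hVj, inner_sub_left _ (τ j z.1 - _ + _), traceL_sub]
    ring
  have hdiag : ∀ i, 2 * a i i + b i i ≤ K₂ * (m i i : Measure (Space d × Sph d)).real univ :=
    fun i => by
    have hVii : Integrable (fun z => V i z.1 ^ 2) (m i i : Measure (Space d × Sph d)) :=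
      (hk.V_int i).mono_measure (diag_le_grain m i)
    have hbii : Integrable (networkTerm H B DB) (m i i : Measure (Space d × Sph d)) :=
      (hng i).mono_measure (diag_le_grain m i)
    have ci := hcal.continuous_wedgeAt i
    have ti := hcal.tau_cont i
    have Di := hcal.Dxi_cont i
    have cB := hcal.B_cont
    have wi := hwc i
    have hdM : 0 ≤ (d : ℝ) * M := by positivity
    have hu : Continuous fun x => τ i x - wedgeAt (ξ i x) (B x) (Dξ i x) (DB x) + w i x • B x := by
      fun_prop
    have is := integrable_scalarTerm (γ := (m i i : Measure (Space d × Sph d)))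
      (f := fun x => traceL (Dξ i x)) (N := M + d * M) (hk.V_meas i) wi
      (by fun_prop) (fun x => by linarith [hwM i x])
      (fun x => by linarith [hcal.abs_trace_le i x]) hVii
    have iu := integrable_inner_varifold (m i i) hu (hcal.norm_field_le i (hwM i))
    have e1 : a i i = ∫ z, scalarTerm (V i) (w i) (fun x => traceL (Dξ i x)) z.1
        ∂(m i i : Measure (Space d × Sph d)) := by
      have : a i i = ∫ z, (inner ℝ (τ i z.1 - wedgeAt (ξ i z.1) (B z.1) (Dξ i z.1) (DB z.1) +
          w i z.1 • B z.1) (z.2 : Space d) + scalarTerm (V i) (w i) (fun x => traceL (Dξ i x)) z.1)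
          ∂(m i i : Measure (Space d × Sph d)) :=
        integral_congr_ae (Eventually.of_forall fun z => grainTerm_eq _ _ _ _ _ _ _ z)
      rw [this, integral_add iu is, integral_inner_eq_zero (hm.normal_diag i) hu
        (hcal.norm_field_le i (hwM i)), zero_add]
    have hbe : b i i = ∫ z, networkTerm H B DB z ∂(m i i : Measure (Space d × Sph d)) := rfl
    rw [e1, hbe, ← integral_const_mul, ← integral_add (is.const_mul 2) hbii]
    have e3 : K₂ * (m i i : Measure (Space d × Sph d)).real univ =
        ∫ _z, K₂ ∂(m i i : Measure (Space d × Sph d)) := by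
      rw [integral_const, smul_eq_mul, mul_comm]
    rw [e3]
    refine integral_mono_ae ((is.const_mul 2).add hbii) (integrable_const _)
      (Eventually.of_forall fun z => ?_)
    have t1 := hcal.abs_trace_le i z.1
    have t2 := hwM i z.1
    have t3 : |traceL (DB z.1)| ≤ d * M := (abs_traceL_le _).trans (by gcongr; exact hcal.DB_le _)
    have t4 : |inner ℝ (z.2 : Space d) (DB z.1 (z.2 : Space d))| ≤ M := by
      refine (abs_real_inner_le_norm _ _).trans ?_
      have h1 := (DB z.1).le_opNorm (z.2 : Space d)
      rw [norm_sph, mul_one] at h1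
      rw [norm_sph, one_mul]
      exact h1.trans (hcal.DB_le _)
    have t5 : inner ℝ (H z.1) (B z.1) ≤ 1 / 2 * ‖H z.1‖ ^ 2 + M ^ 2 := by
      have h1 := real_inner_le_norm (H z.1) (B z.1)
      have h2 := hcal.B_le z.1
      have h3 : ‖B z.1‖ ^ 2 ≤ M ^ 2 := by gcongr
      nlinarith only [h1, h3, sq_nonneg (‖H z.1‖ - ‖B z.1‖), sq_nonneg ‖B z.1‖]
    have t6 : (traceL (Dξ i z.1) - w i z.1) ^ 2 ≤ (d * M + M) ^ 2 := by
      refine sq_le_sq.2 ?_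
      rw [abs_of_nonneg (by positivity : 0 ≤ (d : ℝ) * M + M)]
      exact (abs_sub _ _).trans (add_le_add t1 t2)
    have t7 : 2 * V i z.1 * (traceL (Dξ i z.1) - w i z.1) ≤ 1 / 2 * V i z.1 ^ 2 +
        2 * (traceL (Dξ i z.1) - w i z.1) ^ 2 := by
      nlinarith only [sq_nonneg (V i z.1 - 2 * (traceL (Dξ i z.1) - w i z.1))]
    simp only [scalarTerm, networkTerm, hK₂]
    linarith [le_of_abs_le t3, neg_le_of_abs_le t4]
  have hsum : ∑ i, (2 * a i i + ∑ j ∈ Finset.univ.erase i, a i j) +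
      (∑ i, b i i + 1 / 2 * ∑ i, ∑ j ∈ Finset.univ.erase i, b i j) =
      ∑ i, (2 * a i i + b i i) + 1 / 2 * ∑ i, ∑ j ∈ Finset.univ.erase i,
        (a i j + a j i + b i j) := by
    simp only [Finset.sum_add_distrib]
    rw [← sum_erase_comm a]
    ring
  rw [hsum, tiltExcess]
  have hs1 : ∑ i, (2 * a i i + b i i) ≤ K₂ * ∑ i, (m i i : Measure (Space d × Sph d)).real univ := by
    rw [Finset.mul_sum]
    exact Finset.sum_le_sum fun i _ => hdiag i
  have hs2 : ∑ i, ∑ j ∈ Finset.univ.erase i, (a i j + a j i + b i j) ≤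
      K₁ * ∑ i, ∑ j ∈ Finset.univ.erase i, E i j := by
    rw [Finset.mul_sum]
    refine Finset.sum_le_sum fun i _ => ?_
    rw [Finset.mul_sum]
    exact Finset.sum_le_sum fun j hj => hpair i j (Finset.ne_of_mem_erase hj).symm
  have p1 : 0 ≤ ∑ i, (m i i : Measure (Space d × Sph d)).real univ :=
    Finset.sum_nonneg fun i _ => measureReal_nonneg
  have p2 : 0 ≤ ∑ i, ∑ j ∈ Finset.univ.erase i, E i j :=
    Finset.sum_nonneg fun i _ => Finset.sum_nonneg fun j hj =>
      hE0 i j (Finset.ne_of_mem_erase hj).symm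
  have p3 := mul_nonneg hK₁0 p1
  have p4 := mul_nonneg hK₂0 p2
  nlinarith only [hs1, hs2, p3, p4]

end FixedTimeTotal

/-! ### Space-time form of De Giorgi solutions -/

section SpacetimeForm

open ProbabilityTheory
open scoped ENNReal

variable {d P : ℕ}

lemma isPolarGradient_perimeterMeasure {A : Set (Space d)} (hA : HasFinitePerimeter A) :
    IsPolarGradient A (perimeterMeasure A) (innerNormal A) := by
  have h := hA.2.choose_spec
  simp only [perimeterMeasure, innerNormal, dif_pos hA]
  exact h

/-- The divergence theorem on a phase, in terms of the varifold of its boundary. -/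
lemma IsCompatible.integral_divergence {m : Fin P → Fin P → Varifold d} {A : Fin P → Set (Space d)}
    (hm : IsCompatible m A) (hA : IsPhasePartition A) (i : Fin P) {φ : Space d → Space d}
    (hφ : IsTest φ) :
    ∫ x in A i, divergence φ x =
      -∫ z, inner ℝ (φ z.1) (z.2 : Space d) ∂(grain m i : Measure (Space d × Sph d)) := by
  rw [(isPolarGradient_perimeterMeasure (hA.finitePerimeter i)).2.2.2 φ hφ, hm.gradient i φ hφ]

/-- The space-time track of a moving set. -/
def track (A : ℝ → Set (Space d)) : Set (ℝ × Space d) := {q | q.2 ∈ A q.1}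

/-- Lebesgue measure on the part of the track of a moving set up to the time `T`. -/
noncomputable def trackMeasure (A : ℝ → Set (Space d)) (T : ℝ) : Measure (ℝ × Space d) :=
  (volume.restrict (Ioc 0 T ×ˢ univ)).restrict (track A)

lemma trackMeasure_le (A : ℝ → Set (Space d)) (T : ℝ) :
    trackMeasure A T ≤ volume.restrict (Ioc 0 T ×ˢ univ) := Measure.restrict_le_self

lemma restrict_Ioc_prod (T : ℝ) :
    (volume.restrict (Ioc 0 T ×ˢ univ) : Measure (ℝ × Space d)) =
      (volume.restrict (Ioc 0 T)).prod volume := by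
  rw [Measure.volume_eq_prod, ← Measure.prod_restrict, Measure.restrict_univ]

lemma nullMeasurableSet_track {A : ℝ → Set (Space d)}
    (hA : NullMeasurableSet {q : ℝ × Space d | q.2 ∈ A q.1}
      (volume.restrict (Ioi (0 : ℝ) ×ˢ univ))) (T : ℝ) :
    NullMeasurableSet (track A) (volume.restrict (Ioc 0 T ×ˢ univ)) :=
  hA.mono (Measure.restrict_mono (prod_mono Ioc_subset_Ioi_self subset_rfl) le_rfl)

lemma integral_trackMeasure {A : ℝ → Set (Space d)}
    (hA : NullMeasurableSet {q : ℝ × Space d | q.2 ∈ A q.1}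
      (volume.restrict (Ioi (0 : ℝ) ×ˢ univ)))
    (hAm : ∀ t, 0 < t → MeasurableSet (A t)) {T : ℝ} {f : ℝ × Space d → ℝ}
    (hf : Integrable f (volume.restrict (Ioc 0 T ×ˢ univ))) :
    ∫ q, f q ∂(trackMeasure A T) = ∫ t in Ioc 0 T, ∫ x in A t, f (t, x) := by
  have hn := nullMeasurableSet_track hA T
  rw [trackMeasure, ← integral_indicator₀ hn]
  have hi := hf.indicator₀ hn
  rw [restrict_Ioc_prod] at hi ⊢
  rw [integral_prod _ hi]
  refine setIntegral_congr_fun measurableSet_Ioc fun t ht => ?_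
  rw [← integral_indicator (hAm t ht.1)]
  rfl

lemma IsTest.integrable {X : Type*} [NormedAddCommGroup X] [NormedSpace ℝ X] [MeasurableSpace X]
    [OpensMeasurableSpace X] {Y : Type*} [NormedAddCommGroup Y] [NormedSpace ℝ Y] {f : X → Y}
    (hf : IsTest f) (μ : Measure X) [IsFiniteMeasureOnCompacts μ] : Integrable f μ :=
  hf.continuous.integrable_of_hasCompactSupport hf.2

lemma IsTest.exists_bound {X : Type*} [NormedAddCommGroup X] [NormedSpace ℝ X]
    {Y : Type*} [NormedAddCommGroup Y] [NormedSpace ℝ Y] {f : X → Y}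
    (hf : IsTest f) : ∃ C, ∀ x, ‖f x‖ ≤ C := hf.2.exists_bound_of_continuous hf.continuous

/-- A De Giorgi solution in space-time form: the varifolds are given by measurable kernels and all
the identities are expressed by space-time integrals. -/
structure IsSpacetimeForm (μ₀ : Fin P → Fin P → Varifold d) (A₀ : Fin P → Set (Space d))
    (μ : ℝ → Fin P → Fin P → Varifold d) (A : ℝ → Fin P → Set (Space d))
    (V : ℝ → Fin P → Space d → ℝ) (H : ℝ → Space d → Space d)
    (κ : Fin P → Kernel ℝ (Space d × Sph d)) (κn : Kernel ℝ (Space d × Sph d)) : Prop where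
  finite : ∀ i, IsFiniteKernel (κ i)
  finite_network : IsFiniteKernel κn
  grain_eq : ∀ i, ∀ᵐ t ∂(volume.restrict (Ioi (0 : ℝ))),
    κ i t = (grain (μ t) i : Measure (Space d × Sph d))
  network_eq : ∀ᵐ t ∂(volume.restrict (Ioi (0 : ℝ))),
    κn t = (network (μ t) : Measure (Space d × Sph d))
  V_meas : ∀ i, Measurable fun q : ℝ × Space d => V q.1 i q.2
  H_meas : Measurable fun q : ℝ × Space d => H q.1 q.2
  V_int : ∀ i T, Integrable (fun q => V q.1 i q.2.1 ^ 2) (spacetime (κ i) T)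
  H_int : ∀ T, Integrable (fun q => ‖H q.1 q.2.1‖ ^ 2) (spacetime κn T)
  kinematics : ∀ᵐ t ∂(volume.restrict (Ioi (0 : ℝ))), KinematicsAt (μ t) (V t) (H t)
  evolution : ∀ i, ∀ᵐ T ∂(volume.restrict (Ioi (0 : ℝ))),
    WeakEvolution T (volume.restrict (A₀ i)) (volume.restrict (A T i))
      (trackMeasure (fun t => A t i) T) (spacetime (κ i) T) (fun q => V q.1 i q.2)
  curvature : ∀ᵐ T ∂(volume.restrict (Ioi (0 : ℝ))), ∀ F : ℝ × Space d → Space d, IsTest F →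
    ∫ q, inner ℝ (H q.1 q.2.1) (F (base q)) ∂(spacetime κn T) =
      -∫ q, (divX F (base q) -
        inner ℝ (q.2.2 : Space d) (fderiv ℝ F (base q) (0, (q.2.2 : Space d)))) ∂(spacetime κn T)
  energy : ∀ᵐ T ∂(volume.restrict (Ioi (0 : ℝ))),
    (network (μ T) : Measure (Space d × Sph d)).real univ +
      ∑ i, ∫ q, 1 / 4 * V q.1 i q.2.1 ^ 2 ∂(spacetime (κ i) T) +
      ∫ q, 1 / 2 * ‖H q.1 q.2.1‖ ^ 2 ∂(spacetime κn T) ≤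
    (network μ₀ : Measure (Space d × Sph d)).real univ

/-- Integrals of continuous vanishing functions against the varifolds depend measurably on time. -/
def IsWeaklyMeasurable (m : ℝ → Varifold d) : Prop :=
  ∀ η : ℝ → C₀(Space d × Sph d, ℝ), IntegrableOn η (Ioi 0) →
    AEStronglyMeasurable (fun t => ∫ z, η t z ∂(m t : Measure (Space d × Sph d)))
      (volume.restrict (Ioi 0))

lemma integrable_zeroAtInfty (f : C₀(Space d × Sph d, ℝ)) (m : Measure (Space d × Sph d))
    [IsFiniteMeasure m] : Integrable (fun z => f z) m := by
  refine Integrable.mono' (integrable_const ‖f‖) (map_continuous f).aestronglyMeasurable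
    (Eventually.of_forall fun z => ?_)
  simpa using ZeroAtInftyContinuousMap.norm_toBCF_eq_norm (f := f) ▸
    BoundedContinuousFunction.norm_coe_le_norm f.toBCF z

lemma isWeaklyMeasurable_grain {μ : ℝ → Fin P → Fin P → Varifold d}
    (h : ∀ i j, IsWeaklyMeasurable fun t => μ t i j) (i : Fin P) :
    IsWeaklyMeasurable fun t => grain (μ t) i := fun η hη => by
  simp only [integral_grain _ i (integrable_zeroAtInfty (η _) _)]
  refine ((h i i η hη).const_mul 2).add ?_
  exact Finset.aestronglyMeasurable_fun_sum _ fun j _ => h j i η hη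

lemma isWeaklyMeasurable_network {μ : ℝ → Fin P → Fin P → Varifold d}
    (h : ∀ i j, IsWeaklyMeasurable fun t => μ t i j) :
    IsWeaklyMeasurable fun t => network (μ t) := fun η hη => by
  simp only [integral_network _ (integrable_zeroAtInfty (η _) _)]
  refine (Finset.aestronglyMeasurable_fun_sum _ fun i _ => h i i η hη).add
    (AEStronglyMeasurable.const_mul (Finset.aestronglyMeasurable_fun_sum _ fun i _ =>
      Finset.aestronglyMeasurable_fun_sum _ fun j _ => h i j η hη) _)

lemma grain_le_network (m : Fin P → Fin P → Varifold d) (i : Fin P) :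
    (grain m i : Measure (Space d × Sph d)) univ ≤
      2 * (network m : Measure (Space d × Sph d)) univ := by
  rw [coe_network, Measure.smul_apply, ENNReal.smul_def, smul_eq_mul, ← mul_assoc]
  have : (2 : ℝ≥0∞) * ((2⁻¹ : ℝ≥0) : ℝ≥0∞) = 1 := by
    rw [ENNReal.coe_inv (by norm_num)]
    exact ENNReal.mul_inv_cancel (by simp) (by simp)
  rw [this, one_mul, Measure.finsetSum_apply]
  exact Finset.single_le_sum (f := fun i => (grain m i : Measure (Space d × Sph d)) univ)
    (fun _ _ => zero_le) (Finset.mem_univ i)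

lemma mass_univ (m : Varifold d) : mass m univ = (m : Measure (Space d × Sph d)) univ := by
  rw [mass_eq_map, Measure.map_apply measurable_fst MeasurableSet.univ]; rfl

lemma lintegral_mass {m : Varifold d} {f : Space d → ℝ≥0∞} (hf : Measurable f) :
    ∫⁻ x, f x ∂(mass m) = ∫⁻ z, f z.1 ∂(m : Measure (Space d × Sph d)) := by
  rw [mass_eq_map, lintegral_map hf measurable_fst]

lemma integrable_sq_of_lintegral {Z Y : Type*} [MeasurableSpace Z] [NormedAddCommGroup Y]
    [MeasurableSpace Y] [BorelSpace Y] [SecondCountableTopology Y] {γ : Measure Z} {f : Z → Y}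
    (hf : Measurable f)
    (h : ∫⁻ z, ‖f z‖ₑ ^ 2 ∂γ < ⊤) : Integrable (fun z => ‖f z‖ ^ 2) γ := by
  refine ⟨(hf.norm.pow_const 2).aestronglyMeasurable, ?_⟩
  simpa [HasFiniteIntegral] using h

lemma ofReal_integral_sq {Z Y : Type*} [MeasurableSpace Z] [NormedAddCommGroup Y]
    {γ : Measure Z} {f : Z → Y} {c : ℝ≥0∞} (hc : c ≠ ⊤)
    (h : Integrable (fun z => ‖f z‖ ^ 2) γ) :
    ∫⁻ z, c * ‖f z‖ₑ ^ 2 ∂γ = ENNReal.ofReal (∫ z, c.toReal * ‖f z‖ ^ 2 ∂γ) := by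
  rw [ofReal_integral_eq_lintegral_ofReal (h.const_mul _)
    (Eventually.of_forall fun z => by positivity)]
  refine lintegral_congr fun z => ?_
  rw [ENNReal.ofReal_mul ENNReal.toReal_nonneg, ENNReal.ofReal_toReal hc,
    ENNReal.ofReal_pow (norm_nonneg _), ofReal_norm]

/-- De Giorgi solutions can be put into space-time form. -/
theorem IsDeGiorgiSolution.exists_spacetimeForm {μ₀ : Fin P → Fin P → Varifold d}
    {A₀ : Fin P → Set (Space d)} {μ : ℝ → Fin P → Fin P → Varifold d}
    {A : ℝ → Fin P → Set (Space d)} (h : IsDeGiorgiSolution μ₀ A₀ μ A) :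
    ∃ V H κ κn, IsSpacetimeForm μ₀ A₀ μ A V H κ κn := by
  obtain ⟨V, H, hVm, hVi, hHm, hHi, hvel, hcur, hen, hdir⟩ := h.exists_velocity_curvature
  have hwm : ∀ i j, IsWeaklyMeasurable fun t => μ t i j := h.varifold_measurable
  set M₀ : ℝ≥0∞ := (network μ₀ : Measure (Space d × Sph d)) univ with hM₀
  have hM₀t : M₀ < ⊤ := measure_lt_top _ _
  have hnet : ∀ᵐ t ∂(volume.restrict (Ioi (0 : ℝ))),
      (network (μ t) : Measure (Space d × Sph d)) univ ≤ M₀ := by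
    filter_upwards [hen] with T hT
    rw [mass_univ, mass_univ] at hT
    exact le_trans (le_trans le_self_add le_self_add) hT
  have hgrain : ∀ i, ∀ᵐ t ∂(volume.restrict (Ioi (0 : ℝ))),
      (grain (μ t) i : Measure (Space d × Sph d)) univ ≤ 2 * M₀ := fun i => by
    filter_upwards [hnet] with T hT
    exact (grain_le_network _ i).trans (by gcongr)
  have h2M₀ : 2 * M₀ < ⊤ := ENNReal.mul_lt_top (by simp) hM₀t
  choose κ hκf hκ using fun i => exists_kernel_ae_eq (fun t => grain (μ t) i)
    (isWeaklyMeasurable_grain hwm i) h2M₀ (hgrain i)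
  obtain ⟨κn, hκnf, hκn⟩ := exists_kernel_ae_eq (fun t => network (μ t))
    (isWeaklyMeasurable_network hwm) hM₀t hnet
  have hVb : ∀ i, Measurable fun q : ℝ × (Space d × Sph d) => V q.1 i q.2.1 := fun i =>
    (hVm i).comp measurable_base
  have hHb : Measurable fun q : ℝ × (Space d × Sph d) => H q.1 q.2.1 := hHm.comp measurable_base
  have hVt : ∀ t i, Measurable (V t i) := fun t i => (hVm i).comp measurable_prodMk_left
  have hHt : ∀ t, Measurable (H t) := fun t => hHm.comp measurable_prodMk_left
  have hVl : ∀ i T (c : ℝ≥0∞), ∫⁻ q, c * ‖V q.1 i q.2.1‖ₑ ^ 2 ∂(spacetime (κ i) T) =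
      ∫⁻ t in Ioc 0 T, ∫⁻ x, c * ‖V t i x‖ₑ ^ 2 ∂(mass (grain (μ t) i)) := fun i T c => by
    rw [lintegral_spacetime (hκ i) (((hVb i).enorm.pow_const 2).const_mul c)]
    refine lintegral_congr fun t => ?_
    rw [lintegral_mass (((hVt t i).enorm.pow_const 2).const_mul c)]
  have hHl : ∀ T (c : ℝ≥0∞), ∫⁻ q, c * ‖H q.1 q.2.1‖ₑ ^ 2 ∂(spacetime κn T) =
      ∫⁻ t in Ioc 0 T, ∫⁻ x, c * ‖H t x‖ₑ ^ 2 ∂(mass (network (μ t))) := fun T c => by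
    rw [lintegral_spacetime hκn ((hHb.enorm.pow_const 2).const_mul c)]
    refine lintegral_congr fun t => ?_
    rw [lintegral_mass (((hHt t).enorm.pow_const 2).const_mul c)]
  have hVi2 : ∀ i T, Integrable (fun q => ‖V q.1 i q.2.1‖ ^ 2) (spacetime (κ i) T) := fun i T => by
    refine integrable_sq_of_lintegral (hVb i) ?_
    have := hVl i T 1
    simp only [one_mul] at this
    rw [this]
    exact (lintegral_mono_set Ioc_subset_Ioi_self).trans_lt (hVi i)
  have hVi3 : ∀ i T, Integrable (fun q => V q.1 i q.2.1 ^ 2) (spacetime (κ i) T) := fun i T => by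
    simpa using hVi2 i T
  have hHi2 : ∀ T, Integrable (fun q => ‖H q.1 q.2.1‖ ^ 2) (spacetime κn T) := fun T => by
    refine integrable_sq_of_lintegral hHb ?_
    have := hHl T 1
    simp only [one_mul] at this
    rw [this]
    exact (lintegral_mono_set Ioc_subset_Ioi_self).trans_lt hHi
  have hVi4 : ∀ i T, Integrable (fun q => V q.1 i q.2.1) (spacetime (κ i) T) := fun i T =>
    integrable_of_sq (hVb i).aestronglyMeasurable (hVi3 i T)
  refine ⟨V, H, κ, κn, hκf, hκnf, hκ, hκn, hVm, hHm, hVi3, hHi2, ?_, fun i => ?_, ?_, ?_⟩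
  · have hVfin : ∀ᵐ t ∂(volume.restrict (Ioi (0 : ℝ))), ∀ i,
        Integrable (fun z => V t i z.1 ^ 2) (grain (μ t) i : Measure (Space d × Sph d)) := by
      rw [ae_all_iff]
      intro i
      have hm : Measurable fun t => ∫⁻ z, ‖V t i z.1‖ₑ ^ 2 ∂(κ i t) :=
        Measurable.lintegral_kernel_prod_right
          (f := fun t (z : Space d × Sph d) => ‖V t i z.1‖ₑ ^ 2) ((hVb i).enorm.pow_const 2)
      have e : (fun t => ∫⁻ x, ‖V t i x‖ₑ ^ 2 ∂(mass (grain (μ t) i)))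
          =ᵐ[volume.restrict (Ioi 0)] fun t => ∫⁻ z, ‖V t i z.1‖ₑ ^ 2 ∂(κ i t) := by
        filter_upwards [hκ i] with t ht
        rw [lintegral_mass ((hVt t i).enorm.pow_const 2), ht]
      have hfin := hVi i
      rw [lintegral_congr_ae e] at hfin
      filter_upwards [ae_lt_top hm hfin.ne, hκ i] with t ht hk
      rw [hk] at ht
      have := integrable_sq_of_lintegral ((hVt t i).comp measurable_fst) ht
      simpa using this
    have hHfin : ∀ᵐ t ∂(volume.restrict (Ioi (0 : ℝ))),
        Integrable (fun z => ‖H t z.1‖ ^ 2) (network (μ t) : Measure (Space d × Sph d)) := by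
      have hm : Measurable fun t => ∫⁻ z, ‖H t z.1‖ₑ ^ 2 ∂(κn t) :=
        Measurable.lintegral_kernel_prod_right
          (f := fun t (z : Space d × Sph d) => ‖H t z.1‖ₑ ^ 2) (hHb.enorm.pow_const 2)
      have e : (fun t => ∫⁻ x, ‖H t x‖ₑ ^ 2 ∂(mass (network (μ t))))
          =ᵐ[volume.restrict (Ioi 0)] fun t => ∫⁻ z, ‖H t z.1‖ₑ ^ 2 ∂(κn t) := by
        filter_upwards [hκn] with t ht
        rw [lintegral_mass ((hHt t).enorm.pow_const 2), ht]
      have hfin := hHi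
      rw [lintegral_congr_ae e] at hfin
      filter_upwards [ae_lt_top hm hfin.ne, hκn] with t ht hk
      rw [hk] at ht
      exact integrable_sq_of_lintegral ((hHt t).comp measurable_fst) ht
    filter_upwards [hVfin, hHfin, hdir] with t h1 h2 h3
    exact ⟨hVt t, hHt t, h1, h2, fun i j hij => (h3 i j hij).mono fun x hx => hx.1,
      fun i j hij => (h3 i j hij).mono fun x hx => hx.2⟩
  · have hAm : ∀ t, 0 < t → MeasurableSet (A t i) := fun t ht =>
      ((h.partition t ht).isOpen i).measurableSet
    filter_upwards [hvel i, ae_restrict_mem measurableSet_Ioi] with T hT hT0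
    refine ⟨inferInstance, ae_spacetime_mem_Ioo, hVi4 i T, Measure.restrict_le_self,
      Measure.restrict_le_self, trackMeasure_le _ T, fun ζ hζ => ?_, fun F hF => ?_⟩
    · rw [hT ζ hζ, intervalIntegral.integral_of_le (le_of_lt hT0),
        intervalIntegral.integral_of_le (le_of_lt hT0),
        integral_trackMeasure (h.phase_measurable i) hAm ((hζ.fderiv_apply (1, 0)).integrable _)]
      congr 1
      · refine setIntegral_congr_fun measurableSet_Ioc fun t _ => ?_
        refine integral_congr_ae (Eventually.of_forall fun x => ?_)
        exact deriv_slice_time (q := (t, x)) (hζ.differentiable _)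
      · obtain ⟨C, hC⟩ := hζ.exists_bound
        have hi : Integrable (fun q => V q.1 i q.2.1 * ζ (base q)) (spacetime (κ i) T) :=
          (hVi4 i T).mul_bdd (c := C)
            (hζ.continuous.comp continuous_base).aestronglyMeasurable
            (Eventually.of_forall fun q => hC _)
        refine Eq.trans ?_ (integral_spacetime (hκ i) hi).symm
        refine integral_congr_ae (Eventually.of_forall fun t => ?_)
        exact integral_mass (h := fun x => V t i x * ζ (t, x))
          ((hVt t i).mul (hζ.continuous.comp (by fun_prop)).measurable).stronglyMeasurable
    · obtain ⟨C, hC⟩ := hF.exists_bound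
      have hFc := hF.continuous
      have hi : Integrable (fun q => inner ℝ (F (base q)) (q.2.2 : Space d))
          (spacetime (κ i) T) :=
        Integrable.mono' (integrable_const C) (Continuous.aestronglyMeasurable (by fun_prop))
          (Eventually.of_forall fun q => (abs_inner_sph_le _ _).trans (hC _))
      rw [integral_trackMeasure (h.phase_measurable i) hAm (hF.divX.integrable _),
        integral_spacetime (hκ i) hi, ← integral_neg]
      refine integral_congr_ae ?_
      filter_upwards [ae_restrict_Ioc_of_Ioi h.compatible, ae_restrict_mem measurableSet_Ioc]
        with t ht ht0
      refine Eq.trans ?_ (ht.integral_divergence (h.partition t ht0.1) i (hF.slice t))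
      refine integral_congr_ae (Eventually.of_forall fun x => ?_)
      exact (divergence_slice (q := (t, x)) (hF.differentiable _)).symm
  · filter_upwards [hcur, ae_restrict_mem measurableSet_Ioi] with T hT hT0 F hF
    have hT := hT F hF
    rw [intervalIntegral.integral_of_le (le_of_lt hT0),
      intervalIntegral.integral_of_le (le_of_lt hT0)] at hT
    obtain ⟨C, hC⟩ := hF.exists_bound
    have hFc := hF.continuous
    have hFb : Continuous fun q : ℝ × (Space d × Sph d) => F (base q) := by fun_prop
    have iH : Integrable (fun q => H q.1 q.2.1) (spacetime κn T) := by
      rw [← integrable_norm_iff hHb.aestronglyMeasurable]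
      exact integrable_of_sq hHb.norm.aestronglyMeasurable (hHi2 T)
    have i1 : Integrable (fun q => inner ℝ (H q.1 q.2.1) (F (base q))) (spacetime κn T) := by
      refine Integrable.mono' (iH.norm.mul_const C)
        (hHb.aestronglyMeasurable.inner hFb.aestronglyMeasurable)
        (Eventually.of_forall fun q => (abs_real_inner_le_norm _ _).trans ?_)
      gcongr; exact hC _
    have hDc : Continuous (fderiv ℝ F) := hF.1.continuous_fderiv (by simp)
    obtain ⟨C', hC'⟩ := (hF.2.fderiv (𝕜 := ℝ)).exists_bound_of_continuous hDc
    obtain ⟨C'', hC''⟩ := hF.divX.exists_bound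
    have hdc := hF.divX.continuous
    have i2 : Integrable (fun q : ℝ × (Space d × Sph d) => divX F (base q) -
        inner ℝ (q.2.2 : Space d) (fderiv ℝ F (base q) (0, (q.2.2 : Space d))))
        (spacetime κn T) := by
      refine Integrable.mono' (integrable_const (C'' + C')) (Continuous.aestronglyMeasurable
        (by fun_prop)) (Eventually.of_forall fun q => (norm_sub_le _ _).trans
          (add_le_add (hC'' _) ((abs_real_inner_le_norm _ _).trans ?_)))
      rw [norm_sph, one_mul]
      refine ((fderiv ℝ F (base q)).le_opNorm _).trans ?_
      rw [Prod.norm_def, norm_zero, norm_sph]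
      simpa using hC' _
    rw [integral_spacetime hκn i1, integral_spacetime hκn i2]
    refine Eq.trans (Eq.trans ?_ hT) ?_
    · refine integral_congr_ae (Eventually.of_forall fun t => ?_)
      exact (integral_mass (h := fun x => inner ℝ (H t x) (F (t, x)))
        ((hHt t).stronglyMeasurable.inner
          (hFc.comp (by fun_prop)).stronglyMeasurable)).symm
    · congr 1
      refine integral_congr_ae (Eventually.of_forall fun t => ?_)
      refine integral_congr_ae (Eventually.of_forall fun z => ?_)
      have e1 : divergence (fun y => F (t, y)) z.1 = divX F (t, z.1) :=
        divergence_slice (q := (t, z.1)) (hF.differentiable _)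
      have e2 : fderiv ℝ (fun y => F (t, y)) z.1 (z.2 : Space d) =
          fderiv ℝ F (t, z.1) (0, (z.2 : Space d)) :=
        fderiv_slice_space (q := (t, z.1)) (hF.differentiable _) _
      simp only [e1, e2, base]
  · filter_upwards [hen] with T hT
    simp only [mass_univ, ← hVl] at hT
    have e1 : ∀ i, ∫⁻ q, 2⁻¹ * ‖V q.1 i q.2.1‖ₑ ^ 2 ∂(spacetime (κ i) T) =
        ENNReal.ofReal (∫ q, 1 / 2 * V q.1 i q.2.1 ^ 2 ∂(spacetime (κ i) T)) := fun i => by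
      rw [ofReal_integral_sq (by simp) (hVi2 i T)]
      simp
    have e2 : ∫⁻ t in Ioc 0 T, ∫⁻ x, ‖H t x‖ₑ ^ 2 ∂(mass (network (μ t))) =
        ENNReal.ofReal (∫ q, ‖H q.1 q.2.1‖ ^ 2 ∂(spacetime κn T)) := by
      have := hHl T 1
      simp only [one_mul] at this
      rw [← this]
      have := ofReal_integral_sq (c := 1) (by simp) (hHi2 T)
      simpa using this
    have e3 : ∀ m : Varifold d, (m : Measure (Space d × Sph d)) univ =
        ENNReal.ofReal ((m : Measure (Space d × Sph d)).real univ) := fun m =>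
      (ENNReal.ofReal_toReal (measure_ne_top _ _)).symm
    have n1 : ∀ i, 0 ≤ ∫ q, 1 / 2 * V q.1 i q.2.1 ^ 2 ∂(spacetime (κ i) T) := fun i =>
      integral_nonneg fun q => by positivity
    have n2 : 0 ≤ ∫ q, ‖H q.1 q.2.1‖ ^ 2 ∂(spacetime κn T) :=
      integral_nonneg fun q => by positivity
    have e4 : (2⁻¹ : ℝ≥0∞) = ENNReal.ofReal 2⁻¹ := by
      rw [ENNReal.ofReal_inv_of_pos (by norm_num)]; simp
    simp only [e1] at hT
    rw [e2, e3 (network (μ T)), e3 (network μ₀), e4,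
      ← ENNReal.ofReal_sum_of_nonneg fun i _ => n1 i, ← ENNReal.ofReal_mul (by norm_num),
      ← ENNReal.ofReal_mul (by norm_num),
      ← ENNReal.ofReal_add measureReal_nonneg
        (mul_nonneg (by norm_num) (Finset.sum_nonneg fun i _ => n1 i)),
      ← ENNReal.ofReal_add (add_nonneg measureReal_nonneg
        (mul_nonneg (by norm_num) (Finset.sum_nonneg fun i _ => n1 i)))
        (mul_nonneg (by norm_num) n2), ENNReal.ofReal_le_ofReal_iff measureReal_nonneg] at hT
    refine le_trans (le_of_eq ?_) hT
    rw [Finset.mul_sum, ← integral_const_mul]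
    congr 1
    · congr 1
      refine Finset.sum_congr rfl fun i _ => ?_
      rw [← integral_const_mul]
      exact integral_congr_ae (Eventually.of_forall fun q => by ring)
    · exact integral_congr_ae (Eventually.of_forall fun q => by ring)

end SpacetimeForm

/-! ### Calibrations on the whole space-time -/

section Clamp

variable {d P : ℕ}

lemma truncDist_nonneg (x : Space d) (S : Set (Space d)) : 0 ≤ truncDist x S :=
  ENNReal.toReal_nonneg

lemma truncDist_le_one (x : Space d) (S : Set (Space d)) : truncDist x S ≤ 1 := by
  have := ENNReal.toReal_mono ENNReal.one_ne_top (min_le_left 1 (Metric.infEDist x S))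
  rwa [ENNReal.toReal_one] at this

lemma truncDist_anti (x : Space d) {S S' : Set (Space d)} (h : S ⊆ S') :
    truncDist x S' ≤ truncDist x S :=
  ENNReal.toReal_mono (ne_top_of_le_ne_top ENNReal.one_ne_top (min_le_left _ _))
    (min_le_min le_rfl (Metric.infEDist_anti h))

/-- The point of `[0, T]` closest to `t`. -/
def clampTime (T t : ℝ) : ℝ := max 0 (min T t)

lemma clampTime_mem {T : ℝ} (hT : 0 < T) (t : ℝ) : clampTime T t ∈ Icc 0 T :=
  ⟨le_max_left _ _, max_le hT.le (min_le_left _ _)⟩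

lemma clampTime_of_mem {T t : ℝ} (ht : t ∈ Icc 0 T) : clampTime T t = t := by
  rw [clampTime, min_eq_right ht.2, max_eq_right ht.1]

lemma lipschitzWith_clampTime (T : ℝ) : LipschitzWith 1 (clampTime T) := by
  have h := (LipschitzWith.id.const_min T).const_max 0 (f := fun t => min T (id t))
  exact h

@[fun_prop]
lemma continuous_clampTime (T : ℝ) : Continuous (clampTime T) := (lipschitzWith_clampTime T).continuous

/-- The extension of a field on `[0, T] × ℝ^d` to all times which is constant in time outside
`[0, T]`. -/
def clampField {Y : Type*} (T : ℝ) (f : ℝ → Space d → Y) (q : ℝ × Space d) : Y :=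
  f (clampTime T q.1) q.2

variable {Y : Type*} [NormedAddCommGroup Y] [NormedSpace ℝ Y]

lemma clampField_of_mem {T t : ℝ} (ht : t ∈ Icc 0 T) (f : ℝ → Space d → Y) (x : Space d) :
    clampField T f (t, x) = f t x := by simp [clampField, clampTime_of_mem ht]

lemma continuous_clampField {T : ℝ} (hT : 0 < T) {f : ℝ → Space d → Y}
    (hf : ContinuousOn (fun q : ℝ × Space d => f q.1 q.2) (Icc 0 T ×ˢ univ)) :
    Continuous (clampField T f) :=
  hf.comp_continuous (f := fun q : ℝ × Space d => (clampTime T q.1, q.2)) (by fun_prop)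
    fun q => ⟨clampTime_mem hT _, mem_univ _⟩

lemma lipschitzWith_clampField {T : ℝ} (hT : 0 < T) {f : ℝ → Space d → Y} {L : ℝ≥0}
    (hf : LipschitzOnWith L (fun q : ℝ × Space d => f q.1 q.2) (Icc 0 T ×ˢ univ)) :
    LipschitzWith L (clampField T f) := by
  have h1 : LipschitzWith 1 fun q : ℝ × Space d => (clampTime T q.1, q.2) := by
    have := ((lipschitzWith_clampTime T).comp LipschitzWith.prod_fst).prodMk
      (LipschitzWith.prod_snd (α := ℝ) (β := Space d))
    simpa using this
  intro q r
  have h2 := hf (x := (clampTime T q.1, q.2)) ⟨clampTime_mem hT _, mem_univ _⟩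
    (y := (clampTime T r.1, r.2)) ⟨clampTime_mem hT _, mem_univ _⟩
  refine h2.trans ?_
  gcongr
  simpa using h1 q r

/-- The fields of a calibration, extended to all times. -/
structure IsSpacetimeCalibration (T c C M : ℝ) (L : ℝ≥0) (ξ τ : Fin P → ℝ × Space d → Space d)
    (Dξ : Fin P → ℝ × Space d → Space d →L[ℝ] Space d) (B : ℝ × Space d → Space d)
    (DB : ℝ × Space d → Space d →L[ℝ] Space d) (ϑ : Fin P → ℝ × Space d → ℝ)
    (δ : ℝ → Fin P → Fin P → Space d → ℝ) : Prop where
  c_pos : 0 < c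
  C_nonneg : 0 ≤ C
  M_nonneg : 0 ≤ M
  xi_C1 : ∀ i, SpatiallyC1 (ξ i) (Dξ i) M
  xi_lip : ∀ i, LipschitzWith L (ξ i)
  tau_cont : ∀ i, Continuous (τ i)
  xi_deriv : ∀ i, ∀ t ∈ Ioo 0 T, ∀ x, HasDerivAt (fun s => ξ i (s, x)) (τ i (t, x)) t
  B_C1 : SpatiallyC1 B DB M
  calibrated : ∀ t, CalibratedAt c C M (fun i x => ξ i (t, x)) (fun i x => τ i (t, x))
    (fun i x => Dξ i (t, x)) (fun x => B (t, x)) (fun x => DB (t, x)) (δ t)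
  weight_lip : ∀ i, LipschitzWith L (ϑ i)
  weight_le : ∀ i q, |ϑ i q| ≤ M
  weight_sub_le : ∀ t i j, i ≠ j → ∀ x, |ϑ i (t, x) - ϑ j (t, x)| ≤ C * δ t i j x
  weight_transport : ∀ i, ∀ᵐ q ∂(volume.restrict (Ioo 0 T ×ˢ (univ : Set (Space d)))),
    |fderiv ℝ (ϑ i) q (1, 0) + fderiv ℝ (ϑ i) q (0, B q)| ≤ C * |ϑ i q|

variable {T : ℝ} {𝒜 : ℝ → Fin P → Set (Space d)} {ξ : ℝ → Fin P → Space d → Space d}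
  {B : ℝ → Space d → Space d} {ϑ : ℝ → Fin P → Space d → ℝ}

lemma uniqueDiffOn_slab {T : ℝ} (hT : 0 < T) :
    UniqueDiffOn ℝ (Icc 0 T ×ˢ (univ : Set (Space d))) :=
  (uniqueDiffOn_Icc hT).prod uniqueDiffOn_univ

/-! #### Slices of `C¹` fields on `[0, T] × ℝ^d` -/

section C1

variable {f : ℝ → Space d → Y}

lemma hasFDerivWithinAt_slab
    (hf : ContDiffOn ℝ 1 (fun q : ℝ × Space d => f q.1 q.2) (Icc 0 T ×ˢ univ)) {t : ℝ}
    (ht : t ∈ Icc 0 T) (x : Space d) :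
    HasFDerivWithinAt (fun q : ℝ × Space d => f q.1 q.2)
      (fderivWithin ℝ (fun q : ℝ × Space d => f q.1 q.2) (Icc 0 T ×ˢ univ) (t, x))
      (Icc 0 T ×ˢ univ) (t, x) :=
  (hf.differentiableOn (by simp) (t, x) ⟨ht, mem_univ _⟩).hasFDerivWithinAt

lemma hasFDerivAt_slab
    (hf : ContDiffOn ℝ 1 (fun q : ℝ × Space d => f q.1 q.2) (Icc 0 T ×ˢ univ)) {t : ℝ}
    (ht : t ∈ Icc 0 T) (x : Space d) :
    HasFDerivAt (f t)
      ((fderivWithin ℝ (fun q : ℝ × Space d => f q.1 q.2) (Icc 0 T ×ˢ univ) (t, x)).comp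
        (ContinuousLinearMap.inr ℝ ℝ (Space d))) x := by
  rw [← hasFDerivWithinAt_univ]
  exact (hasFDerivWithinAt_slab hf ht x).comp x
    (hasFDerivAt_prodMk_right t x).hasFDerivWithinAt fun y _ => ⟨ht, mem_univ _⟩

lemma hasDerivWithinAt_slab
    (hf : ContDiffOn ℝ 1 (fun q : ℝ × Space d => f q.1 q.2) (Icc 0 T ×ˢ univ)) {t : ℝ}
    (ht : t ∈ Icc 0 T) (x : Space d) :
    HasDerivWithinAt (fun s => f s x)
      (fderivWithin ℝ (fun q : ℝ × Space d => f q.1 q.2) (Icc 0 T ×ˢ univ) (t, x) (1, 0))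
      (Icc 0 T) t := by
  have h1 : HasDerivWithinAt (fun s : ℝ => (s, x)) ((1 : ℝ), (0 : Space d)) (Icc 0 T) t :=
    ((hasDerivAt_id t).prodMk (hasDerivAt_const t x)).hasDerivWithinAt
  exact (hasFDerivWithinAt_slab hf ht x).comp_hasDerivWithinAt t h1
    fun s hs => Set.mk_mem_prod hs (mem_univ _)

lemma derivWithin_slab (hT : 0 < T)
    (hf : ContDiffOn ℝ 1 (fun q : ℝ × Space d => f q.1 q.2) (Icc 0 T ×ˢ univ)) {t : ℝ}
    (ht : t ∈ Icc 0 T) (x : Space d) :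
    derivWithin (fun s => f s x) (Icc 0 T) t =
      fderivWithin ℝ (fun q : ℝ × Space d => f q.1 q.2) (Icc 0 T ×ˢ univ) (t, x) (1, 0) :=
  (hasDerivWithinAt_slab hf ht x).derivWithin (uniqueDiffOn_Icc hT t ht)

lemma continuousOn_fderivWithin_slab (hT : 0 < T)
    (hf : ContDiffOn ℝ 1 (fun q : ℝ × Space d => f q.1 q.2) (Icc 0 T ×ˢ univ)) :
    ContinuousOn (fderivWithin ℝ (fun q : ℝ × Space d => f q.1 q.2) (Icc 0 T ×ˢ univ))
      (Icc 0 T ×ˢ univ) :=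
  hf.continuousOn_fderivWithin (uniqueDiffOn_slab hT) (by simp)

lemma continuousOn_fderiv_slab (hT : 0 < T)
    (hf : ContDiffOn ℝ 1 (fun q : ℝ × Space d => f q.1 q.2) (Icc 0 T ×ˢ univ)) :
    ContinuousOn (fun q : ℝ × Space d => fderiv ℝ (f q.1) q.2) (Icc 0 T ×ˢ univ) := by
  refine ((continuousOn_fderivWithin_slab hT hf).clm_comp
    (continuousOn_const (c := ContinuousLinearMap.inr ℝ ℝ (Space d)))).congr fun q hq => ?_
  exact (hasFDerivAt_slab hf hq.1 q.2).fderiv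

lemma continuousOn_derivWithin_slab (hT : 0 < T)
    (hf : ContDiffOn ℝ 1 (fun q : ℝ × Space d => f q.1 q.2) (Icc 0 T ×ˢ univ)) :
    ContinuousOn (fun q : ℝ × Space d => derivWithin (fun s => f s q.2) (Icc 0 T) q.1)
      (Icc 0 T ×ˢ univ) := by
  refine ((continuousOn_fderivWithin_slab hT hf).clm_apply
    (continuousOn_const (c := ((1 : ℝ), (0 : Space d))))).congr fun q hq => ?_
  exact derivWithin_slab hT hf hq.1 q.2

lemma lipschitzOnWith_slab (hT : 0 < T)
    (hf : ContDiffOn ℝ 1 (fun q : ℝ × Space d => f q.1 q.2) (Icc 0 T ×ˢ univ)) {M : ℝ≥0}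
    (h1 : ∀ t ∈ Icc 0 T, ∀ x, ‖derivWithin (fun s => f s x) (Icc 0 T) t‖ ≤ M)
    (h2 : ∀ t ∈ Icc 0 T, ∀ x, ‖fderiv ℝ (f t) x‖ ≤ M) :
    LipschitzOnWith (2 * M) (fun q : ℝ × Space d => f q.1 q.2) (Icc 0 T ×ˢ univ) := by
  refine Convex.lipschitzOnWith_of_nnnorm_fderivWithin_le (𝕜 := ℝ)
    (hf.differentiableOn (by simp)) (fun q hq => ?_) ((convex_Icc 0 T).prod convex_univ)
  rw [← NNReal.coe_le_coe, coe_nnnorm]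
  refine ContinuousLinearMap.opNorm_le_bound _ (by positivity) fun v => ?_
  have e1 := derivWithin_slab hT hf hq.1 q.2
  have e2 := (hasFDerivAt_slab hf hq.1 q.2).fderiv
  have b1 := h1 q.1 hq.1 q.2
  have b2 := h2 q.1 hq.1 q.2
  rw [e1] at b1
  rw [e2] at b2
  set G := fderivWithin ℝ (fun q : ℝ × Space d => f q.1 q.2) (Icc 0 T ×ˢ univ) q
  have e3 : G v = v.1 • G (1, 0) + G.comp (ContinuousLinearMap.inr ℝ ℝ (Space d)) v.2 := by
    rw [← map_smul, ContinuousLinearMap.comp_apply, ContinuousLinearMap.inr_apply, ← map_add]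
    simp
  have e4 := (G.comp (ContinuousLinearMap.inr ℝ ℝ (Space d))).le_opNorm v.2
  have e5 : ‖v.1 • G (1, 0)‖ ≤ ‖v‖ * M := by
    rw [norm_smul]
    exact mul_le_mul (norm_fst_le v) b1 (norm_nonneg _) (norm_nonneg _)
  have e6 : ‖G.comp (ContinuousLinearMap.inr ℝ ℝ (Space d))‖ * ‖v.2‖ ≤ M * ‖v‖ :=
    mul_le_mul b2 (norm_snd_le v) (norm_nonneg _) (by positivity)
  have e7 := norm_add_le (v.1 • G (1, 0)) (G.comp (ContinuousLinearMap.inr ℝ ℝ (Space d)) v.2)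
  rw [← e3] at e7
  push_cast
  linarith

end C1

lemma interface_subset_frontier (h : IsCalibratedEvolution T 𝒜 ξ B ϑ) {t : ℝ} (ht : t ∈ Icc 0 T)
    (i j : Fin P) : interface (𝒜 t) i j ⊆ frontier (𝒜 t i) := by
  rw [h.frontier_eq t ht i]
  exact inter_subset_left.trans subset_closure

lemma interface_symm (A : Fin P → Set (Space d)) (i j : Fin P) :
    interface A i j = interface A j i := inter_comm _ _

/-- The fields of a calibrated evolution, frozen in time outside `[0, T]`, form a calibration on
space-time. -/
theorem IsCalibratedEvolution.exists_spacetimeCalibration (hT : 0 < T)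
    (h : IsCalibratedEvolution T 𝒜 ξ B ϑ) :
    ∃ c C M L, IsSpacetimeCalibration T c C M L (fun i => clampField T fun t => ξ t i)
      (fun i => clampField T fun t x => derivWithin (fun s => ξ s i x) (Icc 0 T) t)
      (fun i => clampField T fun t => fderiv ℝ (ξ t i)) (clampField T B)
      (clampField T fun t => fderiv ℝ (B t)) (fun i => clampField T fun t => ϑ t i)
      (fun t i j x => truncDist x (interface (𝒜 (clampTime T t)) i j)) := by
  obtain ⟨M₁, hM₁⟩ := h.xi_bounded
  obtain ⟨M₂, hM₂⟩ := h.B_bounded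
  choose L₁ hL₁ using h.weight_lipschitz
  obtain ⟨c₁, hc₁, -, hlen⟩ := h.length_control
  obtain ⟨C₁, hC₁⟩ := h.transport_xi
  obtain ⟨C₂, hC₂⟩ := h.transport_length
  obtain ⟨C₃, hC₃⟩ := h.mean_curvature
  obtain ⟨C₄, hC₄⟩ := h.weight_transport
  obtain ⟨c₅, C₅, hc₅, -, hC₅1, hcoer⟩ := h.weight_coercive
  have hC₅ : 0 ≤ C₅ := by linarith
  set C : ℝ := |C₁| + |C₂| + |C₃| + |C₄| / c₅ + 2 * C₅ with hC
  have p1 := abs_nonneg C₁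
  have p2 := abs_nonneg C₂
  have p3 := abs_nonneg C₃
  have p4 : 0 ≤ |C₄| / c₅ := by positivity
  have a1 := le_abs_self C₁
  have a2 := le_abs_self C₂
  have a3 := le_abs_self C₃
  set M : ℝ := |M₁| + |M₂| + C₅ with hM
  have m1 := le_abs_self M₁
  have m2 := le_abs_self M₂
  have q1 := abs_nonneg M₁
  have q2 := abs_nonneg M₂
  have hM0 : 0 ≤ M := by positivity
  set L : ℝ≥0 := 2 * ⟨M, hM0⟩ + ∑ i, L₁ i with hL
  have hmem : ∀ t, clampTime T t ∈ Icc 0 T := clampTime_mem hT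
  have hxiC : ∀ i t x, HasFDerivAt (ξ (clampTime T t) i) (fderiv ℝ (ξ (clampTime T t) i) x) x :=
    fun i t x => (hasFDerivAt_slab (f := fun t => ξ t i) (h.xi_contDiff i)
      (hmem t) x).differentiableAt.hasFDerivAt
  have hdiff : ∀ i j t, t ∈ Icc 0 T → ∀ x, fderiv ℝ (xiDiff ξ i j t) x =
      fderiv ℝ (ξ t i) x - fderiv ℝ (ξ t j) x := fun i j t ht x =>
    fderiv_sub (hasFDerivAt_slab (f := fun t => ξ t i) (h.xi_contDiff i) ht x).differentiableAt
      (hasFDerivAt_slab (f := fun t => ξ t j) (h.xi_contDiff j) ht x).differentiableAt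
  have hdiff' : ∀ i j t, t ∈ Icc 0 T → ∀ x,
      derivWithin (fun s => xiDiff ξ i j s x) (Icc 0 T) t =
      derivWithin (fun s => ξ s i x) (Icc 0 T) t - derivWithin (fun s => ξ s j x) (Icc 0 T) t :=
    fun i j t ht x => derivWithin_sub
      (hasDerivWithinAt_slab (f := fun t => ξ t i) (h.xi_contDiff i) ht x).differentiableWithinAt
      (hasDerivWithinAt_slab (f := fun t => ξ t j) (h.xi_contDiff j) ht x).differentiableWithinAt
  have hξc : ∀ i, Continuous (clampField T fun t => ξ t i) := fun i =>
    continuous_clampField hT (h.xi_contDiff i).continuousOn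
  have hDξc : ∀ i, Continuous (clampField T fun t => fderiv ℝ (ξ t i)) := fun i =>
    continuous_clampField hT (continuousOn_fderiv_slab (f := fun t => ξ t i) hT (h.xi_contDiff i))
  have hτc : ∀ i, Continuous
      (clampField T fun t x => derivWithin (fun s => ξ s i x) (Icc 0 T) t) := fun i =>
    continuous_clampField hT
      (continuousOn_derivWithin_slab (f := fun t => ξ t i) hT (h.xi_contDiff i))
  have hBc : Continuous (clampField T B) := continuous_clampField hT h.B_continuous
  have hDBc : Continuous (clampField T fun t => fderiv ℝ (B t)) :=
    continuous_clampField hT h.B_fderiv_continuous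
  have hδ0 : ∀ t i j x, 0 ≤ truncDist x (interface (𝒜 t) i j) := fun t i j x =>
    truncDist_nonneg _ _
  have hwle : ∀ t ∈ Icc 0 T, ∀ i j x, |ϑ t i x| ≤ C₅ * truncDist x (interface (𝒜 t) i j) :=
    fun t ht i j x => ((hcoer i t ht x).2).trans (by
      gcongr; exact truncDist_anti x (interface_subset_frontier h ht i j))
  have hLip : ∀ i, LipschitzOnWith L (fun q : ℝ × Space d => ϑ q.1 i q.2) (Icc 0 T ×ˢ univ) :=
    fun i => (hL₁ i).weaken (le_trans
      (Finset.single_le_sum (f := L₁) (fun _ _ => zero_le) (Finset.mem_univ i)) le_add_self)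
  have hwlip : ∀ i, LipschitzWith L (clampField T fun t => ϑ t i) := fun i =>
    lipschitzWith_clampField (f := fun t => ϑ t i) hT (hLip i)
  refine ⟨c₁, C, M, L, hc₁, by positivity, hM0, fun i => ?_, fun i => ?_, hτc, fun i t ht x => ?_,
    ?_, fun t => ?_, hwlip, fun i q => ?_, fun t i j hij x => ?_, fun i => ?_⟩
  · exact ⟨hξc i, fun q => (hM₁ i _ (hmem q.1) q.2).1.trans (by linarith),
      fun t x => hxiC i t x, hDξc i, fun q => (hM₁ i _ (hmem q.1) q.2).2.2.trans (by linarith)⟩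
  · refine lipschitzWith_clampField (f := fun t => ξ t i) hT
      ((lipschitzOnWith_slab (f := fun t => ξ t i) hT (h.xi_contDiff i) (M := ⟨M, hM0⟩)
        (fun t ht x => ?_) fun t ht x => ?_).weaken le_self_add)
    · exact (hM₁ i t ht x).2.1.trans (by change M₁ ≤ M; linarith)
    · exact (hM₁ i t ht x).2.2.trans (by change M₁ ≤ M; linarith)
  · have ht' := Ioo_subset_Icc_self ht
    have h1 := hasDerivWithinAt_slab (f := fun t => ξ t i) (h.xi_contDiff i) ht' x
    rw [clampField_of_mem ht', derivWithin_slab (f := fun t => ξ t i) hT (h.xi_contDiff i) ht' x]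
    refine (h1.hasDerivAt (Icc_mem_nhds ht.1 ht.2)).congr_of_eventuallyEq ?_
    filter_upwards [Icc_mem_nhds ht.1 ht.2] with s hs
    exact clampField_of_mem hs _ _
  · exact ⟨hBc, fun q => (hM₂ _ (hmem q.1) q.2).1.trans (by linarith),
      fun t x => (h.B_differentiable _ (hmem t) x).hasFDerivAt, hDBc,
      fun q => (hM₂ _ (hmem q.1) q.2).2.trans (by linarith)⟩
  · refine ⟨fun i => (hξc i).comp (by fun_prop), fun i => (hτc i).comp (by fun_prop),
      fun i => (hDξc i).comp (by fun_prop), hBc.comp (by fun_prop), hDBc.comp (by fun_prop),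
      fun i x => ?_, fun i x => ?_, fun i x => ?_, fun x => ?_, fun x => ?_,
      fun i j x => hδ0 _ i j x, fun i j hij x => hlen i j hij _ (hmem t) x,
      fun i j hij x => ?_, fun i j hij x => ?_, fun i j hij x => ?_⟩
    · exact (hM₁ i _ (hmem t) x).1.trans (by linarith)
    · exact (hM₁ i _ (hmem t) x).2.1.trans (by linarith)
    · exact (hM₁ i _ (hmem t) x).2.2.trans (by linarith)
    · exact (hM₂ _ (hmem t) x).1.trans (by linarith)
    · exact (hM₂ _ (hmem t) x).2.trans (by linarith)
    · have h1 := hC₃ i j hij _ (hmem t) x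
      rw [divergence_eq_traceL, hdiff i j _ (hmem t)] at h1
      exact h1.trans (mul_le_mul_of_nonneg_right (by linarith) (hδ0 _ i j x))
    · have h1 := hC₁ i j hij _ (hmem t) x
      rw [hdiff i j _ (hmem t), hdiff' i j _ (hmem t)] at h1
      exact h1.trans (mul_le_mul_of_nonneg_right (by linarith) (hδ0 _ i j x))
    · have h1 := hC₂ i j hij _ (hmem t) x
      rw [hdiff i j _ (hmem t), hdiff' i j _ (hmem t)] at h1
      exact h1.trans (mul_le_mul_of_nonneg_right (by linarith) (sq_nonneg _))
  · have h1 := (hcoer i _ (hmem q.1) q.2).2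
    have h2 := truncDist_le_one q.2 (frontier (𝒜 (clampTime T q.1) i))
    have h3 : C₅ * truncDist q.2 (frontier (𝒜 (clampTime T q.1) i)) ≤ C₅ * 1 := by gcongr
    change |ϑ _ i _| ≤ M
    linarith
  · have h1 := hwle _ (hmem t) i j x
    have h2 := hwle _ (hmem t) j i x
    rw [interface_symm] at h2
    change |ϑ _ i x - ϑ _ j x| ≤ _
    refine (abs_sub _ _).trans ((add_le_add h1 h2).trans ?_)
    rw [← add_mul]
    exact mul_le_mul_of_nonneg_right (by linarith) (hδ0 _ i j x)
  · have hd : ∀ᵐ q ∂(volume.restrict (Ioo 0 T ×ˢ (univ : Set (Space d)))),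
        DifferentiableAt ℝ (clampField T fun t => ϑ t i) q := by
      have : (volume : Measure (ℝ × Space d)).IsAddHaarMeasure := by
        rw [Measure.volume_eq_prod]; infer_instance
      exact ae_restrict_of_ae (hwlip i).ae_differentiableAt
    filter_upwards [hC₄ i, hd, ae_restrict_mem (measurableSet_Ioo.prod MeasurableSet.univ)]
      with q h1 h2 hq
    have hq' := Ioo_subset_Icc_self hq.1
    have e1 : fderiv ℝ (clampField T fun t => ϑ t i) q (1, 0) =
        deriv (fun s => ϑ s i q.2) q.1 := by
      rw [← deriv_slice_time h2]
      refine Filter.EventuallyEq.deriv_eq ?_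
      filter_upwards [Icc_mem_nhds hq.1.1 hq.1.2] with s hs
      exact clampField_of_mem hs _ _
    have e2 : fderiv ℝ (clampField T fun t => ϑ t i) q (0, clampField T B q) =
        fderiv ℝ (ϑ q.1 i) q.2 (B q.1 q.2) := by
      rw [← fderiv_slice_space h2]
      have : (fun y => clampField T (fun t => ϑ t i) (q.1, y)) = ϑ q.1 i := by
        funext y; exact clampField_of_mem hq' _ _
      rw [this]
      congr 1
      exact clampField_of_mem (x := q.2) hq' B
    rw [e1, e2]
    refine h1.trans ?_
    have h3 := (hcoer i _ hq' q.2).1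
    have e3 : clampField T (fun t => ϑ t i) q = ϑ q.1 i q.2 :=
      clampField_of_mem (x := q.2) hq' _
    rw [e3]
    have h4 : C₄ * truncDist q.2 (frontier (𝒜 q.1 i)) ≤
        |C₄| / c₅ * (c₅ * truncDist q.2 (frontier (𝒜 q.1 i))) := by
      rw [← mul_assoc, div_mul_cancel₀ _ hc₅.ne']
      exact mul_le_mul_of_nonneg_right (le_abs_self _) (truncDist_nonneg _ _)
    refine h4.trans ((mul_le_mul_of_nonneg_left h3 p4).trans ?_)
    exact mul_le_mul_of_nonneg_right (by linarith) (abs_nonneg _)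

end Clamp

/-! ### Stability of the relative entropy -/

section Entropy

open ProbabilityTheory

variable {d P : ℕ}

/-- For compatible varifolds the relative entropy is the total mass plus the flux of the calibration
through the boundaries of the phases. -/
lemma relEntropy_eq_flux {m : Fin P → Fin P → Varifold d} {A : Fin P → Set (Space d)}
    (hm : IsCompatible m A) {ξ : ℝ → Fin P → Space d → Space d} {t : ℝ}
    (hξ : ∀ i, Continuous (ξ t i)) {M : ℝ} (hM : ∀ i x, ‖ξ t i x‖ ≤ M) :
    relEntropy m ξ t = (network m : Measure (Space d × Sph d)).real univ +
      ∑ i, ∫ z, inner ℝ (ξ t i z.1) (z.2 : Space d) ∂(grain m i : Measure (Space d × Sph d)) := by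
  have hi : ∀ i m', Integrable (fun z : Space d × Sph d => inner ℝ (ξ t i z.1) (z.2 : Space d))
      (m' : Varifold d) := fun i m' => integrable_inner_varifold m' (hξ i) (hM i)
  set F : Fin P → Fin P → ℝ := fun i j =>
    ∫ z, inner ℝ (ξ t i z.1) (z.2 : Space d) ∂(m j i : Measure (Space d × Sph d)) with hF
  have h1 : ∀ i, ∫ z, inner ℝ (ξ t i z.1) (z.2 : Space d)
      ∂(grain m i : Measure (Space d × Sph d)) = ∑ j ∈ Finset.univ.erase i, F i j := fun i => by
    rw [integral_grain m i (hi i _), integral_inner_eq_zero (hm.normal_diag i) (hξ i) (hM i)]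
    simp [hF]
  have h2 : ∀ i, ∀ j ∈ Finset.univ.erase i, ∫ z, inner ℝ (z.2 : Space d) (xiDiff ξ i j t z.1)
      ∂(m i j : Measure (Space d × Sph d)) = -(F i j + F j i) := fun i j hj => by
    have hij : i ≠ j := (Finset.ne_of_mem_erase hj).symm
    have e1 : F i j = -∫ z, inner ℝ (ξ t i z.1) (z.2 : Space d)
        ∂(m i j : Measure (Space d × Sph d)) :=
      integral_inner_swap (hm.mass_symm j i hij.symm) (hm.normal_antisymm j i hij.symm) (hξ i) (hM i)
    have e2 : ∀ z : Space d × Sph d, inner ℝ (z.2 : Space d) (xiDiff ξ i j t z.1) =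
        inner ℝ (ξ t i z.1) (z.2 : Space d) - inner ℝ (ξ t j z.1) (z.2 : Space d) := fun z => by
      rw [real_inner_comm, xiDiff, inner_sub_left]
    simp only [e2]
    rw [integral_sub (hi i _) (hi j _), e1]
    simp only [hF]
    ring
  have h3 : (mass (network m)).real univ = (network m : Measure (Space d × Sph d)).real univ := by
    simp only [measureReal_def, mass_univ]
  simp only [relEntropy, h3, h1]
  rw [Finset.sum_congr rfl fun i _ => Finset.sum_congr rfl (h2 i)]
  simp only [Finset.sum_neg_distrib, Finset.sum_add_distrib]
  rw [← sum_erase_comm F]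
  ring

variable {μ₀ : Fin P → Fin P → Varifold d} {A₀ : Fin P → Set (Space d)}
  {μ : ℝ → Fin P → Fin P → Varifold d} {A : ℝ → Fin P → Set (Space d)}
  {V : ℝ → Fin P → Space d → ℝ} {H : ℝ → Space d → Space d}
  {κ : Fin P → Kernel ℝ (Space d × Sph d)} {κn : Kernel ℝ (Space d × Sph d)}
  {Tc c C M : ℝ} {L : ℝ≥0} {ξ τ : Fin P → ℝ × Space d → Space d}
  {Dξ : Fin P → ℝ × Space d → Space d →L[ℝ] Space d} {B : ℝ × Space d → Space d}
  {DB : ℝ × Space d → Space d →L[ℝ] Space d} {ϑ : Fin P → ℝ × Space d → ℝ}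
  {δ : ℝ → Fin P → Fin P → Space d → ℝ}

/-- `grainTerm` as a function on space-time. -/
noncomputable def grainDensity (V w : ℝ × Space d → ℝ) (ξ τ B : ℝ × Space d → Space d)
    (Dξ DB : ℝ × Space d → Space d →L[ℝ] Space d) (q : ℝ × (Space d × Sph d)) : ℝ :=
  inner ℝ (τ (base q) - wedgeField ξ B Dξ DB (base q) + w (base q) • B (base q))
    (q.2.2 : Space d) + V (base q) * traceL (Dξ (base q)) - 1 / 4 * V (base q) ^ 2 -
      w (base q) * V (base q)

/-- `networkTerm` as a function on space-time. -/
noncomputable def networkDensity (H B : ℝ × Space d → Space d)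
    (DB : ℝ × Space d → Space d →L[ℝ] Space d) (q : ℝ × (Space d × Sph d)) : ℝ :=
  inner ℝ (H (base q)) (B (base q)) - 1 / 2 * ‖H (base q)‖ ^ 2 +
    (traceL (DB (base q)) - inner ℝ (q.2.2 : Space d) (DB (base q) (q.2.2 : Space d)))

lemma integral_sub_add_eq {Z : Type*} [MeasurableSpace Z] {γ : Measure Z} {f g h : Z → ℝ}
    (hf : Integrable f γ) (hg : Integrable g γ) (hh : Integrable h γ) :
    ∫ z, (f z - g z + h z) ∂γ = ∫ z, f z ∂γ - ∫ z, g z ∂γ + ∫ z, h z ∂γ := by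
  rw [← integral_sub hf hg]
  exact integral_add (hf.sub hg) hh

section Integrability

variable {Γ : Measure (ℝ × (Space d × Sph d))} [IsFiniteMeasure Γ]

lemma integrable_inner_base {u : ℝ × Space d → Space d} (hu : Continuous u) {N : ℝ}
    (hN : ∀ q, ‖u q‖ ≤ N) :
    Integrable (fun q : ℝ × (Space d × Sph d) => inner ℝ (u (base q)) (q.2.2 : Space d)) Γ :=
  Integrable.mono' (integrable_const N) (Continuous.aestronglyMeasurable (by fun_prop))
    (Eventually.of_forall fun q => (abs_inner_sph_le _ _).trans (hN _))

lemma integrable_mul_base {V f : ℝ × Space d → ℝ} (hV : Integrable (fun q => V (base q)) Γ)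
    (hf : Continuous f) {N : ℝ} (hN : ∀ q, |f q| ≤ N) :
    Integrable (fun q : ℝ × (Space d × Sph d) => V (base q) * f (base q)) Γ :=
  hV.mul_bdd (c := N) (Continuous.aestronglyMeasurable (by fun_prop))
    (Eventually.of_forall fun q => hN _)

end Integrability

namespace IsSpacetimeCalibration

lemma norm_wedgeField_le
    (hc : IsSpacetimeCalibration Tc c C M L ξ τ Dξ B DB ϑ δ) (i : Fin P) (q : ℝ × Space d) :
    ‖wedgeField (ξ i) B (Dξ i) DB q‖ ≤ (2 + 2 * d) * M ^ 2 :=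
  norm_wedgeAt_le ((hc.xi_C1 i).norm_le q) (hc.B_C1.norm_le q) ((hc.xi_C1 i).norm_deriv_le q)
    (hc.B_C1.norm_deriv_le q)

lemma continuous_wedgeField
    (hc : IsSpacetimeCalibration Tc c C M L ξ τ Dξ B DB ϑ δ) (i : Fin P) :
    Continuous (wedgeField (ξ i) B (Dξ i) DB) := by
  have h1 := (hc.xi_C1 i).continuous
  have h2 := (hc.xi_C1 i).continuous_deriv
  have h3 := hc.B_C1.continuous
  have h4 := hc.B_C1.continuous_deriv
  unfold wedgeField
  fun_prop

lemma tau_le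
    (hc : IsSpacetimeCalibration Tc c C M L ξ τ Dξ B DB ϑ δ) (i : Fin P) (q : ℝ × Space d) :
    ‖τ i q‖ ≤ M := (hc.calibrated q.1).tau_le i q.2

lemma abs_trace_le
    (hc : IsSpacetimeCalibration Tc c C M L ξ τ Dξ B DB ϑ δ) (i : Fin P) (q : ℝ × Space d) :
    |traceL (Dξ i q)| ≤ d * M := (hc.calibrated q.1).abs_trace_le i q.2

end IsSpacetimeCalibration

namespace IsSpacetimeForm

lemma integrable_V (hf : IsSpacetimeForm μ₀ A₀ μ A V H κ κn) (i : Fin P) (T : ℝ) :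
    Integrable (fun q : ℝ × (Space d × Sph d) => V q.1 i q.2.1) (spacetime (κ i) T) := by
  have := hf.finite i
  exact integrable_of_sq ((hf.V_meas i).comp measurable_base).aestronglyMeasurable (hf.V_int i T)

lemma integrable_H (hf : IsSpacetimeForm μ₀ A₀ μ A V H κ κn) (T : ℝ) :
    Integrable (fun q : ℝ × (Space d × Sph d) => H q.1 q.2.1) (spacetime κn T) := by
  have := hf.finite_network
  have hH : Measurable fun q : ℝ × (Space d × Sph d) => H q.1 q.2.1 :=
    hf.H_meas.comp measurable_base
  rw [← integrable_norm_iff hH.aestronglyMeasurable]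
  exact integrable_of_sq hH.norm.aestronglyMeasurable (hf.H_int T)

lemma integrable_grainDensity (hf : IsSpacetimeForm μ₀ A₀ μ A V H κ κn)
    (hc : IsSpacetimeCalibration Tc c C M L ξ τ Dξ B DB ϑ δ) (i : Fin P) (T : ℝ)
    {w : ℝ × Space d → ℝ} (hw : Continuous w) (hwM : ∀ q, |w q| ≤ M) :
    Integrable (grainDensity (fun q => V q.1 i q.2) w (ξ i) (τ i) B (Dξ i) DB)
      (spacetime (κ i) T) := by
  have := hf.finite i
  have h1 := hc.continuous_wedgeField i
  have h2 := hc.tau_cont i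
  have h3 := hc.B_C1.continuous
  have h4 := (hc.xi_C1 i).continuous_deriv
  have i1 : Integrable (fun q : ℝ × (Space d × Sph d) => inner ℝ (τ i (base q) -
      wedgeField (ξ i) B (Dξ i) DB (base q) + w (base q) • B (base q)) (q.2.2 : Space d))
      (spacetime (κ i) T) := by
    refine integrable_inner_base (u := fun q => τ i q - wedgeField (ξ i) B (Dξ i) DB q + w q • B q)
      (by fun_prop) (N := M + (2 + 2 * d) * M ^ 2 + M * M) fun q => ?_
    refine (norm_add_le _ _).trans (add_le_add ((norm_sub_le _ _).trans
      (add_le_add (hc.tau_le i q) (hc.norm_wedgeField_le i q))) ?_)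
    rw [norm_smul]
    exact mul_le_mul (hwM q) (hc.B_C1.norm_le q) (norm_nonneg _) hc.M_nonneg
  have i2 := integrable_mul_base (V := fun q => V q.1 i q.2) (hf.integrable_V i T)
    (f := fun q => traceL (Dξ i q)) (by fun_prop) (hc.abs_trace_le i)
  have i3 := integrable_mul_base (V := fun q => V q.1 i q.2) (hf.integrable_V i T) hw hwM
  refine (((i1.add i2).sub ((hf.V_int i T).const_mul (1 / 4))).sub i3).congr
    (Eventually.of_forall fun q => ?_)
  simp only [grainDensity, Pi.add_apply, Pi.sub_apply, base]
  ring

lemma integrable_networkDensity (hf : IsSpacetimeForm μ₀ A₀ μ A V H κ κn)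
    (hc : IsSpacetimeCalibration Tc c C M L ξ τ Dξ B DB ϑ δ) (T : ℝ) :
    Integrable (networkDensity (fun q => H q.1 q.2) B DB) (spacetime κn T) ∧
      Integrable (fun q : ℝ × (Space d × Sph d) => inner ℝ (H q.1 q.2.1) (B (base q)))
        (spacetime κn T) ∧
      Integrable (fun q : ℝ × (Space d × Sph d) => traceL (DB (base q)) -
        inner ℝ (q.2.2 : Space d) (DB (base q) (q.2.2 : Space d))) (spacetime κn T) := by
  have := hf.finite_network
  have h3 := hc.B_C1.continuous
  have h4 := hc.B_C1.continuous_deriv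
  have i1 : Integrable (fun q : ℝ × (Space d × Sph d) => inner ℝ (H q.1 q.2.1) (B (base q)))
      (spacetime κn T) := by
    have hB : Continuous fun q : ℝ × (Space d × Sph d) => B (base q) := by fun_prop
    refine Integrable.mono' ((hf.integrable_H T).norm.mul_const M)
      ((hf.integrable_H T).aestronglyMeasurable.inner hB.aestronglyMeasurable)
      (Eventually.of_forall fun z => (abs_real_inner_le_norm _ _).trans ?_)
    gcongr; exact hc.B_C1.norm_le _
  have i2 : Integrable (fun q : ℝ × (Space d × Sph d) => traceL (DB (base q)) -
      inner ℝ (q.2.2 : Space d) (DB (base q) (q.2.2 : Space d))) (spacetime κn T) := by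
    refine Integrable.mono' (integrable_const (d * M + M))
      (Continuous.aestronglyMeasurable (by fun_prop))
      (Eventually.of_forall fun z => (norm_sub_le _ _).trans (add_le_add ?_ ?_))
    · exact (abs_traceL_le _).trans (by gcongr; exact hc.B_C1.norm_deriv_le _)
    · refine (abs_real_inner_le_norm _ _).trans ?_
      have h1 := (DB (base z)).le_opNorm (z.2.2 : Space d)
      rw [norm_sph, mul_one] at h1
      rw [norm_sph, one_mul]
      exact h1.trans (hc.B_C1.norm_deriv_le _)
  exact ⟨(i1.sub ((hf.H_int T).const_mul (1 / 2))).add i2, i1, i2⟩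

/-- For a compatible configuration the relative entropy is affine in the fluxes of the `ξ_i` through
the grains. -/
lemma ae_relEntropy_eq
    (hcomp : ∀ᵐ t ∂(volume.restrict (Ioi (0 : ℝ))), IsCompatible (μ t) (A t))
    (hc : IsSpacetimeCalibration Tc c C M L ξ τ Dξ B DB ϑ δ) :
    ∀ᵐ t ∂(volume.restrict (Ioi (0 : ℝ))),
      relEntropy (μ t) (fun t i x => ξ i (t, x)) t =
        ∫ _z, (1 : ℝ) ∂(network (μ t) : Measure (Space d × Sph d)) +
          ∑ i, ∫ z, inner ℝ (ξ i (base (t, z))) (z.2 : Space d)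
            ∂(grain (μ t) i : Measure (Space d × Sph d)) := by
  filter_upwards [hcomp] with t ht
  rw [relEntropy_eq_flux (ξ := fun t i x => ξ i (t, x)) ht
    (fun i => (hc.calibrated t).xi_cont i) (fun i x => (hc.calibrated t).xi_le i x)]
  simp [base]

lemma integrable_relEntropy (hf : IsSpacetimeForm μ₀ A₀ μ A V H κ κn)
    (hcomp : ∀ᵐ t ∂(volume.restrict (Ioi (0 : ℝ))), IsCompatible (μ t) (A t))
    (hc : IsSpacetimeCalibration Tc c C M L ξ τ Dξ B DB ϑ δ) (T : ℝ) :
    IntegrableOn (fun t => relEntropy (μ t) (fun t i x => ξ i (t, x)) t) (Ioc 0 T) := by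
  have := hf.finite_network
  have := hf.finite
  have i1 := integrable_integral_spacetime (T := T) hf.network_eq
    (f := fun _ => (1 : ℝ)) (integrable_const _)
  have i2 := fun i => integrable_integral_spacetime (T := T) (hf.grain_eq i)
    (integrable_inner_base (Γ := spacetime (κ i) T) (hc.xi_C1 i).continuous (hc.xi_C1 i).norm_le)
  refine (i1.add (integrable_finsetSum Finset.univ fun i _ => i2 i)).congr ?_
  filter_upwards [ae_restrict_Ioc_of_Ioi (ae_relEntropy_eq hcomp hc)] with t ht
  rw [ht]
  simp [base]

/-- The dissipation is controlled by the time integral of the relative entropy. -/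
lemma exists_dissipation_le (P : ℕ) {Tc c C M : ℝ} {L : ℝ≥0} {ξ τ : Fin P → ℝ × Space d → Space d}
    {Dξ : Fin P → ℝ × Space d → Space d →L[ℝ] Space d} {B : ℝ × Space d → Space d}
    {DB : ℝ × Space d → Space d →L[ℝ] Space d} {ϑ : Fin P → ℝ × Space d → ℝ}
    {δ : ℝ → Fin P → Fin P → Space d → ℝ}
    (hc : IsSpacetimeCalibration Tc c C M L ξ τ Dξ B DB ϑ δ) :
    ∃ K : ℝ, 0 ≤ K ∧ ∀ (μ₀ : Fin P → Fin P → Varifold d) (A₀ : Fin P → Set (Space d))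
      (μ : ℝ → Fin P → Fin P → Varifold d) (A : ℝ → Fin P → Set (Space d))
      (V : ℝ → Fin P → Space d → ℝ) (H : ℝ → Space d → Space d)
      (κ : Fin P → Kernel ℝ (Space d × Sph d)) (κn : Kernel ℝ (Space d × Sph d)),
      IsSpacetimeForm μ₀ A₀ μ A V H κ κn →
      (∀ᵐ t ∂(volume.restrict (Ioi (0 : ℝ))), IsCompatible (μ t) (A t)) →
      ∀ w : Fin P → ℝ × Space d → ℝ, (∀ i, Continuous (w i)) → (∀ i q, |w i q| ≤ M) →
      (∀ t i j, i ≠ j → ∀ x, |w i (t, x) - w j (t, x)| ≤ C * δ t i j x) → ∀ T,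
      ∑ i, ∫ q, grainDensity (fun q => V q.1 i q.2) (w i) (ξ i) (τ i) B (Dξ i) DB q
          ∂(spacetime (κ i) T) +
        ∫ q, networkDensity (fun q => H q.1 q.2) B DB q ∂(spacetime κn T) ≤
        K * ∫ t in Ioc 0 T, relEntropy (μ t) (fun t i x => ξ i (t, x)) t := by
  obtain ⟨K, hK0, hK⟩ := exists_fixed_time_bound (d := d) P hc.c_pos hc.C_nonneg hc.M_nonneg
  refine ⟨K, hK0, fun μ₀ A₀ μ A V H κ κn hf hcomp w hwc hwM hwδ T => ?_⟩
  have := hf.finite_network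
  have := hf.finite
  have ig := fun i => hf.integrable_grainDensity hc i T (hwc i) (hwM i)
  have inn := (hf.integrable_networkDensity hc T).1
  rw [integral_spacetime hf.network_eq inn]
  simp only [integral_spacetime (hf.grain_eq _) (ig _)]
  have ig2 := fun i => integrable_integral_spacetime (hf.grain_eq i) (ig i)
  have in2 := integrable_integral_spacetime hf.network_eq inn
  rw [← integral_finsetSum _ fun i _ => ig2 i,
    ← integral_add (integrable_finsetSum _ fun i _ => ig2 i) in2, ← integral_const_mul]
  refine integral_mono_ae ((integrable_finsetSum _ fun i _ => ig2 i).add in2)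
    ((hf.integrable_relEntropy hcomp hc T).const_mul K) ?_
  filter_upwards [ae_restrict_Ioc_of_Ioi hcomp, ae_restrict_Ioc_of_Ioi hf.kinematics]
    with t h1 h2
  have h3 := hK (μ t) (A t) (V t) (fun i x => w i (t, x)) (H t) _ _ _ _ _ _ h1 h2
    (hc.calibrated t) (fun i => (hwc i).comp (by fun_prop)) (fun i x => hwM i _)
    (fun i j hij x => hwδ t i j hij x)
  rw [← relEntropy_eq_tiltExcess (ξ := fun t i x => ξ i (t, x)) (t := t) (μ t)
    (fun i => (hc.calibrated t).xi_cont i) (fun i x => (hc.calibrated t).xi_le i x)] at h3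
  exact h3

/-- The relative entropy grows at most by the dissipation. -/
lemma relEntropy_le (hf : IsSpacetimeForm μ₀ A₀ μ A V H κ κn)
    (hcomp₀ : IsCompatible μ₀ A₀) (hpart₀ : IsPhasePartition A₀)
    (hcomp : ∀ᵐ t ∂(volume.restrict (Ioi (0 : ℝ))), IsCompatible (μ t) (A t))
    (hpart : ∀ t, 0 < t → IsPhasePartition (A t))
    (hc : IsSpacetimeCalibration Tc c C M L ξ τ Dξ B DB ϑ δ) :
    ∀ᵐ T ∂(volume.restrict (Ioc 0 Tc)),
      relEntropy (μ T) (fun t i x => ξ i (t, x)) T ≤ relEntropy μ₀ (fun t i x => ξ i (t, x)) 0 +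
        (∑ i, ∫ q, grainDensity (fun q => V q.1 i q.2) (fun _ => 0) (ξ i) (τ i) B (Dξ i) DB q
          ∂(spacetime (κ i) T) +
        ∫ q, networkDensity (fun q => H q.1 q.2) B DB q ∂(spacetime κn T)) := by
  have := hf.finite_network
  have := hf.finite
  filter_upwards [ae_restrict_Ioc_of_Ioi hcomp, ae_restrict_Ioc_of_Ioi hf.energy,
    ae_restrict_Ioc_of_Ioi hf.curvature,
    ae_restrict_Ioc_of_Ioi (ae_all_iff.2 hf.evolution), ae_restrict_mem measurableSet_Ioc]
    with T hT hen hcur hev hTm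
  rw [relEntropy_eq_flux (ξ := fun t i x => ξ i (t, x)) hT
    (fun i => (hc.calibrated T).xi_cont i) (fun i x => (hc.calibrated T).xi_le i x),
    relEntropy_eq_flux (ξ := fun t i x => ξ i (t, x)) hcomp₀
    (fun i => (hc.calibrated 0).xi_cont i) (fun i x => (hc.calibrated 0).xi_le i x)]
  have hflux := fun i => (hev i).flux
    (g₀ := (grain μ₀ i : Measure (Space d × Sph d)))
    (gT := (grain (μ T) i : Measure (Space d × Sph d)))
    (fun φ hφ => hcomp₀.integral_divergence hpart₀ i hφ)
    (fun φ hφ => hT.integral_divergence (hpart T hTm.1) i hφ) (hc.xi_C1 i) (hc.xi_lip i)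
    (fun t ht x => hc.xi_deriv i t ⟨ht.1, ht.2.trans_le hTm.2⟩ x) (hc.tau_cont i).continuousOn
  have hwedge := fun i => (hev i).integral_wedgeField (hc.xi_C1 i) hc.B_C1
  have hcurv := curvature_identity_of_test (H := fun q => H q.1 q.2) (hf.integrable_H T) hcur
    hc.B_C1
  obtain ⟨inn, in1, in2⟩ := hf.integrable_networkDensity hc T
  have hnet : ∫ q, networkDensity (fun q => H q.1 q.2) B DB q ∂(spacetime κn T) =
      -∫ q, 1 / 2 * ‖H q.1 q.2.1‖ ^ 2 ∂(spacetime κn T) := by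
    have e : ∀ q, networkDensity (fun q => H q.1 q.2) B DB q =
        inner ℝ (H q.1 q.2.1) (B (base q)) - 1 / 2 * ‖H q.1 q.2.1‖ ^ 2 + (traceL (DB (base q)) -
          inner ℝ (q.2.2 : Space d) (DB (base q) (q.2.2 : Space d))) := fun q => rfl
    have hcurv' : ∫ q, inner ℝ (H q.1 q.2.1) (B (base q)) ∂(spacetime κn T) = _ := hcurv
    simp only [e]
    rw [integral_sub_add_eq in1 ((hf.H_int T).const_mul (1 / 2)) in2, hcurv']
    ring
  have hgr : ∀ i, ∫ q, grainDensity (fun q => V q.1 i q.2) (fun _ => 0) (ξ i) (τ i) B (Dξ i) DB q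
      ∂(spacetime (κ i) T) = (∫ z, inner ℝ (ξ i (T, z.1)) (z.2 : Space d)
        ∂(grain (μ T) i : Measure (Space d × Sph d))) -
      (∫ z, inner ℝ (ξ i (0, z.1)) (z.2 : Space d) ∂(grain μ₀ i : Measure (Space d × Sph d))) -
      ∫ q, 1 / 4 * V q.1 i q.2.1 ^ 2 ∂(spacetime (κ i) T) := fun i => by
    have h4 := (hc.xi_C1 i).continuous_deriv
    have i1 := integrable_inner_base (Γ := spacetime (κ i) T) (hc.tau_cont i) (hc.tau_le i)
    have i2 := integrable_inner_base (Γ := spacetime (κ i) T) (hc.continuous_wedgeField i)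
      (hc.norm_wedgeField_le i)
    have i3 := integrable_mul_base (V := fun q => V q.1 i q.2) (hf.integrable_V i T)
      (f := fun q => traceL (Dξ i q)) (by fun_prop) (hc.abs_trace_le i)
    have i4 := (hf.V_int i T).const_mul (1 / 4)
    have e : ∀ q, grainDensity (fun q => V q.1 i q.2) (fun _ => 0) (ξ i) (τ i) B (Dξ i) DB q =
        (inner ℝ (τ i (base q)) (q.2.2 : Space d) -
          inner ℝ (wedgeField (ξ i) B (Dξ i) DB (base q)) (q.2.2 : Space d)) +
        V (base q).1 i (base q).2 * traceL (Dξ i (base q)) - 1 / 4 * V q.1 i q.2.1 ^ 2 := fun q => by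
      simp only [grainDensity, zero_smul, add_zero, zero_mul, sub_zero, inner_sub_left, base]
    simp only [e]
    have e2 := integral_sub ((i1.sub i2).add i3) i4
    have e3 := integral_sub_add_eq i1 i2 i3
    simp only [Pi.add_apply, Pi.sub_apply] at e2
    refine e2.trans ?_
    have e4 : ∫ q, V (base q).1 i (base q).2 * traceL (Dξ i (base q)) ∂(spacetime (κ i) T) = _ :=
      eq_sub_of_add_eq' (hflux i).symm
    rw [e3, hwedge i, e4]
    ring
  rw [hnet]
  simp only [hgr, Finset.sum_sub_distrib]
  linarith

end IsSpacetimeForm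

end Entropy

/-! ### A Grönwall inequality, weights and the trivial evolution -/

/-- Grönwall's inequality for integrable functions, in integrated form. -/
lemma ae_le_exp_of_ae_le_integral {f : ℝ → ℝ} {T a K : ℝ} (ha : 0 ≤ a) (hK : 0 ≤ K)
    (hf : IntegrableOn f (Ioc 0 T))
    (h : ∀ᵐ t ∂(volume.restrict (Ioc 0 T)), f t ≤ a + K * ∫ s in Ioc 0 t, f s) :
    ∀ᵐ t ∂(volume.restrict (Ioc 0 T)), f t ≤ a * Real.exp (K * T) := by
  set g : ℝ → ℝ := (Ioc 0 T).indicator f with hg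
  have hgi : Integrable g := (integrable_indicator_iff measurableSet_Ioc).2 hf
  set G : ℝ → ℝ := fun t => a + K * ∫ s in (0 : ℝ)..t, g s with hG
  have hGc : Continuous G := by
    have := intervalIntegral.continuous_primitive (fun a b => hgi.intervalIntegrable (a := a)
      (b := b)) 0
    fun_prop
  have hgf : ∀ t ∈ Ioc 0 T, ∫ s in (0 : ℝ)..t, g s = ∫ s in Ioc 0 t, f s := fun t ht => by
    rw [intervalIntegral.integral_of_le ht.1.le]
    refine setIntegral_congr_fun measurableSet_Ioc fun s hs => ?_
    exact indicator_of_mem (show s ∈ Ioc 0 T from ⟨hs.1, hs.2.trans ht.2⟩) f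
  have hfG : ∀ᵐ t ∂(volume.restrict (Ioc 0 T)), g t ≤ G t := by
    filter_upwards [h, ae_restrict_mem measurableSet_Ioc] with t h1 ht
    rw [hg, indicator_of_mem ht]
    simp only [hG]
    rwa [hgf t ht]
  set H : ℝ → ℝ := fun t => ∫ s in (0 : ℝ)..t, G s with hH
  have hHd : ∀ t, HasDerivAt H (G t) t := fun t => hGc.integral_hasStrictDerivAt 0 t |>.hasDerivAt
  have hGH : ∀ t ∈ Icc 0 T, G t ≤ a + K * H t := fun t ht => by
    simp only [hG, hH]
    gcongr
    rw [intervalIntegral.integral_of_le ht.1, intervalIntegral.integral_of_le ht.1]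
    refine setIntegral_mono_ae_restrict hgi.integrableOn
      (hGc.integrableOn_Ioc) ?_
    exact ae_mono (Measure.restrict_mono_set volume (Ioc_subset_Ioc_right ht.2)) hfG
  have hφ : AntitoneOn (fun t => Real.exp (-K * t) * (a + K * H t)) (Icc 0 T) := by
    have hd : ∀ t, HasDerivAt (fun t => Real.exp (-K * t) * (a + K * H t))
        (Real.exp (-K * t) * (-K * 1) * (a + K * H t) + Real.exp (-K * t) * (K * G t)) t :=
      fun t => (((hasDerivAt_id t).const_mul (-K)).exp).mul (((hHd t).const_mul K).const_add a)
    refine antitoneOn_of_deriv_nonpos (convex_Icc 0 T)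
      (fun t _ => (hd t).continuousAt.continuousWithinAt)
      (fun t _ => (hd t).differentiableAt.differentiableWithinAt) fun t ht => ?_
    rw [interior_Icc] at ht
    rw [(hd t).deriv]
    have h1 := hGH t (Ioo_subset_Icc_self ht)
    have h2 := Real.exp_pos (-K * t)
    have h3 : Real.exp (-K * t) * (-K * 1) * (a + K * H t) + Real.exp (-K * t) * (K * G t) =
        -(Real.exp (-K * t) * K * (a + K * H t - G t)) := by ring
    rw [h3, neg_nonpos]
    exact mul_nonneg (by positivity) (by linarith)
  filter_upwards [hfG, ae_restrict_mem measurableSet_Ioc] with t h1 ht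
  rw [hg, indicator_of_mem ht] at h1
  have hT : 0 ≤ T := ht.1.le.trans ht.2
  have h2 := hφ (left_mem_Icc.2 hT) (Ioc_subset_Icc_self ht) ht.1.le
  have h3 : H 0 = 0 := by simp [hH]
  simp only [h3, mul_zero, Real.exp_zero, one_mul, add_zero] at h2
  have h4 := hGH t (Ioc_subset_Icc_self ht)
  have h5 : a + K * H t ≤ a * Real.exp (K * t) := by
    have h6 : a + K * H t = Real.exp (K * t) * (Real.exp (-K * t) * (a + K * H t)) := by
      rw [← mul_assoc, ← Real.exp_add]
      simp
    rw [h6, mul_comm a]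
    gcongr
  have h7 : a * Real.exp (K * t) ≤ a * Real.exp (K * T) := by
    gcongr
    exact ht.2
  linarith

section Weight

variable {d : ℕ}

/-- The standard weight of polynomial decay, `(1 + ‖x‖²)^{-(d+1)}`. -/
noncomputable def decayWeight (x : Space d) : ℝ := ((1 + ‖x‖ ^ 2) ^ (d + 1))⁻¹

lemma isWeight_decayWeight : IsWeight (decayWeight : Space d → ℝ) (d + 1) := by
  have hpos : ∀ x : Space d, 0 < 1 + ‖x‖ ^ 2 := fun x => by positivity
  have hc : ContDiff ℝ ∞ fun x : Space d => (1 + ‖x‖ ^ 2) ^ (d + 1) :=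
    (contDiff_const.add (contDiff_norm_sq ℝ)).pow _
  refine ⟨hc.inv fun x => (pow_pos (hpos x) _).ne', fun x => ?_, fun x => ?_, ?_, fun x v => ?_⟩
  · have := hpos x
    unfold decayWeight; positivity
  · refine inv_le_one_of_one_le₀ (one_le_pow₀ ?_)
    linarith [sq_nonneg ‖x‖]
  · have h := integrable_rpow_neg_one_add_norm_sq (E := Space d) (μ := volume)
      (r := 2 * ((d : ℝ) + 1)) (by simp; linarith [d.cast_nonneg (α := ℝ)])
    refine h.congr (Eventually.of_forall fun x => ?_)
    have e : -(2 * ((d : ℝ) + 1)) / 2 = -((d + 1 : ℕ) : ℝ) := by push_cast; ring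
    simp only [e, decayWeight]
    rw [Real.rpow_neg (hpos x).le, Real.rpow_natCast]
  · have h1 : HasFDerivAt (fun x : Space d => ‖x‖ ^ 2) (2 • (innerSL ℝ x)) x :=
      (hasStrictFDerivAt_norm_sq x).hasFDerivAt
    have h2 : HasDerivAt (fun s : ℝ => ((1 + s) ^ (d + 1))⁻¹)
        (-(((d + 1 : ℕ) : ℝ) * (1 + ‖x‖ ^ 2) ^ d * 1) / ((1 + ‖x‖ ^ 2) ^ (d + 1)) ^ 2)
        (‖x‖ ^ 2) := by
      have := (((hasDerivAt_id (‖x‖ ^ 2)).const_add 1).pow (d + 1)).inv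
        (pow_pos (hpos x) _).ne'
      exact this
    have h3 : HasFDerivAt (decayWeight : Space d → ℝ)
        ((-(((d + 1 : ℕ) : ℝ) * (1 + ‖x‖ ^ 2) ^ d * 1) / ((1 + ‖x‖ ^ 2) ^ (d + 1)) ^ 2) •
          (2 • (innerSL ℝ x))) x :=
      HasDerivAt.comp_hasFDerivAt (h₂ := fun s : ℝ => ((1 + s) ^ (d + 1))⁻¹) x h2 h1
    rw [h3.fderiv]
    have h4 : |inner ℝ x v| ≤ ‖x‖ * ‖v‖ := abs_real_inner_le_norm x v
    have h5 : 2 * ‖x‖ ≤ 1 + ‖x‖ ^ 2 := by nlinarith [sq_nonneg (‖x‖ - 1)]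
    have h6 := hpos x
    have e : (-(((d + 1 : ℕ) : ℝ) * (1 + ‖x‖ ^ 2) ^ d * 1) / ((1 + ‖x‖ ^ 2) ^ (d + 1)) ^ 2) *
        (2 * inner ℝ x v) =
        -((d + 1) * (decayWeight x * (2 * inner ℝ x v / (1 + ‖x‖ ^ 2)))) := by
      unfold decayWeight
      push_cast
      field_simp
      ring
    have h7 : |2 * inner ℝ x v / (1 + ‖x‖ ^ 2)| ≤ ‖v‖ := by
      rw [abs_div, abs_of_pos h6, div_le_iff₀ h6, abs_mul, abs_two]
      nlinarith [norm_nonneg v]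
    have h8 : 0 ≤ decayWeight x := by unfold decayWeight; positivity
    simp only [_root_.smul_apply, smul_eq_mul, innerSL_apply_apply, nsmul_eq_mul, Nat.cast_ofNat]
    rw [e, abs_neg, abs_mul, abs_mul, abs_of_nonneg h8,
      abs_of_nonneg (by positivity : (0 : ℝ) ≤ d + 1), ← mul_assoc]
    gcongr

lemma IsWeight.scale {ψ : Space d → ℝ} {c : ℝ} (hψ : IsWeight ψ c) (hc : 0 ≤ c) {s : ℝ} (h0 : 0 < s)
    (h1 : s ≤ 1) : IsWeight (fun x => ψ (s • x)) c := by
  refine ⟨hψ.contDiff.comp (contDiff_const_smul s), fun x => hψ.nonneg _, fun x => hψ.le_one _,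
    hψ.integrable.comp_smul h0.ne', fun x v => ?_⟩
  have h2 : HasFDerivAt ψ (fderiv ℝ ψ (s • x)) (s • x) :=
    (hψ.contDiff.differentiable (by simp) _).hasFDerivAt
  have h3 : HasFDerivAt (fun x => ψ (s • x)) _ x :=
    h2.comp x ((hasFDerivAt_id x).const_smul s)
  rw [h3.fderiv]
  have h4 := hψ.grad_le (s • x) (s • v)
  rw [norm_smul, Real.norm_eq_abs, abs_of_pos h0] at h4
  refine h4.trans ?_
  have h5 := mul_nonneg (mul_nonneg hc (hψ.nonneg (s • x))) (norm_nonneg v)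
  nlinarith

/-- The weights of polynomial decay at the scale `n + 1`; they increase to `1` as `n → ∞`. -/
noncomputable def scaledWeight (n : ℕ) (x : Space d) : ℝ := decayWeight ((1 / ((n : ℝ) + 1)) • x)

lemma isWeight_scaledWeight (n : ℕ) : IsWeight (scaledWeight n : Space d → ℝ) (d + 1) :=
  isWeight_decayWeight.scale (by positivity) (by positivity)
    (by rw [div_le_one (by positivity)]; linarith [n.cast_nonneg (α := ℝ)])

lemma tendsto_scaledWeight (x : Space d) :
    Tendsto (fun n => scaledWeight n x) atTop (𝓝 1) := by
  have h1 : Tendsto (fun n : ℕ => (1 / ((n : ℝ) + 1)) • x) atTop (𝓝 ((0 : ℝ) • x)) :=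
    tendsto_one_div_add_atTop_nhds_zero_nat.smul_const x
  have h2 := (isWeight_decayWeight (d := d)).contDiff.continuous.tendsto ((0 : ℝ) • x)
  have h3 : decayWeight ((0 : ℝ) • x : Space d) = 1 := by simp [decayWeight]
  rw [h3] at h2
  exact h2.comp h1

end Weight

section Trivial

variable {d : ℕ}

lemma integral_fderiv_eq_zero {E : Type*} [NormedAddCommGroup E] [NormedSpace ℝ E]
    [FiniteDimensional ℝ E] [MeasurableSpace E] [BorelSpace E] {μ : Measure E} [μ.IsAddHaarMeasure]
    {f : E → ℝ} (hf : IsTest f) (v : E) : ∫ x, fderiv ℝ f x v ∂μ = 0 := by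
  have h := integral_mul_fderiv_eq_neg_fderiv_mul_of_integrable (μ := μ) (f := fun _ : E => (1 : ℝ))
    (g := f) (v := v) (by simp) (by simpa using (hf.fderiv_apply v).integrable μ)
    (by simpa using hf.integrable μ) (fun _ _ => differentiableAt_const _)
    (fun x _ => hf.differentiable x)
  simpa using h

/-- The whole space, at rest, is a weak evolution. -/
lemma weakEvolution_univ {T : ℝ} (hT : 0 ≤ T) :
    WeakEvolution T volume volume (volume.restrict (Ioc 0 T ×ˢ univ))
      (0 : Measure (ℝ × (Space d × Sph d))) (fun _ => 0) := by
  refine ⟨inferInstance, by simp, by simp, le_rfl, le_rfl, le_rfl,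
    fun ζ hζ => ?_, fun F hF => ?_⟩
  · have i1 := (hζ.fderiv_apply (1, 0)).integrable
      (volume.restrict (Ioc 0 T ×ˢ (univ : Set (Space d))))
    rw [restrict_Ioc_prod] at i1 ⊢
    rw [integral_prod_symm _ i1]
    simp only [integral_zero_measure, sub_zero]
    rw [← integral_sub ((hζ.slice T).integrable _) ((hζ.slice 0).integrable _)]
    refine integral_congr_ae (Eventually.of_forall fun x => ?_)
    have hd : ∀ t ∈ uIcc 0 T, HasDerivAt (fun s => ζ (s, x)) (fderiv ℝ ζ (t, x) (1, 0)) t :=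
      fun t _ => by
        have h1 : HasDerivAt (fun s : ℝ => (s, x)) ((1 : ℝ), (0 : Space d)) t :=
          (hasDerivAt_id t).prodMk (hasDerivAt_const t x)
        exact (hζ.differentiable (t, x)).hasFDerivAt.comp_hasDerivAt t h1
    have hcont : Continuous fun t => fderiv ℝ ζ (t, x) (1, 0) :=
      (hζ.fderiv_apply (1, 0)).continuous.comp (by fun_prop)
    have := intervalIntegral.integral_eq_sub_of_hasDerivAt hd (hcont.intervalIntegrable 0 T)
    rw [intervalIntegral.integral_of_le hT] at this
    exact this.symm
  · have i1 := hF.divX.integrable (volume.restrict (Ioc 0 T ×ˢ (univ : Set (Space d))))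
    rw [restrict_Ioc_prod] at i1 ⊢
    rw [integral_prod _ i1]
    simp only [integral_zero_measure, neg_zero]
    refine integral_eq_zero_of_ae (Eventually.of_forall fun t => ?_)
    change ∫ x, divX F (t, x) = 0
    have e : ∀ x, divX F (t, x) = ∑ k : Fin d, fderiv ℝ (fun y => F (t, y) k) x (basisVec k) :=
      fun x => Finset.sum_congr rfl fun k _ => by
        have h1 := fderiv_slice_space (q := (t, x)) ((hF.coord k).differentiable _) (basisVec k)
        have h2 : HasFDerivAt (fun q => F q k) _ (t, x) :=
          (EuclideanSpace.proj (𝕜 := ℝ) k).hasFDerivAt.comp (t, x)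
            (hF.differentiable (t, x)).hasFDerivAt
        rw [h1, h2.fderiv]
        rfl
    simp only [e]
    rw [integral_finsetSum _ fun k _ => (((hF.coord k).slice t).fderiv_apply _).integrable _]
    exact Finset.sum_eq_zero fun k _ => integral_fderiv_eq_zero ((hF.coord k).slice t) _

end Trivial

/-! ### Stability of the bulk error -/

section Bulk

open ProbabilityTheory

variable {d P : ℕ}

/-- The density `1_A θ + θ⁻`. If `θ` is negative exactly on `𝒜`, it is the density
`|1_A - 1_𝒜| |θ|` of the bulk error. -/
noncomputable def bulkDensity {X : Type*} (A : Set X) (θ : X → ℝ) (x : X) : ℝ :=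
  A.indicator (fun _ => (1 : ℝ)) x * θ x + max (-θ x) 0

lemma bulkDensity_nonneg {X : Type*} (A : Set X) (θ : X → ℝ) (x : X) : 0 ≤ bulkDensity A θ x := by
  by_cases hx : x ∈ A
  · simp only [bulkDensity, indicator_of_mem hx, one_mul]
    linarith [le_max_left (-θ x) 0]
  · simp only [bulkDensity, indicator_of_notMem hx, zero_mul, zero_add]
    exact le_max_right _ _

lemma bulkDensity_le_abs {X : Type*} (A : Set X) (θ : X → ℝ) (x : X) :
    bulkDensity A θ x ≤ |θ x| := by
  have h1 : max (-θ x) 0 ≤ |θ x| := max_le (neg_le_abs _) (abs_nonneg _)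
  by_cases hx : x ∈ A
  · simp only [bulkDensity, indicator_of_mem hx, one_mul]
    rcases le_total 0 (θ x) with h | h
    · rw [max_eq_right (by linarith)]; simpa using le_abs_self _
    · rw [max_eq_left (by linarith)]; simp
  · simpa only [bulkDensity, indicator_of_notMem hx, zero_mul, zero_add]

lemma bulkDensity_eq {X : Type*} {A 𝒜 : Set X} {θ : X → ℝ} (h : ∀ x, θ x < 0 ↔ x ∈ 𝒜) (x : X) :
    bulkDensity A θ x = |A.indicator (fun _ => (1 : ℝ)) x - 𝒜.indicator (fun _ => (1 : ℝ)) x| *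
      |θ x| := by
  by_cases h1 : x ∈ A <;> by_cases h2 : x ∈ 𝒜
  · have := (h x).2 h2
    simp [bulkDensity, h1, h2, max_eq_left (by linarith : 0 ≤ -θ x)]
  · have := not_lt.1 (mt (h x).1 h2)
    simp [bulkDensity, h1, h2, max_eq_right (by linarith : -θ x ≤ 0), abs_of_nonneg this]
  · have := (h x).2 h2
    simp [bulkDensity, h1, h2, max_eq_left (by linarith : 0 ≤ -θ x), abs_of_neg this]
  · have := not_lt.1 (mt (h x).1 h2)
    simp [bulkDensity, h1, h2, max_eq_right (by linarith : -θ x ≤ 0)]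

lemma aestronglyMeasurable_bulkDensity {X : Type*} [MeasurableSpace X] {γ : Measure X} {A : Set X}
    (hA : NullMeasurableSet A γ) {θ : X → ℝ} (hθ : Measurable θ) :
    AEStronglyMeasurable (bulkDensity A θ) γ := by
  refine AEStronglyMeasurable.add (AEStronglyMeasurable.mul ?_ hθ.aestronglyMeasurable)
    (hθ.neg.max measurable_const).aestronglyMeasurable
  exact aestronglyMeasurable_const.indicator₀ hA

/-- Almost everywhere, the derivative of the negative part of `f` is that of `-f` where `f < 0`, and
vanishes elsewhere. -/
lemma fderiv_negPart {E : Type*} [NormedAddCommGroup E] [NormedSpace ℝ E] {f : E → ℝ} {q : E}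
    (hf : ContinuousAt f q) :
    (f q < 0 → fderiv ℝ (fun q => max (-f q) 0) q = -fderiv ℝ f q) ∧
      (0 ≤ f q → fderiv ℝ (fun q => max (-f q) 0) q = 0) := by
  constructor
  · intro h
    have h1 : (fun q => max (-f q) 0) =ᶠ[𝓝 q] fun q => -f q := by
      filter_upwards [hf.eventually_lt continuousAt_const h] with y hy
      exact max_eq_left (by linarith)
    rw [h1.fderiv_eq, fderiv_fun_neg]
  · intro h
    have h1 : IsLocalMin (fun q => max (-f q) 0) q := by
      refine Eventually.of_forall fun y => ?_
      change max (-f q) 0 ≤ max (-f y) 0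
      rw [max_eq_right (by linarith)]
      exact le_max_right _ _
    exact h1.fderiv_eq_zero

lemma integrable_transport {T : ℝ} {ψ : Space d → ℝ} {c : ℝ} (hψ : IsWeight ψ c) (hc : 0 ≤ c)
    {f : ℝ × Space d → ℝ} {L : ℝ≥0} {M : ℝ} (hfL : LipschitzWith L f) (hfM : ∀ z, ‖f z‖ ≤ M)
    {B : ℝ × Space d → Space d} {DB : ℝ × Space d → Space d →L[ℝ] Space d} {M' : ℝ}
    (hB : SpatiallyC1 B DB M') :
    Integrable (fun q => ψ q.2 * (fderiv ℝ f q (1, 0) + fderiv ℝ f q (0, B q)) +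
      f q * (fderiv ℝ ψ q.2 (B q) + ψ q.2 * traceL (DB q)))
      (volume.restrict (Ioc 0 T ×ˢ univ)) := by
  have hψi := integrable_weight_track hψ.integrable T
  have hM' : 0 ≤ M' := (norm_nonneg _).trans (hB.norm_le 0)
  have hBc := hB.continuous
  have hDBc := hB.continuous_deriv
  have hψc := hψ.contDiff.continuous
  have hDψ : Continuous (fderiv ℝ ψ) := hψ.contDiff.continuous_fderiv (by simp)
  have hfc := hfL.continuous
  have hm : Measurable fun q => fderiv ℝ f q (0, B q) := by
    rw [funext fun q => clm_prod_expand (fderiv ℝ f q) (B q)]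
    refine Finset.measurable_fun_sum _ fun k _ => ?_
    have hk : Continuous fun q => B q k := by fun_prop
    exact hk.measurable.smul (measurable_fderiv_apply_const ℝ f _)
  have h1 : ∀ q, ‖fderiv ℝ f q‖ ≤ L := fun q => norm_fderiv_le_of_lipschitz ℝ hfL
  refine Integrable.mono' (hψi.mul_const (L + L * M' + M * (c * M' + d * M'))) ?_
    (Eventually.of_forall fun q => ?_)
  · refine (Measurable.add (Measurable.mul (Continuous.measurable (by fun_prop))
      ((measurable_fderiv_apply_const ℝ f _).add hm)) ?_).aestronglyMeasurable
    exact Continuous.measurable (by fun_prop)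
  · have p := hψ.nonneg q.2
    have e1 : |fderiv ℝ f q (1, 0)| ≤ L := by
      refine ((fderiv ℝ f q).le_opNorm _).trans ?_
      rw [Prod.norm_def]; simpa using h1 q
    have e2 : |fderiv ℝ f q (0, B q)| ≤ L * M' := by
      refine ((fderiv ℝ f q).le_opNorm _).trans ?_
      rw [Prod.norm_def, norm_zero, max_eq_right (norm_nonneg _)]
      exact mul_le_mul (h1 q) (hB.norm_le q) (norm_nonneg _) (by positivity)
    have e3 : |fderiv ℝ ψ q.2 (B q)| ≤ ψ q.2 * (c * M') := by
      refine (hψ.grad_le _ _).trans ?_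
      have := hB.norm_le q
      have : c * ψ q.2 * ‖B q‖ ≤ c * ψ q.2 * M' := by gcongr
      linarith
    have e4 : |ψ q.2 * traceL (DB q)| ≤ ψ q.2 * (d * M') := by
      rw [abs_mul, abs_of_nonneg p]
      gcongr
      exact (abs_traceL_le _).trans (by gcongr; exact hB.norm_deriv_le q)
    refine (norm_add_le _ _).trans ?_
    rw [norm_mul, norm_mul, Real.norm_of_nonneg p, mul_add, mul_add]
    have e5 : ‖fderiv ℝ f q (1, 0) + fderiv ℝ f q (0, B q)‖ ≤ L + L * M' :=
      (norm_add_le _ _).trans (add_le_add e1 e2)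
    have e6 : ‖fderiv ℝ ψ q.2 (B q) + ψ q.2 * traceL (DB q)‖ ≤
        ψ q.2 * (c * M') + ψ q.2 * (d * M') := (norm_add_le _ _).trans (add_le_add e3 e4)
    have e7 := mul_le_mul_of_nonneg_left e5 p
    have e8 := mul_le_mul (hfM q) e6 (norm_nonneg _) ((norm_nonneg _).trans (hfM q))
    nlinarith only [e7, e8]

lemma integrable_weight_mul_bulkDensity {T : ℝ} {ψ : Space d → ℝ} (hψ : Integrable ψ)
    {f : ℝ × Space d → ℝ} {M : ℝ} (hfc : Continuous f) (hfM : ∀ z, ‖f z‖ ≤ M)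
    {A : ℝ → Set (Space d)}
    (hA : NullMeasurableSet {q : ℝ × Space d | q.2 ∈ A q.1}
      (volume.restrict (Ioi (0 : ℝ) ×ˢ univ))) :
    Integrable (fun q : ℝ × Space d => ψ q.2 * bulkDensity (track A) f q)
      (volume.restrict (Ioc 0 T ×ˢ univ)) := by
  refine (integrable_weight_track hψ T).mul_bdd (c := M)
    (aestronglyMeasurable_bulkDensity (nullMeasurableSet_track hA T) hfc.measurable)
    (Eventually.of_forall fun q => ?_)
  rw [Real.norm_of_nonneg (bulkDensity_nonneg _ _ _)]
  exact (bulkDensity_le_abs _ _ _).trans (hfM q)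

/-- Growth of the weighted bulk error of a single phase. The density is `1_A f + f⁻`, and the transport
identity is used for `f` on the moving set `A` and for `f⁻` on the whole space at rest. This avoids any
weak evolution equation for the calibrated phase. -/
lemma weighted_bulk_le {T : ℝ} (hT : 0 ≤ T) {A₀ : Set (Space d)} {A : ℝ → Set (Space d)}
    {Γ : Measure (ℝ × (Space d × Sph d))} {V : ℝ × Space d → ℝ}
    (h : WeakEvolution T (volume.restrict A₀) (volume.restrict (A T)) (trackMeasure A T) Γ V)
    (hA₀ : MeasurableSet A₀) (hAT : MeasurableSet (A T))
    (hA : NullMeasurableSet {q : ℝ × Space d | q.2 ∈ A q.1}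
      (volume.restrict (Ioi (0 : ℝ) ×ˢ univ)))
    {ψ : Space d → ℝ} {c : ℝ} (hψ : IsWeight ψ c) (hc : 0 ≤ c)
    {f : ℝ × Space d → ℝ} {L : ℝ≥0} {M : ℝ} (hfL : LipschitzWith L f) (hfM : ∀ z, ‖f z‖ ≤ M)
    {B : ℝ × Space d → Space d} {DB : ℝ × Space d → Space d →L[ℝ] Space d} {M' C : ℝ}
    (hB : SpatiallyC1 B DB M') (hC : ∀ᵐ q ∂(volume.restrict (Ioc 0 T ×ˢ (univ : Set (Space d)))),
      |fderiv ℝ f q (1, 0) + fderiv ℝ f q (0, B q)| ≤ C * |f q|) :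
    ∫ x, ψ x * bulkDensity (A T) (fun x => f (T, x)) x ≤
      (∫ x, ψ x * bulkDensity A₀ (fun x => f (0, x)) x) +
        (C + c * M' + d * M') *
          ∫ q, ψ q.2 * bulkDensity (track A) f q ∂(volume.restrict (Ioc 0 T ×ˢ univ)) +
        ∫ q, ψ q.2.1 * f (base q) * (inner ℝ (B (base q)) (q.2.2 : Space d) - V (base q)) ∂Γ := by
  set g : ℝ × Space d → ℝ := fun q => max (-f q) 0 with hg
  have hgL : LipschitzWith L g := hfL.neg.max_const 0
  have hgM : ∀ z, ‖g z‖ ≤ M := fun z => by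
    rw [Real.norm_of_nonneg (le_max_right _ _)]
    exact (max_le (neg_le_abs _) (abs_nonneg _)).trans (hfM z)
  have hfc := hfL.continuous
  have hgc := hgL.continuous
  have t1 := h.transport hψ hfL hfM hB
  have t2 := (weakEvolution_univ (d := d) hT).transport hψ hgL hgM hB
  simp only [integral_zero_measure, add_zero] at t2
  have i1 := integrable_transport (T := T) hψ hc hfL hfM hB
  have i2 := integrable_transport (T := T) hψ hc hgL hgM hB
  have hn := nullMeasurableSet_track hA T
  have hslice : ∀ (t : ℝ) (S : Set (Space d)), MeasurableSet S →
      ∫ x, ψ x * bulkDensity S (fun x => f (t, x)) x =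
        (∫ x in S, ψ x * f (t, x)) + ∫ x, ψ x * g (t, x) := fun t S hS => by
    have j1 : Integrable fun x => ψ x * f (t, x) :=
      hψ.integrable.mul_bdd (c := M) (Continuous.aestronglyMeasurable (by fun_prop))
        (Eventually.of_forall fun x => hfM _)
    have j2 : Integrable fun x => ψ x * g (t, x) :=
      hψ.integrable.mul_bdd (c := M) (Continuous.aestronglyMeasurable (by fun_prop))
        (Eventually.of_forall fun x => hgM _)
    rw [← integral_indicator hS, ← integral_add (j1.indicator hS) j2]
    refine integral_congr_ae (Eventually.of_forall fun x => ?_)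
    by_cases hx : x ∈ S
    · simp [bulkDensity, hx, hg]
      ring
    · simp [bulkDensity, hx, hg]
  rw [hslice T _ hAT, hslice 0 _ hA₀]
  have hmain : (∫ q, (ψ q.2 * (fderiv ℝ f q (1, 0) + fderiv ℝ f q (0, B q)) +
      f q * (fderiv ℝ ψ q.2 (B q) + ψ q.2 * traceL (DB q))) ∂(trackMeasure A T)) +
      ∫ q, (ψ q.2 * (fderiv ℝ g q (1, 0) + fderiv ℝ g q (0, B q)) +
        g q * (fderiv ℝ ψ q.2 (B q) + ψ q.2 * traceL (DB q)))
        ∂(volume.restrict (Ioc 0 T ×ˢ univ)) ≤ (C + c * M' + d * M') *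
          ∫ q, ψ q.2 * bulkDensity (track A) f q ∂(volume.restrict (Ioc 0 T ×ˢ univ)) := by
    rw [trackMeasure, ← integral_indicator₀ hn, ← integral_add (i1.indicator₀ hn) i2,
      ← integral_const_mul]
    refine integral_mono_ae ((i1.indicator₀ hn).add i2)
      ((integrable_weight_mul_bulkDensity hψ.integrable hfc hfM hA).const_mul _) ?_
    filter_upwards [hC] with q hq
    have p := hψ.nonneg q.2
    have hd := fderiv_negPart (f := f) (q := q) hfc.continuousAt
    have e3 : |fderiv ℝ ψ q.2 (B q) + ψ q.2 * traceL (DB q)| ≤ ψ q.2 * (c * M' + d * M') := by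
      refine (abs_add_le _ _).trans ?_
      rw [mul_add]
      refine add_le_add ((hψ.grad_le _ _).trans ?_) ?_
      · have := hB.norm_le q
        have : c * ψ q.2 * ‖B q‖ ≤ c * ψ q.2 * M' := by gcongr
        linarith
      · rw [abs_mul, abs_of_nonneg p]
        gcongr
        exact (abs_traceL_le _).trans (by gcongr; exact hB.norm_deriv_le q)
    have e4 := le_of_abs_le e3
    have e5 := neg_le_of_abs_le e3
    change (track A).indicator _ q + _ ≤ (C + c * M' + d * M') * (ψ q.2 * bulkDensity (track A) f q)
    set Θ := fderiv ℝ f q (1, 0) + fderiv ℝ f q (0, B q)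
    set W := fderiv ℝ ψ q.2 (B q) + ψ q.2 * traceL (DB q)
    have q1 := le_of_abs_le hq
    have q2 := neg_le_of_abs_le hq
    rcases lt_or_ge (f q) 0 with hf | hf
    · have hgq : g q = -f q := max_eq_left (by linarith)
      have hgd : fderiv ℝ g q = -fderiv ℝ f q := hd.1 hf
      have e6 : fderiv ℝ g q (1, 0) + fderiv ℝ g q (0, B q) = -Θ := by
        rw [hgd]; simp only [_root_.neg_apply, Θ]; ring
      rw [e6, hgq]
      rw [abs_of_neg hf] at q1 q2
      by_cases hqA : q ∈ track A
      · rw [indicator_of_mem hqA]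
        simp only [bulkDensity, indicator_of_mem hqA, one_mul]
        rw [max_eq_left (by linarith)]
        nlinarith
      · rw [indicator_of_notMem hqA]
        simp only [bulkDensity, indicator_of_notMem hqA]
        rw [max_eq_left (by linarith)]
        have e7 := mul_le_mul_of_nonneg_left q2 p
        have e8 := mul_le_mul_of_nonneg_left e4 (by linarith : 0 ≤ -f q)
        nlinarith only [e7, e8]
    · have hgq : g q = 0 := max_eq_right (by linarith)
      have hgd : fderiv ℝ g q = 0 := hd.2 hf
      rw [hgd, hgq]
      rw [abs_of_nonneg hf] at q1 q2
      by_cases hqA : q ∈ track A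
      · rw [indicator_of_mem hqA]
        simp only [bulkDensity, indicator_of_mem hqA, one_mul]
        rw [max_eq_right (by linarith)]
        have e7 := mul_le_mul_of_nonneg_left q1 p
        have e8 := mul_le_mul_of_nonneg_left e4 hf
        simp
        nlinarith only [e7, e8]
      · rw [indicator_of_notMem hqA]
        simp only [bulkDensity, indicator_of_notMem hqA]
        rw [max_eq_right (by linarith)]
        simp
  linarith

end Bulk

section BulkTotal

open ProbabilityTheory

variable {d P : ℕ}

/-- The total bulk error with weight `ψ`. -/
noncomputable def weightedBulk (ψ : Space d → ℝ) (A : Fin P → Set (Space d))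
    (θ : Fin P → Space d → ℝ) : ℝ := ∑ i, ∫ x, ψ x * bulkDensity (A i) (θ i) x

lemma weightedBulk_nonneg {ψ : Space d → ℝ} (hψ : ∀ x, 0 ≤ ψ x) (A : Fin P → Set (Space d))
    (θ : Fin P → Space d → ℝ) : 0 ≤ weightedBulk ψ A θ :=
  Finset.sum_nonneg fun _ _ => integral_nonneg fun x =>
    mul_nonneg (hψ x) (bulkDensity_nonneg _ _ x)

lemma weightedBulk_le {ψ : Space d → ℝ} (hψc : Continuous ψ) (hψ0 : ∀ x, 0 ≤ ψ x)
    (hψ1 : ∀ x, ψ x ≤ 1) {A : Fin P → Set (Space d)} {θ : Fin P → Space d → ℝ}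
    (hi : ∀ i, Integrable (bulkDensity (A i) (θ i))) :
    weightedBulk ψ A θ ≤ weightedBulk (fun _ => 1) A θ := by
  refine Finset.sum_le_sum fun i _ => integral_mono ?_ (by simpa using hi i) fun x => ?_
  · exact (hi i).bdd_mul (c := 1) hψc.aestronglyMeasurable (Eventually.of_forall fun x => by
      rw [Real.norm_of_nonneg (hψ0 x)]; exact hψ1 x)
  · exact mul_le_mul_of_nonneg_right (hψ1 x) (bulkDensity_nonneg _ _ x)

lemma tendsto_weightedBulk {A : Fin P → Set (Space d)} {θ : Fin P → Space d → ℝ}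
    (hi : ∀ i, Integrable (bulkDensity (A i) (θ i))) :
    Tendsto (fun n => weightedBulk (scaledWeight n) A θ) atTop
      (𝓝 (weightedBulk (fun _ => 1) A θ)) := by
  refine tendsto_finsetSum _ fun i _ => ?_
  refine tendsto_integral_of_dominated_convergence (bulkDensity (A i) (θ i)) (fun n => ?_) (hi i)
    (fun n => Eventually.of_forall fun x => ?_) (Eventually.of_forall fun x => ?_)
  · exact (isWeight_scaledWeight n).contDiff.continuous.aestronglyMeasurable.mul
      (hi i).aestronglyMeasurable
  · have h0 := bulkDensity_nonneg (A i) (θ i) x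
    have h1 := (isWeight_scaledWeight n).nonneg x
    rw [Real.norm_of_nonneg (mul_nonneg h1 h0)]
    exact mul_le_of_le_one_left h0 ((isWeight_scaledWeight n).le_one x)
  · exact (tendsto_scaledWeight x).mul_const _

variable {μ₀ : Fin P → Fin P → Varifold d} {A₀ : Fin P → Set (Space d)}
  {μ : ℝ → Fin P → Fin P → Varifold d} {A : ℝ → Fin P → Set (Space d)}
  {V : ℝ → Fin P → Space d → ℝ} {H : ℝ → Space d → Space d}
  {κ : Fin P → Kernel ℝ (Space d × Sph d)} {κn : Kernel ℝ (Space d × Sph d)}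
  {Tc c C M : ℝ} {L : ℝ≥0} {ξ τ : Fin P → ℝ × Space d → Space d}
  {Dξ : Fin P → ℝ × Space d → Space d →L[ℝ] Space d} {B : ℝ × Space d → Space d}
  {DB : ℝ × Space d → Space d →L[ℝ] Space d} {ϑ : Fin P → ℝ × Space d → ℝ}
  {δ : ℝ → Fin P → Fin P → Space d → ℝ}

lemma relEntropy_nonneg (hc : IsSpacetimeCalibration Tc c C M L ξ τ Dξ B DB ϑ δ)
    (m : Fin P → Fin P → Varifold d) (t : ℝ) :
    0 ≤ relEntropy m (fun t i x => ξ i (t, x)) t := by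
  rw [relEntropy_eq_tiltExcess (ξ := fun t i x => ξ i (t, x)) m
    (fun i => (hc.calibrated t).xi_cont i) (fun i x => (hc.calibrated t).xi_le i x), tiltExcess]
  refine add_nonneg (Finset.sum_nonneg fun i _ => measureReal_nonneg) (mul_nonneg (by norm_num)
    (Finset.sum_nonneg fun i _ => Finset.sum_nonneg fun j hj => integral_nonneg fun z => ?_))
  have h1 := real_inner_le_norm (z.2 : Space d) (ξ i (t, z.1) - ξ j (t, z.1))
  rw [norm_sph, one_mul] at h1
  have h2 := (hc.calibrated t).length i j (Finset.ne_of_mem_erase hj).symm z.1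
  have h3 : 0 ≤ c * δ t i j z.1 ^ 2 := mul_nonneg hc.c_pos.le (sq_nonneg _)
  change 0 ≤ 1 - inner ℝ (z.2 : Space d) (ξ i (t, z.1) - ξ j (t, z.1))
  linarith

lemma integral_weighted_slab {T : ℝ} {ψ : Space d → ℝ} (hψ : Integrable ψ)
    {f : ℝ × Space d → ℝ} {M : ℝ} (hfc : Continuous f) (hfM : ∀ z, ‖f z‖ ≤ M)
    {A : ℝ → Set (Space d)}
    (hA : NullMeasurableSet {q : ℝ × Space d | q.2 ∈ A q.1}
      (volume.restrict (Ioi (0 : ℝ) ×ˢ univ))) :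
    IntegrableOn (fun t => ∫ x, ψ x * bulkDensity (A t) (fun x => f (t, x)) x) (Ioc 0 T) ∧
      ∫ q, ψ q.2 * bulkDensity (track A) f q ∂(volume.restrict (Ioc 0 T ×ˢ univ)) =
        ∫ t in Ioc 0 T, ∫ x, ψ x * bulkDensity (A t) (fun x => f (t, x)) x := by
  have hi := integrable_weight_mul_bulkDensity (T := T) hψ hfc hfM hA
  rw [restrict_Ioc_prod] at hi ⊢
  exact ⟨hi.integral_prod_left, integral_prod _ hi⟩

/-- Stability of the weighted bulk error: the boundary terms in the transport of the weights are
absorbed into the dissipation of the relative entropy. -/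
lemma exists_weightedBulk_le (P : ℕ) {Tc c C M : ℝ} {L : ℝ≥0} {ξ τ : Fin P → ℝ × Space d → Space d}
    {Dξ : Fin P → ℝ × Space d → Space d →L[ℝ] Space d} {B : ℝ × Space d → Space d}
    {DB : ℝ × Space d → Space d →L[ℝ] Space d} {ϑ : Fin P → ℝ × Space d → ℝ}
    {δ : ℝ → Fin P → Fin P → Space d → ℝ}
    (hc : IsSpacetimeCalibration Tc c C M L ξ τ Dξ B DB ϑ δ) :
    ∃ K : ℝ, 0 ≤ K ∧ ∀ (μ₀ : Fin P → Fin P → Varifold d) (A₀ : Fin P → Set (Space d))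
      (μ : ℝ → Fin P → Fin P → Varifold d) (A : ℝ → Fin P → Set (Space d)),
      IsDeGiorgiSolution μ₀ A₀ μ A →
      IntegrableOn (fun t => relEntropy (μ t) (fun t i x => ξ i (t, x)) t) (Ioc 0 Tc) ∧
      (∀ᵐ T ∂(volume.restrict (Ioc 0 Tc)),
        relEntropy (μ T) (fun t i x => ξ i (t, x)) T ≤
          relEntropy μ₀ (fun t i x => ξ i (t, x)) 0 +
            K * ∫ t in Ioc 0 T, relEntropy (μ t) (fun t i x => ξ i (t, x)) t) ∧
      ∀ n, IntegrableOn (fun t => weightedBulk (scaledWeight n) (A t) fun i x => ϑ i (t, x))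
          (Ioc 0 Tc) ∧
        ∀ᵐ T ∂(volume.restrict (Ioc 0 Tc)),
          weightedBulk (scaledWeight n) (A T) (fun i x => ϑ i (T, x)) ≤
            weightedBulk (scaledWeight n) A₀ (fun i x => ϑ i (0, x)) +
              relEntropy μ₀ (fun t i x => ξ i (t, x)) 0 +
              K * ((∫ t in Ioc 0 T, weightedBulk (scaledWeight n) (A t) fun i x => ϑ i (t, x)) +
                ∫ t in Ioc 0 T, relEntropy (μ t) (fun t i x => ξ i (t, x)) t) := by
  obtain ⟨K, hK0, hK⟩ := IsSpacetimeForm.exists_dissipation_le P hc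
  set K₁ : ℝ := C + ((d : ℝ) + 1) * M + d * M with hK₁
  have hC0 := hc.C_nonneg
  have hM0 := hc.M_nonneg
  have hK₁0 : 0 ≤ K₁ := by positivity
  refine ⟨K + K₁, by positivity, fun μ₀ A₀ μ A h => ?_⟩
  obtain ⟨V, H, κ, κn, hf⟩ := h.exists_spacetimeForm
  have := hf.finite
  have hcomp := h.compatible
  have hEi := fun T => hf.integrable_relEntropy hcomp hc T
  have hE0 : ∀ T, 0 ≤ ∫ t in Ioc 0 T, relEntropy (μ t) (fun t i x => ξ i (t, x)) t := fun T =>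
    integral_nonneg fun t => relEntropy_nonneg hc _ _
  have hent := hf.relEntropy_le h.initial_compatible h.initial_partition hcomp h.partition hc
  have hdis := hK μ₀ A₀ μ A V H κ κn hf hcomp
  have hϑM : ∀ i z, ‖ϑ i z‖ ≤ M := hc.weight_le
  refine ⟨hEi Tc, ?_, fun n => ⟨?_, ?_⟩⟩
  · filter_upwards [hent] with T hT
    have h1 := hdis (fun _ _ => 0) (fun _ => continuous_const) (fun _ _ => by simpa using hM0)
      (fun t i j hij x => by
        have := (hc.calibrated t).dist_nonneg i j x
        simp only [sub_zero, abs_zero]; positivity) T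
    have h2 := mul_nonneg hK₁0 (hE0 T)
    linarith
  · exact integrable_finsetSum _ fun i _ => (integral_weighted_slab
      (isWeight_scaledWeight n).integrable (hc.weight_lip i).continuous (hϑM i)
      (h.phase_measurable i)).1
  · have hw := isWeight_scaledWeight (d := d) n
    set ψ : Space d → ℝ := scaledWeight n with hψ
    have hψc : Continuous ψ := hw.contDiff.continuous
    set w : Fin P → ℝ × Space d → ℝ := fun i q => ψ q.2 * ϑ i q with hwdef
    have hwc : ∀ i, Continuous (w i) := fun i => by
      have := (hc.weight_lip i).continuous
      fun_prop
    have hψabs : ∀ x, |ψ x| ≤ 1 := fun x => by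
      rw [abs_of_nonneg (hw.nonneg x)]; exact hw.le_one x
    have hwM : ∀ i q, |w i q| ≤ M := fun i q => by
      rw [hwdef, abs_mul]
      exact (mul_le_of_le_one_left (abs_nonneg _) (hψabs _)).trans (hc.weight_le i q)
    have hwδ : ∀ t i j, i ≠ j → ∀ x, |w i (t, x) - w j (t, x)| ≤ C * δ t i j x :=
      fun t i j hij x => by
        simp only [hwdef]
        rw [← mul_sub, abs_mul]
        exact (mul_le_of_le_one_left (abs_nonneg _) (hψabs _)).trans
          (hc.weight_sub_le t i j hij x)
    filter_upwards [hent, ae_restrict_Ioc_of_Ioi (ae_all_iff.2 hf.evolution),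
      ae_restrict_mem measurableSet_Ioc] with T hT hev hTm
    have hJ := hdis w hwc hwM hwδ T
    have hET := relEntropy_nonneg hc (μ T) T
    have hb : ∀ i, ∫ q, ψ q.2.1 * ϑ i (base q) *
        (inner ℝ (B (base q)) (q.2.2 : Space d) - V q.1 i q.2.1) ∂(spacetime (κ i) T) =
        (∫ q, grainDensity (fun q => V q.1 i q.2) (w i) (ξ i) (τ i) B (Dξ i) DB q
          ∂(spacetime (κ i) T)) -
        ∫ q, grainDensity (fun q => V q.1 i q.2) (fun _ => 0) (ξ i) (τ i) B (Dξ i) DB q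
          ∂(spacetime (κ i) T) := fun i => by
      rw [← integral_sub (hf.integrable_grainDensity hc i T (hwc i) (hwM i))
        (hf.integrable_grainDensity hc i T continuous_const (fun _ => by simpa using hM0))]
      refine integral_congr_ae (Eventually.of_forall fun q => ?_)
      simp only [grainDensity, hwdef, base, inner_add_left, inner_smul_left, zero_smul, add_zero]
      simp
      ring
    have hbulk : ∀ i, _ := fun i => weighted_bulk_le (C := C) (M' := M) (A := fun t => A t i)
      hTm.1.le (hev i) ((h.initial_partition.isOpen i).measurableSet)
      (((h.partition T hTm.1).isOpen i).measurableSet) (h.phase_measurable i) hw (by positivity)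
      (hc.weight_lip i) (hϑM i) hc.B_C1 (by
        have h1 : (volume.restrict (Ioc 0 T ×ˢ (univ : Set (Space d))) : Measure (ℝ × Space d)) ≤
            volume.restrict (Ioo 0 Tc ×ˢ univ) := by
          rw [Measure.volume_eq_prod, ← Measure.prod_restrict, ← Measure.prod_restrict,
            restrict_Ioo_eq_restrict_Ioc]
          exact Measure.prod_mono (Measure.restrict_mono_set _ (Ioc_subset_Ioc_right hTm.2)) le_rfl
        exact ae_mono h1 (hc.weight_transport i))
    have hsl := fun i => (integral_weighted_slab (T := T) (A := fun t => A t i) hw.integrable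
      (hc.weight_lip i).continuous (hϑM i) (h.phase_measurable i))
    have hsum : ∫ t in Ioc 0 T, weightedBulk ψ (A t) (fun i x => ϑ i (t, x)) =
        ∑ i, ∫ q, ψ q.2 * bulkDensity (track fun t => A t i) (ϑ i) q
          ∂(volume.restrict (Ioc 0 T ×ˢ univ)) := by
      simp only [weightedBulk, (hsl _).2]
      exact integral_finsetSum _ fun i _ => (hsl i).1
    have htot := Finset.sum_le_sum fun i (_ : i ∈ Finset.univ) => hbulk i
    simp only [Finset.sum_add_distrib, ← Finset.mul_sum] at htot
    rw [← hsum] at htot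
    have hb' : ∑ i, ∫ q, ψ q.2.1 * ϑ i (base q) *
        (inner ℝ (B (base q)) (q.2.2 : Space d) - V (base q).1 i (base q).2)
          ∂(spacetime (κ i) T) = _ := Finset.sum_congr rfl fun i _ => hb i
    rw [hb', Finset.sum_sub_distrib] at htot
    have p1 := mul_nonneg hK₁0 (hE0 T)
    have p2 : 0 ≤ ∫ t in Ioc 0 T, weightedBulk ψ (A t) (fun i x => ϑ i (t, x)) :=
      integral_nonneg fun t => weightedBulk_nonneg hw.nonneg _ _
    have p3 := mul_nonneg hK0 p2
    change weightedBulk ψ (A T) (fun i x => ϑ i (T, x)) ≤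
      weightedBulk ψ A₀ (fun i x => ϑ i (0, x)) + _ + _ at htot
    rw [← hK₁] at htot
    linarith

end BulkTotal

/-! ### Stability for calibrated evolutions -/

section Stability

variable {d P : ℕ}

/-- Two phase partitions agree outside a set of finite volume. -/
lemma IsPhasePartition.exists_finite_volume {A 𝒜 : Fin P → Set (Space d)} (hA : IsPhasePartition A)
    (h𝒜 : IsPhasePartition 𝒜) : ∃ S : Set (Space d), MeasurableSet S ∧ volume S < ⊤ ∧
      ∀ᵐ x, x ∉ S → ∀ i, x ∈ A i ↔ x ∈ 𝒜 i := by
  refine ⟨⋃ j : {j : Fin P // (j : ℕ) + 1 ≠ P}, (A j ∪ 𝒜 j),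
    MeasurableSet.iUnion fun j => (hA.isOpen j).measurableSet.union (h𝒜.isOpen j).measurableSet,
    ?_, ?_⟩
  · refine (measure_iUnion_le _).trans_lt ?_
    rw [tsum_fintype]
    exact ENNReal.sum_lt_top.2 fun j _ => (measure_union_le _ _).trans_lt
      (ENNReal.add_lt_top.2 ⟨hA.finiteVolume j j.2, h𝒜.finiteVolume j j.2⟩)
  · filter_upwards [hA.cover, h𝒜.cover] with x ⟨k, hk⟩ ⟨l, hl⟩ hx i
    have hk' : (k : ℕ) + 1 = P := by
      by_contra h
      exact hx (mem_iUnion.2 ⟨⟨k, h⟩, Or.inl hk⟩)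
    have hl' : (l : ℕ) + 1 = P := by
      by_contra h
      exact hx (mem_iUnion.2 ⟨⟨l, h⟩, Or.inr hl⟩)
    have hkl : k = l := Fin.ext (by omega)
    subst hkl
    by_cases hik : i = k
    · subst hik; exact iff_of_true hk hl
    · exact iff_of_false (fun h => disjoint_left.1 (hA.disjoint i k hik) h hk)
        (fun h => disjoint_left.1 (h𝒜.disjoint i k hik) h hl)

lemma integrable_bulkDensity {A 𝒜 : Fin P → Set (Space d)} (hA : IsPhasePartition A)
    (h𝒜 : IsPhasePartition 𝒜) {i : Fin P} {θ : Space d → ℝ} {M : ℝ} (hθ : Continuous θ)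
    (hM : ∀ x, |θ x| ≤ M) (hneg : ∀ x, θ x < 0 ↔ x ∈ 𝒜 i) :
    Integrable (bulkDensity (A i) θ) := by
  obtain ⟨S, hS, hSv, hS'⟩ := hA.exists_finite_volume h𝒜
  have h1 : Integrable (S.indicator fun _ => M) :=
    (integrable_indicator_iff hS).2 (integrableOn_const hSv.ne)
  refine h1.mono' (aestronglyMeasurable_bulkDensity
    (hA.isOpen i).measurableSet.nullMeasurableSet hθ.measurable) ?_
  filter_upwards [hS'] with x hx
  rw [Real.norm_of_nonneg (bulkDensity_nonneg _ _ _)]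
  by_cases hxS : x ∈ S
  · rw [indicator_of_mem hxS]
    exact (bulkDensity_le_abs _ _ _).trans (hM x)
  · rw [indicator_of_notMem hxS, bulkDensity_eq hneg]
    have h2 := hx hxS i
    by_cases hxA : x ∈ A i
    · simp [hxA, h2.1 hxA]
    · simp [hxA, mt h2.2 hxA]

variable {T : ℝ} {𝒜 : ℝ → Fin P → Set (Space d)} {ξ : ℝ → Fin P → Space d → Space d}
  {B : ℝ → Space d → Space d} {ϑ : ℝ → Fin P → Space d → ℝ}

lemma IsCalibratedEvolution.weight_neg_iff (h : IsCalibratedEvolution T 𝒜 ξ B ϑ) {t : ℝ}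
    (ht : t ∈ Icc 0 T) (i : Fin P) (x : Space d) : ϑ t i x < 0 ↔ x ∈ 𝒜 t i := by
  refine ⟨fun hx => ?_, h.weight_neg i t ht x⟩
  by_contra hxA
  have h1 : x ∈ closure (𝒜 t i) := by
    by_contra h2
    exact (h.weight_pos i t ht x h2).not_gt hx
  obtain ⟨c, C, -, -, -, hcC⟩ := h.weight_coercive
  have h2 : x ∈ frontier (𝒜 t i) := by
    rw [((h.partition t ht).isOpen i).frontier_eq]
    exact ⟨h1, hxA⟩
  have h3 : truncDist x (frontier (𝒜 t i)) = 0 := by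
    simp [truncDist, Metric.infEDist_zero_of_mem h2]
  have h4 := (hcC i t ht x).2
  rw [h3, mul_zero] at h4
  exact hx.ne (abs_nonpos_iff.1 h4)

lemma relEntropy_clampField (m : Fin P → Fin P → Varifold d) {t : ℝ} (ht : t ∈ Icc 0 T) :
    relEntropy m (fun t i x => clampField T (fun t => ξ t i) (t, x)) t = relEntropy m ξ t := by
  simp only [relEntropy, xiDiff, clampField_of_mem ht]

lemma IsCalibratedEvolution.bulkError_eq (h : IsCalibratedEvolution T 𝒜 ξ B ϑ) {t : ℝ}
    (ht : t ∈ Icc 0 T) (A : Fin P → Set (Space d)) :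
    bulkError A (𝒜 t) (ϑ t) =
      weightedBulk (fun _ => 1) A fun i x => clampField T (fun t => ϑ t i) (t, x) := by
  simp only [clampField_of_mem ht, bulkError, weightedBulk, one_mul]
  refine Finset.sum_congr rfl fun i _ => integral_congr_ae (Eventually.of_forall fun x => ?_)
  exact (bulkDensity_eq (h.weight_neg_iff ht i) x).symm

/-- Stability of the relative entropy and of the bulk error. -/
theorem IsCalibratedEvolution.exists_stability (hT : 0 < T)
    (h : IsCalibratedEvolution T 𝒜 ξ B ϑ) :
    ∃ K : ℝ, 0 < K ∧ ∀ (μ₀ : Fin P → Fin P → Varifold d) (A₀ : Fin P → Set (Space d))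
      (μ : ℝ → Fin P → Fin P → Varifold d) (A : ℝ → Fin P → Set (Space d)),
      IsDeGiorgiSolution μ₀ A₀ μ A →
      IntegrableOn (fun t => relEntropy (μ t) ξ t) (Ioc 0 T) ∧
      IntegrableOn (fun t => bulkError (A t) (𝒜 t) (ϑ t)) (Ioc 0 T) ∧
      (∀ᵐ t ∂(volume.restrict (Ioc 0 T)),
        relEntropy (μ t) ξ t ≤ relEntropy μ₀ ξ 0 + K * ∫ s in Ioc 0 t, relEntropy (μ s) ξ s) ∧
      ∀ᵐ t ∂(volume.restrict (Ioc 0 T)),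
        bulkError (A t) (𝒜 t) (ϑ t) ≤ bulkError A₀ (𝒜 0) (ϑ 0) + relEntropy μ₀ ξ 0 +
          K * ((∫ s in Ioc 0 t, bulkError (A s) (𝒜 s) (ϑ s)) +
            ∫ s in Ioc 0 t, relEntropy (μ s) ξ s) := by
  obtain ⟨c, C, M, L, hc⟩ := h.exists_spacetimeCalibration hT
  obtain ⟨K, hK0, hK⟩ := exists_weightedBulk_le P hc
  refine ⟨K + 1, by positivity, fun μ₀ A₀ μ A hsol => ?_⟩
  obtain ⟨hEi, hE, hbulk⟩ := hK μ₀ A₀ μ A hsol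
  set ϑc : ℝ → Fin P → Space d → ℝ := fun t i x => clampField T (fun t => ϑ t i) (t, x) with hϑc
  have h0T : (0 : ℝ) ∈ Icc 0 T := ⟨le_rfl, hT.le⟩
  have hIcc : ∀ {t : ℝ}, t ∈ Ioc 0 T → t ∈ Icc 0 T := fun ht => Ioc_subset_Icc_self ht
  have hEeq : ∀ t ∈ Ioc 0 T, relEntropy (μ t)
      (fun t i x => clampField T (fun t => ξ t i) (t, x)) t = relEntropy (μ t) ξ t :=
    fun t ht => relEntropy_clampField (μ t) (hIcc ht)
  have hEint : ∀ t ∈ Ioc 0 T, ∫ s in Ioc 0 t, relEntropy (μ s)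
      (fun t i x => clampField T (fun t => ξ t i) (t, x)) s = ∫ s in Ioc 0 t, relEntropy (μ s) ξ s :=
    fun t ht => setIntegral_congr_fun measurableSet_Ioc fun s hs =>
      hEeq s ⟨hs.1, hs.2.trans ht.2⟩
  have hE0 : ∀ t, 0 ≤ relEntropy (μ t) (fun t i x => clampField T (fun t => ξ t i) (t, x)) t :=
    fun t => relEntropy_nonneg hc _ _
  have hi : ∀ t ∈ Icc 0 T, ∀ A' : Fin P → Set (Space d), IsPhasePartition A' → ∀ i,
      Integrable (bulkDensity (A' i) (ϑc t i)) := fun t ht A' hA' i =>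
    integrable_bulkDensity hA' (h.partition t ht) ((hc.weight_lip i).continuous.comp (by fun_prop))
      (fun x => hc.weight_le i (t, x)) fun x => by
        simp only [hϑc, clampField_of_mem ht]
        exact h.weight_neg_iff ht i x
  set e : ℝ → ℝ := fun t => weightedBulk (fun _ => 1) (A t) (ϑc t) with he
  set en : ℕ → ℝ → ℝ := fun n t => weightedBulk (scaledWeight n) (A t) (ϑc t) with hen
  have hen0 : ∀ n t, 0 ≤ en n t := fun n t =>
    weightedBulk_nonneg (isWeight_scaledWeight n).nonneg _ _
  have he0 : ∀ t, 0 ≤ e t := fun t => weightedBulk_nonneg (fun _ => zero_le_one) _ _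
  have hle : ∀ n, ∀ t ∈ Ioc 0 T, en n t ≤ e t := fun n t ht =>
    weightedBulk_le (isWeight_scaledWeight n).contDiff.continuous (isWeight_scaledWeight n).nonneg
      (isWeight_scaledWeight n).le_one (hi t (hIcc ht) _ (hsol.partition t ht.1))
  have hle0 : ∀ n, weightedBulk (scaledWeight n) A₀ (ϑc 0) ≤
      weightedBulk (fun _ => 1) A₀ (ϑc 0) := fun n =>
    weightedBulk_le (isWeight_scaledWeight n).contDiff.continuous (isWeight_scaledWeight n).nonneg
      (isWeight_scaledWeight n).le_one (hi 0 h0T _ hsol.initial_partition)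
  have hlim : ∀ t ∈ Ioc 0 T, Tendsto (fun n => en n t) atTop (𝓝 (e t)) := fun t ht =>
    tendsto_weightedBulk (hi t (hIcc ht) _ (hsol.partition t ht.1))
  have hE00 := relEntropy_nonneg hc μ₀ 0
  set a : ℝ := weightedBulk (fun _ => 1) A₀ (ϑc 0) +
    relEntropy μ₀ (fun t i x => clampField T (fun t => ξ t i) (t, x)) 0 with ha
  have ha0 : 0 ≤ a := add_nonneg (weightedBulk_nonneg (fun _ => zero_le_one) _ _) hE00
  set I : ℝ → ℝ := fun t => ∫ s in Ioc 0 t, relEntropy (μ s)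
    (fun t i x => clampField T (fun t => ξ t i) (t, x)) s with hI
  have hI0 : ∀ t, 0 ≤ I t := fun t => integral_nonneg fun s => hE0 s
  have hImono : ∀ t ∈ Ioc 0 T, I t ≤ I T := fun t ht =>
    setIntegral_mono_set hEi (Eventually.of_forall hE0)
      (Eventually.of_forall (Ioc_subset_Ioc_right ht.2))
  have hineq : ∀ᵐ t ∂(volume.restrict (Ioc 0 T)), ∀ n,
      en n t ≤ a + K * ((∫ s in Ioc 0 t, en n s) + I t) := by
    rw [ae_all_iff]
    intro n
    filter_upwards [(hbulk n).2] with t ht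
    have := hle0 n
    refine ht.trans ?_
    simp only [ha]
    gcongr
  have heni : ∀ n, IntegrableOn (en n) (Ioc 0 T) := fun n => (hbulk n).1
  -- the localized errors are bounded uniformly in the scale of the localization
  have hbd : ∀ᵐ t ∂(volume.restrict (Ioc 0 T)), ∀ n,
      en n t ≤ (a + K * I T) * Real.exp (K * T) := by
    rw [ae_all_iff]
    intro n
    refine ae_le_exp_of_ae_le_integral (f := en n) (a := a + K * I T)
      (add_nonneg ha0 (mul_nonneg hK0 (hI0 T))) hK0 (heni n) ?_
    filter_upwards [hineq, ae_restrict_mem measurableSet_Ioc] with t ht htm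
    have h1 := mul_le_mul_of_nonneg_left (hImono t htm) hK0
    have h2 := ht n
    linarith
  have hei : IntegrableOn e (Ioc 0 T) := by
    have hm : AEStronglyMeasurable e (volume.restrict (Ioc 0 T)) := by
      refine aestronglyMeasurable_of_tendsto_ae atTop (f := en)
        (fun n => (heni n).aestronglyMeasurable) ?_
      filter_upwards [ae_restrict_mem measurableSet_Ioc] with t ht using hlim t ht
    refine Integrable.mono' (integrable_const ((a + K * I T) * Real.exp (K * T))) hm ?_
    filter_upwards [hbd, ae_restrict_mem measurableSet_Ioc] with t ht htm
    rw [Real.norm_of_nonneg (he0 t)]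
    exact le_of_tendsto' (hlim t htm) ht
  have heeq : ∀ t ∈ Ioc 0 T, e t = bulkError (A t) (𝒜 t) (ϑ t) := fun t ht =>
    (h.bulkError_eq (hIcc ht) (A t)).symm
  refine ⟨hEi.congr_fun hEeq measurableSet_Ioc, hei.congr_fun heeq measurableSet_Ioc, ?_, ?_⟩
  · filter_upwards [hE, ae_restrict_mem measurableSet_Ioc] with t ht htm
    have h1 := hI0 t
    simp only [hI] at h1
    rw [hEint t htm] at ht h1
    rw [hEeq t htm, relEntropy_clampField μ₀ h0T] at ht
    linarith
  · filter_upwards [hineq, ae_restrict_mem measurableSet_Ioc] with t ht htm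
    have hsub : Ioc 0 t ⊆ Ioc 0 T := Ioc_subset_Ioc_right htm.2
    have h1 : e t ≤ a + K * ((∫ s in Ioc 0 t, e s) + I t) := by
      refine le_of_tendsto' (hlim t htm) fun n => (ht n).trans ?_
      have h0 : ∫ s in Ioc 0 t, en n s ≤ ∫ s in Ioc 0 t, e s :=
        setIntegral_mono_on ((heni n).mono_set hsub) (hei.mono_set hsub) measurableSet_Ioc
          fun s hs => hle n s (hsub hs)
      have := mul_le_mul_of_nonneg_left h0 hK0
      linarith
    have h2 : ∫ s in Ioc 0 t, e s = ∫ s in Ioc 0 t, bulkError (A s) (𝒜 s) (ϑ s) :=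
      setIntegral_congr_fun measurableSet_Ioc fun s hs => heeq s (hsub hs)
    have h3 := hI0 t
    have h4 : 0 ≤ ∫ s in Ioc 0 t, e s := integral_nonneg fun s => he0 s
    have h5 : I t = ∫ s in Ioc 0 t, relEntropy (μ s) ξ s := hEint t htm
    have h6 : a = bulkError A₀ (𝒜 0) (ϑ 0) + relEntropy μ₀ ξ 0 := by
      rw [ha, relEntropy_clampField μ₀ h0T, h.bulkError_eq h0T]
    rw [← heeq t htm, ← h2, ← h5, ← h6]
    linarith

end Stability

/-! ### Polar decompositions and the reduced boundary -/

section Polar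

variable {d : ℕ}

lemma IsTest.smul_const {E Y : Type*} [NormedAddCommGroup E] [NormedSpace ℝ E]
    [NormedAddCommGroup Y] [NormedSpace ℝ Y] {g : E → ℝ} (hg : IsTest g) (y : Y) :
    IsTest fun x => g x • y :=
  ⟨hg.1.smul contDiff_const, hg.2.smul_right⟩

/-- A vector measure `a ρ` determines the product of `a` with the density of `ρ` relative to any
measure dominating `ρ`. -/
lemma ae_density_eq {ρ ν : Measure (Space d)} [IsFiniteMeasure ρ] [IsFiniteMeasure ν]
    {a b : Space d → Space d} (ha : Integrable a ρ) (hb : Integrable b ν)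
    (h : ∀ φ : Space d → Space d, IsTest φ →
      ∫ x, inner ℝ (φ x) (a x) ∂ρ = ∫ x, inner ℝ (φ x) (b x) ∂ν) :
    ∀ᵐ x ∂(ρ + ν), (ρ.rnDeriv (ρ + ν) x).toReal • a x = (ν.rnDeriv (ρ + ν) x).toReal • b x := by
  have : ρ.HaveLebesgueDecomposition (ρ + ν) :=
    Measure.haveLebesgueDecomposition_of_sigmaFinite _ _
  have : ν.HaveLebesgueDecomposition (ρ + ν) :=
    Measure.haveLebesgueDecomposition_of_sigmaFinite _ _
  have hρ : ρ ≪ ρ + ν := Measure.AbsolutelyContinuous.rfl.add_right ν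
  have hν : ν ≪ ρ + ν := (Measure.AbsolutelyContinuous.rfl.add_right ρ).trans
    (by rw [add_comm])
  have ia : Integrable (fun x => (ρ.rnDeriv (ρ + ν) x).toReal • a x) (ρ + ν) :=
    (integrable_rnDeriv_smul_iff hρ).2 ha
  have ib : Integrable (fun x => (ν.rnDeriv (ρ + ν) x).toReal • b x) (ρ + ν) :=
    (integrable_rnDeriv_smul_iff hν).2 hb
  have key := ae_eq_zero_of_integral_contDiff_smul_eq_zero (ia.sub ib).locallyIntegrable
    fun g hg hgs => by
    have hgt : IsTest g := ⟨hg, hgs⟩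
    obtain ⟨Cg, hCg⟩ := hgt.exists_bound
    have hgm : AEStronglyMeasurable g (ρ + ν) := hg.continuous.aestronglyMeasurable
    have ja : Integrable (fun x => g x • (ρ.rnDeriv (ρ + ν) x).toReal • a x) (ρ + ν) :=
      ia.bdd_smul Cg hgm (Eventually.of_forall hCg)
    have jb : Integrable (fun x => g x • (ν.rnDeriv (ρ + ν) x).toReal • b x) (ρ + ν) :=
      ib.bdd_smul Cg hgm (Eventually.of_forall hCg)
    have e1 : ∫ x, g x • (ρ.rnDeriv (ρ + ν) x).toReal • a x ∂(ρ + ν) = ∫ x, g x • a x ∂ρ := by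
      rw [← integral_rnDeriv_smul hρ]
      exact integral_congr_ae (Eventually.of_forall fun x => smul_comm _ _ _)
    have e2 : ∫ x, g x • (ν.rnDeriv (ρ + ν) x).toReal • b x ∂(ρ + ν) = ∫ x, g x • b x ∂ν := by
      rw [← integral_rnDeriv_smul hν]
      exact integral_congr_ae (Eventually.of_forall fun x => smul_comm _ _ _)
    have ka : Integrable (fun x => g x • a x) ρ :=
      ha.bdd_smul Cg hg.continuous.aestronglyMeasurable (Eventually.of_forall hCg)
    have kb : Integrable (fun x => g x • b x) ν :=
      hb.bdd_smul Cg hg.continuous.aestronglyMeasurable (Eventually.of_forall hCg)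
    simp only [Pi.sub_apply, smul_sub]
    rw [integral_sub ja jb, e1, e2, sub_eq_zero]
    refine ext_inner_left ℝ fun v => ?_
    rw [← integral_inner ka v, ← integral_inner kb v]
    have := h _ (hgt.smul_const v)
    simpa only [inner_smul_left, inner_smul_right, RCLike.conj_to_real] using this
  filter_upwards [key] with x hx
  exact sub_eq_zero.1 hx

/-- A property holds `ρ`-almost everywhere if and only if it holds `σ`-almost everywhere on the set
where the density of `ρ` does not vanish. -/
lemma ae_rnDeriv_ne_zero {ρ σ : Measure (Space d)} [IsFiniteMeasure ρ] [IsFiniteMeasure σ]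
    (h : ρ ≪ σ) {p : Space d → Prop} :
    (∀ᵐ x ∂ρ, p x) ↔ ∀ᵐ x ∂σ, ρ.rnDeriv σ x ≠ 0 → p x := by
  have : ρ.HaveLebesgueDecomposition σ := Measure.haveLebesgueDecomposition_of_sigmaFinite _ _
  conv_lhs => rw [← Measure.withDensity_rnDeriv_eq ρ σ h]
  exact ae_withDensity_iff (Measure.measurable_rnDeriv ρ σ)

/-- The polar decomposition of the gradient of an indicator function is unique. -/
lemma IsPolarGradient.unique {A A' : Set (Space d)} {ρ ρ' : Measure (Space d)}
    {n n' : Space d → Space d} (h : IsPolarGradient A ρ n) (h' : IsPolarGradient A' ρ' n')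
    (hA : A =ᵐ[volume] A') : ρ = ρ' ∧ ∀ᵐ x ∂ρ, n x = n' x := by
  obtain ⟨hf, hm, hn, hd⟩ := h
  obtain ⟨hf', hm', hn', hd'⟩ := h'
  have i1 : Integrable n ρ := Integrable.mono' (integrable_const 1) hm.aestronglyMeasurable
    (hn.mono fun x hx => hx.le)
  have i2 : Integrable n' ρ' := Integrable.mono' (integrable_const 1) hm'.aestronglyMeasurable
    (hn'.mono fun x hx => hx.le)
  have key := ae_density_eq i1 i2 fun φ hφ => by
    have := hd φ hφ
    rw [setIntegral_congr_set hA, hd' φ hφ] at this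
    linarith
  have : ρ.HaveLebesgueDecomposition (ρ + ρ') :=
    Measure.haveLebesgueDecomposition_of_sigmaFinite _ _
  have : ρ'.HaveLebesgueDecomposition (ρ + ρ') :=
    Measure.haveLebesgueDecomposition_of_sigmaFinite _ _
  have hρ : ρ ≪ ρ + ρ' := Measure.AbsolutelyContinuous.rfl.add_right ρ'
  have hρ' : ρ' ≪ ρ + ρ' := (Measure.AbsolutelyContinuous.rfl.add_right ρ).trans (by rw [add_comm])
  rw [ae_rnDeriv_ne_zero hρ] at hn
  rw [ae_rnDeriv_ne_zero hρ'] at hn'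
  have hmain : ∀ᵐ x ∂(ρ + ρ'), ρ.rnDeriv (ρ + ρ') x = ρ'.rnDeriv (ρ + ρ') x ∧
      (ρ.rnDeriv (ρ + ρ') x ≠ 0 → n x = n' x) := by
    filter_upwards [key, hn, hn', Measure.rnDeriv_ne_top ρ (ρ + ρ'),
      Measure.rnDeriv_ne_top ρ' (ρ + ρ')] with x h1 h2 h3 h4 h5
    have h6 := congrArg norm h1
    simp only [norm_smul, Real.norm_of_nonneg ENNReal.toReal_nonneg] at h6
    by_cases c1 : ρ.rnDeriv (ρ + ρ') x = 0 <;> by_cases c2 : ρ'.rnDeriv (ρ + ρ') x = 0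
    · exact ⟨c1.trans c2.symm, fun h => absurd c1 h⟩
    · rw [h3 c2, c1, ENNReal.toReal_zero, zero_mul, mul_one] at h6
      exact absurd ((ENNReal.toReal_eq_zero_iff _).1 h6.symm) (by simp [c2, h5])
    · rw [h2 c1, c2, ENNReal.toReal_zero, zero_mul, mul_one] at h6
      exact absurd ((ENNReal.toReal_eq_zero_iff _).1 h6) (by simp [c1, h4])
    · rw [h2 c1, h3 c2, mul_one, mul_one] at h6
      refine ⟨(ENNReal.toReal_eq_toReal_iff' h4 h5).1 h6, fun _ => ?_⟩
      rw [← h6] at h1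
      exact smul_right_injective _ (ENNReal.toReal_ne_zero.2 ⟨c1, h4⟩) h1
  refine ⟨?_, (ae_rnDeriv_ne_zero hρ).2 (hmain.mono fun x hx => hx.2)⟩
  calc ρ = (ρ + ρ').withDensity (ρ.rnDeriv (ρ + ρ')) :=
        (Measure.withDensity_rnDeriv_eq _ _ hρ).symm
    _ = (ρ + ρ').withDensity (ρ'.rnDeriv (ρ + ρ')) :=
        withDensity_congr_ae (hmain.mono fun x hx => hx.1)
    _ = ρ' := Measure.withDensity_rnDeriv_eq _ _ hρ'

/-- Averages over open balls are limits of averages over slightly smaller closed balls. -/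
lemma norm_average_ball_sub_le {ρ : Measure (Space d)} [IsFiniteMeasure ρ] {f : Space d → Space d}
    (hf : Integrable f ρ) {x y : Space d} {r ε : ℝ} (hr : 0 < r) (hpos : 0 < ρ (Metric.ball x r))
    (h : ∀ s, 0 < s → s < r → ‖(⨍ z in Metric.closedBall x s, f z ∂ρ) - y‖ ≤ ε) :
    ‖(⨍ z in Metric.ball x r, f z ∂ρ) - y‖ ≤ ε := by
  set s : ℕ → ℝ := fun k => r * (1 - 1 / ((k : ℝ) + 2)) with hs
  have hs0 : ∀ k, 0 < s k := fun k => by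
    have : 1 / ((k : ℝ) + 2) < 1 := by
      rw [div_lt_one (by positivity)]; linarith [k.cast_nonneg (α := ℝ)]
    exact mul_pos hr (by linarith)
  have hsr : ∀ k, s k < r := fun k => by
    have : 0 < 1 / ((k : ℝ) + 2) := by positivity
    simp only [hs]
    nlinarith
  have hmono : Monotone fun k => Metric.closedBall x (s k) := fun k l hkl => by
    refine Metric.closedBall_subset_closedBall ?_
    simp only [hs]
    gcongr
  have hlim : Tendsto s atTop (𝓝 r) := by
    have h1 : Tendsto (fun k : ℕ => 1 / ((k : ℝ) + 2)) atTop (𝓝 0) := by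
      have := (tendsto_const_div_atTop_nhds_zero_nat (1 : ℝ)).comp (tendsto_add_atTop_nat 2)
      refine this.congr fun k => by simp
    have h2 := (h1.const_sub 1).const_mul r
    rwa [sub_zero, mul_one] at h2
  have hU : ⋃ k, Metric.closedBall x (s k) = Metric.ball x r := by
    ext z
    simp only [mem_iUnion, Metric.mem_closedBall, Metric.mem_ball]
    refine ⟨fun ⟨k, hk⟩ => hk.trans_lt (hsr k), fun hz => ?_⟩
    obtain ⟨k, hk⟩ := (hlim.eventually (lt_mem_nhds hz)).exists
    exact ⟨k, hk.le⟩
  have h1 := tendsto_setIntegral_of_monotone (μ := ρ) (f := f)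
    (fun k => Metric.isClosed_closedBall.measurableSet) hmono hf.integrableOn
  have h2 := tendsto_measure_iUnion_atTop (μ := ρ) hmono
  rw [hU] at h1 h2
  have h3 := ((ENNReal.tendsto_toReal (measure_ne_top ρ _)).comp h2).inv₀
    (ENNReal.toReal_ne_zero.2 ⟨hpos.ne', measure_ne_top ρ _⟩)
  have h4 := ((h3.smul h1).sub_const y).norm
  have e : ∀ S : Set (Space d), ⨍ z in S, f z ∂ρ = (ρ S).toReal⁻¹ • ∫ z in S, f z ∂ρ := fun S => by
    rw [setAverage_eq, measureReal_def]
  rw [e]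
  refine le_of_tendsto' h4 fun k => ?_
  have := h (s k) (hs0 k) (hsr k)
  rwa [e] at this

/-- The perimeter measure is concentrated on the reduced boundary, where the pointwise normal exists
and is given by the polar decomposition: Besicovitch's differentiation theorem for the perimeter
measure. It concerns averages over closed balls, whereas the reduced boundary is defined by open
ones. -/
lemma ae_isInnerNormalAt {A : Set (Space d)} (hA : HasFinitePerimeter A) :
    ∀ᵐ x ∂(perimeterMeasure A), IsInnerNormalAt A x (innerNormal A x) := by
  obtain ⟨hf, hm, hn, -⟩ := isPolarGradient_perimeterMeasure hA
  have hi : Integrable (innerNormal A) (perimeterMeasure A) :=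
    Integrable.mono' (integrable_const 1) hm.aestronglyMeasurable (hn.mono fun x hx => hx.le)
  filter_upwards [hn, (Besicovitch.vitaliFamily (perimeterMeasure A)).ae_tendsto_average
    hi.locallyIntegrable, (perimeterMeasure A).support_mem_ae] with x h1 h2 h3
  have hpos : ∀ r : ℝ, 0 < r → 0 < perimeterMeasure A (Metric.ball x r) := fun r hr =>
    (Measure.mem_support_iff_forall x).1 h3 _ (Metric.ball_mem_nhds x hr)
  refine ⟨hpos, h1, ?_⟩
  have h4 := h2.comp (Besicovitch.tendsto_filterAt (perimeterMeasure A) x)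
  rw [Metric.tendsto_nhds] at h4 ⊢
  intro ε hε
  have h5 := h4 (ε / 2) (by positivity)
  rw [eventually_nhdsWithin_iff, Metric.eventually_nhds_iff] at h5 ⊢
  obtain ⟨δ, hδ, h5⟩ := h5
  refine ⟨δ, hδ, fun r hr hr0 => ?_⟩
  have hr0 : 0 < r := hr0
  rw [dist_eq_norm]
  refine (norm_average_ball_sub_le hi hr0 (hpos r hr0) (ε := ε / 2) fun s hs hsr => ?_).trans_lt
    (by linarith)
  have hsd : dist s 0 < δ := by
    rw [Real.dist_0_eq_abs, abs_of_pos hs]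
    rw [Real.dist_0_eq_abs, abs_of_pos hr0] at hr
    linarith
  have := h5 hsd hs
  rw [dist_eq_norm] at this
  exact this.le

end Polar

/-! ### Varifolds carried by the graph of a unit normal -/

section Graph

variable {d P : ℕ}

lemma ae_condKernel_of_ae {m : Varifold d} {q : Space d → Space d → Prop}
    (hq : MeasurableSet {y : Space d × Space d | q y.1 y.2})
    (h : ∀ᵐ z ∂(m : Measure (Space d × Sph d)), q z.1 z.2) :
    ∀ᵐ x ∂(mass m), ∀ᵐ p ∂((ambient m).condKernel x), q x p := by
  have h1 : ∀ᵐ y ∂(ambient m), q y.1 y.2 := by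
    rwa [ambient, ae_map_iff measurable_toAmbient.aemeasurable hq]
  rw [← (ambient m).disintegrate (ambient m).condKernel] at h1
  have h2 := Measure.ae_ae_of_ae_compProd h1
  rwa [ambient_fst] at h2

lemma meanNormal_eq_of_ae {m : Varifold d} {N : Space d → Space d} (hN : Measurable N)
    (h : ∀ᵐ z ∂(m : Measure (Space d × Sph d)), (z.2 : Space d) = N z.1) :
    ∀ᵐ x ∂(mass m), meanNormal m x = N x := by
  filter_upwards [ae_condKernel_of_ae (q := fun x p => p = N x)
    (measurableSet_eq_fun measurable_snd (hN.comp measurable_fst)) h] with x hx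
  rw [meanNormal, integral_congr_ae hx]
  simp

/-- `m = |∇χ_A| ⊗ (δ_{n(x)})_x` in terms of the mass measure and the support of `m`. -/
lemma isUnitDensityBoundary_iff {m : Varifold d} {A : Set (Space d)} (hA : HasFinitePerimeter A) :
    IsUnitDensityBoundary m A ↔ mass m = perimeterMeasure A ∧
      ∀ᵐ z ∂(m : Measure (Space d × Sph d)), (z.2 : Space d) = innerNormal A z.1 := by
  have hn : Measurable (innerNormal A) := (isPolarGradient_perimeterMeasure hA).2.1
  have hg : Measurable fun x => (x, innerNormal A x) := measurable_id.prodMk hn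
  constructor
  · intro h
    refine ⟨?_, ?_⟩
    · rw [← ambient_fst, h, Measure.fst, Measure.map_map measurable_fst hg]
      exact Measure.map_id
    · have hs : MeasurableSet {y : Space d × Space d | y.2 = innerNormal A y.1} :=
        measurableSet_eq_fun measurable_snd (hn.comp measurable_fst)
      have h1 : ∀ᵐ y ∂(ambient m), y.2 = innerNormal A y.1 := by
        rw [h, ae_map_iff hg.aemeasurable hs]
        exact Eventually.of_forall fun x => rfl
      rwa [ambient, ae_map_iff measurable_toAmbient.aemeasurable hs] at h1
  · rintro ⟨h1, h2⟩
    rw [IsUnitDensityBoundary, ← h1, mass_eq_map, Measure.map_map hg measurable_fst, ambient]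
    refine Measure.map_congr ?_
    filter_upwards [h2] with z hz
    exact Prod.ext rfl hz

lemma mass_le_mass {m m' : Varifold d} (h : (m : Measure (Space d × Sph d)) ≤ m') :
    mass m ≤ mass m' := Measure.map_mono h measurable_fst

/-- If the vector measures `a ρ` and `b ν` agree and `b` does not vanish, then `ν` is absolutely
continuous with respect to `ρ`. -/
lemma absolutelyContinuous_of_integral_inner_eq {ρ ν : Measure (Space d)} [IsFiniteMeasure ρ]
    [IsFiniteMeasure ν] {a b : Space d → Space d} (ha : Integrable a ρ) (hb : Integrable b ν)
    (h : ∀ φ : Space d → Space d, IsTest φ →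
      ∫ x, inner ℝ (φ x) (a x) ∂ρ = ∫ x, inner ℝ (φ x) (b x) ∂ν)
    (hb0 : ∀ᵐ x ∂ν, b x ≠ 0) : ν ≪ ρ := by
  have hρ : ρ ≪ ρ + ν := Measure.AbsolutelyContinuous.rfl.add_right ν
  have hν : ν ≪ ρ + ν := (Measure.AbsolutelyContinuous.rfl.add_right ρ).trans (by rw [add_comm])
  refine Measure.AbsolutelyContinuous.mk fun s _ hs => ?_
  have h1 : ∀ᵐ x ∂ρ, x ∉ s := measure_eq_zero_iff_ae_notMem.1 hs
  refine measure_eq_zero_iff_ae_notMem.2 ?_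
  rw [ae_rnDeriv_ne_zero hρ] at h1
  rw [ae_rnDeriv_ne_zero hν] at hb0 ⊢
  filter_upwards [ae_density_eq ha hb h, h1, hb0, Measure.rnDeriv_ne_top ν (ρ + ν)]
    with x e1 e2 e3 e4 e5
  refine e2 fun e6 => ?_
  rw [e6, ENNReal.toReal_zero, zero_smul] at e1
  exact smul_ne_zero (ENNReal.toReal_ne_zero.2 ⟨e5, e4⟩) (e3 e5) e1.symm

lemma integral_inner_eq_mass (m : Varifold d) {φ : Space d → Space d} (hφ : IsTest φ) :
    ∫ z, inner ℝ (φ z.1) (z.2 : Space d) ∂(m : Measure (Space d × Sph d)) =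
      ∫ x, inner ℝ (φ x) (meanNormal m x) ∂(mass m) := by
  obtain ⟨C, hC⟩ := hφ.exists_bound
  rw [integral_inner_meanNormal m hφ.1.continuous hC,
    integral_mass (h := fun x => inner ℝ (φ x) (meanNormal m x))
      (hφ.1.continuous.stronglyMeasurable.inner (stronglyMeasurable_meanNormal m))]

lemma integrable_meanNormal (m : Varifold d) : Integrable (meanNormal m) (mass m) :=
  Integrable.mono' (integrable_const 1) (stronglyMeasurable_meanNormal m).aestronglyMeasurable
    (norm_meanNormal_le m)

lemma ae_grain {m : Fin P → Fin P → Varifold d} {i : Fin P} {q : Space d × Sph d → Prop}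
    (h0 : (m i i : Measure (Space d × Sph d)) = 0)
    (h : ∀ j, j ≠ i → ∀ᵐ z ∂(m j i : Measure (Space d × Sph d)), q z) :
    ∀ᵐ z ∂(grain m i : Measure (Space d × Sph d)), q z := by
  rw [coe_grain, h0, smul_zero, zero_add, ae_iff, Measure.finsetSum_apply]
  exact Finset.sum_eq_zero fun j hj => ae_iff.1 (h j (Finset.ne_of_mem_erase hj))

end Graph

/-! ### Rigidity: vanishing relative entropy and bulk error -/

section Rigidity

variable {d P : ℕ} {T : ℝ} {𝒜 : ℝ → Fin P → Set (Space d)} {ξ : ℝ → Fin P → Space d → Space d}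
  {B : ℝ → Space d → Space d} {ϑ : ℝ → Fin P → Space d → ℝ}

lemma IsCalibratedEvolution.continuous_xi (h : IsCalibratedEvolution T 𝒜 ξ B ϑ) {t : ℝ}
    (ht : t ∈ Icc 0 T) (i : Fin P) : Continuous (ξ t i) := by
  have h1 : ContinuousOn (ξ t i) univ := (h.xi_contDiff i).continuousOn.comp
    (f := fun x : Space d => (t, x)) (by fun_prop) fun x _ => ⟨ht, mem_univ x⟩
  exact continuousOn_univ.1 h1

lemma IsCalibratedEvolution.norm_xiDiff_le (h : IsCalibratedEvolution T 𝒜 ξ B ϑ) {t : ℝ}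
    (ht : t ∈ Icc 0 T) (i j : Fin P) (x : Space d) : ‖ξ t i x - ξ t j x‖ ≤ 1 := by
  by_cases hij : i = j
  · simp [hij]
  obtain ⟨c, hc, -, hl⟩ := h.length_control
  have h1 := hl i j hij t ht x
  have h2 : 0 ≤ c * truncDist x (interface (𝒜 t) i j) ^ 2 := by positivity
  exact sub_nonneg.1 (h2.trans h1)

/-- The calibration agrees with the normal on the interfaces of any partition which agrees with the
calibrated one up to null sets. -/
lemma IsCalibratedEvolution.ae_xi_sub_eq (h : IsCalibratedEvolution T 𝒜 ξ B ϑ) {t : ℝ}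
    (ht : t ∈ Icc 0 T) {i j : Fin P} (hij : i ≠ j) {A A' : Set (Space d)}
    (hA : HasFinitePerimeter A) (hA' : HasFinitePerimeter A') (hAi : A =ᵐ[volume] 𝒜 t i)
    (hAj : A' =ᵐ[volume] 𝒜 t j) {σ : Measure (Space d)} (hσ : σ ≪ perimeterMeasure A)
    (hσ' : σ ≪ perimeterMeasure A') :
    ∀ᵐ x ∂σ, ξ t i x - ξ t j x = -innerNormal A x := by
  have hi := (h.partition t ht).finitePerimeter i
  have hj := (h.partition t ht).finitePerimeter j
  obtain ⟨e1, e2⟩ := (isPolarGradient_perimeterMeasure hA).unique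
    (isPolarGradient_perimeterMeasure hi) hAi
  obtain ⟨e3, -⟩ := (isPolarGradient_perimeterMeasure hA').unique
    (isPolarGradient_perimeterMeasure hj) hAj
  have n1 := ae_isInnerNormalAt hi
  have n2 := ae_isInnerNormalAt hj
  rw [← e1] at n1
  rw [← e3] at n2
  filter_upwards [hσ.ae_le e2, hσ.ae_le n1, hσ'.ae_le n2] with x h1 h2 h3
  rw [h1]
  exact h.extension i j hij t ht x ⟨⟨_, h2⟩, ⟨_, h3⟩⟩ _ h2

/-- Well prepared initial data have no relative entropy. -/
lemma IsCalibratedEvolution.relEntropy_eq_zero (h : IsCalibratedEvolution T 𝒜 ξ B ϑ) {t : ℝ}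
    (ht : t ∈ Icc 0 T) {m : Fin P → Fin P → Varifold d} {A : Fin P → Set (Space d)}
    (hA : ∀ i, HasFinitePerimeter (A i)) (hm : IsCompatible m A)
    (hA𝒜 : ∀ i, A i =ᵐ[volume] 𝒜 t i) (hu : ∀ i, IsUnitDensityBoundary (grain m i) (A i)) :
    relEntropy m ξ t = 0 := by
  obtain ⟨M, hM⟩ := h.xi_bounded
  rw [relEntropy_eq_tiltExcess m (h.continuous_xi ht) (fun i x => (hM i t ht x).1), tiltExcess]
  have hg := fun i => (isUnitDensityBoundary_iff (hA i)).1 (hu i)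
  have hdiag : ∀ i, (m i i : Measure (Space d × Sph d)).real univ = 0 := fun i => by
    have hp := isPolarGradient_perimeterMeasure (hA i)
    have h1 := meanNormal_eq_of_ae hp.2.1 (ae_mono (diag_le_grain m i) (hg i).2)
    have h2 : mass (m i i) ≤ perimeterMeasure (A i) :=
      (hg i).1 ▸ mass_le_mass (diag_le_grain m i)
    have h3 : ∀ᵐ x ∂(mass (m i i)), False := by
      -- on interfaces within a phase the mean normal is both zero and a unit vector
      filter_upwards [h1, hm.normal_diag i, ae_mono h2 hp.2.2.1] with x e1 e2 e3
      rw [← e1, e2, norm_zero] at e3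
      exact zero_ne_one e3
    have h4 : (m i i : Measure (Space d × Sph d)) univ = 0 := by
      have := ae_of_ae_mass h3
      simpa [ae_iff] using this
    rw [measureReal_def, h4, ENNReal.toReal_zero]
  have hoff : ∀ i j, i ≠ j → ∫ z, (1 - inner ℝ (z.2 : Space d) (ξ t i z.1 - ξ t j z.1))
      ∂(m i j : Measure (Space d × Sph d)) = 0 := fun i j hij => by
    have h1 : mass (m i j) ≤ perimeterMeasure (A j) :=
      (hg j).1 ▸ mass_le_mass (le_grain m hij.symm)
    have h2 : mass (m i j) ≤ perimeterMeasure (A i) :=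
      hm.mass_symm i j hij ▸ (hg i).1 ▸ mass_le_mass (le_grain m hij)
    have h3 := h.ae_xi_sub_eq ht hij.symm (hA j) (hA i) (hA𝒜 j) (hA𝒜 i)
      h1.absolutelyContinuous h2.absolutelyContinuous
    refine integral_eq_zero_of_ae ?_
    filter_upwards [ae_of_ae_mass h3, ae_mono (le_grain m hij.symm) (hg j).2] with z e1 e2
    have e3 : ξ t i z.1 - ξ t j z.1 = (z.2 : Space d) := by
      rw [e2, ← neg_sub, e1, neg_neg]
    simp [e3]
  rw [Finset.sum_eq_zero fun i _ => hdiag i, Finset.sum_eq_zero fun i _ =>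
    Finset.sum_eq_zero fun j hj => hoff i j (Finset.ne_of_mem_erase hj).symm]
  simp

/-- If the relative entropy vanishes, there are no interfaces inside the phases, and all others
have the calibration as their normal. -/
lemma IsCalibratedEvolution.of_relEntropy_eq_zero (h : IsCalibratedEvolution T 𝒜 ξ B ϑ) {t : ℝ}
    (ht : t ∈ Icc 0 T) {m : Fin P → Fin P → Varifold d} (hE : relEntropy m ξ t = 0) :
    (∀ i, (m i i : Measure (Space d × Sph d)) = 0) ∧
      ∀ i j, i ≠ j → ∀ᵐ z ∂(m i j : Measure (Space d × Sph d)),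
        (z.2 : Space d) = ξ t i z.1 - ξ t j z.1 := by
  obtain ⟨M, hM⟩ := h.xi_bounded
  rw [relEntropy_eq_tiltExcess m (h.continuous_xi ht) (fun i x => (hM i t ht x).1), tiltExcess]
    at hE
  have hle : ∀ (i j : Fin P) (z : Space d × Sph d),
      0 ≤ 1 - inner ℝ (z.2 : Space d) (ξ t i z.1 - ξ t j z.1) := fun i j z => by
    have h1 := real_inner_le_norm (z.2 : Space d) (ξ t i z.1 - ξ t j z.1)
    rw [norm_sph, one_mul] at h1
    linarith [h.norm_xiDiff_le ht i j z.1]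
  have h1 : ∀ i, 0 ≤ (m i i : Measure (Space d × Sph d)).real univ := fun i => measureReal_nonneg
  have h2 : ∀ i j, 0 ≤ ∫ z, (1 - inner ℝ (z.2 : Space d) (ξ t i z.1 - ξ t j z.1))
      ∂(m i j : Measure (Space d × Sph d)) := fun i j => integral_nonneg (hle i j)
  have h3 : ∀ i, 0 ≤ ∑ j ∈ Finset.univ.erase i,
      ∫ z, (1 - inner ℝ (z.2 : Space d) (ξ t i z.1 - ξ t j z.1))
        ∂(m i j : Measure (Space d × Sph d)) := fun i => Finset.sum_nonneg fun j _ => h2 i j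
  have h4 := Finset.sum_nonneg fun i (_ : i ∈ Finset.univ) => h1 i
  have h5 := Finset.sum_nonneg fun i (_ : i ∈ Finset.univ) => h3 i
  constructor
  · intro i
    have := (Finset.sum_eq_zero_iff_of_nonneg fun i _ => h1 i).1 (by linarith) i (Finset.mem_univ i)
    exact Measure.measure_univ_eq_zero.1 ((measureReal_eq_zero_iff).1 this)
  · intro i j hij
    have e1 := (Finset.sum_eq_zero_iff_of_nonneg fun i _ => h3 i).1 (by linarith) i
      (Finset.mem_univ i)
    have e2 := (Finset.sum_eq_zero_iff_of_nonneg fun j _ => h2 i j).1 e1 j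
      (Finset.mem_erase.2 ⟨hij.symm, Finset.mem_univ j⟩)
    have hi : Integrable (fun z : Space d × Sph d =>
        1 - inner ℝ (z.2 : Space d) (ξ t i z.1 - ξ t j z.1))
        (m i j : Measure (Space d × Sph d)) := by
      have := integrable_inner_varifold (m i j) (u := fun x => ξ t i x - ξ t j x)
        ((h.continuous_xi ht i).sub (h.continuous_xi ht j)) (h.norm_xiDiff_le ht i j)
      exact ((integrable_const (1 : ℝ)).sub this).congr
        (Eventually.of_forall fun z => by
          simp only [Pi.sub_apply]; rw [real_inner_comm])
    filter_upwards [(integral_eq_zero_iff_of_nonneg (hle i j) hi).1 e2] with z hz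
    have hz : 1 - inner ℝ (z.2 : Space d) (ξ t i z.1 - ξ t j z.1) = 0 := hz
    have e3 := norm_sub_sq_real (z.2 : Space d) (ξ t i z.1 - ξ t j z.1)
    have e4 := h.norm_xiDiff_le ht i j z.1
    rw [norm_sph] at e3
    have e5 : ‖(z.2 : Space d) - (ξ t i z.1 - ξ t j z.1)‖ ^ 2 ≤ 0 := by
      rw [e3]
      nlinarith only [e4, hz, norm_nonneg (ξ t i z.1 - ξ t j z.1)]
    exact sub_eq_zero.1 (norm_eq_zero.1 (pow_eq_zero_iff two_ne_zero |>.1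
      (le_antisymm e5 (sq_nonneg _))))

/-- If the bulk error vanishes, then the phases agree up to null sets. -/
lemma IsCalibratedEvolution.ae_eq_of_bulkError_eq_zero (h : IsCalibratedEvolution T 𝒜 ξ B ϑ) {t : ℝ}
    (ht : t ∈ Icc 0 T) {A : Fin P → Set (Space d)} (hA : IsPhasePartition A)
    (hb : bulkError A (𝒜 t) (ϑ t) = 0) (i : Fin P) : A i =ᵐ[volume] 𝒜 t i := by
  have h𝒜 := h.partition t ht
  have h1 := (Finset.sum_eq_zero_iff_of_nonneg fun i _ =>
    integral_nonneg fun x => mul_nonneg (abs_nonneg _) (abs_nonneg _)).1 hb i (Finset.mem_univ i)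
  obtain ⟨L, hL⟩ := h.weight_lipschitz i
  have hcont : Continuous (ϑ t i) := by
    have h1 : ContinuousOn (ϑ t i) univ := hL.continuousOn.comp
      (f := fun x : Space d => (t, x)) (by fun_prop) fun x _ => ⟨ht, mem_univ x⟩
    exact continuousOn_univ.1 h1
  obtain ⟨c, C, hc, -, hC, hcC⟩ := h.weight_coercive
  have hbd : ∀ x, |ϑ t i x| ≤ C := fun x => (hcC i t ht x).2.trans
    (mul_le_of_le_one_right (by linarith) (truncDist_le_one _ _))
  have hi := integrable_bulkDensity hA h𝒜 hcont hbd (h.weight_neg_iff ht i)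
  have hi' := hi.congr (Eventually.of_forall (bulkDensity_eq (A := A i) (h.weight_neg_iff ht i)))
  filter_upwards [(integral_eq_zero_iff_of_nonneg
    (fun x => mul_nonneg (abs_nonneg _) (abs_nonneg _)) hi').1 h1, h𝒜.cover] with x hx ⟨j, hj⟩
  refine propext ?_
  rcases mul_eq_zero.1 hx with h2 | h2
  · have h3 := abs_eq_zero.1 h2
    by_cases e1 : x ∈ A i <;> by_cases e2 : x ∈ 𝒜 t i
    · exact iff_of_true e1 e2
    · simp [e1, e2] at h3
    · simp [e1, e2] at h3
    · exact iff_of_false e1 e2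
  · exfalso
    have h3 := abs_eq_zero.1 h2
    have e1 : x ∉ 𝒜 t i := fun e => (h.weight_neg i t ht x e).ne h3
    have e2 : x ∈ closure (𝒜 t i) := by
      by_contra e
      exact (h.weight_pos i t ht x e).ne' h3
    -- a zero of the weight lies on the boundary of the phase, hence in no phase at all
    have hij : j ≠ i := fun e => e1 (e ▸ hj)
    exact disjoint_left.1 ((h𝒜.disjoint j i hij).closure_right (h𝒜.isOpen j)) hj e2

/-- If `ξ_j - ξ_i` and `ξ_k - ξ_i` are unit vectors, then they make an angle of at most `60°`, because
their difference `ξ_j - ξ_k` has length at most one. Hence the mean normal of a grain cannot vanish. -/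
lemma IsCalibratedEvolution.ae_meanNormal_grain_ne_zero (h : IsCalibratedEvolution T 𝒜 ξ B ϑ)
    {t : ℝ} (ht : t ∈ Icc 0 T) {m : Varifold d} {i : Fin P}
    (hm : ∀ᵐ z ∂(m : Measure (Space d × Sph d)), ∃ j, (z.2 : Space d) = ξ t j z.1 - ξ t i z.1) :
    ∀ᵐ x ∂(mass m), meanNormal m x ≠ 0 := by
  have hs : MeasurableSet {y : Space d × Space d | ∃ j, y.2 = ξ t j y.1 - ξ t i y.1} := by
    have : {y : Space d × Space d | ∃ j, y.2 = ξ t j y.1 - ξ t i y.1} =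
        ⋃ j, {y | y.2 = ξ t j y.1 - ξ t i y.1} := by ext; simp
    rw [this]
    have hc := h.continuous_xi ht
    exact MeasurableSet.iUnion fun j => measurableSet_eq_fun measurable_snd
      (((hc j).sub (hc i)).measurable.comp measurable_fst)
  filter_upwards [ae_condKernel_of_ae (q := fun x p => ∃ j, p = ξ t j x - ξ t i x) hs hm,
    ae_condKernel_norm m] with x h1 h2 h0
  obtain ⟨p₀, ⟨j₀, hp₀⟩, hn₀⟩ := (h1.and h2).exists
  have hi : Integrable (fun p : Space d => p) ((ambient m).condKernel x) :=
    Integrable.mono' (integrable_const 1) aestronglyMeasurable_id (h2.mono fun p hp => hp.le)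
  have h3 : ∫ p, inner ℝ p₀ p ∂((ambient m).condKernel x) = 0 := by
    rw [integral_inner hi]
    rw [meanNormal] at h0
    rw [h0, inner_zero_right]
  have h4 : ∫ _p, (1 / 2 : ℝ) ∂((ambient m).condKernel x) ≤
      ∫ p, inner ℝ p₀ p ∂((ambient m).condKernel x) := by
    refine integral_mono_ae (integrable_const _) (hi.const_inner p₀) ?_
    filter_upwards [h1, h2] with p ⟨j, hp⟩ hn
    have e1 := norm_sub_sq_real p₀ p
    have e2 : ‖p₀ - p‖ ≤ 1 := by
      rw [hp₀, hp, sub_sub_sub_cancel_right]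
      exact h.norm_xiDiff_le ht j₀ j x
    rw [hn₀, hn] at e1
    change (1 / 2 : ℝ) ≤ inner ℝ p₀ p
    nlinarith only [e1, e2, norm_nonneg (p₀ - p)]
  rw [h3] at h4
  simp at h4
  linarith

/-- Rigidity: the vanishing of the relative entropy and the bulk error forces the varifolds to be
the boundaries, with multiplicity one, of the phases of the calibrated partition. -/
theorem IsCalibratedEvolution.rigidity (h : IsCalibratedEvolution T 𝒜 ξ B ϑ) {t : ℝ}
    (ht : t ∈ Icc 0 T) {m : Fin P → Fin P → Varifold d} {A : Fin P → Set (Space d)}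
    (hA : IsPhasePartition A) (hm : IsCompatible m A) (hE : relEntropy m ξ t = 0)
    (hb : bulkError A (𝒜 t) (ϑ t) = 0) (i : Fin P) :
    A i =ᵐ[volume] 𝒜 t i ∧ IsUnitDensityBoundary (grain m i) (A i) := by
  have hAe := h.ae_eq_of_bulkError_eq_zero ht hA hb
  obtain ⟨hd, ho⟩ := h.of_relEntropy_eq_zero ht hE
  have hp := fun i => isPolarGradient_perimeterMeasure (hA.finitePerimeter i)
  have hn : ∀ i, Integrable (innerNormal (A i)) (perimeterMeasure (A i)) := fun i =>
    have := (hp i).1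
    Integrable.mono' (integrable_const 1) (hp i).2.1.aestronglyMeasurable
      ((hp i).2.2.1.mono fun x hx => hx.le)
  have hac : ∀ i, mass (grain m i) ≪ perimeterMeasure (A i) := fun i => by
    have := (hp i).1
    refine absolutelyContinuous_of_integral_inner_eq (hn i) (integrable_meanNormal _)
      (fun φ hφ => ?_) (h.ae_meanNormal_grain_ne_zero ht (ae_grain (hd i) fun j hj =>
        (ho j i hj).mono fun z hz => ⟨j, hz⟩))
    rw [hm.gradient i φ hφ, integral_inner_eq_mass _ hφ]
  have hgr : ∀ᵐ z ∂(grain m i : Measure (Space d × Sph d)),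
      (z.2 : Space d) = innerNormal (A i) z.1 := by
    refine ae_grain (hd i) fun j hj => ?_
    -- the interface between `j` and `i` is carried by both reduced boundaries
    have h1 : mass (m j i) ≪ perimeterMeasure (A i) :=
      (mass_le_mass (le_grain m hj.symm)).absolutelyContinuous.trans (hac i)
    have h2 : mass (m j i) ≪ perimeterMeasure (A j) := by
      rw [hm.mass_symm j i hj]
      exact (mass_le_mass (le_grain m hj)).absolutelyContinuous.trans (hac j)
    filter_upwards [ho j i hj, ae_of_ae_mass (h.ae_xi_sub_eq ht hj.symm (hA.finitePerimeter i)
      (hA.finitePerimeter j) (hAe i) (hAe j) h1 h2)] with z e1 e2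
    rw [e1, ← neg_sub, e2, neg_neg]
  refine ⟨hAe i, (isUnitDensityBoundary_iff (hA.finitePerimeter i)).2 ⟨?_, hgr⟩⟩
  have hpm : IsPolarGradient (A i) (mass (grain m i)) (innerNormal (A i)) := by
    refine ⟨inferInstance, (hp i).2.1, (hac i).ae_le (hp i).2.2.1, fun φ hφ => ?_⟩
    rw [(hp i).2.2.2 φ hφ, hm.gradient i φ hφ, integral_inner_eq_mass _ hφ]
    congr 1
    refine integral_congr_ae ?_
    filter_upwards [meanNormal_eq_of_ae (hp i).2.1 hgr] with x hx
    rw [hx]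
  exact (hpm.unique (hp i) (ae_eq_refl _)).1

/-- Weak-strong uniqueness, from the stability estimates and Grönwall's inequality. -/
theorem IsCalibratedEvolution.weakStrong (hT : 0 < T) (h : IsCalibratedEvolution T 𝒜 ξ B ϑ)
    {μ₀ : Fin P → Fin P → Varifold d} {A₀ : Fin P → Set (Space d)}
    {μ : ℝ → Fin P → Fin P → Varifold d} {A : ℝ → Fin P → Set (Space d)}
    (hsol : IsDeGiorgiSolution μ₀ A₀ μ A) {K : ℝ} (hK : 0 < K)
    (hEi : IntegrableOn (fun t => relEntropy (μ t) ξ t) (Ioc 0 T))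
    (hbi : IntegrableOn (fun t => bulkError (A t) (𝒜 t) (ϑ t)) (Ioc 0 T))
    (hE : ∀ᵐ t ∂(volume.restrict (Ioc 0 T)),
      relEntropy (μ t) ξ t ≤ relEntropy μ₀ ξ 0 + K * ∫ s in Ioc 0 t, relEntropy (μ s) ξ s)
    (hb : ∀ᵐ t ∂(volume.restrict (Ioc 0 T)),
      bulkError (A t) (𝒜 t) (ϑ t) ≤ bulkError A₀ (𝒜 0) (ϑ 0) + relEntropy μ₀ ξ 0 +
        K * ((∫ s in Ioc 0 t, bulkError (A s) (𝒜 s) (ϑ s)) +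
          ∫ s in Ioc 0 t, relEntropy (μ s) ξ s))
    (hA : ∀ i, A₀ i =ᵐ[volume] 𝒜 0 i)
    (hμ : ∀ i, IsUnitDensityBoundary (grain μ₀ i) (A₀ i)) :
    ∀ᵐ t ∂(volume.restrict (Ioc 0 T)), ∀ i,
      A t i =ᵐ[volume] 𝒜 t i ∧ IsUnitDensityBoundary (grain (μ t) i) (A t i) := by
  have h0 : (0 : ℝ) ∈ Icc 0 T := ⟨le_rfl, hT.le⟩
  have hE0 : relEntropy μ₀ ξ 0 = 0 := h.relEntropy_eq_zero h0
    hsol.initial_partition.finitePerimeter hsol.initial_compatible hA hμ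
  have hb0 : bulkError A₀ (𝒜 0) (ϑ 0) = 0 := by
    refine Finset.sum_eq_zero fun i _ => integral_eq_zero_of_ae ?_
    filter_upwards [indicator_ae_eq_of_ae_eq_set (f := fun _ => (1 : ℝ)) (hA i)] with x hx
    simp [hx]
  obtain ⟨c, C, M, L, hc⟩ := h.exists_spacetimeCalibration hT
  have hEnn : ∀ t ∈ Ioc 0 T, 0 ≤ relEntropy (μ t) ξ t := fun t ht => by
    rw [← relEntropy_clampField (μ t) (Ioc_subset_Icc_self ht)]
    exact relEntropy_nonneg hc (μ t) t
  have hbnn : ∀ t, 0 ≤ bulkError (A t) (𝒜 t) (ϑ t) := fun t =>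
    Finset.sum_nonneg fun i _ => integral_nonneg fun x => mul_nonneg (abs_nonneg _) (abs_nonneg _)
  have hE1 : ∀ᵐ t ∂(volume.restrict (Ioc 0 T)), relEntropy (μ t) ξ t = 0 := by
    have := ae_le_exp_of_ae_le_integral hE0.ge hK.le hEi hE
    filter_upwards [this, ae_restrict_mem measurableSet_Ioc] with t ht ht0
    rw [hE0, zero_mul] at ht
    exact le_antisymm ht (hEnn t ht0)
  have hE2 : ∀ t ∈ Ioc 0 T, ∫ s in Ioc 0 t, relEntropy (μ s) ξ s = 0 := fun t ht =>
    integral_eq_zero_of_ae (ae_restrict_of_ae_restrict_of_subset (Ioc_subset_Ioc_right ht.2) hE1)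
  have hb1 : ∀ᵐ t ∂(volume.restrict (Ioc 0 T)), bulkError (A t) (𝒜 t) (ϑ t) = 0 := by
    have := ae_le_exp_of_ae_le_integral (a := 0) le_rfl hK.le hbi (by
      filter_upwards [hb, ae_restrict_mem measurableSet_Ioc] with t ht ht0
      rwa [hE2 t ht0, hb0, hE0, add_zero, add_zero] at ht)
    filter_upwards [this] with t ht
    rw [zero_mul] at ht
    exact le_antisymm ht (hbnn t)
  filter_upwards [hE1, hb1, ae_restrict_mem measurableSet_Ioc,
    ae_restrict_of_ae_restrict_of_subset Ioc_subset_Ioi_self hsol.compatible] with t h1 h2 ht h3 i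
  exact h.rigidity (Ioc_subset_Icc_self ht) (hsol.partition t ht.1) h3 h1 h2 i

end Rigidity

end MultiPhaseMCF

theorem theorem3 (d P : ℕ) (hP : 2 ≤ P) (Tcal : ℝ) (hTcal : 0 < Tcal)
    (𝒜 : ℝ → Fin P → Set (Space d))
    (ξ : ℝ → Fin P → Space d → Space d) (B : ℝ → Space d → Space d)
    (ϑ : ℝ → Fin P → Space d → ℝ)
    (hcal : IsCalibratedEvolution Tcal 𝒜 ξ B ϑ) :
    ∃ C : ℝ, 0 < C ∧
      ∀ (μ₀ : Fin P → Fin P → Varifold d) (A₀ : Fin P → Set (Space d))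
        (μ : ℝ → Fin P → Fin P → Varifold d) (A : ℝ → Fin P → Set (Space d)),
        IsDeGiorgiSolution μ₀ A₀ μ A →
        -- the time integrals in the stability estimates exist
        (IntegrableOn (fun t => relEntropy (μ t) ξ t) (Icc 0 Tcal) ∧
          IntegrableOn (fun t => bulkError (A t) (𝒜 t) (ϑ t)) (Icc 0 Tcal)) ∧
        -- stability of the relative entropy and of the bulk error
        (∀ᵐ T ∂(volume.restrict (Icc 0 Tcal)),
          relEntropy (μ T) ξ T ≤
            relEntropy μ₀ ξ 0 + C * ∫ t in (0 : ℝ)..T, relEntropy (μ t) ξ t) ∧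
        (∀ᵐ T ∂(volume.restrict (Icc 0 Tcal)),
          bulkError (A T) (𝒜 T) (ϑ T) ≤
            bulkError A₀ (𝒜 0) (ϑ 0) + relEntropy μ₀ ξ 0 +
              C * ∫ t in (0 : ℝ)..T,
                (bulkError (A t) (𝒜 t) (ϑ t) + relEntropy (μ t) ξ t)) ∧
        -- weak-strong uniqueness
        ((∀ i, A₀ i =ᵐ[volume] 𝒜 0 i) →
          (∀ i, IsUnitDensityBoundary (grain μ₀ i) (A₀ i)) →
          ∀ᵐ t ∂(volume.restrict (Icc 0 Tcal)), ∀ i,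
            A t i =ᵐ[volume] 𝒜 t i ∧ IsUnitDensityBoundary (grain (μ t) i) (A t i)) := by
  obtain ⟨K, hK, hstab⟩ := hcal.exists_stability hTcal
  refine ⟨K, hK, fun μ₀ A₀ μ A hsol => ?_⟩
  obtain ⟨hEi, hbi, hE, hb⟩ := hstab μ₀ A₀ μ A hsol
  rw [← Measure.restrict_congr_set (μ := volume) (Ioc_ae_eq_Icc (a := (0 : ℝ)) (b := Tcal))]
  refine ⟨⟨?_, ?_⟩, ?_, ?_, fun hA hμ => hcal.weakStrong hTcal hsol hK hEi hbi hE hb hA hμ⟩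
  · rwa [integrableOn_Icc_iff_integrableOn_Ioc]
  · rwa [integrableOn_Icc_iff_integrableOn_Ioc]
  · filter_upwards [hE, ae_restrict_mem measurableSet_Ioc] with t ht ht0
    rwa [intervalIntegral.integral_of_le ht0.1.le]
  · filter_upwards [hb, ae_restrict_mem measurableSet_Ioc] with t ht ht0
    have hsub : Ioc 0 t ⊆ Ioc 0 Tcal := Ioc_subset_Ioc_right ht0.2
    rwa [intervalIntegral.integral_of_le ht0.1.le,
      integral_add (hbi.mono_set hsub) (hEi.mono_set hsub)]
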